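/- **Setting.** Let $D\subset\mathbb{R}^3$ be a bounded domain (open and connected). Let $H$ and $V$ be the closures of the divergence free fields in $C_c^\infty(D)^3$ in $L^2$ and in $H^1$, and let $A$ be the Stokes operator, $\langle Av,w\rangle=\int_D\nabla v:\nabla w\,dx$ for $v,w\in V$, with an orthonormal basis $(e_k)_{k\ge1}$ of $H$ of eigenvectors. Let $(\sigma_k)$ be real with $\sum_k\sigma_k^2<\infty$, and let $L:V\to V'$ be bounded and linear with $c_1\langle Av,v\rangle\le\langle Lv,v\rangle\le c_2\langle Av,v\rangle$ on $V$ for some $c_1,c_2>0$. For $\nu>0$ consider $$\partial_tu+u\cdot\nabla u+\nabla p=\nu\Delta u+Z_t,\quad \operatorname{div}u=0\text{ in }D,\quad u=0\text{ on }\partial D,\qquad dZ_t=-LZ_t\,dt+\sum_k\sigma_ke_k\,d\beta_k(t).\tag{NSE}$$ A *martingale solution* consists of a filtered probability space with independent Brownian motions $(\beta_k)$ and a progressively measurable $H\times H$-valued process $(u,Z)$ on $[0,\infty)$ such that, almost surely, $u$ and $Z$ lie in $C([0,T];D(A^{-\alpha/2}))\cap L^\infty(0,T;H)\cap L^2(0,T;V)$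 for all $T$ (for some $\alpha>1$), the equation for $Z$ holds when integrated in time and tested against $V$, and $$\langle u(t),v\rangle+\int_0^t\langle u\cdot\nabla u,v\rangle ds+\nu\int_0^t\langle\nabla u,\nabla v\rangle ds=\langle u(0),v\rangle+\int_0^t\langle Z_s,v\rangle ds$$ for all $t\ge0$ and all divergence free $v\in C_c^\infty(D)^3$. It is *stationary* if for every $\tau>0$ the paths $(u(\cdot+\tau),Z_{\cdot+\tau})$ and $(u,Z)$ have the same law. A *pressure field* of the solution is a jointly measurable $p(t,\omega,x)$ such that almost surely, for all $t\ge 0$ and all (not necessarily divergence free) $v\in C_c^\infty(D)^3$, the displayed equation holds with $\int_0^t\int_Dp\operatorname{div}v\,dx\,ds$ added on the right. Let $\{u^\nu\}_{\nu\in(0,1)}$ be stationary martingale solutions (probability spaces may depend on $\nu$), with pressures $p^\nu$ and forcings $Z^\nu$, and assume, with constants independent of $\nu$, the energy estimate $$\nu\mathbf{E}\|\nabla u^\nu\|_{L^2}^2\le C_1\nu\mathbf{E}\|u^\nu\|_{L^2}^2+C_2(\mathbf{E}\|u^\nu\|_{L^2}^2)^{3/2}.$$ Expectations without a time variable are taken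 at a fixed time $t\ge0$; hypotheses are required uniformly in $t$, and the conclusions hold for every $t$. Write $\delta_hf(x)=f(x+h)-f(x)$. Let $\psi\in C_c^\infty(D)$ and, with $u=u^\nu$ extended by $0$ outside $D$, $$S_0(\ell)=\frac1{4\pi}\mathbf{E}\int_{S^2}\int_D\psi|\delta_{\ell\hat n}u|^2\,\delta_{\ell\hat n}u\cdot\hat n\,dx\,dS(\hat n),\qquad S_\parallel(\ell)=\frac1{4\pi}\mathbf{E}\int_{S^2}\int_D\psi(\delta_{\ell\hat n}u\cdot\hat n)^3\,dx\,dS(\hat n).$$ **Assumptions.** 1. $\sup_{\nu\in(0,1)}\mathbf{E}\|u^\nu\|_{L^3(D)}^3<\infty$ and $\lim_{|h|\to0}\sup_{\nu\in(0,1)}\mathbf{E}\|\delta_hu^\nu\|_{L^3(D\cap(D-h))}^3=0$. 2. $\sup_{\nu\in(0,1)}\mathbf{E}\|p^\nu\|_{L^{3/2}(D)}^{3/2}<\infty$ and $\lim_{|h|\to0}\sup_{\nu\in(0,1)}\mathbf{E}\|\delta_hp^\nu\|_{L^{3/2}(D\cap(D-h))}^{3/2}=0$. 3. (Local energy equality)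 For every $\nu\in(0,1)$, $$2\nu\mathbf{E}\int\psi|\nabla u^\nu|^2dx=\nu\mathbf{E}\int|u^\nu|^2\Delta\psi\,dx+\mathbf{E}\int(|u^\nu|^2+2p^\nu)\,u^\nu\cdot\nabla\psi\,dx+2\mathbf{E}\int\psi\,u^\nu\cdot Z^\nu dx.$$ **Theorem.** There are scales $\ell_\nu>0$, $\nu\in(0,1)$, with $\ell_\nu\to0$ as $\nu\to0$ such that $$\lim_{\ell_I\to0}\limsup_{\nu\to0}\sup_{\ell\in[\ell_\nu,\ell_I]}\Big|\frac1\ell S_0(\ell)+\frac23\mathbf{E}\int(|u^\nu|^2+2p^\nu)u^\nu\cdot\nabla\psi\,dx+\frac43\mathbf{E}\int\psi u^\nu\cdot Z^\nu dx\Big|=0,$$ $$\lim_{\ell_I\to0}\limsup_{\nu\to0}\sup_{\ell\in[\ell_\nu,\ell_I]}\Big|\frac1\ell S_\parallel(\ell)+\frac25\mathbf{E}\int(|u^\nu|^2+2p^\nu)u^\nu\cdot\nabla\psi\,dx+\frac45\mathbf{E}\int\psi u^\nu\cdot Z^\nu dx\Big|=0,$$ and for any such $\ell_\nu$ one also has $$\lim_{\ell_I\to0}\limsup_{\nu\to0}\sup_{\ell\in[\ell_\nu,\ell_I]}\Big|\frac1\ell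 S_0(\ell)+\frac43\nu\mathbf{E}\int\psi|\nabla u^\nu|^2dx\Big|=0,$$ $$\lim_{\ell_I\to0}\limsup_{\nu\to0}\sup_{\ell\in[\ell_\nu,\ell_I]}\Big|\frac1\ell S_\parallel(\ell)+\frac45\nu\mathbf{E}\int\psi|\nabla u^\nu|^2dx\Big|=0.$$ -/

import Mathlib

open MeasureTheory ProbabilityTheory Filter Topology Set
open scoped NNReal ENNReal

universe u

noncomputable section

namespace LocalTurbulence

/-! ### Function spaces on a domain `D ⊆ ℝ³` -/

/-- Euclidean three-space. -/
abbrev E3 : Type := EuclideanSpace ℝ (Fin 3)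

/-- `3 × 3` matrices with the Frobenius norm; the entry `(i, j)` of a gradient is `∂ᵢ uⱼ`. -/
abbrev M3 : Type := EuclideanSpace ℝ (Fin 3 × Fin 3)

/-- `L²(D; ℝ³)`. -/
abbrev L2 (D : Set E3) : Type := Lp E3 2 (volume.restrict D)

/-- `L²(D; ℝ³ˣ³)`. -/
abbrev L2M (D : Set E3) : Type := Lp M3 2 (volume.restrict D)

/-- The partial derivative `∂ᵢ φⱼ` at `x`. -/
def partialDeriv (φ : E3 → E3) (i j : Fin 3) (x : E3) : ℝ :=
  fderiv ℝ φ x (EuclideanSpace.single i 1) j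

/-- The matrix field `(∂ᵢ φⱼ)`. -/
def jacobian (φ : E3 → E3) (x : E3) : M3 :=
  WithLp.toLp 2 fun ij => partialDeriv φ ij.1 ij.2 x

/-- The divergence of a smooth vector field. -/
def divergence (φ : E3 → E3) (x : E3) : ℝ := ∑ i, partialDeriv φ i i x

/-- `f ∈ C_c^∞(D)`. -/
def IsTest {F : Type*} [NormedAddCommGroup F] [NormedSpace ℝ F] (D : Set E3) (f : E3 → F) :
    Prop :=
  ContDiff ℝ (⊤ : ℕ∞) f ∧ HasCompactSupport f ∧ tsupport f ⊆ D

/-- Smooth divergence free vector fields with compact support in `D`. -/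
def IsSolTest (D : Set E3) (φ : E3 → E3) : Prop :=
  IsTest D φ ∧ ∀ x, divergence φ x = 0

/-- The space `H`: the `L²` closure of the divergence free test fields. -/
def Hsol (D : Set E3) : Submodule ℝ (L2 D) :=
  (Submodule.span ℝ {f : L2 D | ∃ φ, IsSolTest D φ ∧ f =ᵐ[volume.restrict D] φ}).topologicalClosure

/-- The Borel σ-algebra of `H`. -/
instance instMeasurableSpaceHsol (D : Set E3) : MeasurableSpace (Hsol D) := borel _

/-- The space `V`: the `H¹` closure of the divergence free test fields. An element is recorded as
the pair `(v, ∇v)`, so that the ambient norm is equivalent to the `H¹` norm. -/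
def Vsol (D : Set E3) : Submodule ℝ (L2 D × L2M D) :=
  (Submodule.span ℝ {q : L2 D × L2M D | ∃ φ, IsSolTest D φ ∧ q.1 =ᵐ[volume.restrict D] φ ∧
    q.2 =ᵐ[volume.restrict D] jacobian φ}).topologicalClosure

open Classical in
/-- The element `(v, ∇v)` of `V` attached to `v` when `v` belongs to `V` (the gradient is unique,
being the weak gradient), and `0` otherwise. -/
def liftV (D : Set E3) (v : L2 D) : Vsol D :=
  if h : ∃ G : L2M D, (v, G) ∈ Vsol D then ⟨(v, h.choose), h.choose_spec⟩ else 0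

/-- The gradient `∇v` of `v ∈ V`. -/
def grad (D : Set E3) (v : L2 D) : L2M D := (liftV D v : L2 D × L2M D).2

/-- `‖∇v‖²_{L²}`, with the value `+∞` when `v` does not belong to `V`. -/
def dirichlet (D : Set E3) (v : L2 D) : ℝ≥0∞ :=
  ⨅ (G : L2M D) (_ : (v, G) ∈ Vsol D), ‖G‖ₑ ^ 2

/-! ### The Stokes operator and the Ornstein-Uhlenbeck forcing -/

/-- An orthonormal basis of `H` consisting of eigenvectors of the Stokes operator `A`, with the
eigenvalues: `e k ∈ V` and `⟨∇(e k), ∇v⟩ = (ev k) ⟨e k, v⟩` for all `v ∈ V`. -/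
structure StokesBasis (D : Set E3) where
  /-- The basis. -/
  e : HilbertBasis ℕ ℝ (Hsol D)
  /-- The eigenvalues. -/
  ev : ℕ → ℝ
  /-- The gradients of the basis elements. -/
  ge : ℕ → L2M D
  mem_V : ∀ k, ((e k : L2 D), ge k) ∈ Vsol D
  eigen : ∀ k, ∀ v ∈ Vsol D, inner ℝ (ge k) v.2 = ev k * inner ℝ (e k : L2 D) v.1

/-- The square of the norm of `D(A^{-α/2})`, as a series in the eigenbasis. -/
def StokesBasis.negNormSq {D : Set E3} (B : StokesBasis D) (α : ℝ) (v : Hsol D) : ℝ :=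
  ∑' k, (B.ev k) ^ (-α) * inner ℝ (B.e k) v ^ 2

/-- The operator `L : V → V'` with (continuous) bilinear form `a v w = ⟨L v, w⟩` satisfies
`c₁⟨Av, v⟩ ≤ ⟨Lv, v⟩ ≤ c₂⟨Av, v⟩`, where `⟨Av, v⟩ = ‖∇v‖²`. -/
def ComparableToStokes {D : Set E3} (a : Vsol D →L[ℝ] Vsol D →L[ℝ] ℝ) : Prop :=
  ∃ c₁ > 0, ∃ c₂ > 0, ∀ v : Vsol D,
    c₁ * ‖(v : L2 D × L2M D).2‖ ^ 2 ≤ a v v ∧ a v v ≤ c₂ * ‖(v : L2 D × L2M D).2‖ ^ 2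

/-- `(β k)` is a family of independent standard Brownian motions relative to the filtration `𝓕`. -/
structure IsBrownianFamily {Ω : Type u} {m : MeasurableSpace Ω} (P : Measure Ω)
    (𝓕 : Filtration ℝ≥0 m) (β : ℕ → ℝ≥0 → Ω → ℝ) : Prop where
  brownian : ∀ k, IsBrownianReal (β k) P
  adapted : ∀ k t, Measurable[𝓕 t] (β k t)
  independent : iIndepFun (fun k ω t => β k t ω) P
  increments : ∀ s t, s ≤ t →
    Indep (𝓕 s) (⨆ k, MeasurableSpace.comap (fun ω => β k t ω - β k s ω) inferInstance) P

/-! ### Martingale solutions -/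

/-- `⟨f, φ⟩` in `L²(D)`. -/
def pair {D : Set E3} (f : L2 D) (φ : E3 → E3) : ℝ := ∫ x in D, inner ℝ (f x) (φ x)

/-- `⟨v · ∇v, φ⟩`. -/
def convection {D : Set E3} (v : L2 D) (φ : E3 → E3) : ℝ :=
  ∫ x in D, ∑ i, ∑ j, v x i * grad D v x (i, j) * φ x j

/-- `⟨∇v, ∇φ⟩`. -/
def viscous {D : Set E3} (v : L2 D) (φ : E3 → E3) : ℝ :=
  ∫ x in D, inner ℝ (grad D v x) (jacobian φ x)

/-- `⟨u(t), φ⟩ - ⟨u(0), φ⟩ + ∫₀ᵗ ⟨u·∇u, φ⟩ ds + ν ∫₀ᵗ ⟨∇u, ∇φ⟩ ds - ∫₀ᵗ ⟨Z, φ⟩ ds` along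
paths `v` of `u` and `z` of `Z`. -/
def momentum {D : Set E3} (ν : ℝ) (v z : ℝ≥0 → Hsol D) (t : ℝ≥0) (φ : E3 → E3) : ℝ :=
  pair (v t : L2 D) φ - pair (v 0 : L2 D) φ
    + (∫ s in (0 : ℝ)..t, convection (v s.toNNReal : L2 D) φ)
    + ν * (∫ s in (0 : ℝ)..t, viscous (v s.toNNReal : L2 D) φ)
    - ∫ s in (0 : ℝ)..t, pair (z s.toNNReal : L2 D) φ

/-- The path `v` belongs to `C([0,T]; D(A^{-α/2})) ∩ L^∞(0,T; H) ∩ L²(0,T; V)` for all `T`. -/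
def PathRegular {D : Set E3} (B : StokesBasis D) (α : ℝ) (v : ℝ≥0 → Hsol D) : Prop :=
  (∀ t₀, Tendsto (fun t => B.negNormSq α (v t - v t₀)) (𝓝 t₀) (𝓝 0)) ∧
  (∀ T : ℝ, ∃ M : ℝ, ∀ᵐ s ∂(volume.restrict (Icc (0 : ℝ) T)), ‖v s.toNNReal‖ ≤ M) ∧
  (∀ T : ℝ, ∫⁻ s in Icc (0 : ℝ) T, dirichlet D (v s.toNNReal : L2 D) < ∞)

/-- A martingale solution, on `[0, ∞)`, of the Navier-Stokes equations with viscosity `ν` driven by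
`dZ = -L Z dt + ∑ₖ σₖ eₖ dβₖ`. The stochastic basis is part of the solution. -/
structure MartingaleSolution {D : Set E3} (B : StokesBasis D) (σ : ℕ → ℝ)
    (a : Vsol D →L[ℝ] Vsol D →L[ℝ] ℝ) (ν : ℝ) where
  /-- The sample space. -/
  Ω : Type u
  /-- The events. -/
  mΩ : MeasurableSpace Ω
  /-- The probability measure. -/
  P : Measure Ω
  prob : IsProbabilityMeasure P
  /-- The filtration. -/
  𝓕 : Filtration ℝ≥0 mΩ
  /-- The driving Brownian motions. -/
  β : ℕ → ℝ≥0 → Ω → ℝ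
  brownian : IsBrownianFamily P 𝓕 β
  /-- The velocity. -/
  u : ℝ≥0 → Ω → Hsol D
  /-- The body force. -/
  Z : ℝ≥0 → Ω → Hsol D
  progressive : IsStronglyProgressive 𝓕 (fun t ω => (u t ω, Z t ω))
  regular : ∃ α > 1, ∀ᵐ ω ∂P, PathRegular B α (fun t => u t ω) ∧ PathRegular B α (fun t => Z t ω)
  /-- `dZ = -L Z dt + dW`, integrated in time and tested against `v ∈ V`. -/
  forcing : ∀ᵐ ω ∂P, ∀ (t : ℝ≥0) (v : Vsol D),
    HasSum (fun k => σ k * β k t ω * inner ℝ (B.e k : L2 D) (v : L2 D × L2M D).1)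
      (inner ℝ (Z t ω : L2 D) (v : L2 D × L2M D).1 - inner ℝ (Z 0 ω : L2 D) (v : L2 D × L2M D).1
        + ∫ s in (0 : ℝ)..t, a (liftV D (Z s.toNNReal ω : L2 D)) v)
  /-- The Navier-Stokes equations tested against divergence free fields. -/
  weak : ∀ᵐ ω ∂P, ∀ φ, IsSolTest D φ → ∀ t,
    momentum ν (fun t => u t ω) (fun t => Z t ω) t φ = 0

attribute [instance] MartingaleSolution.mΩ MartingaleSolution.prob

/-- A stationary martingale solution: time shifts do not change the law of the path `(u, Z)`. -/
structure StationarySolution {D : Set E3} (B : StokesBasis D) (σ : ℕ → ℝ)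
    (a : Vsol D →L[ℝ] Vsol D →L[ℝ] ℝ) (ν : ℝ) extends MartingaleSolution.{u} B σ a ν where
  stationary : ∀ τ : ℝ≥0,
    IdentDistrib (fun ω (t : ℝ≥0) => (u (t + τ) ω, Z (t + τ) ω))
      (fun ω (t : ℝ≥0) => (u t ω, Z t ω)) P P

/-- `p` is a pressure field of the solution `S`: it is jointly measurable in `(t, ω, x)` and the
Navier-Stokes equations hold against all test fields. -/
def IsPressure {D : Set E3} {B : StokesBasis D} {σ : ℕ → ℝ}
    {a : Vsol D →L[ℝ] Vsol D →L[ℝ] ℝ} {ν : ℝ} (S : MartingaleSolution.{u} B σ a ν)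
    (p : ℝ≥0 → S.Ω → E3 → ℝ) : Prop :=
  Measurable (fun q : ℝ≥0 × S.Ω × E3 => p q.1 q.2.1 q.2.2) ∧
  ∀ᵐ ω ∂S.P, ∀ φ : E3 → E3, IsTest D φ → ∀ t : ℝ≥0,
    momentum ν (fun t => S.u t ω) (fun t => S.Z t ω) t φ
      = ∫ s in (0 : ℝ)..t, ∫ x in D, p s.toNNReal ω x * divergence φ x

/-! ### Structure functions, fluxes and dissipation of random fields -/

/-- The increment `δ_h f (x) = f (x + h) - f x`. -/
def incr {F : Type*} [Sub F] (f : E3 → F) (h x : E3) : F := f (x + h) - f x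

/-- `D ∩ (D - h)`, the part of `D` on which increments by `h` of functions on `D` are defined. -/
def overlap (D : Set E3) (h : E3) : Set E3 := {x | x ∈ D ∧ x + h ∈ D}

section functionals

variable {D : Set E3} {Ω : Type u} {m : MeasurableSpace Ω}

/-- The local structure function `S₀(ℓ)` of a random field `U` (extended by zero outside `D`). -/
def structZero (P : Measure Ω) (U : Ω → Hsol D) (ψ : E3 → ℝ) (ℓ : ℝ) : ℝ :=
  1 / (4 * Real.pi) * ∫ ω, (∫ n : Metric.sphere (0 : E3) 1, (∫ x in D,
    ψ x * (‖incr (D.indicator (U ω : L2 D)) (ℓ • (n : E3)) x‖ ^ 2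
      * inner ℝ (incr (D.indicator (U ω : L2 D)) (ℓ • (n : E3)) x) (n : E3)))
    ∂(volume : Measure E3).toSphere) ∂P

/-- The local longitudinal structure function `S_∥(ℓ)` of a random field `U` (extended by zero
outside `D`). -/
def structPar (P : Measure Ω) (U : Ω → Hsol D) (ψ : E3 → ℝ) (ℓ : ℝ) : ℝ :=
  1 / (4 * Real.pi) * ∫ ω, (∫ n : Metric.sphere (0 : E3) 1, (∫ x in D,
    ψ x * inner ℝ (incr (D.indicator (U ω : L2 D)) (ℓ • (n : E3)) x) (n : E3) ^ 3)
    ∂(volume : Measure E3).toSphere) ∂P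

/-- `E ∫ ψ |∇U|²`. -/
def localDissipation (P : Measure Ω) (U : Ω → Hsol D) (ψ : E3 → ℝ) : ℝ :=
  ∫ ω, (∫ x in D, ψ x * ‖grad D (U ω : L2 D) x‖ ^ 2) ∂P

/-- `E ∫ |U|² Δψ`. -/
def localDiffusion (P : Measure Ω) (U : Ω → Hsol D) (ψ : E3 → ℝ) : ℝ :=
  ∫ ω, (∫ x in D, ‖(U ω : L2 D) x‖ ^ 2 * Laplacian.laplacian ψ x) ∂P

/-- `E ∫ (|U|² + 2 p) U · ∇ψ`. -/
def localFlux (P : Measure Ω) (U : Ω → Hsol D) (p : Ω → E3 → ℝ) (ψ : E3 → ℝ) : ℝ :=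
  ∫ ω, (∫ x in D, (‖(U ω : L2 D) x‖ ^ 2 + 2 * p ω x) * inner ℝ ((U ω : L2 D) x) (gradient ψ x)) ∂P

/-- `E ∫ ψ U · Z`. -/
def localInput (P : Measure Ω) (U Z : Ω → Hsol D) (ψ : E3 → ℝ) : ℝ :=
  ∫ ω, (∫ x in D, ψ x * inner ℝ ((U ω : L2 D) x) ((Z ω : L2 D) x)) ∂P

end functionals

/-! ### Families of solutions indexed by the viscosity `ν ∈ (0, 1)` -/

/-- The range of viscosities. -/
abbrev Visc : Type := Ioo (0 : ℝ) 1

/-- The filter `ν → 0` on `(0, 1)`. -/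
def viscToZero : Filter Visc := comap (fun ν : Visc => (ν : ℝ)) (𝓝 0)

/-- `lim_{ℓ_I → 0} limsup_{ν → 0} sup_{ℓ ∈ [ℓ_ν, ℓ_I]} |F ν ℓ| = 0`, computed in `[0, ∞]`. -/
def VanishesInRange (ℓν : Visc → ℝ) (F : Visc → ℝ → ℝ) : Prop :=
  Tendsto (fun ℓI : ℝ => limsup (fun ν => ⨆ ℓ ∈ Icc (ℓν ν) ℓI, ‖F ν ℓ‖ₑ) viscToZero)
    (𝓝[>] 0) (𝓝 0)

section families

variable {D : Set E3} {B : StokesBasis D} {σ : ℕ → ℝ} {a : Vsol D →L[ℝ] Vsol D →L[ℝ] ℝ}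

/-- The basic energy estimate `ν E‖∇u‖² ≤ c₁ ν E‖u‖² + c₂ (E‖u‖²)^{3/2}` (norms of `L²(D)`), with
constants independent of `ν`. -/
def EnergyEstimate (S : ∀ ν : Visc, StationarySolution.{u} B σ a ν) : Prop :=
  ∃ c₁ c₂ : ℝ≥0, ∀ (ν : Visc) (t : ℝ≥0),
    ENNReal.ofReal ν * ∫⁻ ω, dirichlet D ((S ν).u t ω : L2 D) ∂(S ν).P
      ≤ c₁ * ENNReal.ofReal ν * (∫⁻ ω, ‖(S ν).u t ω‖ₑ ^ 2 ∂(S ν).P)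
        + c₂ * (∫⁻ ω, ‖(S ν).u t ω‖ₑ ^ 2 ∂(S ν).P) ^ (3 / 2 : ℝ)

/-- Precompactness in `L³` on average: `E‖u^ν‖³_{L³}` is bounded and `E‖δ_h u^ν‖³_{L³}` tends to
zero with `h`, uniformly in `ν`. -/
def VelocityCompactness (S : ∀ ν : Visc, StationarySolution.{u} B σ a ν) : Prop :=
  (∃ C : ℝ≥0, ∀ (ν : Visc) (t : ℝ≥0),
    ∫⁻ ω, (∫⁻ x in D, ‖((S ν).u t ω : L2 D) x‖ₑ ^ 3) ∂(S ν).P ≤ C) ∧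
  Tendsto (fun h : E3 => ⨆ (ν : Visc) (t : ℝ≥0),
    ∫⁻ ω, (∫⁻ x in overlap D h, ‖incr ((S ν).u t ω : L2 D) h x‖ₑ ^ 3) ∂(S ν).P) (𝓝 0) (𝓝 0)

/-- The corresponding condition in `L^{3/2}` for the pressure fields `p^ν` of `u^ν`. -/
def PressureCompactness (S : ∀ ν : Visc, StationarySolution.{u} B σ a ν)
    (p : ∀ ν : Visc, ℝ≥0 → (S ν).Ω → E3 → ℝ) : Prop :=
  (∀ ν : Visc, IsPressure (S ν).toMartingaleSolution (p ν)) ∧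
  (∃ C : ℝ≥0, ∀ (ν : Visc) (t : ℝ≥0),
    ∫⁻ ω, (∫⁻ x in D, ‖p ν t ω x‖ₑ ^ (3 / 2 : ℝ)) ∂(S ν).P ≤ C) ∧
  Tendsto (fun h : E3 => ⨆ (ν : Visc) (t : ℝ≥0),
    ∫⁻ ω, (∫⁻ x in overlap D h, ‖incr (p ν t ω) h x‖ₑ ^ (3 / 2 : ℝ)) ∂(S ν).P) (𝓝 0) (𝓝 0)

/-- Local energy equality for the cutoff `ψ`. -/
def LocalEnergyEquality (S : ∀ ν : Visc, StationarySolution.{u} B σ a ν)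
    (p : ∀ ν : Visc, ℝ≥0 → (S ν).Ω → E3 → ℝ) (ψ : E3 → ℝ) : Prop :=
  ∀ (ν : Visc) (t : ℝ≥0),
    2 * (ν : ℝ) * localDissipation (S ν).P ((S ν).u t) ψ
      = (ν : ℝ) * localDiffusion (S ν).P ((S ν).u t) ψ
        + localFlux (S ν).P ((S ν).u t) (p ν t) ψ
        + 2 * localInput (S ν).P ((S ν).u t) ((S ν).Z t) ψ

/-- `ℓ_ν` are scales tending to zero above which the structure functions are given, to first order,
by the nonlinear flux and the energy input. -/
structure IsFluxScale (S : ∀ ν : Visc, StationarySolution.{u} B σ a ν)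
    (p : ∀ ν : Visc, ℝ≥0 → (S ν).Ω → E3 → ℝ) (ψ : E3 → ℝ) (ℓν : Visc → ℝ) : Prop where
  pos : ∀ ν, 0 < ℓν ν
  tendsto_zero : Tendsto ℓν viscToZero (𝓝 0)
  flux_zero : ∀ t : ℝ≥0, VanishesInRange ℓν fun ν ℓ =>
    1 / ℓ * structZero (S ν).P ((S ν).u t) ψ ℓ
      + 2 / 3 * localFlux (S ν).P ((S ν).u t) (p ν t) ψ
      + 4 / 3 * localInput (S ν).P ((S ν).u t) ((S ν).Z t) ψ
  flux_par : ∀ t : ℝ≥0, VanishesInRange ℓν fun ν ℓ =>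
    1 / ℓ * structPar (S ν).P ((S ν).u t) ψ ℓ
      + 2 / 5 * localFlux (S ν).P ((S ν).u t) (p ν t) ψ
      + 4 / 5 * localInput (S ν).P ((S ν).u t) ((S ν).Z t) ψ

end families

end LocalTurbulence

end

open LocalTurbulence

/-! ### Instances -/

namespace LocalTurbulence

/-! The theorem is a localized Kármán–Howarth–Monin relation, read at scales where viscosity no
longer matters. In a stationary state the mean of ⟨u(t), α e_i⟩⟨u(t), β e_j⟩ is the same at t = 0
and t = 1, so the product rule applied to the momentum equation gives a balance of two-point
correlations tested with α(x)β(y) (`balanced_flow`). The fields α e_i are not divergence free, which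
is why the pressure enters. Mollification replaces the products by ψ(x)φ(y − x), so that the
separation h = y − x becomes a variable (`integral_two_point`, `Flow.balance_separation`).

This balance is contracted with a symmetric tensor kernel K(h) satisfying div K = ∇Q. The pointwise
identity `khm_algebra` splits the integrand into a cubic form in δ_h u contracted with ∇K; terms at
a single point, whose integral is ∫Q times flux plus twice the input; terms containing an increment
of u, of p or of ψu; viscous terms; and terms that integrate to zero because u is divergence free.
The outcome is `Flow.integral_cubic`. For K supported in |h| ≤ 2ℓ the increment terms are small
uniformly in ν, by the compactness assumptions and Young's inequality with a large parameter. The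
viscous terms are controlled by ν|∇u||u| ≤ √ν(ν|∇u|² + |u|²), at the cost of at most one derivative
of K, hence of order √ν(1 + 1/ℓ).

Two radial kernels, built from a weight ρ(|h|²) concentrated near |h| = ℓ, reduce the cubic form to
−ρ|δu|²(δu·h) and −ρ(δu·h)³. Their potentials have integrals (2/3)∫ρ|h|² and (2/5)∫ρ|h|⁴, which is
where the constants of the two laws originate. Since the spherical means are continuous in the
radius, an estimate valid for all weights near ℓ holds at ℓ itself (`abs_le_of_weight`). With ℓ_ν =
ν^{1/4} the viscous error √ν/ℓ is at most ν^{1/4} for ℓ ≥ ℓ_ν. The dissipation form follows from the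
local energy equality, because νE∫|u|²Δψ is O(ν).

A uniform bound for E‖Z‖² is not assumed. It is proved path by path (`exists_forcing_bound`): each
Brownian coefficient is split into its deviation from a moving average over a window of length
1/λ_k, with λ_k the Stokes eigenvalue, and that average, which is differentiable. Coercivity of L
then bounds ∫₀ᵀ‖Z‖² by ‖Z_0‖² plus a functional with mean O(T), and stationarity with truncation
removes the initial value as T → ∞. -/

instance completeSpace_Vsol (D : Set E3) : CompleteSpace (Vsol D) :=
  (Submodule.isClosed_topologicalClosure _).isComplete.completeSpace_coe

instance secondCountable_L2 (D : Set E3) : SecondCountableTopology (L2 D) :=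
  haveI : Fact ((2 : ℝ≥0∞) ≠ ⊤) := ⟨by simp⟩
  Lp.SecondCountableTopology

instance secondCountable_L2M (D : Set E3) : SecondCountableTopology (L2M D) :=
  haveI : Fact ((2 : ℝ≥0∞) ≠ ⊤) := ⟨by simp⟩
  Lp.SecondCountableTopology

instance secondCountable_Hsol (D : Set E3) : SecondCountableTopology (Hsol D) :=
  TopologicalSpace.Subtype.secondCountableTopology _

instance secondCountable_Vsol (D : Set E3) : SecondCountableTopology (Vsol D) :=
  TopologicalSpace.Subtype.secondCountableTopology _

instance borelSpace_Hsol (D : Set E3) : BorelSpace (Hsol D) := ⟨rfl⟩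

noncomputable instance measurableSpace_Vsol (D : Set E3) : MeasurableSpace (Vsol D) := borel _

instance borelSpace_Vsol (D : Set E3) : BorelSpace (Vsol D) := ⟨rfl⟩

noncomputable instance measurableSpace_L2 (D : Set E3) : MeasurableSpace (L2 D) := borel _

instance borelSpace_L2 (D : Set E3) : BorelSpace (L2 D) := ⟨rfl⟩

noncomputable instance measurableSpace_L2M (D : Set E3) : MeasurableSpace (L2M D) := borel _

instance borelSpace_L2M (D : Set E3) : BorelSpace (L2M D) := ⟨rfl⟩

/-! ### Partial derivatives -/

/-- The partial derivative of a scalar function on `ℝ³`. -/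
noncomputable def pd (k : Fin 3) (f : E3 → ℝ) (x : E3) : ℝ := fderiv ℝ f x (EuclideanSpace.single k 1)

lemma contDiff_pd {f : E3 → ℝ} (hf : ContDiff ℝ (⊤ : ℕ∞) f) (k : Fin 3) :
    ContDiff ℝ (⊤ : ℕ∞) (pd k f) :=
  (hf.fderiv_right (m := (⊤ : ℕ∞)) (by norm_cast)).clm_apply contDiff_const

lemma tsupport_pd_subset (f : E3 → ℝ) (k : Fin 3) : tsupport (pd k f) ⊆ tsupport f := by
  refine closure_minimal (fun x hx => ?_) (isClosed_tsupport f)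
  by_contra h
  have h2 : x ∉ tsupport (fderiv ℝ f) := fun h' => h (tsupport_fderiv_subset ℝ h')
  exact hx (by simp [pd, image_eq_zero_of_notMem_tsupport h2])

lemma hasCompactSupport_pd {f : E3 → ℝ} (hf : HasCompactSupport f) (k : Fin 3) :
    HasCompactSupport (pd k f) :=
  hf.mono' ((subset_tsupport _).trans (tsupport_pd_subset f k))

lemma IsTest.pd {D : Set E3} {f : E3 → ℝ} (hf : IsTest D f) (k : Fin 3) : IsTest D (pd k f) :=
  ⟨contDiff_pd hf.1 k, hasCompactSupport_pd hf.2.1 k, (tsupport_pd_subset f k).trans hf.2.2⟩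

lemma contDiff_comp_coord {φ : E3 → E3} (hφ : ContDiff ℝ (⊤ : ℕ∞) φ) (j : Fin 3) :
    ContDiff ℝ (⊤ : ℕ∞) (fun x => φ x j) := by
  exact (EuclideanSpace.proj (𝕜 := ℝ) j).contDiff.comp hφ

lemma partialDeriv_eq_pd {φ : E3 → E3} (hφ : ContDiff ℝ (⊤ : ℕ∞) φ) (i j : Fin 3) (x : E3) :
    partialDeriv φ i j x = pd i (fun x => φ x j) x := by
  have h : HasFDerivAt φ (fderiv ℝ φ x) x :=
    (hφ.differentiable (by simp)).differentiableAt.hasFDerivAt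
  have h2 := (EuclideanSpace.proj (𝕜 := ℝ) j).hasFDerivAt.comp x h
  have h3 : fderiv ℝ (fun x => φ x j) x = (EuclideanSpace.proj (𝕜 := ℝ) j).comp (fderiv ℝ φ x) :=
    h2.fderiv
  simp [pd, partialDeriv, h3]

lemma IsTest.coord {D : Set E3} {φ : E3 → E3} (hφ : IsTest D φ) (j : Fin 3) :
    IsTest D (fun x => φ x j) := by
  have hs : Function.support (fun x => φ x j) ⊆ Function.support φ := by
    intro x hx h
    exact hx (by simp [h])
  exact ⟨contDiff_comp_coord hφ.1 j, hφ.2.1.mono hs, (closure_mono hs).trans hφ.2.2⟩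

lemma IsTest.bounded {D : Set E3} {f : E3 → ℝ} (hf : IsTest D f) : ∃ C, ∀ x, |f x| ≤ C :=
  hf.2.1.exists_bound_of_continuous hf.1.continuous

lemma IsTest.univ {F : Type*} [NormedAddCommGroup F] [NormedSpace ℝ F] {D : Set E3} {f : E3 → F}
    (hf : IsTest D f) : IsTest Set.univ f := ⟨hf.1, hf.2.1, Set.subset_univ _⟩

lemma IsTest.mul {D : Set E3} {f g : E3 → ℝ} (hf : IsTest D f) (hg : ContDiff ℝ (⊤ : ℕ∞) g) :
    IsTest D (fun x => f x * g x) :=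
  ⟨hf.1.mul hg, hf.2.1.mul_right, (closure_mono (fun x hx => by
    simp only [Function.mem_support, ne_eq, mul_eq_zero, not_or] at hx ⊢; exact hx.1)).trans hf.2.2⟩

lemma pd_mul {f g : E3 → ℝ} (hf : ContDiff ℝ (⊤ : ℕ∞) f) (hg : ContDiff ℝ (⊤ : ℕ∞) g) (k : Fin 3)
    (x : E3) : pd k (fun x => f x * g x) x = pd k f x * g x + f x * pd k g x := by
  have h1 := (hf.differentiable (by simp)).differentiableAt (x := x)
  have h2 := (hg.differentiable (by simp)).differentiableAt (x := x)
  simp [pd, fderiv_fun_mul h1 h2]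
  ring

lemma integral_pd_mul {f g : E3 → ℝ} (hf : ContDiff ℝ (⊤ : ℕ∞) f) (hg : ContDiff ℝ (⊤ : ℕ∞) g)
    (hc : HasCompactSupport f) (k : Fin 3) :
    ∫ x, pd k f x * g x = - ∫ x, f x * pd k g x := by
  have h := integral_mul_fderiv_eq_neg_fderiv_mul_of_integrable (μ := (volume : Measure E3))
    (f := f) (g := g) (v := EuclideanSpace.single k 1) ?_ ?_ ?_ ?_ ?_
  · simp only [pd]; rw [h]; simp
  · exact ((contDiff_pd hf k).continuous.mul hg.continuous).integrable_of_hasCompactSupport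
      (hasCompactSupport_pd hc k).mul_right
  · exact (hf.continuous.mul (contDiff_pd hg k).continuous).integrable_of_hasCompactSupport
      hc.mul_right
  · exact (hf.continuous.mul hg.continuous).integrable_of_hasCompactSupport hc.mul_right
  · exact fun x _ => (hf.differentiable (by simp)).differentiableAt
  · exact fun x _ => (hg.differentiable (by simp)).differentiableAt

lemma integral_pd_eq_zero {f : E3 → ℝ} (hf : ContDiff ℝ (⊤ : ℕ∞) f)
    (hc : HasCompactSupport f) (k : Fin 3) : ∫ x, pd k f x = 0 := by
  have := integral_pd_mul hf (contDiff_const (c := (1 : ℝ))) hc k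
  simpa [pd] using this

/-! ### Integral functionals on `L²` -/

section functionals

variable {α : Type*} {m : MeasurableSpace α} {μ : Measure α}

/-- The functionals here and below are written through L² inner products and Hölder multiplication
to make them continuous. Identities between them are then closed conditions, and pass from test
fields to `Hsol` and `Vsol` by density. -/
lemma continuous_integral_mul {b : α → ℝ} (hb : MemLp b 2 μ) :
    Continuous fun f : Lp ℝ 2 μ => ∫ x, b x * f x ∂μ := by
  have : (fun f : Lp ℝ 2 μ => ∫ x, b x * f x ∂μ) = fun f => inner ℝ (hb.toLp b) f := by
    ext f
    rw [L2.inner_def]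
    refine integral_congr_ae ?_
    filter_upwards [hb.coeFn_toLp] with x hx
    simp [hx, mul_comm]
  rw [this]
  fun_prop

lemma continuous_integral_mul_mul {b : α → ℝ} (hb : MemLp b ⊤ μ) :
    Continuous fun q : Lp ℝ 2 μ × Lp ℝ 2 μ => ∫ x, b x * q.1 x * q.2 x ∂μ := by
  have : (fun q : Lp ℝ 2 μ × Lp ℝ 2 μ => ∫ x, b x * q.1 x * q.2 x ∂μ) =
      fun q => inner ℝ q.2 ((ContinuousLinearMap.mul ℝ ℝ).holderL μ ⊤ 2 2 (hb.toLp b) q.1) := by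
    ext q
    rw [L2.inner_def]
    refine integral_congr_ae ?_
    filter_upwards [hb.coeFn_toLp,
      (ContinuousLinearMap.mul ℝ ℝ).coeFn_holder (r := 2) (hb.toLp b) q.1] with x hx h2
    simp only [ContinuousLinearMap.holderL_apply_apply, h2]
    simp [hx]
  rw [this]
  fun_prop

/-- The coordinate functions of a square integrable field. -/
noncomputable def coordL2 {ι : Type*} [Fintype ι] (μ : Measure α) (k : ι) :
    Lp (EuclideanSpace ℝ ι) 2 μ →L[ℝ] Lp ℝ 2 μ :=
  (EuclideanSpace.proj (𝕜 := ℝ) k).compLpL 2 μ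

lemma coordL2_ae {ι : Type*} [Fintype ι] (k : ι) (f : Lp (EuclideanSpace ℝ ι) 2 μ) :
    coordL2 μ k f =ᵐ[μ] fun x => f x k :=
  ContinuousLinearMap.coeFn_compLpL _ f

lemma continuous_integral_coord {ι : Type*} [Fintype ι] (k : ι) {b : α → ℝ} (hb : MemLp b 2 μ) :
    Continuous fun f : Lp (EuclideanSpace ℝ ι) 2 μ => ∫ x, b x * f x k ∂μ := by
  refine ((continuous_integral_mul hb).comp (coordL2 μ k).continuous).congr fun f => ?_
  refine integral_congr_ae ?_
  filter_upwards [coordL2_ae k f] with x hx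
  rw [hx]

lemma continuous_integral_coord_coord {ι κ : Type*} [Fintype ι] [Fintype κ] (k : ι) (l : κ)
    {b : α → ℝ} (hb : MemLp b ⊤ μ) :
    Continuous fun q : Lp (EuclideanSpace ℝ ι) 2 μ × Lp (EuclideanSpace ℝ κ) 2 μ =>
      ∫ x, b x * q.1 x k * q.2 x l ∂μ := by
  refine ((continuous_integral_mul_mul hb).comp
    (((coordL2 μ k).continuous.comp continuous_fst).prodMk
      ((coordL2 μ l).continuous.comp continuous_snd))).congr fun q => ?_
  refine integral_congr_ae ?_
  filter_upwards [coordL2_ae k q.1, coordL2_ae l q.2] with x hx hy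
  simp [hx, hy]

lemma memLp_coord {ι : Type*} [Fintype ι] (k : ι) (f : Lp (EuclideanSpace ℝ ι) 2 μ) :
    MemLp (fun x => f x k) 2 μ :=
  (memLp_congr_ae (coordL2_ae k f)).1 (Lp.memLp _)

lemma integrable_mul_coord {ι : Type*} [Fintype ι] (k : ι) (f : Lp (EuclideanSpace ℝ ι) 2 μ)
    {b : α → ℝ} (hb : MemLp b 2 μ) : Integrable (fun x => b x * f x k) μ :=
  MemLp.integrable_mul hb (memLp_coord k f)

lemma integrable_mul_coord_coord {ι κ : Type*} [Fintype ι] [Fintype κ] (k : ι) (l : κ)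
    (f : Lp (EuclideanSpace ℝ ι) 2 μ) (g : Lp (EuclideanSpace ℝ κ) 2 μ)
    {b : α → ℝ} (hb : MemLp b ⊤ μ) : Integrable (fun x => b x * f x k * g x l) μ :=
  MemLp.integrable_mul (p := 2) (q := 2) ((memLp_coord k f).mul hb) (memLp_coord l g)

end functionals

lemma memLp_of_continuous_hasCompactSupport {f : E3 → ℝ} (hf : Continuous f)
    (hc : HasCompactSupport f) (p : ℝ≥0∞) (D : Set E3) : MemLp f p (volume.restrict D) :=
  (hf.memLp_of_hasCompactSupport hc).restrict D

/-! ### Test fields -/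

lemma IsTest.add {F : Type*} [NormedAddCommGroup F] [NormedSpace ℝ F] {D : Set E3} {f g : E3 → F}
    (hf : IsTest D f) (hg : IsTest D g) : IsTest D (f + g) := by
  refine ⟨hf.1.add hg.1, hf.2.1.add hg.2.1, (tsupport_add f g).trans ?_⟩
  exact union_subset hf.2.2 hg.2.2

lemma IsTest.const_smul {F : Type*} [NormedAddCommGroup F] [NormedSpace ℝ F] {D : Set E3}
    {f : E3 → F} (hf : IsTest D f) (c : ℝ) : IsTest D (c • f) :=
  ⟨hf.1.const_smul c, hf.2.1.smul_left (f := fun _ => c),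
    (tsupport_smul_subset_right (fun _ => c) f).trans hf.2.2⟩

lemma isTest_zero {F : Type*} [NormedAddCommGroup F] [NormedSpace ℝ F] (D : Set E3) :
    IsTest D (0 : E3 → F) :=
  ⟨contDiff_const, HasCompactSupport.zero, by simp⟩

lemma partialDeriv_add {φ χ : E3 → E3} (hφ : ContDiff ℝ (⊤ : ℕ∞) φ) (hχ : ContDiff ℝ (⊤ : ℕ∞) χ)
    (i j : Fin 3) (x : E3) :
    partialDeriv (φ + χ) i j x = partialDeriv φ i j x + partialDeriv χ i j x := by
  have h1 := (hφ.differentiable (by simp)).differentiableAt (x := x)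
  have h2 := (hχ.differentiable (by simp)).differentiableAt (x := x)
  simp [partialDeriv, fderiv_add h1 h2]

lemma partialDeriv_smul {φ : E3 → E3} (hφ : ContDiff ℝ (⊤ : ℕ∞) φ) (c : ℝ)
    (i j : Fin 3) (x : E3) : partialDeriv (c • φ) i j x = c * partialDeriv φ i j x := by
  have h1 := (hφ.differentiable (by simp)).differentiableAt (x := x)
  simp [partialDeriv, fderiv_const_smul h1]

lemma partialDeriv_zero (i j : Fin 3) (x : E3) : partialDeriv 0 i j x = 0 := by
  simp [partialDeriv]

lemma jacobian_add {φ χ : E3 → E3} (hφ : ContDiff ℝ (⊤ : ℕ∞) φ) (hχ : ContDiff ℝ (⊤ : ℕ∞) χ)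
    (x : E3) : jacobian (φ + χ) x = jacobian φ x + jacobian χ x := by
  ext ij; simp [jacobian, partialDeriv_add hφ hχ]

lemma jacobian_smul {φ : E3 → E3} (hφ : ContDiff ℝ (⊤ : ℕ∞) φ) (c : ℝ) (x : E3) :
    jacobian (c • φ) x = c • jacobian φ x := by
  ext ij; simp [jacobian, partialDeriv_smul hφ]

/-- The pairs `(φ, ∇φ)` with `φ` a divergence free test field. -/
def testPairs (D : Set E3) : Submodule ℝ (L2 D × L2M D) where
  carrier := {q | ∃ φ, IsSolTest D φ ∧ q.1 =ᵐ[volume.restrict D] φ ∧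
    q.2 =ᵐ[volume.restrict D] jacobian φ}
  add_mem' := by
    rintro q r ⟨φ, hφ, h1, h2⟩ ⟨χ, hχ, h3, h4⟩
    refine ⟨φ + χ, ⟨hφ.1.add hχ.1, fun x => ?_⟩, ?_, ?_⟩
    · have a1 := hφ.2 x
      have a2 := hχ.2 x
      simp only [divergence, partialDeriv_add hφ.1.1 hχ.1.1, Finset.sum_add_distrib] at *
      rw [a1, a2, add_zero]
    · exact (Lp.coeFn_add _ _).trans (h1.add h3)
    · refine (Lp.coeFn_add _ _).trans ((h2.add h4).trans (.of_forall fun x => ?_))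
      simp [jacobian_add hφ.1.1 hχ.1.1]
  zero_mem' := by
    refine ⟨0, ⟨isTest_zero D, fun x => by simp [divergence, partialDeriv_zero]⟩, ?_, ?_⟩
    · exact Lp.coeFn_zero _ _ _
    · refine (Lp.coeFn_zero _ _ _).trans (.of_forall fun x => ?_)
      ext ij; simp [jacobian, partialDeriv_zero]
  smul_mem' := by
    rintro c q ⟨φ, hφ, h1, h2⟩
    refine ⟨c • φ, ⟨hφ.1.const_smul c, fun x => ?_⟩, ?_, ?_⟩
    · have a1 := hφ.2 x
      simp only [divergence, partialDeriv_smul hφ.1.1, ← Finset.mul_sum] at *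
      rw [a1, mul_zero]
    · exact (Lp.coeFn_smul _ _).trans (h1.const_smul c)
    · refine (Lp.coeFn_smul _ _).trans ((h2.const_smul c).trans (.of_forall fun x => ?_))
      simp [jacobian_smul hφ.1.1]

/-- Test pairs are closed under linear combinations, so the span in the definition adds nothing and
every element of V is a limit of single smooth pairs. -/
lemma coe_Vsol (D : Set E3) : (Vsol D : Set (L2 D × L2M D)) = closure (testPairs D) := by
  have : Vsol D = (testPairs D).topologicalClosure := by
    rw [Vsol]; congr 1; exact Submodule.span_eq (testPairs D)
  rw [this]; rfl

/-- A closed property of pairs that holds for test fields holds on `V`. -/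
lemma Vsol_induction {D : Set E3} {p : L2 D × L2M D → Prop} (hp : IsClosed {q | p q})
    (h : ∀ (q : L2 D × L2M D) φ, IsSolTest D φ → q.1 =ᵐ[volume.restrict D] φ →
      q.2 =ᵐ[volume.restrict D] jacobian φ → p q) {q : L2 D × L2M D} (hq : q ∈ Vsol D) : p q := by
  have h2 : q ∈ closure (testPairs D : Set (L2 D × L2M D)) := coe_Vsol D ▸ hq
  exact closure_minimal (by rintro r ⟨φ, a, b, c⟩; exact h r φ a b c) hp h2

lemma continuous_partialDeriv {φ : E3 → E3} (hφ : ContDiff ℝ (⊤ : ℕ∞) φ) (i j : Fin 3) :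
    Continuous (partialDeriv φ i j) := by
  rw [funext (partialDeriv_eq_pd hφ i j)]
  exact (contDiff_pd (contDiff_comp_coord hφ j) i).continuous

lemma continuous_jacobian {φ : E3 → E3} (hφ : ContDiff ℝ (⊤ : ℕ∞) φ) :
    Continuous (jacobian φ) :=
  (PiLp.continuous_toLp 2 _).comp
    (continuous_pi fun ij => continuous_partialDeriv hφ ij.1 ij.2)

lemma hasCompactSupport_jacobian {φ : E3 → E3} (hφ : HasCompactSupport φ) :
    HasCompactSupport (jacobian φ) := by
  refine hφ.mono' fun x hx => ?_
  by_contra h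
  have h2 : x ∉ tsupport (fderiv ℝ φ) := fun h' => h (tsupport_fderiv_subset ℝ h')
  apply hx
  ext ij
  simp [jacobian, partialDeriv, image_eq_zero_of_notMem_tsupport h2]

lemma exists_testPair {D : Set E3} {φ : E3 → E3} (hφ : IsSolTest D φ) {f : L2 D}
    (hf : f =ᵐ[volume.restrict D] φ) : ∃ G, (f, G) ∈ testPairs D := by
  have h : MemLp (jacobian φ) 2 (volume.restrict D) :=
    ((continuous_jacobian hφ.1.1).memLp_of_hasCompactSupport
      (hasCompactSupport_jacobian hφ.1.2.1)).restrict D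
  exact ⟨h.toLp, φ, hφ, hf, h.coeFn_toLp⟩

/-- A closed property of fields that holds for test fields holds on `H`. -/
lemma Hsol_induction {D : Set E3} {p : L2 D → Prop} (hp : IsClosed {f | p f})
    (h : ∀ (f : L2 D) φ, IsSolTest D φ → f =ᵐ[volume.restrict D] φ → p f) {f : L2 D} (hf : f ∈ Hsol D) :
    p f := by
  -- The generators of H are first components of `testPairs`. The projection of that subspace is a
  -- subspace, so again no finite sums have to be considered.
  have h1 : Hsol D ≤ ((testPairs D).map (LinearMap.fst ℝ _ _)).topologicalClosure := by
    refine Submodule.topologicalClosure_mono (Submodule.span_le.2 ?_)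
    rintro g ⟨φ, a, b⟩
    obtain ⟨G, hG⟩ := exists_testPair a b
    exact ⟨(g, G), hG, rfl⟩
  have h2 : f ∈ closure (((testPairs D).map (LinearMap.fst ℝ _ _) : Submodule ℝ (L2 D)) :
    Set (L2 D)) := h1 hf
  refine closure_minimal ?_ hp h2
  rintro _ ⟨q, ⟨φ, a, b, -⟩, rfl⟩
  exact h _ φ a b

lemma fst_mem_Hsol {D : Set E3} {q : L2 D × L2M D} (hq : q ∈ Vsol D) : q.1 ∈ Hsol D := by
  refine Vsol_induction (p := fun q => q.1 ∈ Hsol D) ?_ ?_ hq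
  · exact (Submodule.isClosed_topologicalClosure _).preimage continuous_fst
  · intro q φ h1 h2 h3
    exact Submodule.le_topologicalClosure _ (Submodule.subset_span ⟨φ, h1, h2⟩)

lemma setIntegral_eq_integral_of_tsupport {D : Set E3} {f : E3 → ℝ}
    (hf : ∀ x, x ∉ D → f x = 0) : ∫ x in D, f x = ∫ x, f x :=
  setIntegral_eq_integral_of_forall_compl_eq_zero hf

lemma IsTest.eq_zero {F : Type*} [NormedAddCommGroup F] [NormedSpace ℝ F] {D : Set E3}
    {f : E3 → F} (hf : IsTest D f) {x : E3} (hx : x ∉ D) : f x = 0 :=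
  image_eq_zero_of_notMem_tsupport fun h => hx (hf.2.2 h)

/-- Fields in `H` are weakly divergence free on the whole space. -/
lemma Hsol_divFree {D : Set E3} {v : L2 D} (hv : v ∈ Hsol D) {φ : E3 → ℝ}
    (hφ : IsTest Set.univ φ) : ∑ k, ∫ x in D, pd k φ x * v x k = 0 := by
  have hb : ∀ k, MemLp (pd k φ) 2 (volume.restrict D) := fun k =>
    memLp_of_continuous_hasCompactSupport (contDiff_pd hφ.1 k).continuous
      (hasCompactSupport_pd hφ.2.1 k) _ _
  refine Hsol_induction (p := fun v : L2 D => ∑ k, ∫ x in D, pd k φ x * v x k = 0) ?_ ?_ hv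
  · exact isClosed_eq (continuous_finsetSum _ fun k _ => continuous_integral_coord k (hb k))
      continuous_const
  · intro f χ hχ hf
    -- The approximating field χ is supported in D, so no boundary term appears although φ need not
    -- vanish near ∂D.
    have h1 : ∀ k, ∫ x in D, pd k φ x * f x k = - ∫ x, φ x * partialDeriv χ k k x := by
      intro k
      rw [integral_congr_ae (g := fun x => pd k φ x * χ x k)
        (by filter_upwards [hf] with x hx; rw [hx]),
        setIntegral_eq_integral_of_tsupport (fun x hx => by simp [hχ.1.eq_zero hx]),
        integral_pd_mul hφ.1 (contDiff_comp_coord hχ.1.1 k) hφ.2.1]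
      simp only [partialDeriv_eq_pd hχ.1.1]
    simp only [h1, Finset.sum_neg_distrib]
    rw [← integral_finsetSum]
    · have : ∀ x, ∑ k, φ x * partialDeriv χ k k x = 0 := fun x => by
        have := hχ.2 x
        rw [divergence] at this
        rw [← Finset.mul_sum, this, mul_zero]
      simp [this]
    · intro k _
      exact (hφ.1.continuous.mul (continuous_partialDeriv hχ.1.1 k k)).integrable_of_hasCompactSupport
        hφ.2.1.mul_right

/-- The second entry of an element of `V` is the weak gradient of the first. -/
lemma Vsol_weakGrad {D : Set E3} {q : L2 D × L2M D} (hq : q ∈ Vsol D) {φ : E3 → ℝ}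
    (hφ : IsTest Set.univ φ) (k i : Fin 3) :
    ∫ x in D, φ x * q.2 x (k, i) = - ∫ x in D, pd k φ x * q.1 x i := by
  have hb : MemLp (pd k φ) 2 (volume.restrict D) :=
    memLp_of_continuous_hasCompactSupport (contDiff_pd hφ.1 k).continuous
      (hasCompactSupport_pd hφ.2.1 k) _ _
  have hb' : MemLp φ 2 (volume.restrict D) :=
    memLp_of_continuous_hasCompactSupport hφ.1.continuous hφ.2.1 _ _
  refine Vsol_induction (p := fun q => ∫ x in D, φ x * q.2 x (k, i) =
    - ∫ x in D, pd k φ x * q.1 x i) ?_ ?_ hq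
  · exact isClosed_eq ((continuous_integral_coord _ hb').comp continuous_snd)
      ((continuous_integral_coord _ hb).comp continuous_fst).neg
  · intro q χ hχ h1 h2
    have e1 : ∫ x in D, φ x * q.2 x (k, i) = ∫ x, φ x * pd k (fun x => χ x i) x := by
      rw [← setIntegral_eq_integral_of_tsupport (D := D)
        (fun x hx => by rw [((hχ.1.coord i).pd k).eq_zero hx, mul_zero])]
      refine integral_congr_ae ?_
      filter_upwards [h2] with x hx
      rw [hx, ← partialDeriv_eq_pd hχ.1.1]; rfl
    have e2 : ∫ x in D, pd k φ x * q.1 x i = ∫ x, pd k φ x * χ x i := by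
      rw [← setIntegral_eq_integral_of_tsupport (D := D)
        (fun x hx => by simp [hχ.1.eq_zero hx])]
      refine integral_congr_ae ?_
      filter_upwards [h1] with x hx
      rw [hx]
    rw [e1, e2, integral_pd_mul hφ.1 (contDiff_comp_coord hχ.1.1 i) hφ.2.1, neg_neg]

lemma IsTest.memLp_top {D : Set E3} {f : E3 → ℝ} (hf : IsTest D f) (E : Set E3) :
    MemLp f ⊤ (volume.restrict E) :=
  memLp_of_continuous_hasCompactSupport hf.1.continuous hf.2.1 _ _

/-- Integration by parts in the convection term. -/
lemma Vsol_convection {D : Set E3} {q : L2 D × L2M D} (hq : q ∈ Vsol D) {φ : E3 → ℝ}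
    (hφ : IsTest Set.univ φ) (i : Fin 3) :
    ∑ k, ∫ x in D, φ x * q.1 x k * q.2 x (k, i) =
      - ∑ k, ∫ x in D, pd k φ x * q.1 x k * q.1 x i := by
  refine Vsol_induction (p := fun q => ∑ k, ∫ x in D, φ x * q.1 x k * q.2 x (k, i) =
      - ∑ k, ∫ x in D, pd k φ x * q.1 x k * q.1 x i) ?_ ?_ hq
  · refine isClosed_eq (continuous_finsetSum _ fun k _ => ?_)
      (continuous_finsetSum _ fun k _ => ?_).neg
    · exact continuous_integral_coord_coord _ _ (hφ.memLp_top D)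
    · exact (continuous_integral_coord_coord k i ((hφ.pd k).memLp_top D)).comp
        (continuous_fst.prodMk continuous_fst)
  · intro q χ hχ h1 h2
    have e1 : ∀ k, ∫ x in D, φ x * q.1 x k * q.2 x (k, i) =
        ∫ x, φ x * χ x k * pd k (fun x => χ x i) x := by
      intro k
      rw [integral_congr_ae (g := fun x => φ x * χ x k * pd k (fun x => χ x i) x) (by
        filter_upwards [h1, h2] with x hx hy
        rw [hx, hy, ← partialDeriv_eq_pd hχ.1.1]; rfl),
        setIntegral_eq_integral_of_tsupport (fun x hx => by simp [hχ.1.eq_zero hx])]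
    have e2 : ∀ k, ∫ x in D, pd k φ x * q.1 x k * q.1 x i = ∫ x, pd k φ x * χ x k * χ x i := by
      intro k
      rw [integral_congr_ae (g := fun x => pd k φ x * χ x k * χ x i) (by
        filter_upwards [h1] with x hx
        rw [hx]), setIntegral_eq_integral_of_tsupport (fun x hx => by simp [hχ.1.eq_zero hx])]
    have c := fun j => contDiff_comp_coord hχ.1.1 j
    -- The derivative is moved onto φχ_k. The part falling on χ_k produces div χ after summation
    -- over k.
    have e3 : ∀ k, ∫ x, φ x * χ x k * pd k (fun x => χ x i) x = (- ∫ x, pd k φ x * χ x k * χ x i) -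
        ∫ x, φ x * χ x i * partialDeriv χ k k x := by
      intro k
      have := integral_pd_mul (hφ.1.mul (c k)) (c i) hφ.2.1.mul_right k
      rw [eq_comm, neg_eq_iff_eq_neg] at this
      rw [this, ← neg_add', neg_inj, ← integral_add]
      · refine integral_congr_ae (.of_forall fun x => ?_)
        simp only [pd_mul hφ.1 (c k), partialDeriv_eq_pd hχ.1.1]
        ring
      · exact ((((contDiff_pd hφ.1 k).continuous.mul (c k).continuous).mul
          (c i).continuous)).integrable_of_hasCompactSupport
          (hasCompactSupport_pd hφ.2.1 k).mul_right.mul_right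
      · exact (((hφ.1.continuous.mul (c i).continuous).mul
          (continuous_partialDeriv hχ.1.1 k k))).integrable_of_hasCompactSupport
          hφ.2.1.mul_right.mul_right
    simp only [e1, e2, e3, Finset.sum_sub_distrib, Finset.sum_neg_distrib]
    rw [sub_eq_self, ← integral_finsetSum]
    · have : ∀ x, ∑ k, φ x * χ x i * partialDeriv χ k k x = 0 := fun x => by
        have := hχ.2 x
        rw [divergence] at this
        rw [← Finset.mul_sum, this, mul_zero]
      simp [this]
    · intro k _
      exact (((hφ.1.continuous.mul (c i).continuous).mul
          (continuous_partialDeriv hχ.1.1 k k))).integrable_of_hasCompactSupport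
          hφ.2.1.mul_right.mul_right

/-- Both second components are weak gradients of the same field, hence agree against test functions
of D and so almost everywhere. The choice of gradient made in `liftV` is therefore harmless. -/
lemma Vsol_grad_unique {D : Set E3} (hD : IsOpen D) {q r : L2 D × L2M D} (hq : q ∈ Vsol D)
    (hr : r ∈ Vsol D) (h : q.1 = r.1) : q = r := by
  refine Prod.ext h (Lp.ext ?_)
  have key : ∀ ki : Fin 3 × Fin 3, ∀ᵐ x ∂(volume : Measure E3), x ∈ D →
      q.2 x ki - r.2 x ki = 0 := by
    rintro ⟨k, i⟩
    have m1 : MemLp (fun x => q.2 x (k, i) - r.2 x (k, i)) 2 (volume.restrict D) :=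
      (memLp_coord (k, i) q.2).sub (memLp_coord (k, i) r.2)
    refine hD.ae_eq_zero_of_integral_contDiff_smul_eq_zero ?_ ?_
    · have := (m1.locallyIntegrable (by norm_num))
      exact (locallyIntegrableOn_of_locallyIntegrable_restrict this)
    · intro g hg hc hs
      have ht : IsTest D g := ⟨hg, hc, hs⟩
      have e1 := Vsol_weakGrad hq ht.univ k i
      have e2 := Vsol_weakGrad hr ht.univ k i
      rw [← setIntegral_eq_integral_of_tsupport (D := D)
        (fun x hx => by simp [ht.eq_zero hx])]
      simp only [smul_eq_mul, mul_sub]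
      have mg : MemLp g 2 (volume.restrict D) :=
        memLp_of_continuous_hasCompactSupport hg.continuous hc _ _
      rw [integral_sub (integrable_mul_coord _ _ mg) (integrable_mul_coord _ _ mg), e1, e2, h,
        sub_self]
  rw [Filter.EventuallyEq, ae_restrict_iff' hD.measurableSet]
  filter_upwards [ae_all_iff.2 key] with x hx hxD
  ext ki
  exact sub_eq_zero.1 (hx ki hxD)

/-- The 3 counts the coordinates of v, each at most ‖v‖, and each column of the derivative is
bounded by the Frobenius norm. -/
lemma norm_fderiv_le_jacobian (φ : E3 → E3) (x : E3) : ‖fderiv ℝ φ x‖ ≤ 3 * ‖jacobian φ x‖ := by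
  refine ContinuousLinearMap.opNorm_le_bound _ (by positivity) fun v => ?_
  have hv : v = ∑ i, v i • EuclideanSpace.single i (1 : ℝ) := by
    ext j; simp [Finset.sum_apply, Pi.single_apply]
  have h1 : ∀ i, ‖fderiv ℝ φ x (EuclideanSpace.single i 1)‖ ≤ ‖jacobian φ x‖ := by
    intro i
    rw [EuclideanSpace.norm_eq, EuclideanSpace.norm_eq]
    refine Real.sqrt_le_sqrt ?_
    rw [Fintype.sum_prod_type]
    exact Finset.single_le_sum (f := fun i => ∑ j, ‖jacobian φ x (i, j)‖ ^ 2)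
      (fun _ _ => Finset.sum_nonneg fun _ _ => by positivity) (Finset.mem_univ i)
  calc ‖fderiv ℝ φ x v‖ = ‖∑ i, v i • fderiv ℝ φ x (EuclideanSpace.single i 1)‖ := by
        conv_lhs => rw [hv]
        simp only [map_sum, map_smul]
    _ ≤ ∑ i : Fin 3, ‖v‖ * ‖jacobian φ x‖ := by
        refine norm_sum_le_of_le _ fun i _ => ?_
        rw [norm_smul]
        exact mul_le_mul (PiLp.norm_apply_le v i) (h1 i) (norm_nonneg _) (norm_nonneg _)
    _ = 3 * ‖jacobian φ x‖ * ‖v‖ := by simp; ring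

/-- The Poincaré inequality on `V`. -/
lemma exists_poincare {D : Set E3} (hb : Bornology.IsBounded D) :
    ∃ C : ℝ≥0, ∀ q ∈ Vsol D, ‖q.1‖ ≤ C * ‖q.2‖ := by
  set K := eLpNormLESNormFDerivOfLeConst E3 (volume : Measure E3) D 2 2
  refine ⟨K * 3, fun q hq => ?_⟩
  refine Vsol_induction (p := fun q => ‖q.1‖ ≤ (K * 3 : ℝ≥0) * ‖q.2‖) ?_ ?_ hq
  · exact isClosed_le (by fun_prop) (by fun_prop)
  · intro q χ hχ h1 h2
    have hs : Function.support χ ⊆ D := (subset_tsupport _).trans hχ.1.2.2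
    -- A test field is supported in the bounded set D, where the Gagliardo–Nirenberg–Sobolev
    -- inequality may be used with both exponents equal to 2.
    have h3 := eLpNorm_le_eLpNorm_fderiv_of_le (volume : Measure E3) (u := χ) (s := D) (p := 2)
      (q := 2) (hχ.1.1.of_le (by norm_cast)) hs (by norm_num) (by norm_num)
      (by simp) hb
    have h4 : eLpNorm (fderiv ℝ χ) 2 (volume : Measure E3) ≤
        ENNReal.ofReal 3 * eLpNorm (jacobian χ) 2 volume :=
      eLpNorm_le_mul_eLpNorm_of_ae_le_mul (.of_forall fun x => norm_fderiv_le_jacobian χ x) _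
    have hj : Function.support (jacobian χ) ⊆ D := by
      intro x hx
      by_contra h
      apply hx
      have : x ∉ tsupport (fderiv ℝ χ) := fun h' => h (hχ.1.2.2 (tsupport_fderiv_subset ℝ h'))
      ext ij
      simp [jacobian, partialDeriv, image_eq_zero_of_notMem_tsupport this]
    have e1 : eLpNorm χ 2 (volume.restrict D) = eLpNorm χ 2 volume :=
      eLpNorm_restrict_eq_of_support_subset hs
    have e2 : eLpNorm (jacobian χ) 2 (volume.restrict D) = eLpNorm (jacobian χ) 2 volume :=
      eLpNorm_restrict_eq_of_support_subset hj
    have h5 : ‖q.1‖ₑ ≤ ((K * 3 : ℝ≥0) : ℝ≥0∞) * ‖q.2‖ₑ := by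
      rw [Lp.enorm_def, Lp.enorm_def, eLpNorm_congr_ae h1, eLpNorm_congr_ae h2, e1, e2]
      refine h3.trans ?_
      rw [ENNReal.coe_mul, mul_assoc]
      gcongr
      simpa using h4
    have h6 := ENNReal.toReal_mono (by finiteness) h5
    simpa using h6

/-! ### The lift from `H` to `V` -/

section lift

variable {D : Set E3}

lemma liftV_of_mem (hD : IsOpen D) (q : Vsol D) : liftV D (q : L2 D × L2M D).1 = q := by
  have h : ∃ G : L2M D, ((q : L2 D × L2M D).1, G) ∈ Vsol D := ⟨(q : L2 D × L2M D).2, q.2⟩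
  rw [liftV, dif_pos h]
  exact Subtype.ext (Vsol_grad_unique hD h.choose_spec q.2 rfl)

lemma liftV_fst {v : L2 D} (h : ∃ G : L2M D, (v, G) ∈ Vsol D) :
    (liftV D v : L2 D × L2M D).1 = v := by
  rw [liftV, dif_pos h]

lemma mem_Vsol_grad {v : L2 D} (h : ∃ G : L2M D, (v, G) ∈ Vsol D) : (v, grad D v) ∈ Vsol D := by
  have := (liftV D v).2
  rwa [← Prod.mk.eta (p := (liftV D v : L2 D × L2M D)), liftV_fst h] at this

lemma dirichlet_of_mem (hD : IsOpen D) {v : L2 D} (h : ∃ G : L2M D, (v, G) ∈ Vsol D) :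
    dirichlet D v = ‖grad D v‖ₑ ^ 2 := by
  refine le_antisymm (iInf₂_le (grad D v) (mem_Vsol_grad h)) (le_iInf₂ fun G hG => ?_)
  have e : G = grad D v := (Prod.ext_iff.1 (Vsol_grad_unique hD hG (mem_Vsol_grad h) rfl)).2
  rw [e]

lemma dirichlet_of_notMem {v : L2 D} (h : ¬ ∃ G : L2M D, (v, G) ∈ Vsol D) :
    dirichlet D v = ⊤ := by
  push Not at h
  simp [dirichlet, h]

lemma exists_of_dirichlet_ne_top {v : L2 D} (h : dirichlet D v ≠ ⊤) :
    ∃ G : L2M D, (v, G) ∈ Vsol D := by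
  by_contra h'
  exact h (dirichlet_of_notMem h')

lemma enorm_grad_sq_le (hD : IsOpen D) (v : L2 D) : ‖grad D v‖ₑ ^ 2 ≤ dirichlet D v := by
  by_cases h : ∃ G : L2M D, (v, G) ∈ Vsol D
  · rw [dirichlet_of_mem hD h]
  · rw [dirichlet_of_notMem h]; exact le_top

/-- The embedding of `V` into `H`. -/
def embV (D : Set E3) (q : Vsol D) : Hsol D := ⟨(q : L2 D × L2M D).1, fst_mem_Hsol q.2⟩

/-- Continuous injections between Polish spaces are Borel embeddings (Lusin–Souslin); injectivity is
uniqueness of the gradient. Consequently V is a Borel subset of H and the gradient is a Borel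
function of the field, although it is not continuous in the topology of H. -/
lemma measurableEmbedding_embV (hD : IsOpen D) : MeasurableEmbedding (embV D) := by
  have : PolishSpace (Vsol D) := inferInstance
  refine Continuous.measurableEmbedding ?_ fun q r h => ?_
  · exact Continuous.subtype_mk (continuous_fst.comp continuous_subtype_val) _
  · exact Subtype.ext (Vsol_grad_unique hD q.2 r.2 (congrArg Subtype.val h))

lemma mem_range_embV {v : Hsol D} :
    v ∈ range (embV D) ↔ ∃ G : L2M D, ((v : L2 D), G) ∈ Vsol D := by
  constructor
  · rintro ⟨q, rfl⟩
    exact ⟨(q : L2 D × L2M D).2, q.2⟩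
  · rintro ⟨G, hG⟩
    exact ⟨⟨_, hG⟩, rfl⟩

lemma measurable_liftV (hD : IsOpen D) : Measurable fun v : Hsol D => liftV D (v : L2 D) := by
  have he := measurableEmbedding_embV hD
  -- The lift is the inverse of the embedding, extended by the default value 0 off V.
  have : (fun v : Hsol D => liftV D (v : L2 D)) =
      Function.extend (embV D) id (fun _ => (0 : Vsol D)) := by
    ext1 v
    by_cases h : v ∈ range (embV D)
    · obtain ⟨q, rfl⟩ := h
      rw [he.injective.extend_apply]
      exact liftV_of_mem hD q
    · rw [Function.extend_apply' _ _ _ (by simpa using h), liftV, dif_neg (mem_range_embV.not.1 h)]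
  rw [this]
  exact he.measurable_extend measurable_id measurable_const

lemma measurable_grad (hD : IsOpen D) : Measurable fun v : Hsol D => grad D (v : L2 D) := by
  have h : Continuous fun q : Vsol D => (q : L2 D × L2M D).2 :=
    continuous_snd.comp continuous_subtype_val
  exact h.measurable.comp (measurable_liftV hD)

lemma measurableSet_mem_V (hD : IsOpen D) :
    MeasurableSet {v : Hsol D | ∃ G : L2M D, ((v : L2 D), G) ∈ Vsol D} := by
  have := (measurableEmbedding_embV hD).measurableSet_range
  convert this using 1
  ext v; exact mem_range_embV.symm

open Classical in
lemma measurable_dirichlet (hD : IsOpen D) :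
    Measurable fun v : Hsol D => dirichlet D (v : L2 D) := by
  have : (fun v : Hsol D => dirichlet D (v : L2 D)) = fun v : Hsol D =>
      if ∃ G : L2M D, ((v : L2 D), G) ∈ Vsol D then ‖grad D (v : L2 D)‖ₑ ^ 2 else ⊤ := by
    ext1 v
    split_ifs with h
    · exact dirichlet_of_mem hD h
    · exact dirichlet_of_notMem h
  rw [this]
  exact Measurable.ite (measurableSet_mem_V hD) ((measurable_grad hD).enorm.pow_const 2)
    measurable_const

end lift

/-! ### Jointly measurable representatives -/

section rep

variable {α F : Type*} {m : MeasurableSpace α} {μ : Measure α} [NormedAddCommGroup F]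
  [CompleteSpace F]

/-- Elements of `L²` have representatives depending measurably on the element. -/
lemma exists_measurable_rep [SecondCountableTopology (Lp F 2 μ)] [MeasurableSpace (Lp F 2 μ)]
    [BorelSpace (Lp F 2 μ)] [SecondCountableTopology F] [MeasurableSpace F] [BorelSpace F] :
    ∃ R : Lp F 2 μ × α → F, Measurable R ∧ ∀ v : Lp F 2 μ, (fun x => R (v, x)) =ᵐ[μ] v := by
  classical
  set d : ℕ → Lp F 2 μ := TopologicalSpace.denseSeq (Lp F 2 μ) with hd
  -- The representative is a pointwise limit of elements of a countable dense sequence. Taking the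
  -- first index within 4^{-k} of v makes the choice measurable in v, and summability of 4^{-k}
  -- gives convergence almost everywhere.
  have hdense : ∀ (k : ℕ) (v : Lp F 2 μ), ∃ n, ‖d n - v‖ₑ < (1 / 4 : ℝ≥0∞) ^ k := by
    intro k v
    have hpos : (0 : ℝ≥0∞) < (1 / 4 : ℝ≥0∞) ^ k := ENNReal.pow_pos (by simp) _
    obtain ⟨n, hy⟩ := (TopologicalSpace.denseRange_denseSeq (Lp F 2 μ)).exists_mem_open
      (Metric.isOpen_eball (x := v) (ε := (1 / 4 : ℝ≥0∞) ^ k)) ⟨v, Metric.mem_eball_self hpos⟩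
    exact ⟨n, by simpa [edist_eq_enorm_sub] using hy⟩
  set N : ℕ → Lp F 2 μ → ℕ := fun k v => Nat.find (hdense k v) with hN
  have hNm : ∀ k, Measurable (N k) := fun k => measurable_find _ fun n =>
    measurableSet_lt (by fun_prop) measurable_const
  set G : ℕ → Lp F 2 μ × α → F := fun k q => d (N k q.1) q.2 with hG
  have hGm : ∀ k, Measurable (G k) := fun k => by
    have h1 : Measurable fun q : ℕ × α => d q.1 q.2 :=
      measurable_from_prod_countable_right fun n => (Lp.stronglyMeasurable (d n)).measurable
    exact h1.comp (((hNm k).comp measurable_fst).prodMk measurable_snd)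
  refine ⟨fun q => limUnder atTop fun k => G k q,
    (StronglyMeasurable.limUnder fun k => (hGm k).stronglyMeasurable).measurable, fun v => ?_⟩
  have hclose : ∀ k, eLpNorm (d (N k v) - v : α → F) 2 μ < (1 / 4 : ℝ≥0∞) ^ k := fun k => by
    have := Nat.find_spec (hdense k v)
    rwa [Lp.enorm_def, eLpNorm_congr_ae (Lp.coeFn_sub _ _)] at this
  have hcau := Lp.ae_tendsto_of_cauchy_eLpNorm (μ := μ) (p := 2) (f := fun k => d (N k v))
    (B := fun k => 2 * (1 / 4 : ℝ≥0∞) ^ k) (fun k => Lp.aestronglyMeasurable _) (by norm_num) ?_ ?_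
  -- Convergence to v in measure identifies the almost everywhere limit along a subsequence.
  · have hmeas : TendstoInMeasure μ (fun k => (d (N k v) : α → F)) atTop v := by
      refine tendstoInMeasure_of_tendsto_eLpNorm (p := 2) (by simp)
        (fun k => Lp.aestronglyMeasurable _) (Lp.aestronglyMeasurable _) ?_
      refine tendsto_of_tendsto_of_tendsto_of_le_of_le tendsto_const_nhds
        (ENNReal.tendsto_pow_atTop_nhds_zero_of_lt_one (r := 1 / 4) ?_) (fun _ => zero_le)
        (fun k => (hclose k).le)
      rw [one_div, ENNReal.inv_lt_one]; norm_num
    obtain ⟨ns, hns, hlim⟩ := hmeas.exists_seq_tendsto_ae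
    filter_upwards [hcau, hlim] with x ⟨l, hl⟩ h2
    have : l = v x := tendsto_nhds_unique (hl.comp hns.tendsto_atTop) h2
    exact this ▸ hl.limUnder_eq
  · rw [ENNReal.tsum_mul_left, ENNReal.tsum_geometric]
    refine ENNReal.mul_ne_top (by simp) ?_
    rw [ENNReal.inv_ne_top]
    refine (tsub_pos_of_lt ?_).ne'
    rw [one_div, ENNReal.inv_lt_one]; norm_num
  · intro k n l hn hl
    have e : (d (N n v) - d (N l v) : α → F) = (d (N n v) - v : α → F) - (d (N l v) - v) := by
      abel
    rw [e]
    refine (eLpNorm_sub_le ((Lp.aestronglyMeasurable _).sub (Lp.aestronglyMeasurable _))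
      ((Lp.aestronglyMeasurable _).sub (Lp.aestronglyMeasurable _)) (by norm_num)).trans_lt ?_
    rw [two_mul]
    have hmono : ∀ n, k ≤ n → (1 / 4 : ℝ≥0∞) ^ n ≤ (1 / 4 : ℝ≥0∞) ^ k := fun n hn =>
      pow_le_pow_of_le_one (by simp) (by rw [one_div, ENNReal.inv_le_one]; norm_num) hn
    exact ENNReal.add_lt_add ((hclose n).trans_le (hmono n hn)) ((hclose l).trans_le (hmono l hl))

end rep

/-- The product rule for primitives of integrable functions. -/
lemma primitive_mul {f g f' g' : ℝ → ℝ} {T : ℝ} (hT : 0 ≤ T)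
    (hf' : IntervalIntegrable f' volume 0 T) (hg' : IntervalIntegrable g' volume 0 T)
    (hf : ∀ t ∈ Icc 0 T, f t = f 0 + ∫ s in (0 : ℝ)..t, f' s)
    (hg : ∀ t ∈ Icc 0 T, g t = g 0 + ∫ s in (0 : ℝ)..t, g' s) :
    f T * g T - f 0 * g 0 = ∫ s in (0 : ℝ)..T, (f' s * g s + f s * g' s) := by
  have cst : ∀ c : ℝ, AbsolutelyContinuousOnInterval (fun _ => c) 0 T := fun c =>
    (LipschitzWith.const c).lipschitzOnWith.absolutelyContinuousOnInterval
  have af : AbsolutelyContinuousOnInterval (fun t => f 0 + ∫ s in (0 : ℝ)..t, f' s) 0 T :=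
    (cst _).fun_add (hf'.absolutelyContinuousOnInterval_intervalIntegral (by simp))
  have ag : AbsolutelyContinuousOnInterval (fun t => g 0 + ∫ s in (0 : ℝ)..t, g' s) 0 T :=
    (cst _).fun_add (hg'.absolutelyContinuousOnInterval_intervalIntegral (by simp))
  have key := AbsolutelyContinuousOnInterval.integral_deriv_mul_eq_sub af ag
  rw [hf T ⟨hT, le_rfl⟩, hg T ⟨hT, le_rfl⟩]
  simp only [intervalIntegral.integral_same, add_zero] at key
  rw [← key]
  refine intervalIntegral.integral_congr_ae ?_
  filter_upwards [hf'.ae_hasDerivAt_integral, hg'.ae_hasDerivAt_integral] with x h1 h2 hx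
  have hx' : x ∈ uIcc 0 T := uIoc_subset_uIcc hx
  have hxI : x ∈ Icc 0 T := by rwa [uIcc_of_le hT] at hx'
  have d1 := (h1 hx' 0 (by simp)).const_add (f 0)
  have d2 := (h2 hx' 0 (by simp)).const_add (g 0)
  rw [d1.deriv, d2.deriv, hf x hxI, hg x hxI]

/-! ### The Stokes eigenbasis -/

namespace StokesBasis

variable {D : Set E3} (B : StokesBasis D)

/-- The eigenvector `e k` as an element of `V`. -/
noncomputable def vec (k : ℕ) : Vsol D := ⟨((B.e k : L2 D), B.ge k), B.mem_V k⟩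

lemma inner_e (k l : ℕ) : inner ℝ (B.e k : L2 D) (B.e l : L2 D) = if k = l then 1 else 0 := by
  have := orthonormal_iff_ite.1 B.e.orthonormal k l
  exact this

/-- The eigenvalue relation tested with another eigenvector turns orthonormality in H into
orthogonality of the gradients. -/
lemma inner_ge (k l : ℕ) : inner ℝ (B.ge k) (B.ge l) = if k = l then B.ev k else 0 := by
  rw [B.eigen k _ (B.mem_V l)]
  simp only [inner_e]
  split_ifs <;> simp

lemma ev_eq (k : ℕ) : B.ev k = ‖B.ge k‖ ^ 2 := by
  rw [← real_inner_self_eq_norm_sq, inner_ge, if_pos rfl]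

lemma norm_e (k : ℕ) : ‖(B.e k : L2 D)‖ = 1 := B.e.orthonormal.1 k

/-- A vanishing gradient would contradict ‖e_k‖ = 1 by the Poincaré inequality. -/
lemma ev_pos (hb : Bornology.IsBounded D) (k : ℕ) : 0 < B.ev k := by
  obtain ⟨C, hC⟩ := exists_poincare hb
  rw [ev_eq]
  have h := hC _ (B.mem_V k)
  simp only [norm_e] at h
  have : ‖B.ge k‖ ≠ 0 := fun h0 => by rw [h0] at h; norm_num at h
  positivity

lemma norm_sum_ge_sq (s : Finset ℕ) (y : ℕ → ℝ) :
    ‖∑ k ∈ s, y k • B.ge k‖ ^ 2 = ∑ k ∈ s, B.ev k * y k ^ 2 := by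
  rw [← real_inner_self_eq_norm_sq, sum_inner]
  refine Finset.sum_congr rfl fun k hk => ?_
  rw [inner_sum, Finset.sum_eq_single k]
  · rw [inner_smul_left, inner_smul_right, inner_ge, if_pos rfl]; simp; ring
  · intro l _ hl
    rw [inner_smul_left, inner_smul_right, inner_ge, if_neg hl.symm]; simp
  · exact fun h => absurd hk h

/-- Partial sums of the expansion of `q ∈ V` in the eigenbasis. -/
noncomputable def partialSum (q : Vsol D) (N : ℕ) : Vsol D :=
  ∑ k ∈ Finset.range N, inner ℝ (B.e k : L2 D) (q : L2 D × L2M D).1 • B.vec k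

lemma partialSum_snd (q : Vsol D) (N : ℕ) : (B.partialSum q N : L2 D × L2M D).2 =
    ∑ k ∈ Finset.range N, inner ℝ (B.e k : L2 D) (q : L2 D × L2M D).1 • B.ge k := by
  simp [partialSum, vec, Prod.snd_sum]

lemma partialSum_fst (q : Vsol D) (N : ℕ) : (B.partialSum q N : L2 D × L2M D).1 =
    ∑ k ∈ Finset.range N, inner ℝ (B.e k : L2 D) (q : L2 D × L2M D).1 • (B.e k : L2 D) := by
  simp [partialSum, vec, Prod.fst_sum]

/-- Pythagoras: the eigenvalue relation shows that the gradient of the partial sum is the orthogonal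
projection of ∇q onto the span of the first N gradients `ge k`. -/
lemma norm_sub_partialSum_sq (q : Vsol D) (N : ℕ) :
    ‖(q : L2 D × L2M D).2 - (B.partialSum q N : L2 D × L2M D).2‖ ^ 2 =
      ‖(q : L2 D × L2M D).2‖ ^ 2 -
        ∑ k ∈ Finset.range N, B.ev k * inner ℝ (B.e k : L2 D) (q : L2 D × L2M D).1 ^ 2 := by
  rw [norm_sub_sq_real, partialSum_snd, norm_sum_ge_sq, inner_sum]
  have : ∀ k, inner ℝ (q : L2 D × L2M D).2
      (inner ℝ (B.e k : L2 D) (q : L2 D × L2M D).1 • B.ge k) =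
      B.ev k * inner ℝ (B.e k : L2 D) (q : L2 D × L2M D).1 ^ 2 := fun k => by
    rw [inner_smul_right, real_inner_comm (B.ge k), B.eigen k _ q.2]; ring
  simp only [this]
  ring

lemma norm_sub_partialSum_le (q : Vsol D) (hb : Bornology.IsBounded D) (N : ℕ) :
    ‖(q : L2 D × L2M D).2 - (B.partialSum q N : L2 D × L2M D).2‖ ^ 2 ≤
      ‖(q : L2 D × L2M D).2‖ ^ 2 := by
  rw [norm_sub_partialSum_sq]
  have : 0 ≤ ∑ k ∈ Finset.range N, B.ev k * inner ℝ (B.e k : L2 D) (q : L2 D × L2M D).1 ^ 2 :=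
    Finset.sum_nonneg fun k _ => mul_nonneg (B.ev_pos hb k).le (sq_nonneg _)
  linarith

/-- The eigenbasis is complete in `V`. -/
lemma tendsto_partialSum (hD : IsOpen D) (hb : Bornology.IsBounded D) (q : Vsol D) :
    Tendsto (fun N => ‖(q : L2 D × L2M D).2 - (B.partialSum q N : L2 D × L2M D).2‖ ^ 2) atTop
      (𝓝 0) := by
  set c : ℕ → ℝ := fun k => inner ℝ (B.e k : L2 D) (q : L2 D × L2M D).1 with hc
  have hpos := fun k => B.ev_pos hb k
  have hsum : Summable fun k => B.ev k * c k ^ 2 := by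
    refine summable_of_sum_range_le (c := ‖(q : L2 D × L2M D).2‖ ^ 2)
      (fun k => mul_nonneg (hpos k).le (sq_nonneg _)) fun N => ?_
    have := B.norm_sub_partialSum_sq q N
    have h2 := sq_nonneg ‖(q : L2 D × L2M D).2 - (B.partialSum q N : L2 D × L2M D).2‖
    simp only [hc]
    linarith
  have hcau : CauchySeq fun N => (B.partialSum q N : L2 D × L2M D).2 := by
    simp only [partialSum_snd]
    refine cauchySeq_finset_iff_vanishing_norm.2 (fun ε hε => ?_) |>.comp_tendsto
      Filter.tendsto_finset_range
    obtain ⟨s, hs⟩ := cauchySeq_finset_iff_vanishing_norm.1 hsum.hasSum.cauchySeq (ε ^ 2)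
      (by positivity)
    refine ⟨s, fun t ht => ?_⟩
    have h1 := hs t ht
    rw [Real.norm_of_nonneg (Finset.sum_nonneg fun k _ =>
      mul_nonneg (hpos k).le (sq_nonneg _)), ← norm_sum_ge_sq] at h1
    exact lt_of_pow_lt_pow_left₀ 2 hε.le h1
  obtain ⟨G, hG⟩ := cauchySeq_tendsto_of_complete hcau
  have hfst : Tendsto (fun N => (B.partialSum q N : L2 D × L2M D).1) atTop
      (𝓝 (q : L2 D × L2M D).1) := by
    have h1 := (B.e.hasSum_repr (embV D q)).tendsto_sum_nat
    have h2 := (continuous_subtype_val.tendsto _).comp h1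
    refine h2.congr fun N => ?_
    rw [partialSum_fst]
    simp only [Function.comp_apply, HilbertBasis.repr_apply_apply, AddSubmonoidClass.coe_finsetSum,
      Submodule.coe_smul]
    rfl
  -- Completeness of the basis in H gives convergence of the first components. Since V is closed,
  -- the limit G of the gradients belongs to the same field, and uniqueness of the gradient forces G
  -- = ∇q.
  have hmem : ((q : L2 D × L2M D).1, G) ∈ Vsol D := by
    refine (Submodule.isClosed_topologicalClosure _).mem_of_tendsto (hfst.prodMk_nhds hG) ?_
    exact .of_forall fun N => (B.partialSum q N).2
  have hGq : G = (q : L2 D × L2M D).2 :=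
    congrArg Prod.snd (Vsol_grad_unique hD hmem q.2 rfl)
  rw [hGq] at hG
  have := ((tendsto_const_nhds (x := (q : L2 D × L2M D).2)).sub hG).norm.pow 2
  simpa using this

end StokesBasis

/-! ### Galerkin energy estimate for the forcing along one path. -/

lemma sq_le_of_coercive {c A G b r W S E Q : ℝ} (hc : 0 < c) (hW : 0 ≤ W)
    (hQ : 0 ≤ Q) (h8 : Q ≤ G + b + r) (h1 : S ≤ c / 4 * G ^ 2 + W / c)
    (h4 : c * G ^ 2 - A * b * G - A * r * G ≤ E) :
    Q ^ 2 ≤ -(6 / c) * (S - E) +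
      (12 * A ^ 2 / c ^ 2 + 6 / c ^ 2 + 3) * (b ^ 2 + W + r ^ 2) := by
  have h7 : A * (b + r) * G ≤ c / 4 * G ^ 2 + 2 * A ^ 2 / c * (b ^ 2 + r ^ 2) := by
    have e : c / 4 * G ^ 2 + 2 * A ^ 2 / c * (b ^ 2 + r ^ 2) - A * (b + r) * G =
        (c * G / 2 - A * (b + r)) ^ 2 / c + A ^ 2 * (b - r) ^ 2 / c := by field_simp; ring
    have : 0 ≤ (c * G / 2 - A * (b + r)) ^ 2 / c + A ^ 2 * (b - r) ^ 2 / c := by positivity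
    linarith
  have h9 : Q ^ 2 ≤ 3 * (G ^ 2 + b ^ 2 + r ^ 2) := by
    have := pow_le_pow_left₀ hQ h8 2
    nlinarith [sq_nonneg (G - b), sq_nonneg (G - r), sq_nonneg (b - r)]
  -- Each of the two Young inequalities uses up c/4 of the coercive term, which leaves c/2.
  -- Multiplication by 6/c matches the 3G² of `h9`.
  have h10 : c / 2 * G ^ 2 ≤ - (S - E) + 2 * A ^ 2 / c * (b ^ 2 + r ^ 2) + W / c := by linarith
  have h11 := mul_le_mul_of_nonneg_left h10 (by positivity : (0 : ℝ) ≤ 6 / c)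
  have e1 : 6 / c * (c / 2 * G ^ 2) = 3 * G ^ 2 := by field_simp; ring
  have e2 : (6 / c) * (- (S - E) + 2 * A ^ 2 / c * (b ^ 2 + r ^ 2) + W / c) =
      -(6 / c) * (S - E) + 12 * A ^ 2 / c ^ 2 * (b ^ 2 + r ^ 2) + 6 / c ^ 2 * W := by
    field_simp; ring
  have p1 : 0 ≤ 12 * A ^ 2 / c ^ 2 * W := by positivity
  have p2 : 0 ≤ 6 / c ^ 2 * b ^ 2 := by positivity
  have p3 : 0 ≤ 6 / c ^ 2 * r ^ 2 := by positivity
  linarith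

namespace StokesBasis

variable {D : Set E3} (B : StokesBasis D)

lemma norm_le_of_poincare {C : ℝ≥0} (hC : ∀ q ∈ Vsol D, ‖q.1‖ ≤ C * ‖q.2‖) (q : Vsol D) :
    ‖q‖ ≤ (1 + C) * ‖(q : L2 D × L2M D).2‖ := by
  have h := hC _ q.2
  have h2 : ‖q‖ = max ‖(q : L2 D × L2M D).1‖ ‖(q : L2 D × L2M D).2‖ := rfl
  rw [h2]
  have h3 := norm_nonneg (q : L2 D × L2M D).2
  have h4 : 0 ≤ (C : ℝ) * ‖(q : L2 D × L2M D).2‖ := by positivity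
  refine max_le ?_ ?_ <;> nlinarith

/-- Coercivity estimate for the Galerkin projection of a perturbed equation. -/
lemma galerkin_coercive (hb : Bornology.IsBounded D) {a : Vsol D →L[ℝ] Vsol D →L[ℝ] ℝ} {c A : ℝ}
    (hc : 0 < c) (hac : ∀ q : Vsol D, c * ‖(q : L2 D × L2M D).2‖ ^ 2 ≤ a q q)
    (haA : ∀ q r : Vsol D, |a q r| ≤ A * ‖(q : L2 D × L2M D).2‖ * ‖(r : L2 D × L2M D).2‖)
    (q : Vsol D) (β γ : ℕ → ℝ) (N : ℕ) :
    ‖(q : L2 D × L2M D).2‖ ^ 2 ≤ -(6 / c) * ∑ k ∈ Finset.range N,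
        (inner ℝ (B.e k : L2 D) (q : L2 D × L2M D).1 - β k) * (γ k - a q (B.vec k)) +
      (12 * A ^ 2 / c ^ 2 + 6 / c ^ 2 + 3) * (∑ k ∈ Finset.range N,
        (B.ev k * β k ^ 2 + γ k ^ 2 / B.ev k) +
        ‖(q : L2 D × L2M D).2 - (B.partialSum q N : L2 D × L2M D).2‖ ^ 2) := by
  set y : ℕ → ℝ := fun k => inner ℝ (B.e k : L2 D) (q : L2 D × L2M D).1 - β k with hy
  set η : Vsol D := ∑ k ∈ Finset.range N, y k • B.vec k with hη
  set w : Vsol D := ∑ k ∈ Finset.range N, β k • B.vec k with hw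
  set ζ := B.partialSum q N with hζ
  have snd_sum : ∀ x : ℕ → ℝ, ((∑ k ∈ Finset.range N, x k • B.vec k : Vsol D) : L2 D × L2M D).2 =
      ∑ k ∈ Finset.range N, x k • B.ge k := fun x => by simp [vec, Prod.snd_sum]
  have hηζ : ζ = η + w := by
    simp only [hη, hw, hζ, partialSum, hy, ← Finset.sum_add_distrib, ← add_smul, sub_add_cancel]
  set G := ‖(η : L2 D × L2M D).2‖ with hG
  set b := ‖(w : L2 D × L2M D).2‖ with hb'
  set r := ‖(q : L2 D × L2M D).2 - (ζ : L2 D × L2M D).2‖ with hr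
  have G0 : 0 ≤ G := norm_nonneg _
  have b0 : 0 ≤ b := norm_nonneg _
  have r0 : 0 ≤ r := norm_nonneg _
  have hG2 : G ^ 2 = ∑ k ∈ Finset.range N, B.ev k * y k ^ 2 := by
    rw [hG, hη, snd_sum, norm_sum_ge_sq]
  have hb2 : b ^ 2 = ∑ k ∈ Finset.range N, B.ev k * β k ^ 2 := by
    rw [hb', hw, snd_sum, norm_sum_ge_sq]
  set W := ∑ k ∈ Finset.range N, γ k ^ 2 / B.ev k with hW
  have hW0 : 0 ≤ W := Finset.sum_nonneg fun k _ => div_nonneg (sq_nonneg _) (B.ev_pos hb k).le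
  -- Young's inequality with weights λ_k and 1/λ_k, that is, duality between the gradient norm and
  -- its dual norm.
  have h1 : ∑ k ∈ Finset.range N, y k * γ k ≤ c / 4 * G ^ 2 + W / c := by
    rw [hG2, hW, Finset.mul_sum, Finset.sum_div, ← Finset.sum_add_distrib]
    refine Finset.sum_le_sum fun k _ => ?_
    have hev := B.ev_pos hb k
    have : c / 4 * (B.ev k * y k ^ 2) + γ k ^ 2 / B.ev k / c - y k * γ k =
        (c * B.ev k * y k / 2 - γ k) ^ 2 / (c * B.ev k) := by field_simp; ring
    have h2 : 0 ≤ (c * B.ev k * y k / 2 - γ k) ^ 2 / (c * B.ev k) := by positivity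
    linarith
  have h2 : ∑ k ∈ Finset.range N, y k * a q (B.vec k) = a q η := by
    rw [hη, map_sum]
    exact Finset.sum_congr rfl fun k _ => by rw [map_smul, smul_eq_mul]
  -- The field is the projected smooth part η, plus the rough part w, plus the truncation error.
  -- Only the first contributes coercivity; the other two are perturbations.
  have h3 : a q η = a η η + a w η + a (q - ζ) η := by
    have : q = η + w + (q - ζ) := by rw [hηζ]; abel
    conv_lhs => rw [this]
    simp only [map_add, _root_.add_apply]
  have h4 := hac η
  have h5 := (abs_le.1 (haA w η)).1
  have h6 : -(A * r * G) ≤ a (q - ζ) η := (abs_le.1 (haA (q - ζ) η)).1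
  have h8 : ‖(q : L2 D × L2M D).2‖ ≤ G + b + r := by
    have e : (q : L2 D × L2M D).2 = (η : L2 D × L2M D).2 + (w : L2 D × L2M D).2 +
        ((q : L2 D × L2M D).2 - (ζ : L2 D × L2M D).2) := by rw [hηζ]; simp
    calc ‖(q : L2 D × L2M D).2‖ = ‖(η : L2 D × L2M D).2 + (w : L2 D × L2M D).2 +
        ((q : L2 D × L2M D).2 - (ζ : L2 D × L2M D).2)‖ := by rw [← e]
      _ ≤ _ := norm_add₃_le
  rw [Finset.sum_add_distrib, ← hb2, ← hW]
  have h9 : ∑ k ∈ Finset.range N, y k * (γ k - a q (B.vec k)) =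
      ∑ k ∈ Finset.range N, y k * γ k - a q η := by
    simp only [mul_sub, Finset.sum_sub_distrib, h2]
  rw [h9]
  have h10 : c * G ^ 2 - A * b * G - A * r * G ≤ a q η := by linarith
  exact sq_le_of_coercive hc hW0 (norm_nonneg _) h8 h1 h10

set_option maxHeartbeats 1000000 in
/-- The energy estimate for a path of the forcing, written as `Z = y + ∑ σₖ bₖ eₖ` with
`yₖ` absolutely continuous. -/
lemma path_energy (hD : IsOpen D) (hb : Bornology.IsBounded D)
    {a : Vsol D →L[ℝ] Vsol D →L[ℝ] ℝ} {c A : ℝ}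
    (hc : 0 < c) (hac : ∀ q : Vsol D, c * ‖(q : L2 D × L2M D).2‖ ^ 2 ≤ a q q)
    (haA : ∀ q r : Vsol D, |a q r| ≤ A * ‖(q : L2 D × L2M D).2‖ * ‖(r : L2 D × L2M D).2‖)
    {T : ℝ} (hT : 0 ≤ T) (z : ℝ → Hsol D) (ζ : ℝ → Vsol D) (hζm : Measurable ζ)
    (hζ : ∀ᵐ s ∂volume.restrict (Icc 0 T), (ζ s : L2 D × L2M D).1 = z s)
    (hζ2 : ∫⁻ s in Icc 0 T, ‖(ζ s : L2 D × L2M D).2‖ₑ ^ 2 < ⊤)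
    (β γ : ℕ → ℝ → ℝ) (hβ : ∀ k, Continuous (β k)) (hγ : ∀ k, Continuous (γ k))
    (hβ0 : ∀ k, β k 0 = 0)
    (heq : ∀ k, ∀ t ∈ Icc 0 T, β k t + ∫ s in (0 : ℝ)..t, γ k s =
      inner ℝ (z t : L2 D) (B.e k : L2 D) - inner ℝ (z 0 : L2 D) (B.e k : L2 D) +
        ∫ s in (0 : ℝ)..t, a (ζ s) (B.vec k)) :
    ∫⁻ s in Icc 0 T, ‖(ζ s : L2 D × L2M D).2‖ₑ ^ 2 ≤
      ENNReal.ofReal (12 * A ^ 2 / c ^ 2 + 6 / c ^ 2 + 3 / c + 3) * (‖z 0‖ₑ ^ 2 +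
        ∫⁻ s in Icc 0 T, ∑' k, ENNReal.ofReal (B.ev k * β k s ^ 2 + γ k s ^ 2 / B.ev k)) := by
  set μ := volume.restrict (Icc (0 : ℝ) T) with hμ
  set X := ∫⁻ s in Icc 0 T, ∑' k, ENNReal.ofReal (B.ev k * β k s ^ 2 + γ k s ^ 2 / B.ev k) with hX
  set K := 12 * A ^ 2 / c ^ 2 + 6 / c ^ 2 + 3 with hK
  have hK0 : 0 ≤ K := by positivity
  have hKpos : 0 < 12 * A ^ 2 / c ^ 2 + 6 / c ^ 2 + 3 / c + 3 := by positivity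
  -- If X is infinite the bound is trivial, because the constant in front is positive.
  rcases eq_or_ne X ⊤ with hXt | hXt
  · rw [hXt, add_top, ENNReal.mul_top (by simpa using hKpos)]; exact le_top
  have hsnd : Continuous fun q : Vsol D => (q : L2 D × L2M D).2 :=
    continuous_snd.comp continuous_subtype_val
  have hsm : StronglyMeasurable fun s => (ζ s : L2 D × L2M D).2 :=
    (hsnd.measurable.comp hζm).stronglyMeasurable
  have hqm : MemLp (fun s => (ζ s : L2 D × L2M D).2) 2 μ := by
    refine ⟨hsm.aestronglyMeasurable, ?_⟩
    rw [eLpNorm_lt_top_iff_lintegral_rpow_enorm_lt_top (by norm_num) (by norm_num)]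
    simpa using hζ2
  have hq2 : Integrable (fun s => ‖(ζ s : L2 D × L2M D).2‖ ^ 2) μ := hqm.integrable_norm_pow (by norm_num)
  have hq1 : Integrable (fun s => ‖(ζ s : L2 D × L2M D).2‖) μ :=
    (hqm.integrable (by norm_num)).norm
  have hai : ∀ k, Integrable (fun s => a (ζ s) (B.vec k)) μ := fun k => by
    refine (hq1.const_mul (A * ‖(B.vec k : L2 D × L2M D).2‖)).mono' ?_ ?_
    · exact (((a.flip (B.vec k)).continuous.measurable.comp hζm)).aestronglyMeasurable
    · refine .of_forall fun s => (haA _ _).trans (le_of_eq ?_)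
      ring
  have hγi : ∀ k, Integrable (γ k) μ := fun k =>
    (hγ k).continuousOn.integrableOn_compact isCompact_Icc
  -- Subtracting the rough part β_k from the k-th coefficient of Z leaves an absolutely continuous
  -- function with derivative γ_k − a(Z, e_k), to which the ordinary chain rule applies.
  set y : ℕ → ℝ → ℝ := fun k t => inner ℝ (B.e k : L2 D) (z t : L2 D) - β k t with hy
  set g : ℕ → ℝ → ℝ := fun k s => γ k s - a (ζ s) (B.vec k) with hg
  have hgi : ∀ k, Integrable (g k) μ := fun k => (hγi k).sub (hai k)
  have toI : ∀ {f : ℝ → ℝ} {t : ℝ}, t ∈ Icc 0 T → Integrable f μ →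
      IntervalIntegrable f volume 0 t := fun {f t} ht hf => by
    rw [intervalIntegrable_iff_integrableOn_Icc_of_le ht.1]
    exact IntegrableOn.mono_set hf (Icc_subset_Icc_right ht.2)
  have hyg : ∀ k, ∀ t ∈ Icc 0 T, y k t = y k 0 + ∫ s in (0 : ℝ)..t, g k s := fun k t ht => by
    have h1 := heq k t ht
    simp only [hy, hg]
    rw [intervalIntegral.integral_sub (toI ht (hγi k)) (toI ht (hai k)), hβ0,
      real_inner_comm (z t : L2 D), real_inner_comm (z 0 : L2 D)]
    linarith
  have hyc : ∀ k, ContinuousOn (y k) (Icc 0 T) := fun k => by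
    have h1 : ContinuousOn (fun t => y k 0 + ∫ s in (0 : ℝ)..t, g k s) (Icc 0 T) := by
      have := intervalIntegral.continuousOn_primitive_interval (f := g k) (a := 0) (b := T)
        (μ := volume) (by rw [uIcc_of_le hT]; exact hgi k)
      rw [uIcc_of_le hT] at this
      exact continuousOn_const.add this
    exact h1.congr (hyg k)
  have hygi : ∀ k, Integrable (fun s => y k s * g k s) μ := fun k =>
    IntegrableOn.continuousOn_mul (hyc k) (hgi k) isCompact_Icc
  have hint : ∀ k, ∫ s, y k s * g k s ∂μ = (y k T ^ 2 - y k 0 ^ 2) / 2 := fun k => by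
    have h1 := primitive_mul hT (toI ⟨hT, le_rfl⟩ (hgi k)) (toI ⟨hT, le_rfl⟩ (hgi k)) (hyg k) (hyg k)
    have h2 : ∀ s, g k s * y k s + y k s * g k s = 2 * (y k s * g k s) := fun s => by ring
    simp only [h2] at h1
    rw [intervalIntegral.integral_const_mul, intervalIntegral.integral_of_le hT,
      ← integral_Icc_eq_integral_Ioc] at h1
    rw [hμ]; linarith
  have hQcont : ∀ k, Continuous fun s => B.ev k * β k s ^ 2 + γ k s ^ 2 / B.ev k := fun k =>
    (continuous_const.mul ((hβ k).pow 2)).add (((hγ k).pow 2).div_const _)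
  have hQi : ∀ k, Integrable (fun s => B.ev k * β k s ^ 2 + γ k s ^ 2 / B.ev k) μ := fun k =>
    (hQcont k).continuousOn.integrableOn_compact isCompact_Icc
  have hQ0 : ∀ k s, 0 ≤ B.ev k * β k s ^ 2 + γ k s ^ 2 / B.ev k := fun k s => by
    have := B.ev_pos hb k
    positivity
  -- The truncation error tends to zero pointwise by completeness in V and is dominated by ‖∇Z‖²,
  -- which is integrable along the path. The estimate is obtained for each N and the limit taken
  -- afterwards.
  set r : ℕ → ℝ → ℝ := fun N s =>
    ‖(ζ s : L2 D × L2M D).2 - (B.partialSum (ζ s) N : L2 D × L2M D).2‖ ^ 2 with hr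
  have hpc : ∀ N, Continuous fun q : Vsol D => B.partialSum q N := fun N => by
    unfold partialSum
    refine continuous_finsetSum _ fun k _ => ?_
    have h1 : Continuous fun q : Vsol D => inner ℝ (B.e k : L2 D) (q : L2 D × L2M D).1 :=
      continuous_const.inner (continuous_fst.comp continuous_subtype_val)
    exact h1.smul continuous_const
  have hrm : ∀ N, AEStronglyMeasurable (r N) μ := fun N => by
    have : Continuous fun q : Vsol D =>
        ‖(q : L2 D × L2M D).2 - (B.partialSum q N : L2 D × L2M D).2‖ ^ 2 :=
      ((hsnd.sub (hsnd.comp (hpc N))).norm.pow 2)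
    exact (this.measurable.comp hζm).aestronglyMeasurable
  have hrle : ∀ N s, r N s ≤ ‖(ζ s : L2 D × L2M D).2‖ ^ 2 := fun N s =>
    B.norm_sub_partialSum_le _ hb N
  have hri : ∀ N, Integrable (r N) μ := fun N => hq2.mono' (hrm N) (.of_forall fun s => by
    rw [Real.norm_of_nonneg (sq_nonneg _)]; exact hrle N s)
  have hrlim : Tendsto (fun N => ∫ s, r N s ∂μ) atTop (𝓝 0) := by
    have := tendsto_integral_of_dominated_convergence (μ := μ) (F := r) (f := fun _ => 0)
      (fun s => ‖(ζ s : L2 D × L2M D).2‖ ^ 2) hrm hq2 (fun N => .of_forall fun s => by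
        rw [Real.norm_of_nonneg (sq_nonneg _)]; exact hrle N s)
      (.of_forall fun s => B.tendsto_partialSum hD hb (ζ s))
    simpa using this
  have hmain : ∀ N, ∫ s, ‖(ζ s : L2 D × L2M D).2‖ ^ 2 ∂μ ≤
      (3 / c) * ‖z 0‖ ^ 2 + K * (X.toReal + ∫ s, r N s ∂μ) := fun N => by
    have hpt : ∀ᵐ s ∂μ, ‖(ζ s : L2 D × L2M D).2‖ ^ 2 ≤
        -(6 / c) * ∑ k ∈ Finset.range N, y k s * g k s +
        K * (∑ k ∈ Finset.range N, (B.ev k * β k s ^ 2 + γ k s ^ 2 / B.ev k) + r N s) := by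
      filter_upwards [hζ] with s hs
      have := B.galerkin_coercive hb hc hac haA (ζ s) (fun k => β k s) (fun k => γ k s) N
      rw [hs] at this
      exact this
    have i1 : Integrable (fun s => ∑ k ∈ Finset.range N, y k s * g k s) μ :=
      integrable_finsetSum _ fun k _ => hygi k
    have i2 : Integrable (fun s => ∑ k ∈ Finset.range N,
      (B.ev k * β k s ^ 2 + γ k s ^ 2 / B.ev k)) μ := integrable_finsetSum _ fun k _ => hQi k
    have i3 : Integrable (fun s => ∑ k ∈ Finset.range N,
      (B.ev k * β k s ^ 2 + γ k s ^ 2 / B.ev k) + r N s) μ := i2.add (hri N)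
    have i4 := i1.const_mul (-(6 / c))
    have i5 := i3.const_mul K
    have h1 : _ ≤ ∫ s, (-(6 / c) * ∑ k ∈ Finset.range N, y k s * g k s +
        K * (∑ k ∈ Finset.range N, (B.ev k * β k s ^ 2 + γ k s ^ 2 / B.ev k) + r N s)) ∂μ :=
      integral_mono_ae hq2 (i4.add i5) hpt
    have h2 : ∫ s, (-(6 / c) * ∑ k ∈ Finset.range N, y k s * g k s +
        K * (∑ k ∈ Finset.range N, (B.ev k * β k s ^ 2 + γ k s ^ 2 / B.ev k) + r N s)) ∂μ =
        -(6 / c) * ∑ k ∈ Finset.range N, (y k T ^ 2 - y k 0 ^ 2) / 2 +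
        K * (∫ s, ∑ k ∈ Finset.range N, (B.ev k * β k s ^ 2 + γ k s ^ 2 / B.ev k) ∂μ +
          ∫ s, r N s ∂μ) := by
      rw [integral_add i4 i5, integral_const_mul,
        integral_const_mul, integral_add i2 (hri N), integral_finsetSum _ fun k _ => hygi k]
      simp only [hint]
    have h3 : ∫ s, ∑ k ∈ Finset.range N, (B.ev k * β k s ^ 2 + γ k s ^ 2 / B.ev k) ∂μ ≤
        X.toReal := by
      rw [integral_eq_lintegral_of_nonneg_ae (.of_forall fun s =>
        Finset.sum_nonneg fun k _ => hQ0 k s) i2.aestronglyMeasurable]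
      refine ENNReal.toReal_mono hXt (lintegral_mono fun s => ?_)
      rw [ENNReal.ofReal_sum_of_nonneg fun k _ => hQ0 k s]
      exact ENNReal.sum_le_tsum _
    have h4 : ∑ k ∈ Finset.range N, y k 0 ^ 2 ≤ ‖z 0‖ ^ 2 := by
      have := B.e.orthonormal.sum_inner_products_le (z 0) (s := Finset.range N)
      refine le_trans (le_of_eq (Finset.sum_congr rfl fun k _ => ?_)) this
      simp only [hy, hβ0, sub_zero, Real.norm_eq_abs, sq_abs]
      rfl
    -- The value at T enters with a favourable sign and is discarded. The value at 0 contributes the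
    -- 3/c in the constant and is at most ‖z 0‖² by Bessel, since β_k(0) = 0.
    have h5 : -(6 / c) * ∑ k ∈ Finset.range N, (y k T ^ 2 - y k 0 ^ 2) / 2 ≤ 3 / c * ‖z 0‖ ^ 2 := by
      rw [← Finset.sum_div, Finset.sum_sub_distrib]
      have h6 : 0 ≤ ∑ k ∈ Finset.range N, y k T ^ 2 := Finset.sum_nonneg fun _ _ => sq_nonneg _
      have h7 := mul_le_mul_of_nonneg_left h4 (by positivity : 0 ≤ 3 / c)
      have h8 := mul_nonneg (by positivity : 0 ≤ 3 / c) h6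
      have e : -(6 / c) * ((∑ k ∈ Finset.range N, y k T ^ 2 - ∑ k ∈ Finset.range N, y k 0 ^ 2) / 2) =
        3 / c * ∑ k ∈ Finset.range N, y k 0 ^ 2 - 3 / c * ∑ k ∈ Finset.range N, y k T ^ 2 := by ring
      linarith
    rw [h2] at h1
    have h9 := mul_le_mul_of_nonneg_left h3 hK0
    linarith
  have hfin : ∫ s, ‖(ζ s : L2 D × L2M D).2‖ ^ 2 ∂μ ≤ (3 / c) * ‖z 0‖ ^ 2 + K * (X.toReal + 0) :=
    ge_of_tendsto' (((hrlim.const_add X.toReal).const_mul K).const_add ((3 / c) * ‖z 0‖ ^ 2)) hmain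
  have hfin2 : ∫ s, ‖(ζ s : L2 D × L2M D).2‖ ^ 2 ∂μ ≤
      (12 * A ^ 2 / c ^ 2 + 6 / c ^ 2 + 3 / c + 3) * (‖z 0‖ ^ 2 + X.toReal) := by
    refine hfin.trans ?_
    have p1 : 0 ≤ K * ‖z 0‖ ^ 2 := by positivity
    have p2 : 0 ≤ 3 / c * X.toReal := by positivity
    have e : 12 * A ^ 2 / c ^ 2 + 6 / c ^ 2 + 3 / c + 3 = K + 3 / c := by rw [hK]; ring
    rw [e]; linarith
  have e1 : ∫⁻ s in Icc 0 T, ‖(ζ s : L2 D × L2M D).2‖ₑ ^ 2 =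
      ENNReal.ofReal (∫ s, ‖(ζ s : L2 D × L2M D).2‖ ^ 2 ∂μ) := by
    rw [ofReal_integral_eq_lintegral_ofReal hq2 (.of_forall fun _ => sq_nonneg _)]
    refine lintegral_congr fun s => ?_
    rw [ENNReal.ofReal_pow (norm_nonneg _), ofReal_norm]
  rw [e1]
  refine (ENNReal.ofReal_le_ofReal hfin2).trans (le_of_eq ?_)
  rw [ENNReal.ofReal_mul hKpos.le, ENNReal.ofReal_add (sq_nonneg _) ENNReal.toReal_nonneg,
    ENNReal.ofReal_toReal hXt, ENNReal.ofReal_pow (norm_nonneg _), ofReal_norm]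

end StokesBasis

/-! ### Splitting a Brownian path into a small and an absolutely continuous part -/

/-- The deviation of a path from its average over the preceding interval of length `1 / l`. -/
noncomputable def roughPart (l : ℝ) (w : ℝ → ℝ) (t : ℝ) : ℝ := w t - l * ∫ s in (t - 1 / l)..t, w s

/-- The derivative of the moving average of a path. -/
noncomputable def slopePart (l : ℝ) (w : ℝ → ℝ) (t : ℝ) : ℝ := l * (w t - w (t - 1 / l))

section paths

variable {l : ℝ} {w : ℝ → ℝ}

lemma integral_window (hw : Continuous w) (t : ℝ) : ∫ s in (t - 1 / l)..t, w s =
    (∫ s in (0 : ℝ)..t, w s) - ∫ s in (0 : ℝ)..(t - 1 / l), w s :=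
  (intervalIntegral.integral_interval_sub_left (hw.intervalIntegrable _ _)
    (hw.intervalIntegrable _ _)).symm

lemma continuous_roughPart (hw : Continuous w) : Continuous (roughPart l w) := by
  have h : Continuous fun t => ∫ s in (0 : ℝ)..t, w s :=
    intervalIntegral.continuous_primitive (fun a b => hw.intervalIntegrable a b) 0
  have : roughPart l w = fun t => w t - l * ((∫ s in (0 : ℝ)..t, w s) -
    ∫ s in (0 : ℝ)..(t - 1 / l), w s) := funext fun t => by rw [roughPart, integral_window hw]
  rw [this]
  exact hw.sub (continuous_const.mul (h.sub (h.comp (continuous_id.sub continuous_const))))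

lemma continuous_slopePart (hw : Continuous w) : Continuous (slopePart l w) := by
  unfold slopePart; fun_prop

lemma integral_prehistory (hl : 0 < l) (h0 : ∀ t ≤ 0, w t = 0) :
    ∫ s in (0 - 1 / l)..0, w s = 0 := by
  have : ∫ s in (0 - 1 / l)..0, w s = ∫ s in (0 - 1 / l)..0, (0 : ℝ) := by
    refine intervalIntegral.integral_congr fun s hs => h0 s ?_
    rw [uIcc_of_le (by have : 0 < 1 / l := by positivity
                       linarith)] at hs
    exact hs.2
  simpa using this

lemma roughPart_zero (hl : 0 < l) (h0 : ∀ t ≤ 0, w t = 0) : roughPart l w 0 = 0 := by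
  rw [roughPart, integral_prehistory hl h0, h0 0 le_rfl]; simp

/-- The moving average has derivative `slopePart` and vanishes at t = 0, because the path is zero at
nonpositive times. Thus a path is the sum of its rough part and a differentiable part. -/
lemma roughPart_add_integral (hl : 0 < l) (hw : Continuous w) (h0 : ∀ t ≤ 0, w t = 0) (t : ℝ) :
    roughPart l w t + ∫ s in (0 : ℝ)..t, slopePart l w s = w t := by
  have hi := fun a b => hw.intervalIntegrable (μ := volume) a b
  have h1 : ∫ s in (0 : ℝ)..t, slopePart l w s =
      l * ((∫ s in (0 : ℝ)..t, w s) - ∫ s in (0 - 1 / l)..(t - 1 / l), w s) := by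
    simp only [slopePart]
    have h3 : Continuous fun s => w (s - 1 / l) := by fun_prop
    rw [intervalIntegral.integral_const_mul, intervalIntegral.integral_sub (hi _ _)
      (h3.intervalIntegrable _ _), intervalIntegral.integral_comp_sub_right (fun s => w s)]
  have h2 := intervalIntegral.integral_add_adjacent_intervals (hi (0 - 1 / l) 0) (hi 0 (t - 1 / l))
  rw [integral_prehistory hl h0, zero_add] at h2
  rw [roughPart, integral_window hw, h1, ← h2]
  ring

/-- Nonnegativity of the variance of f about its mean m on the interval. -/
lemma sq_integral_le {f : ℝ → ℝ} (hf : Continuous f) {x y : ℝ} (hxy : x < y) :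
    (∫ s in x..y, f s) ^ 2 ≤ (y - x) * ∫ s in x..y, f s ^ 2 := by
  set m := (∫ s in x..y, f s) / (y - x) with hm
  have hpos : 0 < y - x := sub_pos.2 hxy
  have h0 : 0 ≤ ∫ s in x..y, (f s - m) ^ 2 :=
    intervalIntegral.integral_nonneg hxy.le fun _ _ => sq_nonneg _
  have e : ∀ s, (f s - m) ^ 2 = f s ^ 2 - 2 * m * f s + m ^ 2 := fun s => by ring
  simp only [e] at h0
  rw [intervalIntegral.integral_add, intervalIntegral.integral_sub,
    intervalIntegral.integral_const_mul, intervalIntegral.integral_const] at h0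
  · have h1 : ∫ s in x..y, f s = m * (y - x) := by rw [hm]; field_simp
    rw [h1] at h0 ⊢
    simp only [smul_eq_mul] at h0
    nlinarith
  · exact (hf.pow 2).intervalIntegrable _ _
  · exact (continuous_const.mul hf).intervalIntegrable _ _
  · exact ((hf.pow 2).sub (continuous_const.mul hf)).intervalIntegrable _ _
  · exact continuous_const.intervalIntegrable _ _

/-- The rough part is the mean of w(t) − w(s) over the window, so the Cauchy–Schwarz inequality
applies with window length 1/l. -/
lemma roughPart_sq_le (hl : 0 < l) (hw : Continuous w) (t : ℝ) :
    l * roughPart l w t ^ 2 ≤ l ^ 2 * ∫ s in (t - 1 / l)..t, (w t - w s) ^ 2 := by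
  have hlt : t - 1 / l < t := by have : 0 < 1 / l := by positivity
                                 linarith
  have h1 : roughPart l w t = l * ∫ s in (t - 1 / l)..t, (w t - w s) := by
    rw [intervalIntegral.integral_sub (continuous_const.intervalIntegrable _ _)
      (hw.intervalIntegrable _ _), intervalIntegral.integral_const, roughPart]
    simp only [smul_eq_mul]
    field_simp
    ring
  have h2 := sq_integral_le (f := fun s => w t - w s) (by fun_prop) hlt
  have h3 : (t - (t - 1 / l)) = 1 / l := by ring
  rw [h3] at h2
  rw [h1, mul_pow]
  have h4 := mul_le_mul_of_nonneg_left h2 (by positivity : 0 ≤ l ^ 3)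
  calc l * (l ^ 2 * (∫ s in (t - 1 / l)..t, (w t - w s)) ^ 2)
      = l ^ 3 * (∫ s in (t - 1 / l)..t, (w t - w s)) ^ 2 := by ring
    _ ≤ _ := h4
    _ = _ := by field_simp

end paths

section brownian

variable {Ω : Type*} {m : MeasurableSpace Ω} {P : Measure Ω}

/-- A modification of a Brownian motion all of whose paths are continuous and start at zero. -/
lemma exists_continuous_modification {β : ℝ≥0 → Ω → ℝ}
    (hβ : IsBrownianReal β P) (hm : ∀ t, Measurable (β t)) :
    ∃ β' : ℝ≥0 → Ω → ℝ, (∀ t, Measurable (β' t)) ∧ (∀ ω, Continuous fun t => β' t ω) ∧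
      (∀ ω, β' 0 ω = 0) ∧ ∀ᵐ ω ∂P, ∀ t, β' t ω = β t ω := by
  have h0 := hβ.toIsPreBrownianReal.eval_zero_ae_eq_zero
  have hall := hβ.cont.and h0
  obtain ⟨N, hN, hNm, hN0⟩ := exists_measurable_superset_of_null hall
  refine ⟨fun t => Nᶜ.indicator (β t), fun t => (hm t).indicator hNm.compl, fun ω => ?_,
    fun ω => ?_, ?_⟩
  · by_cases h : ω ∈ N
    · simp [h, continuous_const]
    · have h2 : Continuous fun t => β t ω := by
        by_contra h'
        exact h (hN fun h'' => h' h''.1)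
      simpa [h] using h2
  · by_cases h : ω ∈ N
    · simp [h]
    · have h2 : β 0 ω = 0 := by
        by_contra h'
        exact h (hN fun h'' => h' h''.2)
      simpa [h] using h2
  · have : ∀ᵐ ω ∂P, ω ∉ N := by
      rw [ae_iff]; simpa using hN0
    filter_upwards [this] with ω h t
    simp [h]

lemma lintegral_increment_sq {β : ℝ≥0 → Ω → ℝ} (hβ : IsPreBrownianReal β P) (s t : ℝ≥0) :
    ∫⁻ ω, ENNReal.ofReal ((β s ω - β t ω) ^ 2) ∂P = ENNReal.ofReal |(s : ℝ) - t| := by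
  have h := hβ.hasLaw_sub s t
  have h1 := h.lintegral_comp (f := fun x : ℝ => ENNReal.ofReal (x ^ 2)) (by fun_prop)
  simp only [Pi.sub_apply] at h1
  rw [h1, ← ofReal_integral_eq_lintegral_ofReal]
  · have h2 := variance_id_gaussianReal (μ := 0) (v := nndist s.1 t.1)
    rw [variance_of_integral_eq_zero (by fun_prop) (by simp)] at h2
    simp only [id_eq] at h2
    rw [h2]
    congr 1
  · exact (memLp_id_gaussianReal 2).integrable_sq
  · exact .of_forall fun _ => sq_nonneg _

/-- The path of a process, extended to negative times by its initial value. -/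
def extPath (β : ℝ≥0 → Ω → ℝ) (ω : Ω) (s : ℝ) : ℝ := β s.toNNReal ω

variable {β : ℝ≥0 → Ω → ℝ}

lemma continuous_extPath (hc : ∀ ω, Continuous fun t => β t ω) (ω : Ω) :
    Continuous (extPath β ω) := (hc ω).comp continuous_real_toNNReal

lemma measurable_extPath (hm : ∀ t, Measurable (β t)) (hc : ∀ ω, Continuous fun t => β t ω) :
    Measurable fun q : ℝ × Ω => extPath β q.2 q.1 :=
  measurable_uncurry_of_continuous_of_measurable (u := fun s ω => extPath β ω s)
    (fun ω => continuous_extPath hc ω) (fun _ => hm _)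

lemma measurable_slopePart (hm : ∀ t, Measurable (β t)) (hc : ∀ ω, Continuous fun t => β t ω)
    (l : ℝ) : Measurable fun q : ℝ × Ω => slopePart l (extPath β q.2) q.1 :=
  measurable_uncurry_of_continuous_of_measurable (u := fun s ω => slopePart l (extPath β ω) s)
    (fun ω => continuous_slopePart (continuous_extPath hc ω))
    (fun _ => ((hm _).sub (hm _)).const_mul _)

lemma measurable_roughPart (hm : ∀ t, Measurable (β t)) (hc : ∀ ω, Continuous fun t => β t ω)
    (l : ℝ) : Measurable fun q : ℝ × Ω => roughPart l (extPath β q.2) q.1 := by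
  refine measurable_uncurry_of_continuous_of_measurable
    (u := fun s ω => roughPart l (extPath β ω) s)
    (fun ω => continuous_roughPart (continuous_extPath hc ω)) (fun s => ?_)
  have h := (measurable_extPath hm hc).stronglyMeasurable
  have h2 : ∀ x y : ℝ, Measurable fun ω => ∫ s in Ioc x y, extPath β ω s := fun x y =>
    (StronglyMeasurable.integral_prod_left' (μ := volume.restrict (Ioc x y)) h).measurable
  refine (hm _).sub (Measurable.const_mul ?_ l)
  exact (h2 _ _).sub (h2 _ _)

/-- A Brownian increment over a window of length 1/l has second moment at most 1/l, so each of the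
two terms has mean at most 1. With l an eigenvalue λ_k these terms are the gradient energy of the
rough part and the dual energy of the slope. The window 1/λ_k balances them, so that only Σσ_k² is
needed and nothing about the growth of λ_k. -/
lemma lintegral_rough_slope_le [IsProbabilityMeasure P] (hβ : IsPreBrownianReal β P)
    (hm : ∀ t, Measurable (β t))
    (hc : ∀ ω, Continuous fun t => β t ω) {l : ℝ} (hl : 0 < l) {t : ℝ} (ht : 0 ≤ t) :
    ∫⁻ ω, ENNReal.ofReal (l * roughPart l (extPath β ω) t ^ 2 +
      slopePart l (extPath β ω) t ^ 2 / l) ∂P ≤ 2 := by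
  have hinc : ∀ s ∈ Icc (t - 1 / l) t, ∫⁻ ω, ENNReal.ofReal ((extPath β ω t - extPath β ω s) ^ 2) ∂P
      ≤ ENNReal.ofReal (1 / l) := fun s hs => by
    simp only [extPath]
    rw [lintegral_increment_sq hβ]
    refine ENNReal.ofReal_le_ofReal ?_
    have h1 : 0 < 1 / l := by positivity
    rw [Real.coe_toNNReal', Real.coe_toNNReal', max_eq_left ht, abs_of_nonneg]
    · have := le_max_left s 0
      linarith [hs.1]
    · exact sub_nonneg.2 (max_le hs.2 ht)
  have hlt : t - 1 / l ≤ t := by have : 0 < 1 / l := by positivity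
                                 linarith
  have hll : ENNReal.ofReal (l ^ 2) * (ENNReal.ofReal (1 / l) * ENNReal.ofReal (1 / l)) = 1 := by
    rw [← ENNReal.ofReal_mul (by positivity), ← ENNReal.ofReal_mul (by positivity)]
    have : l ^ 2 * (1 / l * (1 / l)) = 1 := by field_simp
    rw [this, ENNReal.ofReal_one]
  have hll2 : ENNReal.ofReal l * ENNReal.ofReal (1 / l) = 1 := by
    rw [← ENNReal.ofReal_mul hl.le]
    have : l * (1 / l) = 1 := by field_simp
    rw [this, ENNReal.ofReal_one]
  have h1 : ∫⁻ ω, ENNReal.ofReal (l * roughPart l (extPath β ω) t ^ 2) ∂P ≤ 1 := by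
    have hpt : ∀ ω, ENNReal.ofReal (l * roughPart l (extPath β ω) t ^ 2) ≤
        ENNReal.ofReal (l ^ 2) * ∫⁻ s in Ioc (t - 1 / l) t,
          ENNReal.ofReal ((extPath β ω t - extPath β ω s) ^ 2) := fun ω => by
      have hcw := continuous_extPath hc ω
      refine (ENNReal.ofReal_le_ofReal (roughPart_sq_le hl hcw t)).trans (le_of_eq ?_)
      rw [ENNReal.ofReal_mul (by positivity), intervalIntegral.integral_of_le hlt,
        ofReal_integral_eq_lintegral_ofReal]
      · have : Continuous fun s => (extPath β ω t - extPath β ω s) ^ 2 := by fun_prop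
        exact (this.continuousOn.integrableOn_compact isCompact_Icc).mono_set Ioc_subset_Icc_self
      · exact .of_forall fun _ => sq_nonneg _
    have hme : Measurable fun q : ℝ × Ω =>
        ENNReal.ofReal ((extPath β q.2 t - extPath β q.2 q.1) ^ 2) :=
      ((((hm t.toNNReal).comp measurable_snd).sub
        (measurable_extPath hm hc)).pow_const 2).ennreal_ofReal
    calc _ ≤ ∫⁻ ω, ENNReal.ofReal (l ^ 2) * (∫⁻ s in Ioc (t - 1 / l) t,
          ENNReal.ofReal ((extPath β ω t - extPath β ω s) ^ 2)) ∂P := lintegral_mono hpt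
      _ = ENNReal.ofReal (l ^ 2) * ∫⁻ s in Ioc (t - 1 / l) t, (∫⁻ ω,
          ENNReal.ofReal ((extPath β ω t - extPath β ω s) ^ 2) ∂P) := by
          rw [lintegral_const_mul' _ _ (by simp), lintegral_lintegral_swap]
          exact (hme.comp measurable_swap).aemeasurable
      _ ≤ ENNReal.ofReal (l ^ 2) * ∫⁻ s in Ioc (t - 1 / l) t, ENNReal.ofReal (1 / l) := by
          exact mul_le_mul' le_rfl (setLIntegral_mono' measurableSet_Ioc fun s hs =>
            hinc s (Ioc_subset_Icc_self hs))
      _ = 1 := by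
          rw [setLIntegral_const, Real.volume_Ioc]
          have : t - (t - 1 / l) = 1 / l := by ring
          rw [this, hll]
  have h2 : ∫⁻ ω, ENNReal.ofReal (slopePart l (extPath β ω) t ^ 2 / l) ∂P ≤ 1 := by
    have hpt : ∀ ω, ENNReal.ofReal (slopePart l (extPath β ω) t ^ 2 / l) = ENNReal.ofReal l *
        ENNReal.ofReal ((extPath β ω t - extPath β ω (t - 1 / l)) ^ 2) := fun ω => by
      rw [← ENNReal.ofReal_mul hl.le, slopePart]
      congr 1; field_simp
    simp only [hpt]
    rw [lintegral_const_mul' _ _ (by simp), ← hll2]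
    gcongr
    exact hinc _ ⟨le_rfl, hlt⟩
  have hms : Measurable fun ω => ENNReal.ofReal (slopePart l (extPath β ω) t ^ 2 / l) :=
    ((((measurable_slopePart hm hc l).comp measurable_prodMk_left).pow_const 2).div_const
      l).ennreal_ofReal
  calc _ ≤ ∫⁻ ω, (ENNReal.ofReal (l * roughPart l (extPath β ω) t ^ 2) +
      ENNReal.ofReal (slopePart l (extPath β ω) t ^ 2 / l)) ∂P :=
        lintegral_mono fun ω => ENNReal.ofReal_add_le
    _ = _ := lintegral_add_right _ hms
    _ ≤ 1 + 1 := add_le_add h1 h2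
    _ = 2 := one_add_one_eq_two

end brownian

/-! ### Second moments of the stationary forcing. -/

section solution

variable {D : Set E3} {B : StokesBasis D} {σ : ℕ → ℝ} {a : Vsol D →L[ℝ] Vsol D →L[ℝ] ℝ} {ν : ℝ}

/-- The pair `(u, Z)` is jointly measurable. -/
lemma MartingaleSolution.measurable_pair (S : MartingaleSolution.{u} B σ a ν) :
    Measurable fun q : ℝ≥0 × S.Ω => (S.u q.1 q.2, S.Z q.1 q.2) := by
  have h : ∀ n : ℕ, Measurable fun q : Iic (n : ℝ≥0) × S.Ω => (S.u q.1 q.2, S.Z q.1 q.2) := fun n =>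
    ((S.progressive n).measurable).mono
      (sup_le_sup le_rfl (MeasurableSpace.comap_mono (S.𝓕.le _))) le_rfl
  refine measurable_of_tendsto_metrizable (f := fun (n : ℕ) (q : ℝ≥0 × S.Ω) =>
    (S.u (min q.1 n) q.2, S.Z (min q.1 n) q.2)) (fun n => ?_) ?_
  · have hmin : Measurable fun q : ℝ≥0 × S.Ω =>
        ((⟨min q.1 n, mem_Iic.2 (min_le_right _ _)⟩, q.2) : Iic (n : ℝ≥0) × S.Ω) :=
      ((measurable_fst.min measurable_const).subtype_mk).prodMk measurable_snd
    exact (h n).comp hmin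
  · refine tendsto_pi_nhds.2 fun q => tendsto_const_nhds.congr' ?_
    obtain ⟨n, hn⟩ := exists_nat_ge q.1
    filter_upwards [eventually_ge_atTop n] with k hk
    rw [min_eq_left (hn.trans (by exact_mod_cast hk))]

lemma MartingaleSolution.measurable_u (S : MartingaleSolution.{u} B σ a ν) :
    Measurable fun q : ℝ≥0 × S.Ω => S.u q.1 q.2 := measurable_fst.comp S.measurable_pair

lemma MartingaleSolution.measurable_Z (S : MartingaleSolution.{u} B σ a ν) :
    Measurable fun q : ℝ≥0 × S.Ω => S.Z q.1 q.2 := measurable_snd.comp S.measurable_pair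

/-- The law of `(u t, Z t)` does not depend on `t`. -/
lemma StationarySolution.identDistrib (S : StationarySolution.{u} B σ a ν) (t : ℝ≥0) :
    IdentDistrib (fun ω => (S.u t ω, S.Z t ω)) (fun ω => (S.u 0 ω, S.Z 0 ω)) S.P S.P := by
  have := (S.stationary t).comp (measurable_pi_apply (0 : ℝ≥0))
  simpa [Function.comp_def] using this

/-- Continuity of `a` is given in the full norm of V. The Poincaré inequality restates it in terms
of gradients, matching the form of the coercivity bound. -/
lemma ComparableToStokes.exists_bounds (ha : ComparableToStokes a) (hb : Bornology.IsBounded D) :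
    ∃ c A : ℝ, 0 < c ∧ (∀ q : Vsol D, c * ‖(q : L2 D × L2M D).2‖ ^ 2 ≤ a q q) ∧
      (∀ q r : Vsol D, |a q r| ≤ A * ‖(q : L2 D × L2M D).2‖ * ‖(r : L2 D × L2M D).2‖) := by
  obtain ⟨c, hc, c₂, -, h⟩ := ha
  obtain ⟨C, hC⟩ := exists_poincare hb
  obtain ⟨N, hN0, hN⟩ : ∃ N : ℝ, 0 ≤ N ∧ ∀ q r : Vsol D, ‖a q r‖ ≤ N * ‖q‖ * ‖r‖ := by
    obtain ⟨N, hN⟩ : ∃ N : ℝ, ∀ q r : Vsol D, ‖a q r‖ ≤ N * ‖q‖ * ‖r‖ :=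
      ⟨_, fun q r => a.le_opNorm₂ q r⟩
    refine ⟨max N 0, le_max_right _ _, fun q r => (hN q r).trans ?_⟩
    gcongr
    exact le_max_left _ _
  refine ⟨c, N * (1 + C) ^ 2, hc, fun q => (h q).1, fun q r => (hN q r).trans ?_⟩
  have hq := StokesBasis.norm_le_of_poincare hC q
  have hr := StokesBasis.norm_le_of_poincare hC r
  calc N * ‖q‖ * ‖r‖ ≤ N * ((1 + C) * ‖(q : L2 D × L2M D).2‖) *
        ((1 + C) * ‖(r : L2 D × L2M D).2‖) := by gcongr
    _ = _ := by ring

/-- Along almost every path the time integral of the squared norm of the forcing is controlled by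
the initial value and a functional of the driving Brownian motions. -/
lemma exists_forcing_path_bound (hD : IsOpen D) (hb : Bornology.IsBounded D)
    (ha : ComparableToStokes a) : ∃ K : ℝ≥0, ∀ (ν : ℝ) (S : MartingaleSolution.{u} B σ a ν) (T : ℝ),
    0 ≤ T → ∃ X : S.Ω → ℝ≥0∞,
      ∫⁻ ω, X ω ∂S.P ≤ ENNReal.ofReal T * (2 * ∑' k, ENNReal.ofReal (σ k ^ 2)) ∧ Measurable X ∧
      ∀ᵐ ω ∂S.P, ∫⁻ s in Icc 0 T, ‖S.Z s.toNNReal ω‖ₑ ^ 2 ≤ K * (‖S.Z 0 ω‖ₑ ^ 2 + X ω) := by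
  obtain ⟨c, A, hc, hac, haA⟩ := ha.exists_bounds hb
  obtain ⟨C, hC⟩ := exists_poincare hb
  refine ⟨C ^ 2 * (12 * A ^ 2 / c ^ 2 + 6 / c ^ 2 + 3 / c + 3).toNNReal, fun ν S T hT => ?_⟩
  -- Paths that are all continuous and start at zero make the moving averages meaningful for every ω
  -- and jointly measurable.
  have hex := fun k => exists_continuous_modification (S.brownian.brownian k)
    (fun t => (S.brownian.adapted k t).mono (S.𝓕.le t) le_rfl)
  choose β hβm hβc hβ0 hβ using hex
  have hpre : ∀ k, IsPreBrownianReal (β k) S.P := fun k =>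
    (S.brownian.brownian k).toIsPreBrownianReal.congr fun t => by
      filter_upwards [hβ k] with ω h; exact (h t).symm
  have hev := fun k => B.ev_pos hb k
  set Q : ℕ → ℝ × S.Ω → ℝ≥0∞ := fun k q => ENNReal.ofReal (B.ev k *
    (σ k * roughPart (B.ev k) (extPath (β k) q.2) q.1) ^ 2 +
    (σ k * slopePart (B.ev k) (extPath (β k) q.2) q.1) ^ 2 / B.ev k) with hQ
  have hQm : ∀ k, Measurable (Q k) := fun k =>
    (((((measurable_roughPart (hβm k) (hβc k) _).const_mul _).pow_const 2).const_mul _).add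
      ((((measurable_slopePart (hβm k) (hβc k) _).const_mul _).pow_const 2).div_const
        _)).ennreal_ofReal
  have hQm' : Measurable fun q => ∑' k, Q k q := Measurable.tsum hQm
  refine ⟨fun ω => ∫⁻ s in Icc 0 T, ∑' k, Q k (s, ω), ?_, ?_, ?_⟩
  · rw [lintegral_lintegral_swap (f := fun ω s => ∑' k, Q k (s, ω))
      (hQm'.comp measurable_swap).aemeasurable]
    have hs : ∀ s ∈ Icc 0 T, ∫⁻ ω, ∑' k, Q k (s, ω) ∂S.P ≤ 2 * ∑' k, ENNReal.ofReal (σ k ^ 2) := by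
      intro s hs
      rw [lintegral_tsum (f := fun k ω => Q k (s, ω)) fun k => ((hQm k).comp measurable_prodMk_left).aemeasurable,
        ← ENNReal.tsum_mul_left]
      refine ENNReal.tsum_le_tsum fun k => ?_
      have e : ∀ ω, Q k (s, ω) = ENNReal.ofReal (σ k ^ 2) * ENNReal.ofReal
          (B.ev k * roughPart (B.ev k) (extPath (β k) ω) s ^ 2 +
            slopePart (B.ev k) (extPath (β k) ω) s ^ 2 / B.ev k) := fun ω => by
        rw [hQ, ← ENNReal.ofReal_mul (sq_nonneg _)]
        exact congrArg ENNReal.ofReal (by ring)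
      simp only [e]
      rw [lintegral_const_mul' _ _ (by simp), mul_comm]
      exact mul_le_mul' (lintegral_rough_slope_le (hpre k) (hβm k) (hβc k) (hev k) hs.1) le_rfl
    refine (setLIntegral_mono' measurableSet_Icc hs).trans ?_
    rw [setLIntegral_const, Real.volume_Icc, sub_zero, mul_comm]
  · exact Measurable.lintegral_prod_left' hQm'
  · obtain ⟨α, -, hreg⟩ := S.regular
    filter_upwards [hreg, S.forcing, ae_all_iff.2 hβ] with ω h1 h2 h3
    have hZm : Measurable fun s : ℝ => S.Z s.toNNReal ω :=
      S.measurable_Z.comp (measurable_real_toNNReal.prodMk measurable_const)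
    have hdir : ∫⁻ s in Icc 0 T, dirichlet D (S.Z s.toNNReal ω : L2 D) < ⊤ := h1.2.2.2 T
    have hmem : ∀ᵐ s ∂volume.restrict (Icc 0 T),
        ∃ G : L2M D, ((S.Z (Real.toNNReal s) ω : L2 D), G) ∈ Vsol D := by
      filter_upwards [ae_lt_top ((measurable_dirichlet hD).comp hZm) hdir.ne] with s hs
      exact exists_of_dirichlet_ne_top hs.ne
    -- The k-th Brownian term is split with window parameter equal to the k-th eigenvalue.
    have key := B.path_energy (A := A) hD hb hc hac haA hT (fun s => S.Z s.toNNReal ω)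
      (fun s => liftV D (S.Z s.toNNReal ω : L2 D)) ((measurable_liftV hD).comp hZm)
      (by filter_upwards [hmem] with s hs; exact liftV_fst hs)
      ((lintegral_mono fun s => enorm_grad_sq_le hD _).trans_lt hdir)
      (fun k s => σ k * roughPart (B.ev k) (extPath (β k) ω) s)
      (fun k s => σ k * slopePart (B.ev k) (extPath (β k) ω) s)
      (fun k => continuous_const.mul (continuous_roughPart (continuous_extPath (hβc k) ω)))
      (fun k => continuous_const.mul (continuous_slopePart (continuous_extPath (hβc k) ω)))
      (fun k => ?_) (fun k t ht => ?_)
    · rw [Real.toNNReal_zero] at key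
      have hpoin : ∀ᵐ s ∂volume.restrict (Icc 0 T), ‖S.Z (Real.toNNReal s) ω‖ₑ ^ 2 ≤
          (C : ℝ≥0∞) ^ 2 * ‖grad D (S.Z (Real.toNNReal s) ω : L2 D)‖ₑ ^ 2 := by
        filter_upwards [hmem] with s hs
        have h4 := hC _ (mem_Vsol_grad hs)
        rw [← mul_pow]
        gcongr
        rw [← ofReal_norm, ← ofReal_norm, ← ENNReal.ofReal_coe_nnreal,
          ← ENNReal.ofReal_mul (by positivity)]
        exact ENNReal.ofReal_le_ofReal h4
      refine (lintegral_mono_ae hpoin).trans ?_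
      rw [lintegral_const_mul' _ _ (by finiteness)]
      refine (mul_le_mul' le_rfl key).trans (le_of_eq ?_)
      rw [ENNReal.coe_mul, ENNReal.coe_pow, mul_assoc]
      rfl
    · rw [roughPart_zero (hev k), mul_zero]
      intro t ht
      simp [extPath, Real.toNNReal_of_nonpos ht, hβ0]
    -- Tested against e_k, the noise series has a single nonzero term by orthonormality.
    · have h5 := (h2 t.toNNReal (B.vec k)).unique (hasSum_single k fun j hj => ?_)
      · rw [Real.coe_toNNReal _ ht.1] at h5
        have h6 : (B.vec k : L2 D × L2M D).1 = (B.e k : L2 D) := rfl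
        rw [h6, B.inner_e, if_pos rfl] at h5
        rw [Real.toNNReal_zero, h5, intervalIntegral.integral_const_mul, ← mul_add,
          roughPart_add_integral (hev k) (continuous_extPath (hβc k) ω), mul_one, extPath, h3]
        intro t ht
        simp [extPath, Real.toNNReal_of_nonpos ht, hβ0]
      · have h6 : (B.vec k : L2 D × L2M D).1 = (B.e k : L2 D) := rfl
        rw [h6, B.inner_e, if_neg hj, mul_zero]

/-- The second moments of the forcing of stationary solutions are bounded in terms of the data. -/
theorem exists_forcing_bound (hD : IsOpen D) (hb : Bornology.IsBounded D)
    (hσ : Summable fun k => σ k ^ 2) (ha : ComparableToStokes a) :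
    ∃ K : ℝ≥0, ∀ (ν : ℝ) (S : StationarySolution.{u} B σ a ν) (t : ℝ≥0),
      ∫⁻ ω, ‖S.Z t ω‖ₑ ^ 2 ∂S.P ≤ K := by
  obtain ⟨K, hK⟩ := exists_forcing_path_bound (σ := σ) (B := B) hD hb ha
  have hσ' : ∑' k, ENNReal.ofReal (σ k ^ 2) ≠ ⊤ := by
    rw [← ENNReal.ofReal_tsum_of_nonneg (fun _ => sq_nonneg _) hσ]; simp
  refine ⟨K * (2 * (∑' k, ENNReal.ofReal (σ k ^ 2)).toNNReal), fun ν S t => ?_⟩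
  rw [ENNReal.coe_mul, ENNReal.coe_mul, ENNReal.coe_toNNReal hσ']
  set M := ∑' k, ENNReal.ofReal (σ k ^ 2)
  have hZt : ∀ t, Measurable (S.Z t) := fun t => S.measurable_Z.comp measurable_prodMk_left
  have hlaw : ∀ (f : Hsol D → ℝ≥0∞), Measurable f → ∀ t,
      ∫⁻ ω, f (S.Z t ω) ∂S.P = ∫⁻ ω, f (S.Z 0 ω) ∂S.P := fun f hf t =>
    (((S.identDistrib t).comp measurable_snd).comp hf).lintegral_eq
  rw [hlaw (fun z => ‖z‖ₑ ^ 2) (by fun_prop) t]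
  -- The second moment at time 0 is not known to be finite at this point. Truncation at R makes
  -- every quantity finite, and the bound does not depend on R.
  have htr : ∀ R : ℝ≥0, ∫⁻ ω, min (‖S.Z 0 ω‖ₑ ^ 2) R ∂S.P ≤ K * (2 * M) := by
    intro R
    -- The path bound is averaged over [0, n]. By stationarity the left side is n times the
    -- truncated moment, while the noise contributes at most n·2Σσ_k² up to the factor K.
    have hn : ∀ n : ℕ, 0 < n → ∫⁻ ω, min (‖S.Z 0 ω‖ₑ ^ 2) R ∂S.P ≤
        ∫⁻ ω, min (R : ℝ≥0∞) (K * ‖S.Z 0 ω‖ₑ ^ 2 / n) ∂S.P + K * (2 * M) := by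
      intro n hn
      have hn0 : (n : ℝ≥0∞) ≠ 0 := by simpa using hn.ne'
      obtain ⟨X, hX, hXm, hle⟩ := hK ν S.toMartingaleSolution n (by positivity)
      rw [ENNReal.ofReal_natCast] at hX
      have hj : Measurable fun q : ℝ × S.Ω => min (‖S.Z q.1.toNNReal q.2‖ₑ ^ 2) (R : ℝ≥0∞) :=
        ((S.measurable_Z.comp ((measurable_real_toNNReal.comp measurable_fst).prodMk
          measurable_snd)).enorm.pow_const 2).min measurable_const
      have e1 : ∫⁻ ω, ∫⁻ s in Icc (0 : ℝ) n, min (‖S.Z s.toNNReal ω‖ₑ ^ 2) (R : ℝ≥0∞) ∂volume ∂S.P =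
          n * ∫⁻ ω, min (‖S.Z 0 ω‖ₑ ^ 2) R ∂S.P := by
        rw [lintegral_lintegral_swap (f := fun ω (s : ℝ) => min (‖S.Z s.toNNReal ω‖ₑ ^ 2) (R : ℝ≥0∞))
          (hj.comp measurable_swap).aemeasurable]
        have : ∀ s : ℝ, ∫⁻ ω, min (‖S.Z s.toNNReal ω‖ₑ ^ 2) (R : ℝ≥0∞) ∂S.P =
            ∫⁻ ω, min (‖S.Z 0 ω‖ₑ ^ 2) R ∂S.P := fun s =>
          hlaw (fun z => min (‖z‖ₑ ^ 2) (R : ℝ≥0∞)) (by fun_prop) _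
        simp only [this]
        rw [setLIntegral_const, Real.volume_Icc, sub_zero, ENNReal.ofReal_natCast, mul_comm]
      have e2 : ∫⁻ ω, ∫⁻ s in Icc (0 : ℝ) n, min (‖S.Z s.toNNReal ω‖ₑ ^ 2) (R : ℝ≥0∞) ∂volume ∂S.P ≤
          ∫⁻ ω, (n * min (R : ℝ≥0∞) (K * ‖S.Z 0 ω‖ₑ ^ 2 / n) + K * X ω) ∂S.P := by
        refine lintegral_mono_ae ?_
        filter_upwards [hle] with ω h
        have b1 : ∫⁻ s in Icc (0 : ℝ) n, min (‖S.Z s.toNNReal ω‖ₑ ^ 2) (R : ℝ≥0∞) ≤ n * R := by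
          refine (lintegral_mono fun s => min_le_right _ _).trans ?_
          rw [setLIntegral_const, Real.volume_Icc, sub_zero, ENNReal.ofReal_natCast, mul_comm]
        have b2 : ∫⁻ s in Icc (0 : ℝ) n, min (‖S.Z s.toNNReal ω‖ₑ ^ 2) (R : ℝ≥0∞) ≤
            K * ‖S.Z 0 ω‖ₑ ^ 2 + K * X ω := by
          rw [← mul_add]
          exact (lintegral_mono fun s => min_le_left _ _).trans h
        have b3 : n * min (R : ℝ≥0∞) (K * ‖S.Z 0 ω‖ₑ ^ 2 / n) =
            min (n * R : ℝ≥0∞) (K * ‖S.Z 0 ω‖ₑ ^ 2) := by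
          rw [mul_min, ENNReal.mul_div_cancel hn0 (by simp)]
        rw [b3]
        rcases le_total (n * R : ℝ≥0∞) (K * ‖S.Z 0 ω‖ₑ ^ 2) with h | h
        · rw [min_eq_left h]; exact b1.trans le_self_add
        · rw [min_eq_right h]; exact b2
      rw [e1, lintegral_add_right _ (hXm.const_mul _), lintegral_const_mul' _ _ (by simp),
        lintegral_const_mul' _ _ (by simp)] at e2
      have e3 : (n : ℝ≥0∞) * ∫⁻ ω, min (‖S.Z 0 ω‖ₑ ^ 2) R ∂S.P ≤
          n * (∫⁻ ω, min (R : ℝ≥0∞) (K * ‖S.Z 0 ω‖ₑ ^ 2 / n) ∂S.P + K * (2 * M)) := by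
        refine e2.trans ?_
        rw [mul_add]
        refine add_le_add le_rfl ?_
        calc (K : ℝ≥0∞) * ∫⁻ ω, X ω ∂S.P ≤ K * (n * (2 * M)) := by gcongr
          _ = n * (K * (2 * M)) := by ring
      exact (ENNReal.mul_le_mul_iff_right hn0 (by simp)).1 e3
    -- The initial value, divided by n, tends to 0 pointwise and is dominated by the constant R.
    have hlim : Tendsto (fun n : ℕ => ∫⁻ ω, min (R : ℝ≥0∞) (K * ‖S.Z 0 ω‖ₑ ^ 2 / n) ∂S.P) atTop
        (𝓝 0) := by
      have := tendsto_lintegral_of_dominated_convergence (μ := S.P)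
        (F := fun (n : ℕ) ω => min (R : ℝ≥0∞) (K * ‖S.Z 0 ω‖ₑ ^ 2 / n)) (f := fun _ => 0)
        (fun _ => (R : ℝ≥0∞)) (fun n => ?_) (fun n => .of_forall fun ω => min_le_left _ _)
        (by simp) (.of_forall fun ω => ?_)
      · simpa using this
      · exact measurable_const.min ((((hZt 0).enorm.pow_const 2).const_mul _).div_const _)
      · refine tendsto_of_tendsto_of_tendsto_of_le_of_le tendsto_const_nhds ?_
          (fun _ => zero_le) (fun n => min_le_right _ _)
        have := ENNReal.Tendsto.const_mul (a := (K : ℝ≥0∞) * ‖S.Z 0 ω‖ₑ ^ 2)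
          ENNReal.tendsto_inv_nat_nhds_zero (Or.inr (by finiteness))
        simpa [div_eq_mul_inv] using this
    refine ge_of_tendsto (f := fun n : ℕ => ∫⁻ ω, min (R : ℝ≥0∞) (K * ‖S.Z 0 ω‖ₑ ^ 2 / n) ∂S.P +
      K * (2 * M)) (by simpa using hlim.add_const (K * (2 * M))) ?_
    filter_upwards [eventually_gt_atTop 0] with n hn'
    exact hn n hn'
  -- Monotone convergence in the truncation level.
  have hsup : ∫⁻ ω, ‖S.Z 0 ω‖ₑ ^ 2 ∂S.P = ⨆ n : ℕ, ∫⁻ ω, min (‖S.Z 0 ω‖ₑ ^ 2) (n : ℝ≥0) ∂S.P := by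
    rw [← lintegral_iSup]
    · refine lintegral_congr fun ω => le_antisymm ?_ (iSup_le fun n => min_le_left _ _)
      obtain ⟨n, hn⟩ := exists_nat_ge (‖S.Z 0 ω‖₊ ^ 2)
      refine le_iSup_of_le n (le_min le_rfl ?_)
      rw [enorm_eq_nnnorm, ← ENNReal.coe_pow]
      exact_mod_cast hn
    · intro n
      exact ((hZt 0).enorm.pow_const 2).min measurable_const
    · intro n k h ω
      have h' : ((n : ℝ≥0) : ℝ≥0∞) ≤ ((k : ℝ≥0) : ℝ≥0∞) := by exact_mod_cast h
      exact min_le_min le_rfl h'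
  rw [hsup]
  exact iSup_le fun n => htr n

end solution

/-! ### From products of test functions to two-point test functions -/

section tensor

lemma pd_comp_sub (f : E3 → ℝ) (k : Fin 3) (z x : E3) :
    pd k (fun y => f (y - z)) x = pd k f (x - z) := by
  simp only [pd]; rw [fderiv_comp_sub]

lemma pd_comp_const_sub (f : E3 → ℝ) (k : Fin 3) (z x : E3) :
    pd k (fun y => f (z - y)) x = - pd k f (z - x) := by
  by_cases h : DifferentiableAt ℝ f (z - x)
  · have h2 : HasFDerivAt (fun y => z - y) (-ContinuousLinearMap.id ℝ E3) x :=
      (hasFDerivAt_id x).const_sub z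
    have h3 : HasFDerivAt (fun y => f (z - y)) _ x := h.hasFDerivAt.comp x h2
    simp [pd, h3.fderiv]
  · have h4 : ¬ DifferentiableAt ℝ (fun y => f (z - y)) x := fun h5 => h (by
      have h2 : DifferentiableAt ℝ (fun y => z - y) (z - x) := by fun_prop
      have h5' : DifferentiableAt ℝ (fun y => f (z - y)) (z - (z - x)) := by rwa [sub_sub_cancel]
      simpa [Function.comp_def] using h5'.comp (z - x) h2)
    simp [pd, fderiv_zero_of_not_differentiableAt h, fderiv_zero_of_not_differentiableAt h4]

variable {Y : Type*} [MeasurableSpace Y] {m : Measure Y} {q₁ q₂ : Y → E3}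

lemma integrable_mul_shift {L : Y → ℝ} (hL : Integrable L m) {k : E3 → ℝ} (hk : Integrable k)
    (hkm : Measurable k) (hq : Measurable q₁) :
    Integrable (fun s : Y × E3 => L s.1 * k (s.2 - q₁ s.1)) (m.prod volume) := by
  have hms : AEStronglyMeasurable (fun s : Y × E3 => L s.1 * k (s.2 - q₁ s.1)) (m.prod volume) :=
    hL.1.comp_fst.mul (hkm.comp (measurable_snd.sub (hq.comp measurable_fst))).aestronglyMeasurable
  refine (integrable_prod_iff hms).2 ⟨.of_forall fun y => (hk.comp_sub_right (q₁ y)).const_mul (L y), ?_⟩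
  have : ∀ y, ∫ z, ‖L y * k (z - q₁ y)‖ = ‖L y‖ * ∫ z, ‖k z‖ := fun y => by
    simp only [norm_mul]
    rw [integral_const_mul, integral_sub_right_eq_self (fun z => ‖k z‖)]
  simp only [this]
  exact hL.norm.mul_const _

lemma integrable_mul_shift_shift [SFinite m] {L : Y → ℝ} (hL : Integrable L m) {b d : E3 → ℝ}
    (hb : Continuous b) (hb' : HasCompactSupport b) (hd : Continuous d) (hd' : HasCompactSupport d)
    (hq₁ : Measurable q₁) (hq₂ : Measurable q₂) :
    Integrable (fun s : Y × E3 => L s.1 * (b (s.2 - q₁ s.1) * d (q₂ s.1 - s.2)))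
      (m.prod volume) := by
  obtain ⟨C, hC⟩ := hd'.exists_bound_of_continuous hd
  have h1 := integrable_mul_shift (q₁ := q₁) hL (hb.integrable_of_hasCompactSupport hb')
    hb.measurable hq₁
  refine (h1.bdd_mul (f := fun s : Y × E3 => d (q₂ s.1 - s.2)) (c := C)
    (hd.measurable.comp ((hq₂.comp measurable_fst).sub measurable_snd)).aestronglyMeasurable
    (.of_forall fun s => hC _)).congr (.of_forall fun s => ?_)
  simp only; ring

lemma integral_shift_shift (b d : E3 → ℝ) (x y : E3) :
    ∫ z, b (z - x) * d (y - z) = ∫ t, b (y - x - t) * d t := by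
  rw [← integral_sub_left_eq_self (fun z => b (z - x) * d (y - z)) volume y]
  refine integral_congr_ae (.of_forall fun t => ?_)
  simp only
  congr 2 <;> abel

lemma integral_shift_pd {φ c : E3 → ℝ} (hφ : ContDiff ℝ (⊤ : ℕ∞) φ) (hφ' : HasCompactSupport φ)
    (hc : ContDiff ℝ (⊤ : ℕ∞) c) (k : Fin 3) (h : E3) :
    ∫ t, φ (h - t) * pd k c t = ∫ t, pd k φ (h - t) * c t := by
  have := integral_pd_mul (f := fun t => φ (h - t)) (hφ.comp (contDiff_const.sub contDiff_id)) hc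
    (hφ'.comp_homeomorph (Homeomorph.subLeft h)) k
  simp only [pd_comp_const_sub, neg_mul, integral_neg, neg_inj] at this
  exact this.symm

/-- An identity which is linear in the test function and its first derivatives, valid for products
`α(x) β(y)` of test functions of `D`, holds for `ψ(x) φ(y - x)` if `φ` is supported near `0`. -/
theorem integral_two_point [SFinite m] {D : Set E3} (hq₁ : Measurable q₁) (hq₂ : Measurable q₂)
    {G₀ : Y → ℝ} {G H : Fin 3 → Y → ℝ} (hG₀ : Integrable G₀ m) (hG : ∀ k, Integrable (G k) m)
    (hH : ∀ k, Integrable (H k) m)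
    (h : ∀ α β : E3 → ℝ, IsTest D α → IsTest D β → ∫ y, (G₀ y * (α (q₁ y) * β (q₂ y)) +
      (∑ k, G k y * (pd k α (q₁ y) * β (q₂ y)) +
      ∑ k, H k y * (α (q₁ y) * pd k β (q₂ y)))) ∂m = 0)
    {ψ φ : E3 → ℝ} (hψ : IsTest D ψ) (hφ : IsTest univ φ) {r : ℝ} (hr : 0 < r)
    (hD : ∀ x ∈ tsupport ψ, ∀ y, y ∈ tsupport φ → Metric.closedBall (x + y) r ⊆ D) :
    ∫ y, (G₀ y * (ψ (q₁ y) * φ (q₂ y - q₁ y)) +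
      (∑ k, G k y * (pd k ψ (q₁ y) * φ (q₂ y - q₁ y) - ψ (q₁ y) * pd k φ (q₂ y - q₁ y)) +
      ∑ k, H k y * (ψ (q₁ y) * pd k φ (q₂ y - q₁ y)))) ∂m = 0 := by
  obtain ⟨Cψ, hCψ⟩ := hψ.bounded
  have hdψ := fun k => (hψ.pd k).bounded
  choose Cd hCd using hdψ
  -- The target integrand regrouped: A collects the coefficients of φ(y − x), and `Bf k` those of
  -- its k-th derivative.
  set A : Y → ℝ := fun y => G₀ y * ψ (q₁ y) + ∑ k, G k y * pd k ψ (q₁ y) with hA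
  set Bf : Fin 3 → Y → ℝ := fun k y => (H k y - G k y) * ψ (q₁ y) with hBf
  have hbψ : ∀ {f : Y → ℝ} {g : E3 → ℝ} {C : ℝ}, Integrable f m → Continuous g →
      (∀ x, |g x| ≤ C) → Integrable (fun y => f y * g (q₁ y)) m := fun hf hg hC =>
    hf.mul_bdd (hg.measurable.comp hq₁).aestronglyMeasurable (.of_forall fun y => hC _)
  have hAi : Integrable A m := (hbψ hG₀ hψ.1.continuous hCψ).add
    (integrable_finsetSum _ fun k _ => hbψ (hG k) (contDiff_pd hψ.1 k).continuous (hCd k))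
  have hBi : ∀ k, Integrable (Bf k) m := fun k =>
    hbψ ((hH k).sub (hG k)) hψ.1.continuous hCψ
  have hGi : ∀ k, Integrable (fun y => G k y * ψ (q₁ y)) m := fun k =>
    hbψ (hG k) hψ.1.continuous hCψ
  have hHi : ∀ k, Integrable (fun y => H k y * ψ (q₁ y)) m := fun k =>
    hbψ (hH k) hψ.1.continuous hCψ
  -- The mollifiers have radius r/(n+2) ≤ r, so that translated to a reachable point z they remain
  -- supported in D.
  let bump : ℕ → ContDiffBump (0 : E3) := fun n =>
    ⟨r / (n + 2) / 2, r / (n + 2), by positivity, half_lt_self (by positivity)⟩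
  let c : ℕ → E3 → ℝ := fun n => (bump n).normed volume
  have hcs : ∀ n, ContDiff ℝ (⊤ : ℕ∞) (c n) := fun n => (bump n).contDiff_normed
  have hcc : ∀ n, HasCompactSupport (c n) := fun n => (bump n).hasCompactSupport_normed
  let R : ℕ → (E3 → ℝ) → E3 → ℝ := fun n b x => ∫ t, b (x - t) * c n t
  -- For fixed z the product identity is used with α(x) = ψ(x)φ(z − x) and β(y) = c_n(y − z).
  -- Integrating over z afterwards produces the mollification of φ at y − x.
  have hzero : ∀ n z, ∫ y, (A y * (φ (z - q₁ y) * c n (q₂ y - z)) +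
      (- ∑ k, G k y * ψ (q₁ y) * (pd k φ (z - q₁ y) * c n (q₂ y - z)) +
      ∑ k, H k y * ψ (q₁ y) * (φ (z - q₁ y) * pd k (c n) (q₂ y - z)))) ∂m = 0 := by
    intro n z
    have hφz : ContDiff ℝ (⊤ : ℕ∞) fun x => φ (z - x) := hφ.1.comp (contDiff_const.sub contDiff_id)
    have hα : IsTest D fun x => ψ x * φ (z - x) := hψ.mul hφz
    have hpd : ∀ k x, pd k (fun x => ψ x * φ (z - x)) x =
        pd k ψ x * φ (z - x) - ψ x * pd k φ (z - x) := fun k x => by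
      rw [pd_mul hψ.1 hφz, pd_comp_const_sub]; ring
    by_cases hz : ∃ x ∈ tsupport ψ, z - x ∈ tsupport φ
    · obtain ⟨x, hx, hzx⟩ := hz
      have hβ : IsTest D fun y => c n (y - z) := by
        refine ⟨(hcs n).comp (contDiff_id.sub contDiff_const),
          (hcc n).comp_homeomorph (Homeomorph.subRight z), ?_⟩
        have h1 := hD x hx _ hzx
        rw [add_sub_cancel] at h1
        refine subset_trans (closure_minimal (fun y hy => ?_) Metric.isClosed_closedBall) h1
        have hy' : y - z ∈ Function.support (c n) := hy
        rw [(bump n).support_normed_eq] at hy'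
        have h3 : (bump n).rOut ≤ r := div_le_self hr.le (by linarith [n.cast_nonneg (α := ℝ)])
        rw [Metric.mem_closedBall, dist_eq_norm]
        have := mem_ball_zero_iff.1 hy'
        linarith
      rw [← h _ _ hα hβ]
      refine integral_congr_ae (.of_forall fun y => ?_)
      simp only [hpd, pd_comp_sub, hA, Fin.sum_univ_three]
      ring
    -- If z is not a point of supp ψ + supp φ then α and its gradient vanish identically, so no
    -- condition on β is needed.
    · push Not at hz
      have e : ∀ x, ψ x ≠ 0 → φ (z - x) = 0 ∧ ∀ k, pd k φ (z - x) = 0 := fun x hx => by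
        have := hz x (subset_tsupport _ hx)
        exact ⟨image_eq_zero_of_notMem_tsupport this, fun k =>
          image_eq_zero_of_notMem_tsupport fun h' => this (tsupport_pd_subset _ _ h')⟩
      have e2 : ∀ x k, pd k ψ x * φ (z - x) = 0 := fun x k => by
        by_cases hx : x ∈ tsupport ψ
        · rw [image_eq_zero_of_notMem_tsupport (hz x hx), mul_zero]
        · rw [image_eq_zero_of_notMem_tsupport fun h' => hx (tsupport_pd_subset _ _ h'), zero_mul]
      have e3 : ∀ x, ψ x * φ (z - x) = 0 := fun x => by
        by_cases hx : ψ x = 0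
        · rw [hx, zero_mul]
        · rw [(e x hx).1, mul_zero]
      have e4 : ∀ x k, ψ x * pd k φ (z - x) = 0 := fun x k => by
        by_cases hx : ψ x = 0
        · rw [hx, zero_mul]
        · rw [(e x hx).2, mul_zero]
      rw [← integral_zero Y ℝ (μ := m)]
      refine integral_congr_ae (.of_forall fun y => ?_)
      have f1 : ∀ k, G k y * ψ (q₁ y) * (pd k φ (z - q₁ y) * c n (q₂ y - z)) = 0 := fun k => by
        linear_combination G k y * c n (q₂ y - z) * e4 (q₁ y) k
      have f2 : ∀ k, H k y * ψ (q₁ y) * (φ (z - q₁ y) * pd k (c n) (q₂ y - z)) = 0 := fun k => by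
        linear_combination H k y * pd k (c n) (q₂ y - z) * e3 (q₁ y)
      have f3 : A y * (φ (z - q₁ y) * c n (q₂ y - z)) = 0 := by
        have f4 : ∑ k, G k y * pd k ψ (q₁ y) * φ (z - q₁ y) = 0 :=
          Finset.sum_eq_zero fun k _ => by linear_combination G k y * e2 (q₁ y) k
        rw [← Finset.sum_mul] at f4
        simp only [hA]
        linear_combination G₀ y * c n (q₂ y - z) * e3 (q₁ y) + c n (q₂ y - z) * f4
      simp only [f1, f2, f3, Finset.sum_const_zero, neg_zero, add_zero]
  -- Fubini in z. The derivative on the mollifier is carried over to φ under the convolution, so all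
  -- three groups involve mollifications of φ or of its derivatives.
  have hmoll : ∀ n, ∫ y, (A y * R n φ (q₂ y - q₁ y) +
      ∑ k, Bf k y * R n (pd k φ) (q₂ y - q₁ y)) ∂m = 0 := by
    intro n
    have i1 := integrable_mul_shift_shift hAi hφ.1.continuous hφ.2.1 (hcs n).continuous (hcc n)
      hq₁ hq₂
    have i2 := fun k => integrable_mul_shift_shift (hGi k) (contDiff_pd hφ.1 k).continuous
      (hφ.pd k).2.1 (hcs n).continuous (hcc n) hq₁ hq₂
    have i3 := fun k => integrable_mul_shift_shift (hHi k) hφ.1.continuous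
      hφ.2.1 (contDiff_pd (hcs n) k).continuous (hasCompactSupport_pd (hcc n) k) hq₁ hq₂
    have i4 := i1.add ((integrable_finsetSum Finset.univ fun k _ => i2 k).neg.add
      (integrable_finsetSum Finset.univ fun k _ => i3 k))
    have := integral_integral_swap (f := fun y z => A y * (φ (z - q₁ y) * c n (q₂ y - z)) +
      (- ∑ k, G k y * ψ (q₁ y) * (pd k φ (z - q₁ y) * c n (q₂ y - z)) +
      ∑ k, H k y * ψ (q₁ y) * (φ (z - q₁ y) * pd k (c n) (q₂ y - z)))) i4
    simp only [hzero, integral_zero] at this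
    rw [← this]
    refine integral_congr_ae ?_
    filter_upwards [i1.prod_right_ae, ae_all_iff.2 fun k => (i2 k).prod_right_ae,
      ae_all_iff.2 fun k => (i3 k).prod_right_ae] with y j1 j2 j3
    have n2 : Integrable fun z => - ∑ k, G k y * ψ (q₁ y) * (pd k φ (z - q₁ y) * c n (q₂ y - z)) :=
      (integrable_finsetSum Finset.univ fun k _ => j2 k).neg
    have n3 : Integrable fun z => ∑ k, H k y * ψ (q₁ y) * (φ (z - q₁ y) * pd k (c n) (q₂ y - z)) :=
      integrable_finsetSum Finset.univ fun k _ => j3 k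
    have n23 : Integrable fun z => - ∑ k, G k y * ψ (q₁ y) * (pd k φ (z - q₁ y) * c n (q₂ y - z)) +
        ∑ k, H k y * ψ (q₁ y) * (φ (z - q₁ y) * pd k (c n) (q₂ y - z)) := n2.add n3
    rw [integral_add j1 n23, integral_add n2 n3, integral_neg,
      integral_finsetSum _ fun k _ => j2 k, integral_finsetSum _ fun k _ => j3 k]
    simp only [integral_const_mul, integral_shift_shift]
    simp only [integral_shift_pd hφ.1 hφ.2.1 (hcs n)]
    simp only [R, hBf, Fin.sum_univ_three]
    ring
  have hRlim : ∀ (b : E3 → ℝ), Continuous b → ∀ x, Tendsto (fun n => R n b x) atTop (𝓝 (b x)) := by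
    intro b hb x
    have := ContDiffBump.convolution_tendsto_right_of_continuous (μ := volume) (φ := bump) (l := atTop)
      (g := b) ?_ hb x
    · refine this.congr fun n => ?_
      simp only [convolution_def, ContinuousLinearMap.lsmul_apply, smul_eq_mul, R, c]
      exact integral_congr_ae (.of_forall fun t => mul_comm _ _)
    · have h1 : Tendsto (fun n : ℕ => (n : ℝ) + 2) atTop atTop :=
        tendsto_atTop_add_const_right _ _ tendsto_natCast_atTop_atTop
      exact h1.const_div_atTop r
  have hRb : ∀ (b : E3 → ℝ) (C : ℝ), (∀ x, |b x| ≤ C) → ∀ n x, ‖R n b x‖ ≤ C := by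
    intro b C hC n x
    have h1 : ∫ t, C * c n t = C := by
      rw [integral_const_mul, (bump n).integral_normed, mul_one]
    rw [← h1]
    refine norm_integral_le_of_norm_le ((bump n).integrable_normed.const_mul C)
      (.of_forall fun t => ?_)
    rw [norm_mul, Real.norm_eq_abs, Real.norm_eq_abs, abs_of_nonneg ((bump n).nonneg_normed t)]
    exact mul_le_mul_of_nonneg_right (hC _) ((bump n).nonneg_normed t)
  have hRm : ∀ (b : E3 → ℝ), Continuous b → ∀ n, Measurable (R n b) := by
    intro b hb n
    have : StronglyMeasurable fun s : E3 × E3 => b (s.1 - s.2) * c n s.2 := by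
      refine Continuous.stronglyMeasurable ?_
      exact (hb.comp (continuous_fst.sub continuous_snd)).mul ((hcs n).continuous.comp continuous_snd)
    exact this.integral_prod_right.measurable
  obtain ⟨Cφ, hCφ⟩ := hφ.bounded
  have hdφ := fun k => (hφ.pd k).bounded
  choose Cφ' hCφ' using hdφ
  have hlim : Tendsto (fun n => ∫ y, (A y * R n φ (q₂ y - q₁ y) +
      ∑ k, Bf k y * R n (pd k φ) (q₂ y - q₁ y)) ∂m) atTop
      (𝓝 (∫ y, (A y * φ (q₂ y - q₁ y) + ∑ k, Bf k y * pd k φ (q₂ y - q₁ y)) ∂m)) := by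
    refine tendsto_integral_of_dominated_convergence
      (fun y => ‖A y‖ * Cφ + ∑ k, ‖Bf k y‖ * Cφ' k) (fun n => ?_) ?_ (fun n => .of_forall fun y => ?_)
      (.of_forall fun y => ?_)
    · refine (hAi.1.mul ((hRm φ hφ.1.continuous n).comp
        (hq₂.sub hq₁)).aestronglyMeasurable).add ?_
      refine Finset.aestronglyMeasurable_fun_sum _ fun k _ => ?_
      exact (hBi k).1.mul ((hRm _ (contDiff_pd hφ.1 k).continuous n).comp
        (hq₂.sub hq₁)).aestronglyMeasurable
    · exact (hAi.norm.mul_const _).add (integrable_finsetSum _ fun k _ => (hBi k).norm.mul_const _)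
    · refine (norm_add_le _ _).trans (add_le_add ?_ ((norm_sum_le _ _).trans
        (Finset.sum_le_sum fun k _ => ?_)))
      · rw [norm_mul]
        exact mul_le_mul_of_nonneg_left (hRb _ _ hCφ _ _) (norm_nonneg _)
      · rw [norm_mul]
        exact mul_le_mul_of_nonneg_left (hRb _ _ (hCφ' k) _ _) (norm_nonneg _)
    · exact ((hRlim φ hφ.1.continuous _).const_mul _).add (tendsto_finsetSum _ fun k _ =>
        (hRlim _ (contDiff_pd hφ.1 k).continuous _).const_mul _)
  simp only [hmoll] at hlim
  rw [← tendsto_nhds_unique hlim tendsto_const_nhds]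
  refine integral_congr_ae (.of_forall fun y => ?_)
  simp only [hA, hBf, Fin.sum_univ_three]
  ring

end tensor

/-! ### Two-point integrals -/

section twoPoint

variable {X : Type*} [MeasurableSpace X] {μ : Measure X}

/-- The map `(ω, x, h) ↦ (ω, x, x + h)`. -/
def shear (q : X × E3 × E3) : X × E3 × E3 := (q.1, q.2.1, q.2.1 + q.2.2)

lemma measurePreserving_shear [SFinite μ] :
    MeasurePreserving (shear (X := X)) (μ.prod (volume.prod volume)) (μ.prod (volume.prod volume)) :=
  (MeasurePreserving.id μ).prod (measurePreserving_prod_add (volume : Measure E3) volume)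

lemma measurableEmbedding_shear : MeasurableEmbedding (shear (X := X)) :=
  ((MeasurableEquiv.refl X).prodCongr (MeasurableEquiv.shearAddRight E3)).measurableEmbedding

lemma measurePreserving_shift [SFinite μ] :
    MeasurePreserving (fun q : X × E3 × E3 => (q.1, q.2.1 + q.2.2, q.2.2))
      (μ.prod (volume.prod volume)) (μ.prod (volume.prod volume)) := by
  have h1 : MeasurePreserving (fun q : E3 × E3 => (q.1 + q.2, q.2)) (volume.prod volume)
      (volume.prod volume) := by
    have h := ((Measure.measurePreserving_swap (μ := (volume : Measure E3))
      (ν := (volume : Measure E3))).comp (measurePreserving_prod_add (volume : Measure E3)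
      (volume : Measure E3))).comp Measure.measurePreserving_swap
    convert h using 2 with q
    simp [add_comm]
  exact (MeasurePreserving.id μ).prod h1

lemma measurableEmbedding_shift :
    MeasurableEmbedding (fun q : X × E3 × E3 => (q.1, q.2.1 + q.2.2, q.2.2)) := by
  have h : (fun q : X × E3 × E3 => (q.1, q.2.1 + q.2.2, q.2.2)) =
      ((MeasurableEquiv.refl X).prodCongr (MeasurableEquiv.prodComm.trans
        ((MeasurableEquiv.shearAddRight E3).trans MeasurableEquiv.prodComm))) := by
    funext q
    exact Prod.ext rfl (Prod.ext (add_comm _ _) rfl)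
  rw [h]
  exact MeasurableEquiv.measurableEmbedding _

lemma measurePreserving_assoc :
    MeasurePreserving (MeasurableEquiv.prodAssoc : (X × E3) × E3 ≃ᵐ X × E3 × E3)
      ((μ.prod volume).prod volume) (μ.prod (volume.prod volume)) :=
  measurePreserving_prodAssoc μ volume volume

/-- Fubini with the first point x held fixed. -/
lemma integral_eq_zero_of_integral_right [SFinite μ] {f : X × E3 × E3 → ℝ}
    (hf : Integrable f (μ.prod (volume.prod volume))) (h : ∀ ω x, ∫ y, f (ω, x, y) = 0) :
    ∫ q, f q ∂(μ.prod (volume.prod volume)) = 0 := by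
  rw [← measurePreserving_assoc.integral_comp (MeasurableEquiv.measurableEmbedding _),
    integral_prod (f := fun s : (X × E3) × E3 => f (MeasurableEquiv.prodAssoc s))
      ((measurePreserving_assoc.integrable_comp_emb (MeasurableEquiv.measurableEmbedding _)).2 hf)]
  simp [MeasurableEquiv.prodAssoc, h]

/-- Fubini with the second point y = x + h held fixed, after the shear (x, h) ↦ (x, x + h). -/
lemma integral_eq_zero_of_integral_left [SFinite μ] {f : X × E3 × E3 → ℝ}
    (hf : Integrable f (μ.prod (volume.prod volume))) (h : ∀ ω y, ∫ x, f (ω, x, y - x) = 0) :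
    ∫ q, f q ∂(μ.prod (volume.prod volume)) = 0 := by
  have e : ∀ q : X × E3 × E3, f q = (fun q : X × E3 × E3 => f (q.1, q.2.1, q.2.2 - q.2.1)) (shear q) := by
    intro q; simp [shear]
  have hf' : Integrable (fun q : X × E3 × E3 => f (q.1, q.2.1, q.2.2 - q.2.1))
      (μ.prod (volume.prod volume)) := by
    refine (measurePreserving_shear.integrable_comp_emb measurableEmbedding_shear).1 ?_
    exact hf.congr (.of_forall e)
  rw [integral_congr_ae (.of_forall e), measurePreserving_shear.integral_comp
    measurableEmbedding_shear (fun q : X × E3 × E3 => f (q.1, q.2.1, q.2.2 - q.2.1)),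
    integral_prod _ hf', ← integral_zero X ℝ (μ := μ)]
  refine integral_congr_ae ?_
  filter_upwards [hf'.prod_right_ae] with ω hω
  rw [integral_prod_symm _ hω]
  simp [h]

lemma integrable_mul_kernel [SFinite μ] {g : X × E3 → ℝ} (hg : Integrable g (μ.prod volume)) {k : E3 → ℝ}
    (hk : Integrable k) :
    Integrable (fun q : X × E3 × E3 => g (q.1, q.2.1) * k q.2.2) (μ.prod (volume.prod volume)) := by
  refine (measurePreserving_assoc.integrable_comp_emb (MeasurableEquiv.measurableEmbedding _)).1 ?_
  exact hg.mul_prod hk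

lemma integral_mul_kernel [SFinite μ] (g : X × E3 → ℝ) (k : E3 → ℝ) :
    ∫ q : X × E3 × E3, g (q.1, q.2.1) * k q.2.2 ∂(μ.prod (volume.prod volume)) =
      (∫ q, g q ∂(μ.prod volume)) * ∫ h, k h := by
  rw [← measurePreserving_assoc.integral_comp (MeasurableEquiv.measurableEmbedding _),
    ← integral_prod_mul]
  rfl

lemma integrable_shift_mul_kernel [SFinite μ] {g : X × E3 → ℝ} (hg : Integrable g (μ.prod volume)) {k : E3 → ℝ}
    (hk : Integrable k) :
    Integrable (fun q : X × E3 × E3 => g (q.1, q.2.1 + q.2.2) * k q.2.2)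
      (μ.prod (volume.prod volume)) :=
  (measurePreserving_shift.integrable_comp_emb measurableEmbedding_shift).2
    (integrable_mul_kernel hg hk)

lemma integral_shift_mul_kernel [SFinite μ] (g : X × E3 → ℝ) (k : E3 → ℝ) :
    ∫ q : X × E3 × E3, g (q.1, q.2.1 + q.2.2) * k q.2.2 ∂(μ.prod (volume.prod volume)) =
      (∫ q, g q ∂(μ.prod volume)) * ∫ h, k h := by
  rw [← integral_mul_kernel]
  exact measurePreserving_shift.integral_comp measurableEmbedding_shift
    (fun q : X × E3 × E3 => g (q.1, q.2.1) * k q.2.2)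

end twoPoint

/-! ### Statistically stationary flows -/

/-- The velocity, its gradient, the pressure and the force of a flow in `D` with viscosity `ν`,
as random fields over a probability space that also carries the time average. -/
structure Flow (D : Set E3) (ν : ℝ) {X : Type u} [MeasurableSpace X] (μ : Measure X) where
  /-- The velocity. -/
  u : X → E3 → E3
  /-- The velocity gradient. -/
  w : X → E3 → M3
  /-- The pressure. -/
  p : X → E3 → ℝ
  /-- The force. -/
  z : X → E3 → E3
  measurable_u : Measurable fun q : X × E3 => u q.1 q.2
  measurable_w : Measurable fun q : X × E3 => w q.1 q.2
  measurable_p : Measurable fun q : X × E3 => p q.1 q.2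
  measurable_z : Measurable fun q : X × E3 => z q.1 q.2
  u_eq_zero : ∀ ω, ∀ x ∉ D, u ω x = 0
  w_eq_zero : ∀ ω, ∀ x ∉ D, w ω x = 0
  p_eq_zero : ∀ ω, ∀ x ∉ D, p ω x = 0
  z_eq_zero : ∀ ω, ∀ x ∉ D, z ω x = 0
  integrable_u : Integrable (fun q : X × E3 => ‖u q.1 q.2‖ ^ 3) (μ.prod volume)
  -- Writing |p|^{3/2} as the cube of √|p| lets the pressure enter cubic inequalities on the same
  -- footing as two velocity factors.
  integrable_p : Integrable (fun q : X × E3 => √|p q.1 q.2| ^ 3) (μ.prod volume)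
  integrable_z : Integrable (fun q : X × E3 => ‖z q.1 q.2‖ ^ 2) (μ.prod volume)
  integrable_w : Integrable (fun q : X × E3 => ν * ‖w q.1 q.2‖ ^ 2) (μ.prod volume)
  divFree : ∀ ω (φ : E3 → ℝ), IsTest univ φ → ∫ x, ∑ k, pd k φ x * u ω x k = 0

namespace Flow

variable {D : Set E3} {ν : ℝ} {X : Type u} [MeasurableSpace X] {μ : Measure X} (F : Flow D ν μ)

/-- The balance of the two-point correlations of the velocity: the momentum equation at two points,
averaged in a statistically stationary state. -/
def Balanced : Prop := ∀ α β : E3 → ℝ, IsTest D α → IsTest D β → ∀ i j,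
    ∫ q : X × E3 × E3, ((F.z q.1 q.2.1 i * F.u q.1 q.2.2 j + F.u q.1 q.2.1 i * F.z q.1 q.2.2 j) *
        (α q.2.1 * β q.2.2) +
      (∑ k, (F.u q.1 q.2.1 k * F.u q.1 q.2.1 i - ν * F.w q.1 q.2.1 (k, i) +
          if k = i then F.p q.1 q.2.1 else 0) * F.u q.1 q.2.2 j * (pd k α q.2.1 * β q.2.2) +
        ∑ k, F.u q.1 q.2.1 i * (F.u q.1 q.2.2 k * F.u q.1 q.2.2 j - ν * F.w q.1 q.2.2 (k, j) +
          if k = j then F.p q.1 q.2.2 else 0) * (α q.2.1 * pd k β q.2.2)))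
      ∂(μ.prod (volume.prod volume)) = 0

open Classical in
/-- The density which controls all products of the fields. -/
noncomputable def dens (q : X × E3) : ℝ :=
  (if q.2 ∈ D then 1 else 0) + ‖F.u q.1 q.2‖ ^ 3 + √|F.p q.1 q.2| ^ 3 + ‖F.z q.1 q.2‖ ^ 2 +
    ν * ‖F.w q.1 q.2‖ ^ 2

lemma integrable_dens [IsFiniteMeasure μ] (hD : IsOpen D) (hb : Bornology.IsBounded D) :
    Integrable F.dens (μ.prod volume) := by
  classical
  refine ((((?_ : Integrable (fun q : X × E3 => if q.2 ∈ D then (1 : ℝ) else 0) _).add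
    F.integrable_u).add F.integrable_p).add F.integrable_z).add F.integrable_w
  have h := (integrable_const (μ := μ) (1 : ℝ)).mul_prod
    ((integrable_indicator_iff hD.measurableSet).2
      (integrableOn_const (μ := volume) (s := D) (C := (1 : ℝ)) hb.measure_lt_top.ne))
  refine h.congr (.of_forall fun q => ?_)
  simp [indicator_apply]

lemma dens_nonneg (hν : 0 ≤ ν) (q : X × E3) : 0 ≤ F.dens q := by
  unfold dens; split_ifs <;> positivity

lemma norm_u_cube_le (hν : 0 ≤ ν) (q : X × E3) : ‖F.u q.1 q.2‖ ^ 3 ≤ F.dens q := by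
  have h1 : 0 ≤ √|F.p q.1 q.2| ^ 3 := by positivity
  have h2 : 0 ≤ ν * ‖F.w q.1 q.2‖ ^ 2 := by positivity
  unfold dens; split_ifs <;> linarith [sq_nonneg ‖F.z q.1 q.2‖]

lemma sqrt_p_cube_le (hν : 0 ≤ ν) (q : X × E3) : √|F.p q.1 q.2| ^ 3 ≤ F.dens q := by
  have h1 : 0 ≤ ‖F.u q.1 q.2‖ ^ 3 := by positivity
  have h2 : 0 ≤ ν * ‖F.w q.1 q.2‖ ^ 2 := by positivity
  unfold dens; split_ifs <;> linarith [sq_nonneg ‖F.z q.1 q.2‖]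

lemma norm_z_sq_le (hν : 0 ≤ ν) (q : X × E3) : ‖F.z q.1 q.2‖ ^ 2 ≤ F.dens q := by
  have h1 : 0 ≤ ‖F.u q.1 q.2‖ ^ 3 := by positivity
  have h2 : 0 ≤ ν * ‖F.w q.1 q.2‖ ^ 2 := by positivity
  have h3 : 0 ≤ √|F.p q.1 q.2| ^ 3 := by positivity
  unfold dens; split_ifs <;> linarith

lemma norm_w_sq_le (q : X × E3) : ν * ‖F.w q.1 q.2‖ ^ 2 ≤ F.dens q := by
  have h1 : 0 ≤ ‖F.u q.1 q.2‖ ^ 3 := by positivity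
  have h3 : 0 ≤ √|F.p q.1 q.2| ^ 3 := by positivity
  unfold dens; split_ifs <;> linarith [sq_nonneg ‖F.z q.1 q.2‖]

/-- The indicator of D in `dens` serves to absorb s² ≤ 1 + s³; outside D the velocity is zero. -/
lemma norm_u_sq_le (hν : 0 ≤ ν) (q : X × E3) : ‖F.u q.1 q.2‖ ^ 2 ≤ F.dens q := by
  have h3 : 0 ≤ √|F.p q.1 q.2| ^ 3 := by positivity
  have h2 : 0 ≤ ν * ‖F.w q.1 q.2‖ ^ 2 := by positivity
  unfold dens
  split_ifs with h
  · have h0 := norm_nonneg (F.u q.1 q.2)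
    rcases le_total ‖F.u q.1 q.2‖ 1 with h1 | h1
    · nlinarith [sq_nonneg ‖F.z q.1 q.2‖, pow_nonneg h0 3]
    · nlinarith [sq_nonneg ‖F.z q.1 q.2‖, pow_le_pow_right₀ h1 (by norm_num : 2 ≤ 3)]
  · rw [F.u_eq_zero _ _ h]
    simp only [norm_zero]
    nlinarith [sq_nonneg ‖F.z q.1 q.2‖]

end Flow

/-! ### Elementary inequalities -/

/-- A weighted Young inequality, by cases on whether λx exceeds y. In this and the two similar
lemmas below x stands for an increment and y for a field with bounded moments: the bounded factor
receives λ⁻¹, and the increment, small in the mean, pays λ³. The same powers are kept in all three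
so that the bounds can be added. -/
lemma mul_sq_le_cube {x y lam : ℝ} (hx : 0 ≤ x) (hy : 0 ≤ y) (hl : 1 ≤ lam) :
    x * y ^ 2 ≤ lam ^ 3 * x ^ 3 + lam⁻¹ * y ^ 3 := by
  have h0 : 0 < lam := by linarith
  rcases le_total (lam * x) y with h | h
  · have h1 : x * y ^ 2 ≤ lam⁻¹ * y ^ 3 := by
      have : x ≤ lam⁻¹ * y := by rw [inv_mul_eq_div, le_div_iff₀ h0]; linarith
      calc x * y ^ 2 ≤ lam⁻¹ * y * y ^ 2 := by gcongr
        _ = _ := by ring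
    have : 0 ≤ lam ^ 3 * x ^ 3 := by positivity
    linarith
  · have h1 : x * y ^ 2 ≤ lam ^ 3 * x ^ 3 := by
      calc x * y ^ 2 ≤ x * (lam * x) ^ 2 := by gcongr
        _ = lam ^ 2 * x ^ 3 := by ring
        _ ≤ lam ^ 3 * x ^ 3 := by gcongr; omega
    have : 0 ≤ lam⁻¹ * y ^ 3 := by positivity
    linarith

lemma sq_mul_le_cube {x y lam : ℝ} (hx : 0 ≤ x) (hy : 0 ≤ y) (hl : 1 ≤ lam) :
    x ^ 2 * y ≤ lam ^ 3 * x ^ 3 + lam⁻¹ * y ^ 3 := by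
  have h0 : 0 < lam := by linarith
  rcases le_total (lam * x) y with h | h
  · have h1 : x ^ 2 * y ≤ lam⁻¹ * y ^ 3 := by
      have : x ≤ lam⁻¹ * y := by rw [inv_mul_eq_div, le_div_iff₀ h0]; linarith
      have h3 : lam⁻¹ ≤ 1 := inv_le_one_of_one_le₀ hl
      have h4 : 0 ≤ lam⁻¹ := by positivity
      calc x ^ 2 * y ≤ (lam⁻¹ * y) ^ 2 * y := by gcongr
        _ = lam⁻¹ * (lam⁻¹ * y ^ 3) := by ring
        _ ≤ 1 * (lam⁻¹ * y ^ 3) := by gcongr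
        _ = _ := one_mul _
    have : 0 ≤ lam ^ 3 * x ^ 3 := by positivity
    linarith
  · have h1 : x ^ 2 * y ≤ lam ^ 3 * x ^ 3 := by
      calc x ^ 2 * y ≤ x ^ 2 * (lam * x) := by gcongr
        _ = lam ^ 1 * x ^ 3 := by ring
        _ ≤ lam ^ 3 * x ^ 3 := by gcongr; omega
    have : 0 ≤ lam⁻¹ * y ^ 3 := by positivity
    linarith

lemma mul_le_cube_add {x y lam : ℝ} (hx : 0 ≤ x) (hl : 1 ≤ lam) :
    x * y ≤ lam ^ 3 * x ^ 3 + lam⁻¹ * (1 + y ^ 2) := by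
  have h0 : 0 < lam := by linarith
  have h1 : x * y ≤ lam * x ^ 2 + lam⁻¹ * y ^ 2 := by
    have : lam * x ^ 2 + lam⁻¹ * y ^ 2 - x * y =
        lam⁻¹ * ((lam * x - y / 2) ^ 2 + 3 / 4 * y ^ 2) := by field_simp; ring
    have : 0 ≤ lam⁻¹ * ((lam * x - y / 2) ^ 2 + 3 / 4 * y ^ 2) := by positivity
    linarith
  have h2 : lam * x ^ 2 ≤ lam ^ 3 * x ^ 3 + lam⁻¹ := by
    rcases le_total (lam * x) 1 with h | h
    · have : lam * x ^ 2 ≤ lam⁻¹ := by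
        have : lam * x ^ 2 = lam⁻¹ * (lam * x) ^ 2 := by field_simp
        rw [this]
        exact mul_le_of_le_one_right (by positivity) (pow_le_one₀ (by positivity) h)
      have : 0 ≤ lam ^ 3 * x ^ 3 := by positivity
      linarith
    · have : lam * x ^ 2 ≤ lam ^ 3 * x ^ 3 := by
        calc lam * x ^ 2 = lam * x ^ 2 * 1 := (mul_one _).symm
          _ ≤ lam * x ^ 2 * (lam * x) := by gcongr
          _ = lam ^ 2 * x ^ 3 := by ring
          _ ≤ lam ^ 3 * x ^ 3 := by gcongr; omega
      have : 0 ≤ lam⁻¹ := by positivity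
      linarith
  rw [mul_add, mul_one]; linarith

/-- One factor √ν is spent on the gradient, since ν|∇u|² has bounded mean; the other one is the
gain. -/
lemma sqrt_mul_le {ν x y : ℝ} (hν : 0 ≤ ν) : ν * (x * y) ≤ √ν * (ν * x ^ 2 + y ^ 2) := by
  have h1 : 0 ≤ √ν := Real.sqrt_nonneg _
  have h2 : √ν * √ν = ν := Real.mul_self_sqrt hν
  have h3 : ν * (x * y) = √ν * ((√ν * x) * y) := by
    calc ν * (x * y) = (√ν * √ν) * (x * y) := by rw [h2]
      _ = _ := by ring
  rw [h3]
  refine mul_le_mul_of_nonneg_left ?_ h1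
  have h4 : ν * x ^ 2 = (√ν * x) ^ 2 := by rw [mul_pow, pow_two (√ν), h2]
  rw [h4]
  nlinarith [sq_nonneg (√ν * x - y), sq_nonneg (√ν * x), sq_nonneg y]

lemma abs_coord_le {ι : Type*} [Fintype ι] (v : EuclideanSpace ℝ ι) (i : ι) : |v i| ≤ ‖v‖ :=
  PiLp.norm_apply_le v i

lemma abs_sum_fin_three_le {f : Fin 3 → ℝ} {C : ℝ} (h : ∀ i, |f i| ≤ C) : |∑ i, f i| ≤ 3 * C := by
  refine (Finset.abs_sum_le_sum_abs _ _).trans ((Finset.sum_le_sum fun i _ => h i).trans (le_of_eq ?_))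
  simp

/-! ### Two-point kernels -/

/-- A smooth, compactly supported, symmetric tensor field `K` with `div K = ∇Q`. -/
structure TwoPointKernel where
  /-- The tensor field. -/
  K : Fin 3 → Fin 3 → E3 → ℝ
  /-- The potential of its divergence. -/
  Q : E3 → ℝ
  isTest : ∀ i j, IsTest univ (K i j)
  isTest_Q : IsTest univ Q
  symm : ∀ i j h, K i j h = K j i h
  div : ∀ j h, ∑ i, pd i (K i j) h = pd j Q h

lemma pd_coord (i j : Fin 3) (x : E3) : pd j (fun x : E3 => x i) x = if i = j then 1 else 0 := by
  have h : HasFDerivAt (fun x : E3 => x i) (EuclideanSpace.proj (𝕜 := ℝ) i) x :=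
    (EuclideanSpace.proj (𝕜 := ℝ) i).hasFDerivAt
  simp [pd, h.fderiv]

lemma contDiff_coord (i : Fin 3) : ContDiff ℝ (⊤ : ℕ∞) fun x : E3 => x i :=
  (EuclideanSpace.proj (𝕜 := ℝ) i).contDiff

lemma IsTest.integrable {D : Set E3} {f : E3 → ℝ} (hf : IsTest D f) : Integrable f :=
  hf.1.continuous.integrable_of_hasCompactSupport hf.2.1

/-- Integrating div K = ∇Q against the linear function h_i shows that the mean of K is the identity
matrix times ∫Q. The single-point terms therefore see K only through a trace. -/
lemma TwoPointKernel.integral_K (k : TwoPointKernel) (i j : Fin 3) :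
    ∫ h, k.K i j h = if i = j then ∫ h, k.Q h else 0 := by
  have h1 : ∀ l, ∫ h : E3, pd l (k.K l j) h * h i = - if i = l then ∫ h, k.K l j h else 0 := by
    intro l
    rw [integral_pd_mul (k.isTest l j).1 (contDiff_coord i) (k.isTest l j).2.1]
    simp only [pd_coord]
    split_ifs <;> simp
  have h2 : ∫ h : E3, pd j k.Q h * h i = - if i = j then ∫ h, k.Q h else 0 := by
    rw [integral_pd_mul k.isTest_Q.1 (contDiff_coord i) k.isTest_Q.2.1]
    simp only [pd_coord]
    split_ifs <;> simp
  have h3 : ∫ h : E3, pd j k.Q h * h i = ∑ l, ∫ h : E3, pd l (k.K l j) h * h i := by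
    rw [← integral_finsetSum]
    · refine integral_congr_ae (.of_forall fun h => ?_)
      simp only [← k.div, Finset.sum_mul]
    · exact fun l _ => (((k.isTest l j).pd l).mul (contDiff_coord i)).integrable
  rw [h2, Finset.sum_congr rfl fun l _ => h1 l] at h3
  simp only [Finset.sum_neg_distrib, Finset.sum_ite_eq, Finset.mem_univ, if_true, neg_inj] at h3
  exact h3.symm

/-- The pointwise algebra of the two-point balance. Here U and V are the velocities at x and x + h,
a = ∇ψ(x), T = ∇K, q = ∇Q; primes mark the second point. The right side consists of the cubic form
in V − U, the single-point terms, the increment terms, the viscous terms, and the terms that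
integrate to zero by incompressibility. Symmetry of K is used to reconstruct the cubic form, and div
K = ∇Q to express the pressure terms through Q. -/
lemma khm_algebra {U V Z Z' a q : Fin 3 → ℝ} {W W' K : Fin 3 → Fin 3 → ℝ} {T : Fin 3 → Fin 3 → Fin 3 → ℝ}
    {P P' ν ψ ψ' Q : ℝ} (hK : ∀ i j, K i j = K j i) (hT : ∀ k i j, T k i j = T k j i)
    (hq : ∀ j, ∑ i, T i i j = q j) :
    ∑ i, ∑ j, ((Z i * V j + U i * Z' j) * (ψ * K i j) +
      (∑ k, (U k * U i - ν * W k i + if k = i then P else 0) * V j * (a k * K i j - ψ * T k i j) +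
      ∑ k, U i * (V k * V j - ν * W' k j + if k = j then P' else 0) * (ψ * T k i j))) =
    - (1 / 2 * ψ * ∑ k, ∑ i, ∑ j, T k i j * ((V k - U k) * (V i - U i) * (V j - U j)))
    + ((∑ i, ∑ j, ((∑ k, a k * U k) * U i + P * a i + ψ * Z i) * U j * K i j + P * (∑ i, a i * U i) * Q) +
      ∑ i, ∑ j, ψ' * V i * Z' j * K i j)
    + ((1 / 2 * ∑ k, ∑ i, ∑ j, a k * K i j * ((V k - U k) * V i * V j) +
      ∑ k, ∑ i, ∑ j, a k * K i j * (U k * U i * (V j - U j)) +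
      ∑ i, ∑ j, a i * K i j * (P * (V j - U j)) + ∑ i, a i * Q * ((P' - P) * U i) +
      ∑ i, ∑ j, ψ * K i j * (Z i * (V j - U j)) + ∑ i, ∑ j, K i j * (Z' j * (ψ * U i - ψ' * V i))) -
      ν * (∑ k, ∑ i, ∑ j, ((a k * K i j - ψ * T k i j) * (W k i * V j) + ψ * T k i j * (U i * W' k j))))
    + (1 / 2 * ∑ i, ∑ j, ∑ k, ψ * U i * U j * (T k i j * V k)
      - 1 / 2 * ∑ i, ∑ j, ∑ k, ψ * U k * U i * U j * T k i j
      - 1 / 2 * ∑ i, ∑ j, ∑ k, V k * V i * V j * (a k * K i j - ψ * T k i j)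
      + 1 / 2 * ∑ i, ∑ j, ∑ k, V i * V j * (U k * (a k * K i j - ψ * T k i j))
      - ∑ j, P * ψ * (q j * V j) - ∑ i, P' * (U i * (a i * Q - ψ * q i))) := by
  have h1 := hK 1 0
  have h2 := hK 2 0
  have h3 := hK 2 1
  have t1 := fun k => hT k 1 0
  have t2 := fun k => hT k 2 0
  have t3 := fun k => hT k 2 1
  simp only [← hq, Fin.sum_univ_three, h1, h2, h3, t1, t2, t3]
  simp
  ring

lemma mul_mul_le_of_cube_le {a b c S : ℝ} (ha : 0 ≤ a) (hb : 0 ≤ b) (hc : 0 ≤ c) (h1 : a ^ 3 ≤ S)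
    (h2 : b ^ 3 ≤ S) (h3 : c ^ 3 ≤ S) : a * b * c ≤ S := by
  set m := max (max a b) c
  have hm : m ^ 3 ≤ S := by
    rcases max_choice (max a b) c with h | h
    · rcases max_choice a b with h' | h' <;> simp only [m, h, h'] <;> assumption
    · simp only [m, h]; assumption
  have ham : a ≤ m := (le_max_left a b).trans (le_max_left _ _)
  have hbm : b ≤ m := (le_max_right a b).trans (le_max_left _ _)
  have hcm : c ≤ m := le_max_right _ _
  calc a * b * c ≤ m * m * m := by gcongr
    _ = m ^ 3 := by ring
    _ ≤ S := hm

lemma mul_le_of_sq_le {a b S : ℝ} (h1 : a ^ 2 ≤ S) (h2 : b ^ 2 ≤ S) : a * b ≤ S := by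
  nlinarith [sq_nonneg (a - b)]

lemma measurable_coord {α ι : Type*} [Fintype ι] [MeasurableSpace α] {f : α → EuclideanSpace ℝ ι}
    (hf : Measurable f) (i : ι) : Measurable fun a => f a i :=
  (EuclideanSpace.proj (𝕜 := ℝ) i).continuous.measurable.comp hf

namespace Flow

variable {D : Set E3} {ν : ℝ} {X : Type u} [MeasurableSpace X] {μ : Measure X} (F : Flow D ν μ)

/-! ### Bounds for products of the fields at two points -/

section bounds

variable (ω : X) (x y : E3)

/-- The sum of the densities at two points. -/
noncomputable def dens₂ : ℝ := F.dens (ω, x) + F.dens (ω, y)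

variable {F ω x y}

lemma dens₂_comm : F.dens₂ ω x y = F.dens₂ ω y x := add_comm _ _

lemma dens_le_left (hν : 0 ≤ ν) {a : ℝ} (h : a ≤ F.dens (ω, x)) : a ≤ F.dens₂ ω x y :=
  h.trans (le_add_of_nonneg_right (F.dens_nonneg hν _))

lemma dens_le_right (hν : 0 ≤ ν) {a : ℝ} (h : a ≤ F.dens (ω, y)) : a ≤ F.dens₂ ω x y :=
  h.trans (le_add_of_nonneg_left (F.dens_nonneg hν _))

lemma norm_u_cube_le_left (hν : 0 ≤ ν) : ‖F.u ω x‖ ^ 3 ≤ F.dens₂ ω x y :=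
  dens_le_left hν (F.norm_u_cube_le hν (ω, x))

lemma norm_u_cube_le_right (hν : 0 ≤ ν) : ‖F.u ω y‖ ^ 3 ≤ F.dens₂ ω x y :=
  dens_le_right hν (F.norm_u_cube_le hν (ω, y))

lemma norm_u_sq_le_left (hν : 0 ≤ ν) : ‖F.u ω x‖ ^ 2 ≤ F.dens₂ ω x y :=
  dens_le_left hν (F.norm_u_sq_le hν (ω, x))

lemma norm_u_sq_le_right (hν : 0 ≤ ν) : ‖F.u ω y‖ ^ 2 ≤ F.dens₂ ω x y :=
  dens_le_right hν (F.norm_u_sq_le hν (ω, y))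

lemma norm_z_sq_le_left (hν : 0 ≤ ν) : ‖F.z ω x‖ ^ 2 ≤ F.dens₂ ω x y :=
  dens_le_left hν (F.norm_z_sq_le hν (ω, x))

lemma norm_z_sq_le_right (hν : 0 ≤ ν) : ‖F.z ω y‖ ^ 2 ≤ F.dens₂ ω x y :=
  dens_le_right hν (F.norm_z_sq_le hν (ω, y))

lemma norm_w_sq_le_left (hν : 0 ≤ ν) : ν * ‖F.w ω x‖ ^ 2 ≤ F.dens₂ ω x y :=
  dens_le_left hν (F.norm_w_sq_le (ω, x))

lemma norm_w_sq_le_right (hν : 0 ≤ ν) : ν * ‖F.w ω y‖ ^ 2 ≤ F.dens₂ ω x y :=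
  dens_le_right hν (F.norm_w_sq_le (ω, y))

lemma sqrt_p_cube_le_left (hν : 0 ≤ ν) : √|F.p ω x| ^ 3 ≤ F.dens₂ ω x y :=
  dens_le_left hν (F.sqrt_p_cube_le hν (ω, x))

lemma sqrt_p_cube_le_right (hν : 0 ≤ ν) : √|F.p ω y| ^ 3 ≤ F.dens₂ ω x y :=
  dens_le_right hν (F.sqrt_p_cube_le hν (ω, y))

lemma abs_mul_mul_le {a b c : E3} {S : ℝ} (ha : ‖a‖ ^ 3 ≤ S) (hb : ‖b‖ ^ 3 ≤ S) (hc : ‖c‖ ^ 3 ≤ S)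
    (i j k : Fin 3) : |a i * b j * c k| ≤ S := by
  rw [abs_mul, abs_mul]
  refine le_trans ?_ (mul_mul_le_of_cube_le (norm_nonneg a) (norm_nonneg b) (norm_nonneg c) ha hb hc)
  gcongr <;> exact abs_coord_le _ _

lemma abs_p_mul_le {P : ℝ} {a : E3} {S : ℝ} (hP : √|P| ^ 3 ≤ S) (ha : ‖a‖ ^ 3 ≤ S) (i : Fin 3) :
    |P * a i| ≤ S := by
  rw [abs_mul]
  refine le_trans ?_ (mul_mul_le_of_cube_le (Real.sqrt_nonneg |P|) (Real.sqrt_nonneg |P|)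
    (norm_nonneg a) hP hP ha)
  rw [Real.mul_self_sqrt (abs_nonneg P)]
  gcongr; exact abs_coord_le _ _

lemma abs_z_mul_le {a b : E3} {S : ℝ} (ha : ‖a‖ ^ 2 ≤ S) (hb : ‖b‖ ^ 2 ≤ S) (i j : Fin 3) :
    |a i * b j| ≤ S := by
  rw [abs_mul]
  refine le_trans ?_ (mul_le_of_sq_le ha hb)
  gcongr <;> exact abs_coord_le _ _

lemma abs_w_mul_le (hν : 0 ≤ ν) (hν1 : ν ≤ 1) {a : M3} {b : E3} {S : ℝ} (ha : ν * ‖a‖ ^ 2 ≤ S)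
    (hb : ‖b‖ ^ 2 ≤ S) (i : Fin 3 × Fin 3) (j : Fin 3) : |ν * a i * b j| ≤ S := by
  rw [abs_mul, abs_mul, abs_of_nonneg hν]
  have h1 : ν * |a i| * |b j| ≤ ν * ‖a‖ * ‖b‖ := by gcongr <;> exact abs_coord_le _ _
  have h2 : ν * ‖a‖ * ‖b‖ ≤ (ν * ‖a‖ ^ 2 + ν * ‖b‖ ^ 2) / 2 := by
    nlinarith [mul_nonneg hν (sq_nonneg (‖a‖ - ‖b‖))]
  have h3 : ν * ‖b‖ ^ 2 ≤ 1 * ‖b‖ ^ 2 := by gcongr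
  linarith

end bounds

variable [IsFiniteMeasure μ]

lemma integrable_dens_mul_kernel (hD : IsOpen D) (hb : Bornology.IsBounded D) {κ : E3 → ℝ}
    (hκ : Integrable κ) :
    Integrable (fun q : X × E3 × E3 => F.dens₂ q.1 q.2.1 (q.2.1 + q.2.2) * κ q.2.2)
      (μ.prod (volume.prod volume)) := by
  refine ((integrable_mul_kernel (F.integrable_dens hD hb) hκ).add
    (integrable_shift_mul_kernel (F.integrable_dens hD hb) hκ)).congr (.of_forall fun q => ?_)
  simp only [Pi.add_apply, dens₂]; ring

lemma integrable_of_dens (hD : IsOpen D) (hb : Bornology.IsBounded D)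
    {c M : X × E3 × E3 → ℝ} (hc : Measurable c) {C : ℝ} (hC : ∀ q, |c q| ≤ C)
    {κ : E3 → ℝ} (hκ : Integrable κ) (hM : Measurable M)
    (hMb : ∀ q : X × E3 × E3, |M q| ≤ F.dens₂ q.1 q.2.1 (q.2.1 + q.2.2)) :
    Integrable (fun q : X × E3 × E3 => c q * κ q.2.2 * M q) (μ.prod (volume.prod volume)) := by
  refine ((F.integrable_dens_mul_kernel hD hb hκ.norm).const_mul C).mono'
    ((hc.aestronglyMeasurable.mul ?_).mul hM.aestronglyMeasurable) (.of_forall fun q => ?_)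
  · exact hκ.1.comp_snd.comp_snd
  · rw [norm_mul, norm_mul, Real.norm_eq_abs (c q), Real.norm_eq_abs (M q)]
    have h0 : 0 ≤ C := (abs_nonneg _).trans (hC q)
    calc |c q| * ‖κ q.2.2‖ * |M q| ≤ C * ‖κ q.2.2‖ * F.dens₂ q.1 q.2.1 (q.2.1 + q.2.2) := by
          gcongr
          · exact hC q
          · exact hMb q
      _ = _ := by ring

/-- Both points range over the bounded set D, so M is dominated by dens(x)1_D(y) + 1_D(x)dens(y); no
kernel in the separation is needed. -/
lemma integrable_of_dens_of_support (hν : 0 ≤ ν) (hD : IsOpen D) (hb : Bornology.IsBounded D)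
    {M : X × E3 × E3 → ℝ} (hM : Measurable M)
    (hMb : ∀ q : X × E3 × E3, |M q| ≤ F.dens₂ q.1 q.2.1 q.2.2)
    (hM₁ : ∀ q : X × E3 × E3, q.2.1 ∉ D → M q = 0) (hM₂ : ∀ q : X × E3 × E3, q.2.2 ∉ D → M q = 0) :
    Integrable M (μ.prod (volume.prod volume)) := by
  have h1 : Integrable (D.indicator fun _ => (1 : ℝ)) (volume : Measure E3) :=
    (integrable_indicator_iff hD.measurableSet).2
      (integrableOn_const (μ := volume) (s := D) (C := (1 : ℝ)) hb.measure_lt_top.ne)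
  have h2 := integrable_mul_kernel (F.integrable_dens hD hb) h1
  have h3 : MeasurePreserving (fun q : X × E3 × E3 => (q.1, q.2.2, q.2.1))
      (μ.prod (volume.prod volume)) (μ.prod (volume.prod volume)) :=
    (MeasurePreserving.id μ).prod Measure.measurePreserving_swap
  have h4 := h3.integrable_comp_of_integrable h2
  refine (h2.add h4).mono' hM.aestronglyMeasurable (.of_forall fun q => ?_)
  have d1 := F.dens_nonneg hν (q.1, q.2.1)
  have d2 := F.dens_nonneg hν (q.1, q.2.2)
  by_cases h5 : q.2.1 ∈ D
  · by_cases h6 : q.2.2 ∈ D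
    · simpa [h5, h6, dens₂] using hMb q
    · rw [hM₂ q h6]
      simp [h5, h6, d2]
  · rw [hM₁ q h5]
    by_cases h6 : q.2.2 ∈ D <;> simp [h5, h6, d1]

end Flow

/-! ### Integrability of two-point correlations and the balance in the separation variable. -/

namespace Flow

variable {D : Set E3} {ν : ℝ} {X : Type u} [MeasurableSpace X] {μ : Measure X} (F : Flow D ν μ)

section measurability

variable {Y : Type*} [MeasurableSpace Y] {f : Y → X} {g : Y → E3}

lemma measurable_u_comp (hf : Measurable f) (hg : Measurable g) (i : Fin 3) :
    Measurable fun y => F.u (f y) (g y) i :=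
  measurable_coord (F.measurable_u.comp (hf.prodMk hg)) i

lemma measurable_z_comp (hf : Measurable f) (hg : Measurable g) (i : Fin 3) :
    Measurable fun y => F.z (f y) (g y) i :=
  measurable_coord (F.measurable_z.comp (hf.prodMk hg)) i

lemma measurable_w_comp (hf : Measurable f) (hg : Measurable g) (i : Fin 3 × Fin 3) :
    Measurable fun y => F.w (f y) (g y) i :=
  measurable_coord (F.measurable_w.comp (hf.prodMk hg)) i

lemma measurable_p_comp (hf : Measurable f) (hg : Measurable g) :
    Measurable fun y => F.p (f y) (g y) := F.measurable_p.comp (hf.prodMk hg)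

end measurability

/-- The 3 counts transport, viscosity and pressure. The point x' of the extra velocity factor is
left free so that one bound serves both orders of the two points. -/
lemma abs_stress_mul_le (hν : 0 ≤ ν) (hν1 : ν ≤ 1) (ω : X) (x y x' : E3)
    (hx' : x' = x ∨ x' = y) (k i : Fin 3) (j : Fin 3) {S : ℝ} (hS : S = F.dens₂ ω x y) :
    |(F.u ω x k * F.u ω x i - ν * F.w ω x (k, i) + if k = i then F.p ω x else 0) * F.u ω x' j| ≤
      3 * S := by
  subst hS
  have hu : ∀ v, v = x ∨ v = y → ‖F.u ω v‖ ^ 3 ≤ F.dens₂ ω x y := by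
    rintro v (rfl | rfl)
    exacts [norm_u_cube_le_left hν, norm_u_cube_le_right hν]
  have hu2 : ‖F.u ω x'‖ ^ 2 ≤ F.dens₂ ω x y := by
    rcases hx' with rfl | rfl
    exacts [norm_u_sq_le_left hν, norm_u_sq_le_right hν]
  have h1 := abs_mul_mul_le (hu x (Or.inl rfl)) (hu x (Or.inl rfl)) (hu x' hx') k i j
  have h2 := abs_w_mul_le hν hν1 (norm_w_sq_le_left (y := y) hν) hu2 (k, i) j
  have h3 : |(if k = i then F.p ω x else 0) * F.u ω x' j| ≤ F.dens₂ ω x y := by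
    split_ifs
    · exact abs_p_mul_le (sqrt_p_cube_le_left hν) (hu x' hx') j
    · rw [zero_mul, abs_zero]; exact (abs_nonneg _).trans h1
  have e : (F.u ω x k * F.u ω x i - ν * F.w ω x (k, i) + if k = i then F.p ω x else 0) * F.u ω x' j =
      F.u ω x k * F.u ω x i * F.u ω x' j - ν * F.w ω x (k, i) * F.u ω x' j +
      (if k = i then F.p ω x else 0) * F.u ω x' j := by ring
  rw [e]
  refine (abs_add_le _ _).trans ?_
  have := abs_sub (F.u ω x k * F.u ω x i * F.u ω x' j) (ν * F.w ω x (k, i) * F.u ω x' j)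
  linarith

lemma measurable_stress {Y : Type*} [MeasurableSpace Y] {f : Y → X} {g : Y → E3}
    (hf : Measurable f) (hg : Measurable g) (k i : Fin 3) :
    Measurable fun y => F.u (f y) (g y) k * F.u (f y) (g y) i - ν * F.w (f y) (g y) (k, i) +
      if k = i then F.p (f y) (g y) else 0 := by
  refine ((((F.measurable_u_comp hf hg k).mul (F.measurable_u_comp hf hg i)).sub
    ((F.measurable_w_comp hf hg (k, i)).const_mul _))).add ?_
  split_ifs
  · exact F.measurable_p_comp hf hg
  · exact measurable_const

section correlations

variable [IsFiniteMeasure μ] (hν : 0 ≤ ν) (hν1 : ν ≤ 1) (hD : IsOpen D) (hb : Bornology.IsBounded D)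
include hν hD hb

lemma integrable_zu (i j : Fin 3) : Integrable (fun q : X × E3 × E3 =>
    F.z q.1 q.2.1 i * F.u q.1 q.2.2 j) (μ.prod (volume.prod volume)) := by
  refine F.integrable_of_dens_of_support hν hD hb ((F.measurable_z_comp measurable_fst
    measurable_snd.fst i).mul (F.measurable_u_comp measurable_fst measurable_snd.snd j))
    (fun q => ?_) (fun q hq => ?_) (fun q hq => ?_)
  · exact abs_z_mul_le (norm_z_sq_le_left hν) (norm_u_sq_le_right hν) _ _
  · simp [F.z_eq_zero _ _ hq]
  · simp [F.u_eq_zero _ _ hq]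

lemma integrable_uz (i j : Fin 3) : Integrable (fun q : X × E3 × E3 =>
    F.u q.1 q.2.1 i * F.z q.1 q.2.2 j) (μ.prod (volume.prod volume)) := by
  refine F.integrable_of_dens_of_support hν hD hb ((F.measurable_u_comp measurable_fst
    measurable_snd.fst i).mul (F.measurable_z_comp measurable_fst measurable_snd.snd j))
    (fun q => ?_) (fun q hq => ?_) (fun q hq => ?_)
  · exact abs_z_mul_le (norm_u_sq_le_left hν) (norm_z_sq_le_right hν) _ _
  · simp [F.u_eq_zero _ _ hq]
  · simp [F.z_eq_zero _ _ hq]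

include hν1

lemma integrable_stress_u (k i j : Fin 3) : Integrable (fun q : X × E3 × E3 =>
    (F.u q.1 q.2.1 k * F.u q.1 q.2.1 i - ν * F.w q.1 q.2.1 (k, i) +
      if k = i then F.p q.1 q.2.1 else 0) * F.u q.1 q.2.2 j) (μ.prod (volume.prod volume)) := by
  refine ((F.integrable_of_dens_of_support hν hD hb (((F.measurable_stress measurable_fst
    measurable_snd.fst k i).mul (F.measurable_u_comp measurable_fst measurable_snd.snd j)).const_mul
    (1 / 3)) (fun q => ?_) (fun q hq => ?_) (fun q hq => ?_)).const_mul 3).congr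
    (.of_forall fun q => ?_)
  · rw [abs_mul, abs_of_pos (by norm_num : (0 : ℝ) < 1 / 3)]
    have := F.abs_stress_mul_le hν hν1 q.1 q.2.1 q.2.2 q.2.2 (Or.inr rfl) k i j rfl
    exact (mul_le_mul_of_nonneg_left this (by norm_num)).trans_eq (by ring)
  · simp [F.u_eq_zero _ _ hq, F.w_eq_zero _ _ hq, F.p_eq_zero _ _ hq]
  · simp [F.u_eq_zero _ _ hq]
  · simp only [Pi.mul_apply]; ring

lemma integrable_u_stress (k i j : Fin 3) : Integrable (fun q : X × E3 × E3 =>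
    F.u q.1 q.2.1 i * (F.u q.1 q.2.2 k * F.u q.1 q.2.2 j - ν * F.w q.1 q.2.2 (k, j) +
      if k = j then F.p q.1 q.2.2 else 0)) (μ.prod (volume.prod volume)) := by
  refine ((F.integrable_of_dens_of_support hν hD hb (((F.measurable_u_comp measurable_fst
    measurable_snd.fst i).mul (F.measurable_stress measurable_fst measurable_snd.snd k j)).const_mul
    (1 / 3)) (fun q => ?_) (fun q hq => ?_) (fun q hq => ?_)).const_mul 3).congr
    (.of_forall fun q => ?_)
  · rw [abs_mul, abs_of_pos (by norm_num : (0 : ℝ) < 1 / 3)]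
    have := F.abs_stress_mul_le hν hν1 q.1 q.2.2 q.2.1 q.2.1 (Or.inr rfl) k j i dens₂_comm
    rw [Pi.mul_apply, mul_comm (F.u _ _ _ : ℝ)]
    exact (mul_le_mul_of_nonneg_left this (by norm_num)).trans_eq (by ring)
  · simp [F.u_eq_zero _ _ hq]
  · simp [F.u_eq_zero _ _ hq, F.w_eq_zero _ _ hq, F.p_eq_zero _ _ hq]
  · simp only [Pi.mul_apply]; ring

end correlations

/-- The balance of the two-point correlations, tested with `ψ(x) φ(h)`, `h` being the separation. -/
lemma balance_separation [IsFiniteMeasure μ] (hF : F.Balanced) (hν : 0 ≤ ν) (hν1 : ν ≤ 1) (hD : IsOpen D) (hb : Bornology.IsBounded D)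
    {ψ φ : E3 → ℝ} (hψ : IsTest D ψ) (hφ : IsTest univ φ) {r : ℝ} (hr : 0 < r)
    (hsupp : ∀ x ∈ tsupport ψ, ∀ y, y ∈ tsupport φ → Metric.closedBall (x + y) r ⊆ D) (i j : Fin 3) :
    ∫ q : X × E3 × E3, ((F.z q.1 q.2.1 i * F.u q.1 (q.2.1 + q.2.2) j +
          F.u q.1 q.2.1 i * F.z q.1 (q.2.1 + q.2.2) j) * (ψ q.2.1 * φ q.2.2) +
      (∑ k, (F.u q.1 q.2.1 k * F.u q.1 q.2.1 i - ν * F.w q.1 q.2.1 (k, i) +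
          if k = i then F.p q.1 q.2.1 else 0) * F.u q.1 (q.2.1 + q.2.2) j *
            (pd k ψ q.2.1 * φ q.2.2 - ψ q.2.1 * pd k φ q.2.2) +
        ∑ k, F.u q.1 q.2.1 i * (F.u q.1 (q.2.1 + q.2.2) k * F.u q.1 (q.2.1 + q.2.2) j -
          ν * F.w q.1 (q.2.1 + q.2.2) (k, j) +
          if k = j then F.p q.1 (q.2.1 + q.2.2) else 0) * (ψ q.2.1 * pd k φ q.2.2)))
      ∂(μ.prod (volume.prod volume)) = 0 := by
  have m1 : Measurable fun q : X × E3 × E3 => q.1 := measurable_fst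
  have m2 : Measurable fun q : X × E3 × E3 => q.2.1 := measurable_fst.comp measurable_snd
  have m3 : Measurable fun q : X × E3 × E3 => q.2.2 := measurable_snd.comp measurable_snd
  have key := integral_two_point (m := μ.prod (volume.prod volume)) (D := D)
    (q₁ := fun q : X × E3 × E3 => q.2.1) (q₂ := fun q => q.2.2) m2 m3
    (G₀ := fun q => F.z q.1 q.2.1 i * F.u q.1 q.2.2 j + F.u q.1 q.2.1 i * F.z q.1 q.2.2 j)
    (G := fun k q => (F.u q.1 q.2.1 k * F.u q.1 q.2.1 i - ν * F.w q.1 q.2.1 (k, i) +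
          if k = i then F.p q.1 q.2.1 else 0) * F.u q.1 q.2.2 j)
    (H := fun k q => F.u q.1 q.2.1 i * (F.u q.1 q.2.2 k * F.u q.1 q.2.2 j - ν * F.w q.1 q.2.2 (k, j) +
          if k = j then F.p q.1 q.2.2 else 0)) ?_ ?_ ?_
    (fun α β hα hβ => hF α β hα hβ i j) hψ hφ hr hsupp
  · rw [← measurePreserving_shear.integral_comp measurableEmbedding_shear] at key
    simpa only [shear, add_sub_cancel_left] using key
  · exact (F.integrable_zu hν hD hb i j).add (F.integrable_uz hν hD hb i j)
  · exact fun k => F.integrable_stress_u hν hν1 hD hb k i j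
  · exact fun k => F.integrable_u_stress hν hν1 hD hb k i j

end Flow

/-! ### Terms of the two-point energy balance and cancellations by incompressibility. -/

namespace Flow

variable {D : Set E3} {ν : ℝ} {X : Type u} [MeasurableSpace X] {μ : Measure X} (F : Flow D ν μ)

/-- The cubic expression in the velocity increments, contracted with the derivative of a kernel. -/
noncomputable def cubic (k : TwoPointKernel) (ψ : E3 → ℝ) (q : X × E3 × E3) : ℝ :=
  1 / 2 * ψ q.2.1 * ∑ l, ∑ i, ∑ j, pd l (k.K i j) q.2.2 *
    ((F.u q.1 (q.2.1 + q.2.2) l - F.u q.1 q.2.1 l) *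
      (F.u q.1 (q.2.1 + q.2.2) i - F.u q.1 q.2.1 i) * (F.u q.1 (q.2.1 + q.2.2) j - F.u q.1 q.2.1 j))

/-- The local energy flux and input at a point. -/
noncomputable def local_ (ψ : E3 → ℝ) (q : X × E3) : ℝ :=
  (∑ l, pd l ψ q.2 * F.u q.1 q.2 l) * (∑ i, F.u q.1 q.2 i * F.u q.1 q.2 i) +
    2 * F.p q.1 q.2 * (∑ l, pd l ψ q.2 * F.u q.1 q.2 l) +
    2 * ψ q.2 * ∑ i, F.u q.1 q.2 i * F.z q.1 q.2 i

/-- The remainder in the two-point energy balance which is small by continuity in the mean. -/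
noncomputable def remainder (k : TwoPointKernel) (ψ : E3 → ℝ) (q : X × E3 × E3) : ℝ :=
  1 / 2 * ∑ l, ∑ i, ∑ j, pd l ψ q.2.1 * k.K i j q.2.2 *
    ((F.u q.1 (q.2.1 + q.2.2) l - F.u q.1 q.2.1 l) * F.u q.1 (q.2.1 + q.2.2) i *
      F.u q.1 (q.2.1 + q.2.2) j) +
  ∑ l, ∑ i, ∑ j, pd l ψ q.2.1 * k.K i j q.2.2 *
    (F.u q.1 q.2.1 l * F.u q.1 q.2.1 i * (F.u q.1 (q.2.1 + q.2.2) j - F.u q.1 q.2.1 j)) +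
  ∑ i, ∑ j, pd i ψ q.2.1 * k.K i j q.2.2 *
    (F.p q.1 q.2.1 * (F.u q.1 (q.2.1 + q.2.2) j - F.u q.1 q.2.1 j)) +
  ∑ i, pd i ψ q.2.1 * k.Q q.2.2 *
    ((F.p q.1 (q.2.1 + q.2.2) - F.p q.1 q.2.1) * F.u q.1 q.2.1 i) +
  ∑ i, ∑ j, ψ q.2.1 * k.K i j q.2.2 *
    (F.z q.1 q.2.1 i * (F.u q.1 (q.2.1 + q.2.2) j - F.u q.1 q.2.1 j)) +
  ∑ i, ∑ j, k.K i j q.2.2 * (F.z q.1 (q.2.1 + q.2.2) j *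
    (ψ q.2.1 * F.u q.1 q.2.1 i - ψ (q.2.1 + q.2.2) * F.u q.1 (q.2.1 + q.2.2) i))

/-- The viscous remainder in the two-point energy balance. -/
noncomputable def viscousRemainder (k : TwoPointKernel) (ψ : E3 → ℝ) (q : X × E3 × E3) : ℝ :=
  ν * ∑ l, ∑ i, ∑ j, ((pd l ψ q.2.1 * k.K i j q.2.2 - ψ q.2.1 * pd l (k.K i j) q.2.2) *
      (F.w q.1 q.2.1 (l, i) * F.u q.1 (q.2.1 + q.2.2) j) +
    ψ q.2.1 * pd l (k.K i j) q.2.2 * (F.u q.1 q.2.1 i * F.w q.1 (q.2.1 + q.2.2) (l, j)))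

/-- For fixed x the kernel is the gradient of the test function y ↦ φ(y − x), paired with the
divergence free u(y). -/
lemma integral_divFree_right {G : X × E3 → ℝ} {φ : E3 → ℝ} (hφ : IsTest univ φ) [SFinite μ]
    (hint : Integrable (fun q : X × E3 × E3 => ∑ l, G (q.1, q.2.1) * (pd l φ q.2.2 *
      F.u q.1 (q.2.1 + q.2.2) l)) (μ.prod (volume.prod volume))) :
    ∫ q : X × E3 × E3, ∑ l, G (q.1, q.2.1) * (pd l φ q.2.2 *
      F.u q.1 (q.2.1 + q.2.2) l) ∂(μ.prod (volume.prod volume)) = 0 := by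
  refine integral_eq_zero_of_integral_right hint fun ω x => ?_
  simp only [← Finset.mul_sum]
  rw [integral_const_mul]
  have h1 : IsTest univ fun y => φ (y - x) := ⟨hφ.1.comp (contDiff_id.sub contDiff_const),
    hφ.2.1.comp_homeomorph (Homeomorph.subRight x), subset_univ _⟩
  have h2 := F.divFree ω _ h1
  simp only [pd_comp_sub] at h2
  rw [← integral_add_left_eq_self _ x] at h2
  simp only [add_sub_cancel_left] at h2
  rw [h2, mul_zero]

/-- For fixed y = x + h, the combination of derivatives is the gradient of x ↦ ψ(x)φ(y − x), paired
with the divergence free u(x). -/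
lemma integral_divFree_left {G : X × E3 → ℝ} {ψ φ : E3 → ℝ} (hψ : IsTest D ψ) (hφ : IsTest univ φ)
    [SFinite μ]
    (hint : Integrable (fun q : X × E3 × E3 => ∑ l, G (q.1, q.2.1 + q.2.2) * (F.u q.1 q.2.1 l *
      (pd l ψ q.2.1 * φ q.2.2 - ψ q.2.1 * pd l φ q.2.2))) (μ.prod (volume.prod volume))) :
    ∫ q : X × E3 × E3, ∑ l, G (q.1, q.2.1 + q.2.2) * (F.u q.1 q.2.1 l *
      (pd l ψ q.2.1 * φ q.2.2 - ψ q.2.1 * pd l φ q.2.2)) ∂(μ.prod (volume.prod volume)) = 0 := by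
  refine integral_eq_zero_of_integral_left hint fun ω y => ?_
  simp only [← Finset.mul_sum, add_sub_cancel]
  rw [integral_const_mul]
  have h0 : ContDiff ℝ (⊤ : ℕ∞) fun x => φ (y - x) := hφ.1.comp (contDiff_const.sub contDiff_id)
  have h2 := F.divFree ω _ (hψ.univ.mul h0)
  simp only [pd_mul hψ.1 h0, pd_comp_const_sub] at h2
  rw [← mul_zero (G (ω, y)), ← h2]
  congr 1
  refine integral_congr_ae (.of_forall fun x => Finset.sum_congr rfl fun l _ => ?_)
  ring

lemma integral_const_right [SFinite μ] {G : X × E3 → ℝ} {φ : E3 → ℝ} (hφ : IsTest univ φ) (l : Fin 3) :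
    ∫ q : X × E3 × E3, G (q.1, q.2.1) * pd l φ q.2.2 ∂(μ.prod (volume.prod volume)) = 0 := by
  rw [integral_mul_kernel, integral_pd_eq_zero hφ.1 hφ.2.1, mul_zero]

lemma integral_const_left [SFinite μ] {G : X × E3 → ℝ} {ψ φ : E3 → ℝ} (hψ : IsTest D ψ)
    (hφ : IsTest univ φ) (l : Fin 3)
    (hint : Integrable (fun q : X × E3 × E3 => G (q.1, q.2.1 + q.2.2) *
      (pd l ψ q.2.1 * φ q.2.2 - ψ q.2.1 * pd l φ q.2.2)) (μ.prod (volume.prod volume))) :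
    ∫ q : X × E3 × E3, G (q.1, q.2.1 + q.2.2) *
      (pd l ψ q.2.1 * φ q.2.2 - ψ q.2.1 * pd l φ q.2.2) ∂(μ.prod (volume.prod volume)) = 0 := by
  refine integral_eq_zero_of_integral_left hint fun ω y => ?_
  simp only [add_sub_cancel]
  rw [integral_const_mul]
  have h0 : ContDiff ℝ (⊤ : ℕ∞) fun x => φ (y - x) := hφ.1.comp (contDiff_const.sub contDiff_id)
  have h2 := integral_pd_eq_zero (hψ.1.mul h0) (hψ.mul h0).2.1 l
  simp only [pd_mul hψ.1 h0, pd_comp_const_sub] at h2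
  rw [← mul_zero (G (ω, y)), ← h2]
  congr 1
  refine integral_congr_ae (.of_forall fun x => ?_)
  simp only; ring

end Flow

/-! ### Estimates of the remainders. -/

namespace Flow

variable {D : Set E3} {ν : ℝ} {X : Type u} [MeasurableSpace X] {μ : Measure X} (F : Flow D ν μ)

open Classical in
/-- The increments of velocity and pressure over the support of a cutoff. -/
noncomputable def incrDens (ψ : E3 → ℝ) (q : X × E3 × E3) : ℝ :=
  if q.2.1 ∈ tsupport ψ then ‖F.u q.1 (q.2.1 + q.2.2) - F.u q.1 q.2.1‖ ^ 3 +
    √|F.p q.1 (q.2.1 + q.2.2) - F.p q.1 q.2.1| ^ 3 else 0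

/-- Bounds for a cutoff function. -/
structure CutoffBound (D : Set E3) (ψ : E3 → ℝ) (C : ℝ) : Prop where
  isTest : IsTest D ψ
  abs_le : ∀ x, |ψ x| ≤ C
  abs_pd_le : ∀ l x, |pd l ψ x| ≤ C
  abs_sub_le : ∀ x h, |ψ (x + h) - ψ x| ≤ C * ‖h‖

/-- Bounds for a kernel. -/
structure KernelBound (k : TwoPointKernel) (k₀ k₁ : E3 → ℝ) (R : ℝ) : Prop where
  abs_K_le : ∀ i j h, |k.K i j h| ≤ k₀ h
  abs_Q_le : ∀ h, |k.Q h| ≤ k₀ h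
  abs_pd_le : ∀ l i j h, |pd l (k.K i j) h| ≤ k₁ h
  eq_zero : ∀ h, R < ‖h‖ → k₀ h = 0
  integrable₀ : Integrable k₀
  integrable₁ : Integrable k₁

lemma sum_two_le {f : Fin 3 → Fin 3 → ℝ} {C : ℝ} (h : ∀ i j, |f i j| ≤ C) :
    |∑ i, ∑ j, f i j| ≤ 9 * C :=
  (abs_sum_fin_three_le fun i => abs_sum_fin_three_le (h i)).trans_eq (by ring)

lemma sum_three_le {f : Fin 3 → Fin 3 → Fin 3 → ℝ} {C : ℝ} (h : ∀ l i j, |f l i j| ≤ C) :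
    |∑ l, ∑ i, ∑ j, f l i j| ≤ 27 * C :=
  (abs_sum_fin_three_le fun l => sum_two_le (h l)).trans_eq (by ring)

lemma abs_mul_mul_le' {a b m A B M : ℝ} (ha : |a| ≤ A) (hb : |b| ≤ B) (hm : |m| ≤ M) :
    |a * b * m| ≤ A * B * M := by
  have hA := (abs_nonneg _).trans ha
  have hB := (abs_nonneg _).trans hb
  rw [abs_mul, abs_mul]
  gcongr

lemma one_le_dens (hν : 0 ≤ ν) {ω : X} {x : E3} (hx : x ∈ D) : 1 + ‖F.z ω x‖ ^ 2 ≤ F.dens (ω, x) := by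
  have h1 : 0 ≤ ‖F.u ω x‖ ^ 3 := by positivity
  have h2 : 0 ≤ ν * ‖F.w ω x‖ ^ 2 := by positivity
  have h3 : 0 ≤ √|F.p ω x| ^ 3 := by positivity
  unfold dens; rw [if_pos hx]; simp only; linarith

lemma incrDens_nonneg (ψ : E3 → ℝ) (q : X × E3 × E3) : 0 ≤ F.incrDens ψ q := by
  unfold incrDens; split_ifs <;> positivity

variable {F} {k : TwoPointKernel} {ψ k₀ k₁ : E3 → ℝ} {C R : ℝ}

set_option maxHeartbeats 1000000 in
-- Each term is a product in which one factor is an increment of u, of p, or of ψu, so Young's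
-- inequality with parameter λ applies. The contribution R comes from the Lipschitz bound for the
-- cutoff, used only in the last group, where ψ is evaluated at both points.
lemma abs_remainder_le (hν : 0 ≤ ν) (hψ : CutoffBound D ψ C)
    (hk : KernelBound k k₀ k₁ R) {lam : ℝ} (hl : 1 ≤ lam) (q : X × E3 × E3) :
    |F.remainder k ψ q| ≤ 200 * C * (k₀ q.2.2 * (lam ^ 3 * F.incrDens ψ q +
      (lam⁻¹ + R) * F.dens₂ q.1 q.2.1 (q.2.1 + q.2.2))) := by
  obtain ⟨ω, x, h⟩ := q
  have hk0 : 0 ≤ k₀ h := (abs_nonneg _).trans (hk.abs_Q_le h)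
  have hC : 0 ≤ C := (abs_nonneg _).trans (hψ.abs_le 0)
  have hl0 : 0 < lam⁻¹ := by positivity
  have hS0 : 0 ≤ F.dens₂ ω x (x + h) := add_nonneg (F.dens_nonneg hν _) (F.dens_nonneg hν _)
  -- Beyond R the kernel and its potential vanish, and with them the remainder.
  by_cases hR : R < ‖h‖
  · have e0 := hk.eq_zero h hR
    have e1 : ∀ i j, k.K i j h = 0 := fun i j => abs_nonpos_iff.1 ((hk.abs_K_le i j h).trans_eq e0)
    have e2 : k.Q h = 0 := abs_nonpos_iff.1 ((hk.abs_Q_le h).trans_eq e0)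
    simp [remainder, e0, e1, e2]
  push Not at hR
  have hR0 : 0 ≤ R := (norm_nonneg _).trans hR
  set S := F.dens₂ ω x (x + h) with hS
  have hz' : ‖F.z ω (x + h)‖ ^ 2 ≤ S := norm_z_sq_le_right hν
  have hv2 : ‖F.u ω (x + h)‖ ^ 2 ≤ S := norm_u_sq_le_right hν
  by_cases hx : x ∈ tsupport ψ
  · have hxD : x ∈ D := hψ.isTest.2.2 hx
    set δ := F.u ω (x + h) - F.u ω x with hδ
    set dp := F.p ω (x + h) - F.p ω x with hdp
    have hδi : ∀ i, F.u ω (x + h) i - F.u ω x i = δ i := fun i => rfl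
    have hI : F.incrDens ψ (ω, x, h) = ‖δ‖ ^ 3 + √|dp| ^ 3 := by
      simp only [incrDens, if_pos hx, ← hδ, ← hdp]
    have hI1 : ‖δ‖ ^ 3 ≤ F.incrDens ψ (ω, x, h) := by
      rw [hI]; have : 0 ≤ √|dp| ^ 3 := by positivity
      linarith
    have hI2 : √|dp| ^ 3 ≤ F.incrDens ψ (ω, x, h) := by
      rw [hI]; have : 0 ≤ ‖δ‖ ^ 3 := by positivity
      linarith
    set I := F.incrDens ψ (ω, x, h)
    have hl3 : 0 ≤ lam ^ 3 := by positivity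
    set B := lam ^ 3 * I + lam⁻¹ * (2 * S) with hB
    have hBi : ∀ {a s : ℝ}, a ≤ I → s ≤ 2 * S → lam ^ 3 * a + lam⁻¹ * s ≤ B := fun ha hs =>
      add_le_add (mul_le_mul_of_nonneg_left ha hl3) (mul_le_mul_of_nonneg_left hs hl0.le)
    have hone : 1 + ‖F.z ω x‖ ^ 2 ≤ S := dens_le_left hν (F.one_le_dens hν hxD)
    have hδn := norm_nonneg δ
    have hUn := norm_nonneg (F.u ω x)
    have hVn := norm_nonneg (F.u ω (x + h))
    have hPn := Real.sqrt_nonneg |F.p ω x|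
    have hdn := Real.sqrt_nonneg |dp|
    have hu3 : ‖F.u ω x‖ ^ 3 ≤ S := norm_u_cube_le_left hν
    have hv3 : ‖F.u ω (x + h)‖ ^ 3 ≤ S := norm_u_cube_le_right hν
    have hp3 : √|F.p ω x| ^ 3 ≤ S := sqrt_p_cube_le_left hν
    have m1 : ∀ l i j, |δ l * F.u ω (x + h) i * F.u ω (x + h) j| ≤ B := fun l i j => by
      rw [abs_mul, abs_mul]
      calc |δ l| * |F.u ω (x + h) i| * |F.u ω (x + h) j|
          ≤ ‖δ‖ * ‖F.u ω (x + h)‖ * ‖F.u ω (x + h)‖ := by gcongr <;> exact abs_coord_le _ _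
        _ = ‖δ‖ * ‖F.u ω (x + h)‖ ^ 2 := by ring
        _ ≤ _ := mul_sq_le_cube hδn hVn hl
        _ ≤ B := hBi hI1 (by linarith)
    have m2 : ∀ l i j, |F.u ω x l * F.u ω x i * δ j| ≤ B := fun l i j => by
      rw [abs_mul, abs_mul]
      calc |F.u ω x l| * |F.u ω x i| * |δ j|
          ≤ ‖F.u ω x‖ * ‖F.u ω x‖ * ‖δ‖ := by gcongr <;> exact abs_coord_le _ _
        _ = ‖δ‖ * ‖F.u ω x‖ ^ 2 := by ring
        _ ≤ _ := mul_sq_le_cube hδn hUn hl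
        _ ≤ B := hBi hI1 (by linarith)
    have m3 : ∀ j, |F.p ω x * δ j| ≤ B := fun j => by
      rw [abs_mul]
      calc |F.p ω x| * |δ j| ≤ |F.p ω x| * ‖δ‖ := by gcongr; exact abs_coord_le _ _
        _ = ‖δ‖ * √|F.p ω x| ^ 2 := by rw [Real.sq_sqrt (abs_nonneg _), mul_comm]
        _ ≤ _ := mul_sq_le_cube hδn hPn hl
        _ ≤ B := hBi hI1 (by linarith)
    have m4 : ∀ i, |dp * F.u ω x i| ≤ B := fun i => by
      rw [abs_mul]
      calc |dp| * |F.u ω x i| ≤ |dp| * ‖F.u ω x‖ := by gcongr; exact abs_coord_le _ _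
        _ = √|dp| ^ 2 * ‖F.u ω x‖ := by rw [Real.sq_sqrt (abs_nonneg _)]
        _ ≤ _ := sq_mul_le_cube hdn hUn hl
        _ ≤ B := hBi hI2 (by linarith)
    have m5 : ∀ i j, |F.z ω x i * δ j| ≤ B := fun i j => by
      rw [abs_mul]
      calc |F.z ω x i| * |δ j| ≤ ‖F.z ω x‖ * ‖δ‖ := by gcongr <;> exact abs_coord_le _ _
        _ = ‖δ‖ * ‖F.z ω x‖ := mul_comm _ _
        _ ≤ _ := mul_le_cube_add hδn hl
        _ ≤ B := hBi hI1 (by linarith)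
    -- ψ(x)u(x) − ψ(y)u(y) is split into ψ(x) times a velocity increment and an increment of ψ, of
    -- size at most CR, times u(y).
    have m6 : ∀ i j, |F.z ω (x + h) j * (ψ x * F.u ω x i - ψ (x + h) * F.u ω (x + h) i)| ≤
        C * (B + R * S) := fun i j => by
      have e : F.z ω (x + h) j * (ψ x * F.u ω x i - ψ (x + h) * F.u ω (x + h) i) =
          - ψ x * (F.z ω (x + h) j * δ i) - (ψ (x + h) - ψ x) *
            (F.z ω (x + h) j * F.u ω (x + h) i) := by
        rw [← hδi]; ring
      have b1 : |F.z ω (x + h) j * δ i| ≤ B := by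
        rw [abs_mul]
        calc |F.z ω (x + h) j| * |δ i| ≤ ‖F.z ω (x + h)‖ * ‖δ‖ := by
              gcongr <;> exact abs_coord_le _ _
          _ = ‖δ‖ * ‖F.z ω (x + h)‖ := mul_comm _ _
          _ ≤ _ := mul_le_cube_add hδn hl
          _ ≤ B := hBi hI1 (by nlinarith [sq_nonneg ‖F.z ω x‖])
      have b2 := abs_z_mul_le hz' hv2 j i
      have b3 : |ψ (x + h) - ψ x| ≤ C * R := (hψ.abs_sub_le x h).trans (by gcongr)
      rw [e]
      refine (abs_sub _ _).trans ?_
      rw [abs_mul, abs_mul (ψ (x + h) - ψ x), abs_neg]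
      calc |ψ x| * |F.z ω (x + h) j * δ i| +
            |ψ (x + h) - ψ x| * |F.z ω (x + h) j * F.u ω (x + h) i| ≤ C * B + C * R * S := by
            gcongr; exact hψ.abs_le x
        _ = _ := by ring
    have hBn : 0 ≤ B := (abs_nonneg _).trans (m4 0)
    simp only [remainder, hδi]
    rw [← hdp]
    have s1 := sum_three_le fun l i j => abs_mul_mul_le' (hψ.abs_pd_le l x) (hk.abs_K_le i j h)
      (m1 l i j)
    have s2 := sum_three_le fun l i j => abs_mul_mul_le' (hψ.abs_pd_le l x) (hk.abs_K_le i j h)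
      (m2 l i j)
    have s3 := sum_two_le fun i j => abs_mul_mul_le' (hψ.abs_pd_le i x) (hk.abs_K_le i j h) (m3 j)
    have s4 := abs_sum_fin_three_le fun i => abs_mul_mul_le' (hψ.abs_pd_le i x) (hk.abs_Q_le h)
      (m4 i)
    have s5 := sum_two_le fun i j => abs_mul_mul_le' (hψ.abs_le x) (hk.abs_K_le i j h) (m5 i j)
    have s6 := sum_two_le fun i j => abs_mul_mul_le' (b := 1) (hk.abs_K_le i j h)
      (by simp : |(1 : ℝ)| ≤ 1) (m6 i j)
    simp only [mul_one] at s6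
    have s1' : |1 / 2 * ∑ l, ∑ i, ∑ j, pd l ψ x * k.K i j h *
        (δ l * F.u ω (x + h) i * F.u ω (x + h) j)| ≤ 27 * (C * k₀ h * B) := by
      rw [abs_mul, abs_of_pos (by norm_num : (0 : ℝ) < 1 / 2)]
      nlinarith [abs_nonneg (∑ l, ∑ i, ∑ j, pd l ψ x * k.K i j h *
        (δ l * F.u ω (x + h) i * F.u ω (x + h) j))]
    -- 84 = 27 + 27 + 9 + 3 + 9 + 9 bounds the six groups by their numbers of summands. The factor 2
    -- in front of S in B raises this to 168, below 200.
    have hfin : 84 * (C * k₀ h * B) + 9 * (k₀ h * (C * (R * S))) ≤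
        200 * C * (k₀ h * (lam ^ 3 * I + (lam⁻¹ + R) * S)) := by
      have t1 : 0 ≤ C * k₀ h * (lam ^ 3 * I) := by
        have := F.incrDens_nonneg ψ (ω, x, h); positivity
      have t2 : 0 ≤ C * k₀ h * (lam⁻¹ * S) := by positivity
      have t3 : 0 ≤ C * k₀ h * (R * S) := by positivity
      rw [hB]
      nlinarith
    refine le_trans ?_ hfin
    refine (abs_add_le _ _).trans ?_
    refine (add_le_add (abs_add_le _ _) le_rfl).trans ?_
    refine (add_le_add (add_le_add (abs_add_le _ _) le_rfl) le_rfl).trans ?_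
    refine (add_le_add (add_le_add (add_le_add (abs_add_le _ _) le_rfl) le_rfl) le_rfl).trans ?_
    refine (add_le_add (add_le_add (add_le_add (add_le_add (abs_add_le _ _) le_rfl) le_rfl)
      le_rfl) le_rfl).trans ?_
    refine (add_le_add (add_le_add (add_le_add (add_le_add (add_le_add s1' s2) s3) s4)
      s5) s6).trans (le_of_eq ?_)
    ring
  -- Off the support of ψ only the last group survives, through ψ(x + h), which is at most CR
  -- because ψ(x) = 0.
  · have e0 : ψ x = 0 := image_eq_zero_of_notMem_tsupport hx
    have e1 : ∀ l, pd l ψ x = 0 := fun l =>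
      image_eq_zero_of_notMem_tsupport fun h' => hx (tsupport_pd_subset _ _ h')
    have b3 : |ψ (x + h)| ≤ C * R := by
      have := hψ.abs_sub_le x h
      rw [e0, sub_zero] at this
      exact this.trans (by gcongr)
    have m6 : ∀ i j, |F.z ω (x + h) j * (ψ x * F.u ω x i - ψ (x + h) * F.u ω (x + h) i)| ≤
        C * (R * S) := fun i j => by
      have e : F.z ω (x + h) j * (ψ x * F.u ω x i - ψ (x + h) * F.u ω (x + h) i) =
          - (ψ (x + h) * (F.z ω (x + h) j * F.u ω (x + h) i)) := by
        rw [e0]; ring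
      rw [e, abs_neg, abs_mul]
      calc _ ≤ C * R * S := by gcongr; exact abs_z_mul_le hz' hv2 j i
        _ = _ := by ring
    have s6 := sum_two_le fun i j => abs_mul_mul_le' (b := 1) (hk.abs_K_le i j h)
      (by simp : |(1 : ℝ)| ≤ 1) (m6 i j)
    simp only [mul_one] at s6
    have hI := F.incrDens_nonneg ψ (ω, x, h)
    simp only [remainder, e0, e1, zero_mul, Finset.sum_const_zero, mul_zero, zero_add]
    simp only [e0, zero_mul, zero_sub] at s6
    simp only [zero_sub]
    refine s6.trans ?_
    have t1 : 0 ≤ C * k₀ h * (lam ^ 3 * F.incrDens ψ (ω, x, h)) := by positivity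
    have t2 : 0 ≤ C * k₀ h * (lam⁻¹ * S) := by positivity
    have t3 : 0 ≤ C * k₀ h * (R * S) := by positivity
    nlinarith

/-- Each summand contains ν times a gradient times a velocity, so `sqrt_mul_le` gives the factor √ν.
The gradient of the kernel appears here, which is why k₁ enters. -/
lemma abs_viscousRemainder_le (hν : 0 ≤ ν) (hψ : CutoffBound D ψ C)
    (hk : KernelBound k k₀ k₁ R) (q : X × E3 × E3) :
    |F.viscousRemainder k ψ q| ≤ 200 * C * (√ν * ((k₀ q.2.2 + k₁ q.2.2) *
      F.dens₂ q.1 q.2.1 (q.2.1 + q.2.2))) := by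
  obtain ⟨ω, x, h⟩ := q
  have hk0 : 0 ≤ k₀ h := (abs_nonneg _).trans (hk.abs_Q_le h)
  have hk1 : 0 ≤ k₁ h := (abs_nonneg _).trans (hk.abs_pd_le 0 0 0 h)
  have hC : 0 ≤ C := (abs_nonneg _).trans (hψ.abs_le 0)
  have hsν := Real.sqrt_nonneg ν
  set S := F.dens₂ ω x (x + h) with hS
  have hS0 : 0 ≤ S := add_nonneg (F.dens_nonneg hν _) (F.dens_nonneg hν _)
  have hv2 : ‖F.u ω (x + h)‖ ^ 2 ≤ S := norm_u_sq_le_right hν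
  have hu2 : ‖F.u ω x‖ ^ 2 ≤ S := norm_u_sq_le_left hν
  have hw2 : ν * ‖F.w ω x‖ ^ 2 ≤ S := norm_w_sq_le_left hν
  have hw2' : ν * ‖F.w ω (x + h)‖ ^ 2 ≤ S := norm_w_sq_le_right hν
  have m1 : ∀ l i j, |ν * (F.w ω x (l, i) * F.u ω (x + h) j)| ≤ √ν * (2 * S) := fun l i j => by
    rw [abs_mul, abs_mul, abs_of_nonneg hν]
    calc ν * (|F.w ω x (l, i)| * |F.u ω (x + h) j|) ≤ ν * (‖F.w ω x‖ * ‖F.u ω (x + h)‖) := by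
          gcongr <;> exact abs_coord_le _ _
      _ ≤ _ := sqrt_mul_le hν
      _ ≤ _ := by gcongr; linarith
  have m2 : ∀ l i j, |ν * (F.u ω x i * F.w ω (x + h) (l, j))| ≤ √ν * (2 * S) := fun l i j => by
    rw [abs_mul, abs_mul, abs_of_nonneg hν]
    calc ν * (|F.u ω x i| * |F.w ω (x + h) (l, j)|) ≤ ν * (‖F.u ω x‖ * ‖F.w ω (x + h)‖) := by
          gcongr <;> exact abs_coord_le _ _
      _ = ν * (‖F.w ω (x + h)‖ * ‖F.u ω x‖) := by ring
      _ ≤ _ := sqrt_mul_le hν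
      _ ≤ _ := by gcongr; linarith
  have s := sum_three_le (f := fun l i j =>
    (pd l ψ x * k.K i j h - ψ x * pd l (k.K i j) h) * 1 * (ν * (F.w ω x (l, i) * F.u ω (x + h) j)) +
    ψ x * pd l (k.K i j) h * (ν * (F.u ω x i * F.w ω (x + h) (l, j))))
    (C := 2 * (C * (k₀ h + k₁ h) * (√ν * (2 * S)))) fun l i j => by
      refine (abs_add_le _ _).trans ?_
      have b1 : |pd l ψ x * k.K i j h - ψ x * pd l (k.K i j) h| ≤ C * (k₀ h + k₁ h) := by
        refine (abs_sub _ _).trans ?_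
        rw [abs_mul, abs_mul, mul_add]
        gcongr
        exacts [hψ.abs_pd_le l x, hk.abs_K_le i j h, hψ.abs_le x, hk.abs_pd_le l i j h]
      have b2 := abs_mul_mul_le' b1 (by simp : |(1 : ℝ)| ≤ 1) (m1 l i j)
      have b3 := abs_mul_mul_le' (hψ.abs_le x) (hk.abs_pd_le l i j h) (m2 l i j)
      have b4 : C * k₁ h * (√ν * (2 * S)) ≤ C * (k₀ h + k₁ h) * (√ν * (2 * S)) := by
        gcongr; linarith
      linarith
  have e : F.viscousRemainder k ψ (ω, x, h) = ∑ l, ∑ i, ∑ j,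
    ((pd l ψ x * k.K i j h - ψ x * pd l (k.K i j) h) * 1 * (ν * (F.w ω x (l, i) * F.u ω (x + h) j)) +
    ψ x * pd l (k.K i j) h * (ν * (F.u ω x i * F.w ω (x + h) (l, j)))) := by
    simp only [viscousRemainder, Finset.mul_sum]
    refine Finset.sum_congr rfl fun l _ => Finset.sum_congr rfl fun i _ =>
      Finset.sum_congr rfl fun j _ => ?_
    ring
  rw [e]
  refine s.trans ?_
  have t : 0 ≤ C * (k₀ h + k₁ h) * (√ν * S) := by positivity
  simp only
  nlinarith

end Flow

section measurability

variable {Y : Type*} [MeasurableSpace Y]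

lemma measurable_remainder_aux {U V Z Z' a : Fin 3 → Y → ℝ} {K : Fin 3 → Fin 3 → Y → ℝ}
    {P P' ψ ψ' Q : Y → ℝ} (hU : ∀ i, Measurable (U i)) (hV : ∀ i, Measurable (V i))
    (hZ : ∀ i, Measurable (Z i)) (hZ' : ∀ i, Measurable (Z' i)) (ha : ∀ i, Measurable (a i))
    (hK : ∀ i j, Measurable (K i j)) (hP : Measurable P) (hP' : Measurable P') (hψ : Measurable ψ)
    (hψ' : Measurable ψ') (hQ : Measurable Q) :
    Measurable fun q => 1 / 2 * ∑ l, ∑ i, ∑ j, a l q * K i j q * ((V l q - U l q) * V i q * V j q) +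
      ∑ l, ∑ i, ∑ j, a l q * K i j q * (U l q * U i q * (V j q - U j q)) +
      ∑ i, ∑ j, a i q * K i j q * (P q * (V j q - U j q)) +
      ∑ i, a i q * Q q * ((P' q - P q) * U i q) +
      ∑ i, ∑ j, ψ q * K i j q * (Z i q * (V j q - U j q)) +
      ∑ i, ∑ j, K i j q * (Z' j q * (ψ q * U i q - ψ' q * V i q)) := by
  fun_prop

end measurability

namespace Flow

variable {D : Set E3} {ν : ℝ} {X : Type u} [MeasurableSpace X] {μ : Measure X} (F : Flow D ν μ)

lemma IsTest.measurable {D : Set E3} {f : E3 → ℝ} (hf : IsTest D f) : Measurable f :=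
  hf.1.continuous.measurable

lemma measurable_remainder (k : TwoPointKernel) {ψ : E3 → ℝ} (hψ : IsTest D ψ) :
    Measurable (F.remainder k ψ) := by
  have m1 : Measurable fun q : X × E3 × E3 => q.1 := measurable_fst
  have m2 : Measurable fun q : X × E3 × E3 => q.2.1 := measurable_fst.comp measurable_snd
  have m3 : Measurable fun q : X × E3 × E3 => q.2.2 := measurable_snd.comp measurable_snd
  have m4 : Measurable fun q : X × E3 × E3 => q.2.1 + q.2.2 := m2.add m3
  unfold remainder
  exact measurable_remainder_aux (F.measurable_u_comp m1 m2) (F.measurable_u_comp m1 m4)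
    (F.measurable_z_comp m1 m2) (F.measurable_z_comp m1 m4)
    (fun l => (IsTest.measurable (hψ.pd l)).comp m2)
    (fun i j => (IsTest.measurable (k.isTest i j)).comp m3) (F.measurable_p_comp m1 m2)
    (F.measurable_p_comp m1 m4) ((IsTest.measurable hψ).comp m2) ((IsTest.measurable hψ).comp m4)
    ((IsTest.measurable k.isTest_Q).comp m3)

lemma measurable_viscousRemainder (k : TwoPointKernel) {ψ : E3 → ℝ} (hψ : IsTest D ψ) :
    Measurable (F.viscousRemainder k ψ) := by
  have m1 : Measurable fun q : X × E3 × E3 => q.1 := measurable_fst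
  have m2 : Measurable fun q : X × E3 × E3 => q.2.1 := measurable_fst.comp measurable_snd
  have m3 : Measurable fun q : X × E3 × E3 => q.2.2 := measurable_snd.comp measurable_snd
  have m4 : Measurable fun q : X × E3 × E3 => q.2.1 + q.2.2 := m2.add m3
  have hU := F.measurable_u_comp m1 m2
  have hV := F.measurable_u_comp m1 m4
  have hW := F.measurable_w_comp m1 m2
  have hW' := F.measurable_w_comp m1 m4
  have ha : ∀ l, Measurable fun q : X × E3 × E3 => pd l ψ q.2.1 := fun l =>
    (IsTest.measurable (hψ.pd l)).comp m2
  have hK : ∀ i j, Measurable fun q : X × E3 × E3 => k.K i j q.2.2 := fun i j =>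
    (IsTest.measurable (k.isTest i j)).comp m3
  have hT : ∀ l i j, Measurable fun q : X × E3 × E3 => pd l (k.K i j) q.2.2 := fun l i j =>
    (IsTest.measurable ((k.isTest i j).pd l)).comp m3
  have hψ' : Measurable fun q : X × E3 × E3 => ψ q.2.1 := (IsTest.measurable hψ).comp m2
  refine Measurable.const_mul (Finset.measurable_fun_sum _ fun l _ =>
    Finset.measurable_fun_sum _ fun i _ => Finset.measurable_fun_sum _ fun j _ => ?_) ν
  exact ((((ha l).mul (hK i j)).sub (hψ'.mul (hT l i j))).mul ((hW (l, i)).mul (hV j))).add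
    ((hψ'.mul (hT l i j)).mul ((hU i).mul (hW' (l, j))))

lemma measurable_incrDens (ψ : E3 → ℝ) : Measurable (F.incrDens ψ) := by
  classical
  have m1 : Measurable fun q : X × E3 × E3 => q.1 := measurable_fst
  have m2 : Measurable fun q : X × E3 × E3 => q.2.1 := measurable_fst.comp measurable_snd
  have m3 : Measurable fun q : X × E3 × E3 => q.2.2 := measurable_snd.comp measurable_snd
  have m4 : Measurable fun q : X × E3 × E3 => q.2.1 + q.2.2 := m2.add m3
  refine Measurable.ite (m2 (isClosed_tsupport ψ).measurableSet) (Measurable.add ?_ ?_)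
    measurable_const
  · exact ((F.measurable_u.comp (m1.prodMk m4)).sub
      (F.measurable_u.comp (m1.prodMk m2))).norm.pow_const 3
  · exact (Real.continuous_sqrt.measurable.comp ((F.measurable_p.comp (m1.prodMk m4)).sub
      (F.measurable_p.comp (m1.prodMk m2))).abs).pow_const 3

lemma norm_sub_cube_le {E : Type*} [NormedAddCommGroup E] (a b : E) :
    ‖a - b‖ ^ 3 ≤ 4 * (‖a‖ ^ 3 + ‖b‖ ^ 3) := by
  have ha := norm_nonneg a
  have hb := norm_nonneg b
  calc ‖a - b‖ ^ 3 ≤ (‖a‖ + ‖b‖) ^ 3 := by gcongr; exact norm_sub_le a b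
    _ ≤ _ := by nlinarith [mul_nonneg (add_nonneg ha hb) (sq_nonneg (‖a‖ - ‖b‖))]

lemma sqrt_abs_sub_cube_le (a b : ℝ) : √|a - b| ^ 3 ≤ 4 * (√|a| ^ 3 + √|b| ^ 3) := by
  have ha := Real.sqrt_nonneg |a|
  have hb := Real.sqrt_nonneg |b|
  have h : √|a - b| ≤ √|a| + √|b| := by
    refine Real.sqrt_le_iff.2 ⟨by positivity, ?_⟩
    have h1 := abs_sub a b
    have h2 := Real.sq_sqrt (abs_nonneg a)
    have h3 := Real.sq_sqrt (abs_nonneg b)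
    nlinarith [mul_nonneg ha hb]
  calc √|a - b| ^ 3 ≤ (√|a| + √|b|) ^ 3 := by gcongr
    _ ≤ _ := by nlinarith [mul_nonneg (add_nonneg ha hb) (sq_nonneg (√|a| - √|b|))]

lemma incrDens_le (hν : 0 ≤ ν) (ψ : E3 → ℝ) (q : X × E3 × E3) :
    F.incrDens ψ q ≤ 8 * F.dens₂ q.1 q.2.1 (q.2.1 + q.2.2) := by
  obtain ⟨ω, x, h⟩ := q
  have h1 := norm_sub_cube_le (F.u ω (x + h)) (F.u ω x)
  have h2 := sqrt_abs_sub_cube_le (F.p ω (x + h)) (F.p ω x)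
  have h3 := F.norm_u_cube_le hν (ω, x)
  have h4 := F.norm_u_cube_le hν (ω, x + h)
  have h5 := F.sqrt_p_cube_le hν (ω, x)
  have h6 := F.sqrt_p_cube_le hν (ω, x + h)
  have h7 := F.dens_nonneg hν (ω, x)
  have h8 := F.dens_nonneg hν (ω, x + h)
  simp only [incrDens, dens₂] at *
  split_ifs <;> linarith

variable [IsFiniteMeasure μ] {k : TwoPointKernel} {ψ k₀ k₁ : E3 → ℝ} {C R : ℝ}

lemma integrable_incrDens (hν : 0 ≤ ν) (hD : IsOpen D) (hb : Bornology.IsBounded D)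
    {κ : E3 → ℝ} (hκ : Integrable κ) :
    Integrable (fun q : X × E3 × E3 => F.incrDens ψ q * κ q.2.2) (μ.prod (volume.prod volume)) := by
  refine ((F.integrable_dens_mul_kernel hD hb hκ.norm).const_mul 8).mono'
    ((F.measurable_incrDens ψ).aestronglyMeasurable.mul hκ.1.comp_snd.comp_snd)
    (.of_forall fun q => ?_)
  rw [norm_mul, Real.norm_of_nonneg (F.incrDens_nonneg ψ q), ← mul_assoc]
  gcongr
  exact F.incrDens_le hν ψ q

/-- The remainder is small if the increments are small in the mean. -/
lemma integrable_remainder (hν : 0 ≤ ν) (hD : IsOpen D) (hb : Bornology.IsBounded D)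
    (hψ : CutoffBound D ψ C) (hk : KernelBound k k₀ k₁ R) :
    Integrable (fun q => F.remainder k ψ q - F.viscousRemainder k ψ q)
      (μ.prod (volume.prod volume)) := by
  have i1 := (F.integrable_incrDens (ψ := ψ) hν hD hb hk.integrable₀)
  have i2 := F.integrable_dens_mul_kernel hD hb hk.integrable₀
  have i3 := F.integrable_dens_mul_kernel hD hb (hk.integrable₀.add hk.integrable₁)
  refine Integrable.sub ?_ ?_
  · refine ((i1.add (i2.const_mul (1 + R))).const_mul (200 * C)).mono'
      (F.measurable_remainder k hψ.isTest).aestronglyMeasurable (.of_forall fun q => ?_)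
    refine (abs_remainder_le hν hψ hk le_rfl q).trans_eq ?_
    simp only [Pi.add_apply]; ring
  · refine (i3.const_mul (200 * C * √ν)).mono'
      (F.measurable_viscousRemainder k hψ.isTest).aestronglyMeasurable (.of_forall fun q => ?_)
    refine (abs_viscousRemainder_le hν hψ hk q).trans_eq ?_
    simp only [Pi.add_apply]; ring

/-- The increments are integrated over (ω, x) with h fixed, where their mean is at most M on the
support of k₀. The densities at the two points each integrate to at most G by translation
invariance. -/
lemma abs_integral_remainder_le (hν : 0 ≤ ν) (hD : IsOpen D) (hb : Bornology.IsBounded D)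
    (hψ : CutoffBound D ψ C) (hk : KernelBound k k₀ k₁ R) {lam : ℝ} (hl : 1 ≤ lam) {M G : ℝ}
    (hG : ∫ q, F.dens q ∂(μ.prod volume) ≤ G) (hR : 0 ≤ R)
    (hM : ∀ h, ‖h‖ ≤ R → ∫ q : X × E3, F.incrDens ψ (q.1, q.2, h) ∂(μ.prod volume) ≤ M) :
    |∫ q, (F.remainder k ψ q - F.viscousRemainder k ψ q) ∂(μ.prod (volume.prod volume))| ≤
      400 * C * ((lam ^ 3 * M + (lam⁻¹ + R) * G) * (∫ h, k₀ h) +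
        √ν * G * ((∫ h, k₀ h) + ∫ h, k₁ h)) := by
  have hC : 0 ≤ C := (abs_nonneg _).trans (hψ.abs_le 0)
  have hl0 : 0 < lam⁻¹ := by positivity
  have hk0 : ∀ h, 0 ≤ k₀ h := fun h => (abs_nonneg _).trans (hk.abs_Q_le h)
  have hk1 : ∀ h, 0 ≤ k₁ h := fun h => (abs_nonneg _).trans (hk.abs_pd_le 0 0 0 h)
  have hI0 : 0 ≤ ∫ h, k₀ h := integral_nonneg hk0
  have hI1 : 0 ≤ ∫ h, k₁ h := integral_nonneg hk1
  have hM0 : 0 ≤ M := (integral_nonneg fun q => F.incrDens_nonneg _ _).trans (hM 0 (by simpa))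
  have i1 := (F.integrable_incrDens (ψ := ψ) hν hD hb hk.integrable₀)
  have i2 := F.integrable_dens_mul_kernel hD hb hk.integrable₀
  have i3 := F.integrable_dens_mul_kernel hD hb (hk.integrable₀.add hk.integrable₁)
  have dint : ∀ κ : E3 → ℝ, Integrable κ → (∀ h, 0 ≤ κ h) →
      ∫ q : X × E3 × E3, F.dens₂ q.1 q.2.1 (q.2.1 + q.2.2) * κ q.2.2 ∂(μ.prod (volume.prod volume)) ≤
        2 * G * ∫ h, κ h := by
    intro κ hκ hκ0
    have e : ∀ q : X × E3 × E3, F.dens₂ q.1 q.2.1 (q.2.1 + q.2.2) * κ q.2.2 =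
        F.dens (q.1, q.2.1) * κ q.2.2 + F.dens (q.1, q.2.1 + q.2.2) * κ q.2.2 := fun q => by
      simp only [dens₂]; ring
    simp only [e]
    rw [integral_add (integrable_mul_kernel (F.integrable_dens hD hb) hκ)
      (integrable_shift_mul_kernel (F.integrable_dens hD hb) hκ), integral_mul_kernel F.dens,
      integral_shift_mul_kernel F.dens]
    have := mul_le_mul_of_nonneg_right hG (integral_nonneg (μ := volume) hκ0)
    linarith
  have hinc : ∫ q : X × E3 × E3, F.incrDens ψ q * k₀ q.2.2 ∂(μ.prod (volume.prod volume)) ≤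
      M * ∫ h, k₀ h := by
    have i4 := (measurePreserving_assoc.integrable_comp_emb
      (MeasurableEquiv.measurableEmbedding _)).2 i1
    rw [← measurePreserving_assoc.integral_comp (MeasurableEquiv.measurableEmbedding _),
      integral_prod_symm (f := fun s : (X × E3) × E3 => F.incrDens ψ (MeasurableEquiv.prodAssoc s) *
        k₀ (MeasurableEquiv.prodAssoc s).2.2) i4, ← integral_const_mul]
    refine integral_mono i4.integral_prod_right (hk.integrable₀.const_mul M) fun h => ?_
    simp only [MeasurableEquiv.prodAssoc, MeasurableEquiv.coe_mk, Equiv.prodAssoc_apply]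
    rw [integral_mul_const]
    by_cases hh : ‖h‖ ≤ R
    · exact mul_le_mul_of_nonneg_right (hM h hh) (hk0 h)
    · rw [hk.eq_zero h (not_le.1 hh), mul_zero, mul_zero]
  have hb1 : |∫ q, (F.remainder k ψ q - F.viscousRemainder k ψ q) ∂(μ.prod (volume.prod volume))| ≤
      ∫ q : X × E3 × E3, (200 * C * (lam ^ 3 * (F.incrDens ψ q * k₀ q.2.2) + ((lam⁻¹ + R) *
        (F.dens₂ q.1 q.2.1 (q.2.1 + q.2.2) * k₀ q.2.2) + √ν *
        (F.dens₂ q.1 q.2.1 (q.2.1 + q.2.2) * (k₀ + k₁) q.2.2)))) ∂(μ.prod (volume.prod volume)) := by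
    rw [← Real.norm_eq_abs]
    refine norm_integral_le_of_norm_le (((i1.const_mul _).add
      ((i2.const_mul _).add (i3.const_mul _))).const_mul _) (.of_forall fun q => ?_)
    refine (abs_sub _ _).trans ((add_le_add (abs_remainder_le hν hψ hk hl q)
      (abs_viscousRemainder_le hν hψ hk q)).trans_eq ?_)
    simp only [Pi.add_apply]; ring
  refine hb1.trans ?_
  have i23 : Integrable (fun q : X × E3 × E3 => (lam⁻¹ + R) *
        (F.dens₂ q.1 q.2.1 (q.2.1 + q.2.2) * k₀ q.2.2) + √ν *
        (F.dens₂ q.1 q.2.1 (q.2.1 + q.2.2) * (k₀ + k₁) q.2.2)) (μ.prod (volume.prod volume)) :=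
    (i2.const_mul _).add (i3.const_mul _)
  rw [integral_const_mul, integral_add (i1.const_mul _) i23,
    integral_add (i2.const_mul _) (i3.const_mul _), integral_const_mul, integral_const_mul,
    integral_const_mul]
  have j2 := dint k₀ hk.integrable₀ hk0
  have j3 := dint (k₀ + k₁) (hk.integrable₀.add hk.integrable₁) fun h => add_nonneg (hk0 h) (hk1 h)
  have e3 : ∫ h : E3, (k₀ + k₁) h = (∫ h, k₀ h) + ∫ h, k₁ h := integral_add hk.integrable₀ hk.integrable₁
  rw [e3] at j3
  have hfin : lam ^ 3 * (∫ q : X × E3 × E3, F.incrDens ψ q * k₀ q.2.2 ∂(μ.prod (volume.prod volume))) +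
      ((lam⁻¹ + R) * (∫ q : X × E3 × E3, F.dens₂ q.1 q.2.1 (q.2.1 + q.2.2) * k₀ q.2.2
        ∂(μ.prod (volume.prod volume))) + √ν * (∫ q : X × E3 × E3,
        F.dens₂ q.1 q.2.1 (q.2.1 + q.2.2) * (k₀ + k₁) q.2.2 ∂(μ.prod (volume.prod volume)))) ≤
      lam ^ 3 * (M * ∫ h, k₀ h) + ((lam⁻¹ + R) * (2 * G * ∫ h, k₀ h) +
        √ν * (2 * G * ((∫ h, k₀ h) + ∫ h, k₁ h))) := by gcongr
  refine (mul_le_mul_of_nonneg_left hfin (by positivity)).trans ?_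
  have : 0 ≤ lam ^ 3 * (M * ∫ h, k₀ h) * C := by positivity
  nlinarith

end Flow

/-! ### The flux and input terms at a single point. -/

namespace Flow

variable {D : Set E3} {ν : ℝ} {X : Type u} [MeasurableSpace X] {μ : Measure X} (F : Flow D ν μ)
  [IsFiniteMeasure μ] {ψ : E3 → ℝ} {C : ℝ}

lemma integrable_one_point (hD : IsOpen D) (hb : Bornology.IsBounded D)
    {c : E3 → ℝ} (hc : Measurable c) (hC : ∀ x, |c x| ≤ C) {M : X × E3 → ℝ} (hM : Measurable M)
    (hMb : ∀ q, |M q| ≤ F.dens q) : Integrable (fun q => c q.2 * M q) (μ.prod volume) :=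
  (F.integrable_dens hD hb).mono' hM.aestronglyMeasurable (.of_forall hMb) |>.bdd_mul
    (hc.comp measurable_snd).aestronglyMeasurable (.of_forall fun q => hC q.2)

section onePoint

variable (hν : 0 ≤ ν) (hD : IsOpen D) (hb : Bornology.IsBounded D) (hψ : CutoffBound D ψ C)
include hν hD hb hψ

lemma integrable_advection (l i j : Fin 3) :
    Integrable (fun q : X × E3 => pd l ψ q.2 * (F.u q.1 q.2 l * F.u q.1 q.2 i * F.u q.1 q.2 j))
      (μ.prod volume) :=
  F.integrable_one_point hD hb (IsTest.measurable (hψ.isTest.pd l)) (hψ.abs_pd_le l)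
    (((F.measurable_u_comp measurable_fst measurable_snd l).mul
      (F.measurable_u_comp measurable_fst measurable_snd i)).mul
      (F.measurable_u_comp measurable_fst measurable_snd j)) fun q =>
    abs_mul_mul_le (F.norm_u_cube_le hν q) (F.norm_u_cube_le hν q) (F.norm_u_cube_le hν q) l i j

lemma integrable_pressureWork (i j : Fin 3) :
    Integrable (fun q : X × E3 => pd i ψ q.2 * (F.p q.1 q.2 * F.u q.1 q.2 j)) (μ.prod volume) :=
  F.integrable_one_point hD hb (IsTest.measurable (hψ.isTest.pd i)) (hψ.abs_pd_le i)
    ((F.measurable_p_comp measurable_fst measurable_snd).mul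
      (F.measurable_u_comp measurable_fst measurable_snd j)) fun q =>
    abs_p_mul_le (F.sqrt_p_cube_le hν q) (F.norm_u_cube_le hν q) j

lemma integrable_power (i j : Fin 3) :
    Integrable (fun q : X × E3 => ψ q.2 * (F.z q.1 q.2 i * F.u q.1 q.2 j)) (μ.prod volume) :=
  F.integrable_one_point hD hb (IsTest.measurable hψ.isTest) hψ.abs_le
    ((F.measurable_z_comp measurable_fst measurable_snd i).mul
      (F.measurable_u_comp measurable_fst measurable_snd j)) fun q =>
    abs_z_mul_le (F.norm_z_sq_le hν q) (F.norm_u_sq_le hν q) i j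

end onePoint

lemma integrable_separation (hD : IsOpen D) (hb : Bornology.IsBounded D) {c : E3 → ℝ} (hc : Measurable c) (hC : ∀ x, |c x| ≤ C) {φ : E3 → ℝ}
    (hφ : IsTest univ φ) {M : X × E3 × E3 → ℝ} (hM : Measurable M)
    (hMb : ∀ q : X × E3 × E3, |M q| ≤ F.dens₂ q.1 q.2.1 (q.2.1 + q.2.2)) :
    Integrable (fun q : X × E3 × E3 => c q.2.1 * φ q.2.2 * M q) (μ.prod (volume.prod volume)) :=
  F.integrable_of_dens hD hb (c := fun q => c q.2.1)
    (hc.comp (measurable_fst.comp measurable_snd)) (fun _ => hC _) hφ.integrable hM hMb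

lemma integrable_cutoff_kernel (hD : IsOpen D) (hb : Bornology.IsBounded D)
    (hψ : CutoffBound D ψ C) {φ : E3 → ℝ} (hφ : IsTest univ φ) (l : Fin 3)
    {M : X × E3 × E3 → ℝ} (hM : Measurable M)
    (hMb : ∀ q : X × E3 × E3, |M q| ≤ F.dens₂ q.1 q.2.1 (q.2.1 + q.2.2)) :
    Integrable (fun q : X × E3 × E3 => M q * (pd l ψ q.2.1 * φ q.2.2 - ψ q.2.1 * pd l φ q.2.2))
      (μ.prod (volume.prod volume)) := by
  refine ((F.integrable_separation hD hb (IsTest.measurable (hψ.isTest.pd l))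
    (hψ.abs_pd_le l) hφ hM hMb).sub (F.integrable_separation hD hb
    (IsTest.measurable hψ.isTest) hψ.abs_le (hφ.pd l) hM hMb)).congr (.of_forall fun q => ?_)
  simp only [Pi.sub_apply]; ring

/-- Each term is a function of one point times a function of h, so the integral factorizes and
`TwoPointKernel.integral_K` leaves a trace times ∫Q. The pressure contributes once through K and
once through Q, and the input once from each point; hence the factors 2 in `local_`. -/
lemma integral_main (hν : 0 ≤ ν) (hD : IsOpen D) (hb : Bornology.IsBounded D)
    (hψ : CutoffBound D ψ C) (k : TwoPointKernel) :
    Integrable (fun q : X × E3 × E3 =>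
      ∑ i, ∑ j, ((∑ l, pd l ψ q.2.1 * F.u q.1 q.2.1 l) * F.u q.1 q.2.1 i +
        F.p q.1 q.2.1 * pd i ψ q.2.1 + ψ q.2.1 * F.z q.1 q.2.1 i) * F.u q.1 q.2.1 j * k.K i j q.2.2 +
      F.p q.1 q.2.1 * (∑ i, pd i ψ q.2.1 * F.u q.1 q.2.1 i) * k.Q q.2.2 +
      ∑ i, ∑ j, ψ (q.2.1 + q.2.2) * F.u q.1 (q.2.1 + q.2.2) i * F.z q.1 (q.2.1 + q.2.2) j *
        k.K i j q.2.2) (μ.prod (volume.prod volume)) ∧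
    ∫ q : X × E3 × E3,
      (∑ i, ∑ j, ((∑ l, pd l ψ q.2.1 * F.u q.1 q.2.1 l) * F.u q.1 q.2.1 i +
        F.p q.1 q.2.1 * pd i ψ q.2.1 + ψ q.2.1 * F.z q.1 q.2.1 i) * F.u q.1 q.2.1 j * k.K i j q.2.2 +
      F.p q.1 q.2.1 * (∑ i, pd i ψ q.2.1 * F.u q.1 q.2.1 i) * k.Q q.2.2 +
      ∑ i, ∑ j, ψ (q.2.1 + q.2.2) * F.u q.1 (q.2.1 + q.2.2) i * F.z q.1 (q.2.1 + q.2.2) j *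
        k.K i j q.2.2) ∂(μ.prod (volume.prod volume)) =
      (∫ h, k.Q h) * ∫ q, F.local_ ψ q ∂(μ.prod volume) := by
  have iA := F.integrable_advection hν hD hb hψ
  have iB := F.integrable_pressureWork hν hD hb hψ
  have iC := F.integrable_power hν hD hb hψ
  set g : Fin 3 → Fin 3 → X × E3 → ℝ := fun i j q =>
    ((∑ l, pd l ψ q.2 * F.u q.1 q.2 l) * F.u q.1 q.2 i +
        F.p q.1 q.2 * pd i ψ q.2 + ψ q.2 * F.z q.1 q.2 i) * F.u q.1 q.2 j with hg
  set b : X × E3 → ℝ := fun q => F.p q.1 q.2 * (∑ i, pd i ψ q.2 * F.u q.1 q.2 i) with hbdef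
  set d : Fin 3 → Fin 3 → X × E3 → ℝ := fun i j q => ψ q.2 * F.u q.1 q.2 i * F.z q.1 q.2 j with hd
  have ig : ∀ i j, Integrable (g i j) (μ.prod volume) := fun i j => by
    refine (((integrable_finsetSum Finset.univ fun l _ => iA l i j).add (iB i j)).add
      (iC i j)).congr (.of_forall fun q => ?_)
    simp only [Pi.add_apply, hg, Fin.sum_univ_three]; ring
  have ib : Integrable b (μ.prod volume) := by
    refine (integrable_finsetSum Finset.univ fun i _ => iB i i).congr (.of_forall fun q => ?_)
    simp only [hbdef, Fin.sum_univ_three]; ring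
  have id' : ∀ i j, Integrable (d i j) (μ.prod volume) := fun i j => by
    refine (iC j i).congr (.of_forall fun q => ?_)
    simp only [hd]; ring
  have jg : ∀ i j, Integrable (fun q : X × E3 × E3 => g i j (q.1, q.2.1) * k.K i j q.2.2)
      (μ.prod (volume.prod volume)) := fun i j => integrable_mul_kernel (ig i j) (k.isTest i j).integrable
  have jb : Integrable (fun q : X × E3 × E3 => b (q.1, q.2.1) * k.Q q.2.2)
      (μ.prod (volume.prod volume)) := integrable_mul_kernel ib k.isTest_Q.integrable
  have jd : ∀ i j, Integrable (fun q : X × E3 × E3 => d i j (q.1, q.2.1 + q.2.2) * k.K i j q.2.2)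
      (μ.prod (volume.prod volume)) := fun i j =>
    integrable_shift_mul_kernel (id' i j) (k.isTest i j).integrable
  have sg : Integrable (fun q : X × E3 × E3 => ∑ i, ∑ j, g i j (q.1, q.2.1) * k.K i j q.2.2)
      (μ.prod (volume.prod volume)) :=
    integrable_finsetSum _ fun i _ => integrable_finsetSum _ fun j _ => jg i j
  have sd : Integrable (fun q : X × E3 × E3 => ∑ i, ∑ j, d i j (q.1, q.2.1 + q.2.2) * k.K i j q.2.2)
      (μ.prod (volume.prod volume)) :=
    integrable_finsetSum _ fun i _ => integrable_finsetSum _ fun j _ => jd i j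
  have sgb : Integrable (fun q : X × E3 × E3 => ∑ i, ∑ j, g i j (q.1, q.2.1) * k.K i j q.2.2 +
    b (q.1, q.2.1) * k.Q q.2.2) (μ.prod (volume.prod volume)) := sg.add jb
  refine ⟨sgb.add sd, ?_⟩
  have e1 : ∫ q : X × E3 × E3, ∑ i, ∑ j, g i j (q.1, q.2.1) * k.K i j q.2.2
      ∂(μ.prod (volume.prod volume)) = (∫ h, k.Q h) * ∑ i, ∫ q, g i i q ∂(μ.prod volume) := by
    rw [integral_finsetSum _ fun i _ => integrable_finsetSum _ fun j _ => jg i j, Finset.mul_sum]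
    refine Finset.sum_congr rfl fun i _ => ?_
    rw [integral_finsetSum _ fun j _ => jg i j]
    simp only [fun j => integral_mul_kernel (μ := μ) (g i j) (k.K i j), k.integral_K]
    simp [mul_comm]
  have e2 : ∫ q : X × E3 × E3, ∑ i, ∑ j, d i j (q.1, q.2.1 + q.2.2) * k.K i j q.2.2
      ∂(μ.prod (volume.prod volume)) = (∫ h, k.Q h) * ∑ i, ∫ q, d i i q ∂(μ.prod volume) := by
    rw [integral_finsetSum _ fun i _ => integrable_finsetSum _ fun j _ => jd i j, Finset.mul_sum]
    refine Finset.sum_congr rfl fun i _ => ?_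
    rw [integral_finsetSum _ fun j _ => jd i j]
    simp only [fun j => integral_shift_mul_kernel (μ := μ) (d i j) (k.K i j), k.integral_K]
    simp [mul_comm]
  have e3 : ∫ q, F.local_ ψ q ∂(μ.prod volume) = ∑ i, ∫ q, g i i q ∂(μ.prod volume) +
      ∫ q, b q ∂(μ.prod volume) + ∑ i, ∫ q, d i i q ∂(μ.prod volume) := by
    have i1 : Integrable (fun q => ∑ i, g i i q) (μ.prod volume) :=
      integrable_finsetSum _ fun i _ => ig i i
    have i2 : Integrable (fun q => ∑ i, d i i q) (μ.prod volume) :=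
      integrable_finsetSum _ fun i _ => id' i i
    have i3 : Integrable (fun q => ∑ i, g i i q + b q) (μ.prod volume) := i1.add ib
    rw [← integral_finsetSum _ fun i _ => ig i i, ← integral_finsetSum _ fun i _ => id' i i,
      ← integral_add i1 ib, ← integral_add i3 i2]
    refine integral_congr_ae (.of_forall fun q => ?_)
    simp only [local_, hg, hbdef, hd, Fin.sum_univ_three]
    ring
  have e4 : ∫ q : X × E3 × E3, b (q.1, q.2.1) * k.Q q.2.2 ∂(μ.prod (volume.prod volume)) =
      (∫ h, k.Q h) * ∫ q, b q ∂(μ.prod volume) := by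
    rw [integral_mul_kernel b k.Q, mul_comm]
  have e5 := integral_add sgb sd
  rw [integral_add sg jb, e1, e2, e4] at e5
  rw [e3, mul_add, mul_add]
  exact e5

end Flow

/-! ### Null terms and the Kármán–Howarth–Monin relation. -/

namespace Flow

variable {D : Set E3} {ν : ℝ} {X : Type u} [MeasurableSpace X] {μ : Measure X} (F : Flow D ν μ) {ψ : E3 → ℝ} {C : ℝ}

lemma measurable_fst_snd : Measurable fun q : X × E3 × E3 => q.2.1 :=
  measurable_fst.comp measurable_snd

lemma measurable_add : Measurable fun q : X × E3 × E3 => q.2.1 + q.2.2 :=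
  measurable_fst_snd.add (measurable_snd.comp measurable_snd)

lemma measurable_u_left (i : Fin 3) : Measurable fun q : X × E3 × E3 => F.u q.1 q.2.1 i :=
  F.measurable_u_comp measurable_fst measurable_fst_snd i

lemma measurable_u_right (i : Fin 3) :
    Measurable fun q : X × E3 × E3 => F.u q.1 (q.2.1 + q.2.2) i :=
  F.measurable_u_comp measurable_fst measurable_add i

/-- Terms which vanish because the velocity is divergence free. -/
lemma null_terms [IsFiniteMeasure μ] (hν : 0 ≤ ν) (hD : IsOpen D) (hb : Bornology.IsBounded D)
    (hψ : CutoffBound D ψ C) (k : TwoPointKernel) :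
    Integrable (fun q : X × E3 × E3 =>
      1 / 2 * ∑ i, ∑ j, ∑ l, ψ q.2.1 * F.u q.1 q.2.1 i * F.u q.1 q.2.1 j *
        (pd l (k.K i j) q.2.2 * F.u q.1 (q.2.1 + q.2.2) l)
      - 1 / 2 * ∑ i, ∑ j, ∑ l, ψ q.2.1 * F.u q.1 q.2.1 l * F.u q.1 q.2.1 i * F.u q.1 q.2.1 j *
        pd l (k.K i j) q.2.2
      - 1 / 2 * ∑ i, ∑ j, ∑ l, F.u q.1 (q.2.1 + q.2.2) l * F.u q.1 (q.2.1 + q.2.2) i *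
        F.u q.1 (q.2.1 + q.2.2) j * (pd l ψ q.2.1 * k.K i j q.2.2 - ψ q.2.1 * pd l (k.K i j) q.2.2)
      + 1 / 2 * ∑ i, ∑ j, ∑ l, F.u q.1 (q.2.1 + q.2.2) i * F.u q.1 (q.2.1 + q.2.2) j *
        (F.u q.1 q.2.1 l * (pd l ψ q.2.1 * k.K i j q.2.2 - ψ q.2.1 * pd l (k.K i j) q.2.2))
      - ∑ j, F.p q.1 q.2.1 * ψ q.2.1 * (pd j k.Q q.2.2 * F.u q.1 (q.2.1 + q.2.2) j)
      - ∑ i, F.p q.1 (q.2.1 + q.2.2) * (F.u q.1 q.2.1 i *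
        (pd i ψ q.2.1 * k.Q q.2.2 - ψ q.2.1 * pd i k.Q q.2.2))) (μ.prod (volume.prod volume)) ∧
    ∫ q : X × E3 × E3,
      (1 / 2 * ∑ i, ∑ j, ∑ l, ψ q.2.1 * F.u q.1 q.2.1 i * F.u q.1 q.2.1 j *
        (pd l (k.K i j) q.2.2 * F.u q.1 (q.2.1 + q.2.2) l)
      - 1 / 2 * ∑ i, ∑ j, ∑ l, ψ q.2.1 * F.u q.1 q.2.1 l * F.u q.1 q.2.1 i * F.u q.1 q.2.1 j *
        pd l (k.K i j) q.2.2
      - 1 / 2 * ∑ i, ∑ j, ∑ l, F.u q.1 (q.2.1 + q.2.2) l * F.u q.1 (q.2.1 + q.2.2) i *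
        F.u q.1 (q.2.1 + q.2.2) j * (pd l ψ q.2.1 * k.K i j q.2.2 - ψ q.2.1 * pd l (k.K i j) q.2.2)
      + 1 / 2 * ∑ i, ∑ j, ∑ l, F.u q.1 (q.2.1 + q.2.2) i * F.u q.1 (q.2.1 + q.2.2) j *
        (F.u q.1 q.2.1 l * (pd l ψ q.2.1 * k.K i j q.2.2 - ψ q.2.1 * pd l (k.K i j) q.2.2))
      - ∑ j, F.p q.1 q.2.1 * ψ q.2.1 * (pd j k.Q q.2.2 * F.u q.1 (q.2.1 + q.2.2) j)
      - ∑ i, F.p q.1 (q.2.1 + q.2.2) * (F.u q.1 q.2.1 i *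
        (pd i ψ q.2.1 * k.Q q.2.2 - ψ q.2.1 * pd i k.Q q.2.2))) ∂(μ.prod (volume.prod volume)) = 0 := by
  have mU := F.measurable_u_left
  have mV := F.measurable_u_right
  have mψ := IsTest.measurable hψ.isTest
  have mP : Measurable fun q : X × E3 × E3 => F.p q.1 q.2.1 :=
    F.measurable_p_comp measurable_fst measurable_fst_snd
  have mP' : Measurable fun q : X × E3 × E3 => F.p q.1 (q.2.1 + q.2.2) :=
    F.measurable_p_comp measurable_fst measurable_add
  have i1 : ∀ i j l, Integrable (fun q : X × E3 × E3 => ψ q.2.1 * F.u q.1 q.2.1 i * F.u q.1 q.2.1 j *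
      (pd l (k.K i j) q.2.2 * F.u q.1 (q.2.1 + q.2.2) l)) (μ.prod (volume.prod volume)) := by
    intro i j l
    refine (F.integrable_separation hD hb mψ hψ.abs_le ((k.isTest i j).pd l)
      (((mU i).mul (mU j)).mul (mV l)) (fun q => abs_mul_mul_le (norm_u_cube_le_left hν)
      (norm_u_cube_le_left hν) (norm_u_cube_le_right hν) i j l)).congr (.of_forall fun q => ?_)
    simp only [Pi.mul_apply]; ring
  have i2 : ∀ i j l, Integrable (fun q : X × E3 × E3 => ψ q.2.1 * F.u q.1 q.2.1 l * F.u q.1 q.2.1 i *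
      F.u q.1 q.2.1 j * pd l (k.K i j) q.2.2) (μ.prod (volume.prod volume)) := by
    intro i j l
    refine (F.integrable_separation hD hb mψ hψ.abs_le ((k.isTest i j).pd l)
      (((mU l).mul (mU i)).mul (mU j)) (fun q => abs_mul_mul_le (norm_u_cube_le_left hν)
      (norm_u_cube_le_left hν) (norm_u_cube_le_left hν) l i j)).congr (.of_forall fun q => ?_)
    simp only [Pi.mul_apply]; ring
  have i3 : ∀ i j l, Integrable (fun q : X × E3 × E3 => F.u q.1 (q.2.1 + q.2.2) l *
      F.u q.1 (q.2.1 + q.2.2) i * F.u q.1 (q.2.1 + q.2.2) j *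
      (pd l ψ q.2.1 * k.K i j q.2.2 - ψ q.2.1 * pd l (k.K i j) q.2.2))
      (μ.prod (volume.prod volume)) := fun i j l =>
    F.integrable_cutoff_kernel hD hb hψ (k.isTest i j) l (((mV l).mul (mV i)).mul (mV j))
      fun q => abs_mul_mul_le (norm_u_cube_le_right hν) (norm_u_cube_le_right hν)
        (norm_u_cube_le_right hν) l i j
  have i4 : ∀ i j l, Integrable (fun q : X × E3 × E3 => F.u q.1 (q.2.1 + q.2.2) i *
      F.u q.1 (q.2.1 + q.2.2) j * (F.u q.1 q.2.1 l *
      (pd l ψ q.2.1 * k.K i j q.2.2 - ψ q.2.1 * pd l (k.K i j) q.2.2)))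
      (μ.prod (volume.prod volume)) := fun i j l => by
    refine (F.integrable_cutoff_kernel hD hb hψ (k.isTest i j) l (((mV i).mul (mV j)).mul (mU l))
      fun q => abs_mul_mul_le (norm_u_cube_le_right hν) (norm_u_cube_le_right hν)
        (norm_u_cube_le_left hν) i j l).congr (.of_forall fun q => ?_)
    simp only [Pi.mul_apply]; ring
  have i5 : ∀ j, Integrable (fun q : X × E3 × E3 => F.p q.1 q.2.1 * ψ q.2.1 *
      (pd j k.Q q.2.2 * F.u q.1 (q.2.1 + q.2.2) j)) (μ.prod (volume.prod volume)) := by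
    intro j
    refine (F.integrable_separation hD hb mψ hψ.abs_le (k.isTest_Q.pd j)
      (mP.mul (mV j)) (fun q => abs_p_mul_le (sqrt_p_cube_le_left hν)
      (norm_u_cube_le_right hν) j)).congr (.of_forall fun q => ?_)
    simp only [Pi.mul_apply]; ring
  have i6 : ∀ i, Integrable (fun q : X × E3 × E3 => F.p q.1 (q.2.1 + q.2.2) * (F.u q.1 q.2.1 i *
        (pd i ψ q.2.1 * k.Q q.2.2 - ψ q.2.1 * pd i k.Q q.2.2))) (μ.prod (volume.prod volume)) := by
    intro i
    refine (F.integrable_cutoff_kernel hD hb hψ k.isTest_Q i (mP'.mul (mU i))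
      fun q => abs_p_mul_le (sqrt_p_cube_le_right hν) (norm_u_cube_le_left hν) i).congr
      (.of_forall fun q => ?_)
    simp only [Pi.mul_apply]; ring
  have s : ∀ {f : Fin 3 → Fin 3 → Fin 3 → X × E3 × E3 → ℝ},
      (∀ i j l, Integrable (f i j l) (μ.prod (volume.prod volume))) →
      Integrable (fun q => 1 / 2 * ∑ i, ∑ j, ∑ l, f i j l q) (μ.prod (volume.prod volume)) :=
    fun h => (integrable_finsetSum _ fun i _ => integrable_finsetSum _ fun j _ =>
      integrable_finsetSum _ fun l _ => h i j l).const_mul _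
  have z : ∀ {f : Fin 3 → Fin 3 → Fin 3 → X × E3 × E3 → ℝ},
      (∀ i j l, Integrable (f i j l) (μ.prod (volume.prod volume))) →
      (∀ i j, ∫ q, ∑ l, f i j l q ∂(μ.prod (volume.prod volume)) = 0) →
      ∫ q, 1 / 2 * ∑ i, ∑ j, ∑ l, f i j l q ∂(μ.prod (volume.prod volume)) = 0 := by
    intro f hf h
    rw [integral_const_mul, integral_finsetSum _ fun i _ => integrable_finsetSum _ fun j _ =>
      integrable_finsetSum _ fun l _ => hf i j l]
    rw [Finset.sum_eq_zero fun i _ => ?_, mul_zero]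
    rw [integral_finsetSum _ fun j _ => integrable_finsetSum _ fun l _ => hf i j l]
    exact Finset.sum_eq_zero fun j _ => h i j
  have z1 := z i1 fun i j => F.integral_divFree_right
    (G := fun q => ψ q.2 * F.u q.1 q.2 i * F.u q.1 q.2 j) (k.isTest i j)
    (integrable_finsetSum _ fun l _ => i1 i j l)
  have z2 := z i2 fun i j => by
    rw [integral_finsetSum _ fun l _ => i2 i j l]
    exact Finset.sum_eq_zero fun l _ => integral_const_right
      (G := fun q => ψ q.2 * F.u q.1 q.2 l * F.u q.1 q.2 i * F.u q.1 q.2 j) (k.isTest i j) l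
  have z3 := z i3 fun i j => by
    rw [integral_finsetSum _ fun l _ => i3 i j l]
    exact Finset.sum_eq_zero fun l _ => integral_const_left
      (G := fun q => F.u q.1 q.2 l * F.u q.1 q.2 i * F.u q.1 q.2 j) hψ.isTest (k.isTest i j) l
      (i3 i j l)
  have z4 := z i4 fun i j => F.integral_divFree_left
    (G := fun q => F.u q.1 q.2 i * F.u q.1 q.2 j) hψ.isTest (k.isTest i j)
    (integrable_finsetSum _ fun l _ => i4 i j l)
  have s5 : Integrable (fun q : X × E3 × E3 => ∑ j, F.p q.1 q.2.1 * ψ q.2.1 *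
      (pd j k.Q q.2.2 * F.u q.1 (q.2.1 + q.2.2) j)) (μ.prod (volume.prod volume)) :=
    integrable_finsetSum _ fun j _ => i5 j
  have s6 : Integrable (fun q : X × E3 × E3 => ∑ i, F.p q.1 (q.2.1 + q.2.2) * (F.u q.1 q.2.1 i *
        (pd i ψ q.2.1 * k.Q q.2.2 - ψ q.2.1 * pd i k.Q q.2.2))) (μ.prod (volume.prod volume)) :=
    integrable_finsetSum _ fun i _ => i6 i
  have z5 := F.integral_divFree_right (G := fun q => F.p q.1 q.2 * ψ q.2) k.isTest_Q s5
  have z6 := F.integral_divFree_left (G := fun q => F.p q.1 q.2) hψ.isTest k.isTest_Q s6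
  have comb : ∀ {f g : X × E3 × E3 → ℝ}, Integrable f (μ.prod (volume.prod volume)) ∧
      ∫ q, f q ∂(μ.prod (volume.prod volume)) = 0 →
      Integrable g (μ.prod (volume.prod volume)) ∧ ∫ q, g q ∂(μ.prod (volume.prod volume)) = 0 →
      Integrable (fun q => f q - g q) (μ.prod (volume.prod volume)) ∧
        ∫ q, (f q - g q) ∂(μ.prod (volume.prod volume)) = 0 := fun hf hg =>
    ⟨hf.1.sub hg.1, by rw [integral_sub hf.1 hg.1, hf.2, hg.2, sub_zero]⟩
  have comb' : ∀ {f g : X × E3 × E3 → ℝ}, Integrable f (μ.prod (volume.prod volume)) ∧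
      ∫ q, f q ∂(μ.prod (volume.prod volume)) = 0 →
      Integrable g (μ.prod (volume.prod volume)) ∧ ∫ q, g q ∂(μ.prod (volume.prod volume)) = 0 →
      Integrable (fun q => f q + g q) (μ.prod (volume.prod volume)) ∧
        ∫ q, (f q + g q) ∂(μ.prod (volume.prod volume)) = 0 := fun hf hg =>
    ⟨hf.1.add hg.1, by rw [integral_add hf.1 hg.1, hf.2, hg.2, add_zero]⟩
  exact comb (comb (comb' (comb (comb ⟨s i1, z1⟩ ⟨s i2, z2⟩) ⟨s i3, z3⟩) ⟨s i4, z4⟩) ⟨s5, z5⟩) ⟨s6, z6⟩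

/-- The two-point energy balance: the cubic expression in the increments is given by flux and input,
up to remainders. -/
theorem integral_cubic [IsFiniteMeasure μ] (hF : F.Balanced) (hν : 0 ≤ ν) (hν1 : ν ≤ 1) (hD : IsOpen D) (hb : Bornology.IsBounded D)
    (hψ : CutoffBound D ψ C) {k : TwoPointKernel} {k₀ k₁ : E3 → ℝ} {R r : ℝ}
    (hk : KernelBound k k₀ k₁ R) (hr : 0 < r)
    (hsupp : ∀ x ∈ tsupport ψ, ∀ y, ‖y‖ ≤ R → Metric.closedBall (x + y) r ⊆ D) :
    ∫ q, F.cubic k ψ q ∂(μ.prod (volume.prod volume)) =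
      (∫ h, k.Q h) * (∫ q, F.local_ ψ q ∂(μ.prod volume)) +
      ∫ q, (F.remainder k ψ q - F.viscousRemainder k ψ q) ∂(μ.prod (volume.prod volume)) := by
  -- The majorant k₀ vanishes beyond R, so K is supported in the closed ball of radius R and the
  -- balance may be tested with it.
  have hKs : ∀ i j, tsupport (k.K i j) ⊆ Metric.closedBall 0 R := fun i j => by
    refine closure_minimal (fun y hy => ?_) Metric.isClosed_closedBall
    by_contra h
    rw [mem_closedBall_zero_iff, not_le] at h
    exact hy (abs_nonpos_iff.1 ((hk.abs_K_le i j y).trans_eq (hk.eq_zero y h)))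
  have mU := F.measurable_u_left
  have mV := F.measurable_u_right
  have mψ := IsTest.measurable hψ.isTest
  have hbal := fun i j => F.balance_separation hF hν hν1 hD hb hψ.isTest (k.isTest i j) hr
    (fun x hx y hy => hsupp x hx y (mem_closedBall_zero_iff.1 (hKs i j hy))) i j
  have mz : ∀ i, Measurable fun q : X × E3 × E3 => F.z q.1 q.2.1 i :=
    F.measurable_z_comp measurable_fst measurable_fst_snd
  have mz' : ∀ i, Measurable fun q : X × E3 × E3 => F.z q.1 (q.2.1 + q.2.2) i :=
    F.measurable_z_comp measurable_fst measurable_add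
  have ibal : ∀ i j, Integrable (fun q : X × E3 × E3 =>
      (F.z q.1 q.2.1 i * F.u q.1 (q.2.1 + q.2.2) j +
          F.u q.1 q.2.1 i * F.z q.1 (q.2.1 + q.2.2) j) * (ψ q.2.1 * k.K i j q.2.2) +
      (∑ l, (F.u q.1 q.2.1 l * F.u q.1 q.2.1 i - ν * F.w q.1 q.2.1 (l, i) +
          if l = i then F.p q.1 q.2.1 else 0) * F.u q.1 (q.2.1 + q.2.2) j *
            (pd l ψ q.2.1 * k.K i j q.2.2 - ψ q.2.1 * pd l (k.K i j) q.2.2) +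
        ∑ l, F.u q.1 q.2.1 i * (F.u q.1 (q.2.1 + q.2.2) l * F.u q.1 (q.2.1 + q.2.2) j -
          ν * F.w q.1 (q.2.1 + q.2.2) (l, j) +
          if l = j then F.p q.1 (q.2.1 + q.2.2) else 0) * (ψ q.2.1 * pd l (k.K i j) q.2.2)))
      (μ.prod (volume.prod volume)) := by
    intro i j
    refine Integrable.add ?_ ((integrable_finsetSum _ fun l _ => ?_).add
      (integrable_finsetSum _ fun l _ => ?_))
    · refine ((F.integrable_separation hD hb mψ hψ.abs_le (k.isTest i j) ((mz i).mul (mV j))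
        fun q => abs_z_mul_le (norm_z_sq_le_left hν) (norm_u_sq_le_right hν) i j).add
        (F.integrable_separation hD hb mψ hψ.abs_le (k.isTest i j) ((mU i).mul (mz' j))
        fun q => abs_z_mul_le (norm_u_sq_le_left hν) (norm_z_sq_le_right hν) i j)).congr
        (.of_forall fun q => ?_)
      simp only [Pi.add_apply, Pi.mul_apply]; ring
    · refine ((F.integrable_cutoff_kernel hD hb hψ (k.isTest i j) l
        (((F.measurable_stress measurable_fst measurable_fst_snd l i).mul (mV j)).const_mul (1 / 3))
        fun q => ?_).const_mul 3).congr (.of_forall fun q => ?_)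
      · rw [abs_mul, abs_of_pos (by norm_num : (0 : ℝ) < 1 / 3)]
        have := F.abs_stress_mul_le hν hν1 q.1 q.2.1 (q.2.1 + q.2.2) _ (Or.inr rfl) l i j rfl
        exact (mul_le_mul_of_nonneg_left this (by norm_num)).trans_eq (by ring)
      · simp only [Pi.mul_apply]; ring
    · refine ((F.integrable_separation hD hb mψ hψ.abs_le ((k.isTest i j).pd l)
        (((F.measurable_stress measurable_fst measurable_add l j).mul (mU i)).const_mul (1 / 3))
        fun q => ?_).const_mul 3).congr (.of_forall fun q => ?_)
      · rw [abs_mul, abs_of_pos (by norm_num : (0 : ℝ) < 1 / 3)]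
        have := F.abs_stress_mul_le hν hν1 q.1 (q.2.1 + q.2.2) q.2.1 _ (Or.inr rfl) l j i dens₂_comm
        exact (mul_le_mul_of_nonneg_left this (by norm_num)).trans_eq (by ring)
      · simp only [Pi.mul_apply]; ring
  obtain ⟨im, em⟩ := F.integral_main hν hD hb hψ k
  obtain ⟨i0, e0⟩ := F.null_terms hν hD hb hψ k
  have ir := F.integrable_remainder hν hD hb hψ hk
  have hsum := integral_finsetSum (μ := μ.prod (volume.prod volume)) (Finset.univ : Finset (Fin 3))
    fun i _ => integrable_finsetSum (Finset.univ : Finset (Fin 3)) fun j _ => ibal i j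
  have hz : ∀ i, _ := fun i => integral_finsetSum (μ := μ.prod (volume.prod volume))
    (Finset.univ : Finset (Fin 3)) fun j _ => ibal i j
  simp only [hz, hbal, Finset.sum_const_zero] at hsum
  -- The contracted balance f has integral zero. Solving the pointwise identity for the cubic term
  -- leaves the single-point terms and the remainders.
  have combine : ∀ {f m n : X × E3 × E3 → ℝ}, Integrable f (μ.prod (volume.prod volume)) →
      ∫ q, f q ∂(μ.prod (volume.prod volume)) = 0 → Integrable m (μ.prod (volume.prod volume)) ∧
      ∫ q, m q ∂(μ.prod (volume.prod volume)) =
        (∫ h, k.Q h) * (∫ q, F.local_ ψ q ∂(μ.prod volume)) →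
      Integrable n (μ.prod (volume.prod volume)) ∧ ∫ q, n q ∂(μ.prod (volume.prod volume)) = 0 →
      (∀ q, f q = - F.cubic k ψ q + m q + (F.remainder k ψ q - F.viscousRemainder k ψ q) + n q) →
      ∫ q, F.cubic k ψ q ∂(μ.prod (volume.prod volume)) =
      (∫ h, k.Q h) * (∫ q, F.local_ ψ q ∂(μ.prod volume)) +
      ∫ q, (F.remainder k ψ q - F.viscousRemainder k ψ q) ∂(μ.prod (volume.prod volume)) := by
    intro f m n hf hf0 hm hn h
    have e : ∀ q, F.cubic k ψ q = m q + (F.remainder k ψ q - F.viscousRemainder k ψ q) + n q - f q :=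
      fun q => by rw [h q]; ring
    have i1 : Integrable (fun q => m q + (F.remainder k ψ q - F.viscousRemainder k ψ q))
      (μ.prod (volume.prod volume)) := hm.1.add ir
    have i2 : Integrable (fun q => m q + (F.remainder k ψ q - F.viscousRemainder k ψ q) + n q)
      (μ.prod (volume.prod volume)) := i1.add hn.1
    rw [integral_congr_ae (.of_forall e), integral_sub i2 hf, integral_add i1 hn.1,
      integral_add hm.1 ir, hf0, hm.2, hn.2, add_zero, sub_zero]
  refine combine (integrable_finsetSum (Finset.univ : Finset (Fin 3)) fun i _ =>
    integrable_finsetSum (Finset.univ : Finset (Fin 3)) fun j _ => ibal i j) hsum ⟨im, em⟩ ⟨i0, e0⟩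
    fun q => ?_
  exact khm_algebra (U := fun i => F.u q.1 q.2.1 i) (V := fun i => F.u q.1 (q.2.1 + q.2.2) i)
    (Z := fun i => F.z q.1 q.2.1 i) (Z' := fun i => F.z q.1 (q.2.1 + q.2.2) i)
    (a := fun i => pd i ψ q.2.1) (q := fun i => pd i k.Q q.2.2)
    (W := fun l i => F.w q.1 q.2.1 (l, i)) (W' := fun l i => F.w q.1 (q.2.1 + q.2.2) (l, i))
    (K := fun i j => k.K i j q.2.2) (T := fun l i j => pd l (k.K i j) q.2.2)
    (P := F.p q.1 q.2.1) (P' := F.p q.1 (q.2.1 + q.2.2)) (ν := ν) (ψ := ψ q.2.1)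
    (ψ' := ψ (q.2.1 + q.2.2)) (Q := k.Q q.2.2) (fun i j => k.symm i j _)
    (fun l i j => by rw [show k.K i j = k.K j i from funext (k.symm i j)])
    (fun j => k.div j _)

end Flow

/-! ### Radial kernels -/

/-- `∫ₛᵇ ρ`. -/
noncomputable def tail (ρ : ℝ → ℝ) (b s : ℝ) : ℝ := ∫ t in s..b, ρ t

section tail

variable {ρ : ℝ → ℝ} {b : ℝ}

lemma hasDerivAt_tail (hρ : Continuous ρ) (s : ℝ) : HasDerivAt (tail ρ b) (-ρ s) s :=
  intervalIntegral.integral_hasDerivAt_left (hρ.intervalIntegrable _ _)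
    (hρ.stronglyMeasurableAtFilter _ _) hρ.continuousAt

lemma contDiff_tail (hρ : ContDiff ℝ (⊤ : ℕ∞) ρ) : ContDiff ℝ (⊤ : ℕ∞) (tail ρ b) := by
  refine contDiff_infty_iff_deriv.2 ⟨fun s => (hasDerivAt_tail hρ.continuous s).differentiableAt, ?_⟩
  have : deriv (tail ρ b) = fun s => -ρ s := funext fun s => (hasDerivAt_tail hρ.continuous s).deriv
  rw [this]
  exact hρ.neg

lemma tail_eq_zero (h : ∀ s, b < s → ρ s = 0) {s : ℝ} (hs : b ≤ s) : tail ρ b s = 0 := by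
  rw [tail, intervalIntegral.integral_symm, neg_eq_zero]
  refine intervalIntegral.integral_zero_ae (.of_forall fun t ht => ?_)
  rw [uIoc_of_le hs] at ht
  exact h t ht.1

lemma tail_nonneg (h : ∀ s, b < s → ρ s = 0) (h0 : ∀ s, 0 ≤ s → 0 ≤ ρ s) {s : ℝ} (hs : 0 ≤ s) :
    0 ≤ tail ρ b s := by
  rcases le_total b s with hb | hb
  · rw [tail_eq_zero h hb]
  · exact intervalIntegral.integral_nonneg hb fun t ht => h0 t (hs.trans ht.1)

lemma tail_le (hρ : Continuous ρ) (h0 : ∀ s, 0 ≤ s → 0 ≤ ρ s) {s : ℝ}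
    (hs : 0 ≤ s) : tail ρ b s ≤ tail ρ b 0 := by
  have e : tail ρ b 0 = (∫ t in (0 : ℝ)..s, ρ t) + tail ρ b s :=
    (intervalIntegral.integral_add_adjacent_intervals (hρ.intervalIntegrable _ _)
      (hρ.intervalIntegrable _ _)).symm
  have := intervalIntegral.integral_nonneg (μ := volume) hs fun t ht => h0 t ht.1
  linarith

lemma tail_eq (hρ : Continuous ρ) {a : ℝ} (h : ∀ s, s < a → ρ s = 0) {s : ℝ}
    (hs : s ≤ a) (hs0 : 0 ≤ s) : tail ρ b s = tail ρ b 0 := by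
  have e : tail ρ b 0 = (∫ t in (0 : ℝ)..s, ρ t) + tail ρ b s :=
    (intervalIntegral.integral_add_adjacent_intervals (hρ.intervalIntegrable _ _)
      (hρ.intervalIntegrable _ _)).symm
  have h2 : ∫ t in (0 : ℝ)..s, ρ t = 0 := by
    rw [intervalIntegral.integral_of_le hs0, integral_Ioc_eq_integral_Ioo]
    exact setIntegral_eq_zero_of_forall_eq_zero fun t ht => h t (ht.2.trans_le hs)
  linarith

end tail

section radial

variable {f : ℝ → ℝ}

lemma pd_radial (hf : ContDiff ℝ (⊤ : ℕ∞) f) (l : Fin 3) (x : E3) :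
    pd l (fun y => f (‖y‖ ^ 2)) x = deriv f (‖x‖ ^ 2) * (2 * x l) := by
  have h1 : HasFDerivAt (fun y : E3 => ‖y‖ ^ 2) (2 • (innerSL ℝ x)) x :=
    (hasStrictFDerivAt_norm_sq x).hasFDerivAt
  have h2 : HasDerivAt f (deriv f (‖x‖ ^ 2)) (‖x‖ ^ 2) :=
    ((hf.differentiable (by simp)).differentiableAt).hasDerivAt
  have h3 := h2.comp_hasFDerivAt x h1
  simp only [pd, Function.comp_def] at h3 ⊢
  rw [h3.fderiv]
  simp [EuclideanSpace.inner_single_right]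

lemma contDiff_radial (hf : ContDiff ℝ (⊤ : ℕ∞) f) : ContDiff ℝ (⊤ : ℕ∞) fun y : E3 => f (‖y‖ ^ 2) :=
  hf.comp (contDiff_norm_sq ℝ)

lemma isTest_radial (hf : ContDiff ℝ (⊤ : ℕ∞) f) {b : ℝ} (hb : ∀ s, b < s → f s = 0) :
    IsTest univ fun y : E3 => f (‖y‖ ^ 2) := by
  refine ⟨contDiff_radial hf, HasCompactSupport.of_support_subset_isCompact
    (isCompact_closedBall (0 : E3) √b) fun y hy => ?_, subset_univ _⟩
  rw [mem_closedBall_zero_iff]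
  by_contra h
  exact hy (hb _ (Real.lt_sq_of_sqrt_lt (not_le.1 h)))

lemma sum_coord_sq (x : E3) : ∑ l, x l * x l = ‖x‖ ^ 2 := by
  rw [EuclideanSpace.norm_sq_eq]; simp [pow_two]

/-- The integral of div(x f(|x|²)) is zero. -/
lemma integral_radial (hf : ContDiff ℝ (⊤ : ℕ∞) f) {b : ℝ} (hb : ∀ s, b < s → f s = 0) :
    3 * ∫ x : E3, f (‖x‖ ^ 2) = - ∫ x : E3, 2 * (‖x‖ ^ 2 * deriv f (‖x‖ ^ 2)) := by
  have ht := isTest_radial hf hb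
  have h1 : ∀ l, ∫ x : E3, pd l (fun y => f (‖y‖ ^ 2)) x * x l = - ∫ x : E3, f (‖x‖ ^ 2) := fun l => by
    rw [integral_pd_mul ht.1 (contDiff_coord l) ht.2.1]
    simp [pd_coord]
  have h2 : ∫ x : E3, 2 * (‖x‖ ^ 2 * deriv f (‖x‖ ^ 2)) =
      ∑ l, ∫ x : E3, pd l (fun y => f (‖y‖ ^ 2)) x * x l := by
    rw [← integral_finsetSum _ fun l _ => ((ht.pd l).mul (contDiff_coord l)).integrable]
    refine integral_congr_ae (.of_forall fun x => ?_)
    simp only [pd_radial hf]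
    rw [← sum_coord_sq, Fin.sum_univ_three, Fin.sum_univ_three]
    ring
  rw [h2]
  simp [h1]

end radial

/-- An admissible weight: smooth, nonnegative, and supported in `[ℓ²/2, 2ℓ²]`. -/
structure Weight (ℓ : ℝ) (ρ : ℝ → ℝ) : Prop where
  contDiff : ContDiff ℝ (⊤ : ℕ∞) ρ
  nonneg : ∀ s, 0 ≤ ρ s
  eq_zero_left : ∀ s, s < ℓ ^ 2 / 2 → ρ s = 0
  eq_zero_right : ∀ s, 2 * ℓ ^ 2 < s → ρ s = 0

namespace Weight

variable {ℓ : ℝ} {ρ : ℝ → ℝ} (hρ : Weight ℓ ρ)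
include hρ

lemma tail_eq_zero {s : ℝ} (hs : 2 * ℓ ^ 2 ≤ s) : tail ρ (2 * ℓ ^ 2) s = 0 :=
  LocalTurbulence.tail_eq_zero hρ.eq_zero_right hs

lemma tail_nonneg {s : ℝ} (hs : 0 ≤ s) : 0 ≤ tail ρ (2 * ℓ ^ 2) s :=
  LocalTurbulence.tail_nonneg hρ.eq_zero_right (fun s _ => hρ.nonneg s) hs

lemma tail_le {s : ℝ} (hs : 0 ≤ s) : tail ρ (2 * ℓ ^ 2) s ≤ tail ρ (2 * ℓ ^ 2) 0 :=
  LocalTurbulence.tail_le hρ.contDiff.continuous (fun s _ => hρ.nonneg s) hs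

lemma contDiff_tail : ContDiff ℝ (⊤ : ℕ∞) (tail ρ (2 * ℓ ^ 2)) :=
  LocalTurbulence.contDiff_tail hρ.contDiff

lemma deriv_tail (s : ℝ) : deriv (tail ρ (2 * ℓ ^ 2)) s = - ρ s :=
  (hasDerivAt_tail hρ.contDiff.continuous s).deriv

lemma tail_tail_eq_zero {s : ℝ} (hs : 2 * ℓ ^ 2 ≤ s) :
    tail (tail ρ (2 * ℓ ^ 2)) (2 * ℓ ^ 2) s = 0 :=
  LocalTurbulence.tail_eq_zero (fun _ h => hρ.tail_eq_zero h.le) hs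

lemma tail_tail_nonneg {s : ℝ} (hs : 0 ≤ s) : 0 ≤ tail (tail ρ (2 * ℓ ^ 2)) (2 * ℓ ^ 2) s :=
  LocalTurbulence.tail_nonneg (fun _ h => hρ.tail_eq_zero h.le) (fun _ h => hρ.tail_nonneg h) hs

lemma tail_tail_le {s : ℝ} (hs : 0 ≤ s) : tail (tail ρ (2 * ℓ ^ 2)) (2 * ℓ ^ 2) s ≤
    2 * ℓ ^ 2 * tail ρ (2 * ℓ ^ 2) 0 := by
  refine (LocalTurbulence.tail_le hρ.contDiff_tail.continuous
    (fun _ h => hρ.tail_nonneg h) hs).trans ?_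
  have h0 : (0 : ℝ) ≤ 2 * ℓ ^ 2 := by positivity
  have := intervalIntegral.integral_mono_on (μ := volume) h0
    (hρ.contDiff_tail.continuous.intervalIntegrable _ _)
    ((continuous_const (y := tail ρ (2 * ℓ ^ 2) 0)).intervalIntegrable _ _)
    fun t ht => hρ.tail_le ht.1
  simpa [tail] using this

end Weight

lemma pd_const_mul {f : E3 → ℝ} (hf : ContDiff ℝ (⊤ : ℕ∞) f) (c : ℝ) (l : Fin 3) (x : E3) :
    pd l (fun y => c * f y) x = c * pd l f x := by
  simp only [pd]
  rw [fderiv_const_mul (hf.differentiable (by simp)).differentiableAt]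
  simp

lemma pd_add {f g : E3 → ℝ} (hf : ContDiff ℝ (⊤ : ℕ∞) f) (hg : ContDiff ℝ (⊤ : ℕ∞) g) (l : Fin 3)
    (x : E3) : pd l (fun y => f y + g y) x = pd l f x + pd l g x := by
  simp only [pd]
  rw [fderiv_fun_add (hf.differentiable (by simp)).differentiableAt
    (hg.differentiable (by simp)).differentiableAt]
  simp

namespace Weight

variable {ℓ : ℝ} {ρ : ℝ → ℝ} (hρ : Weight ℓ ρ)

lemma contDiff_tail_tail (hρ : Weight ℓ ρ) :
    ContDiff ℝ (⊤ : ℕ∞) (tail (tail ρ (2 * ℓ ^ 2)) (2 * ℓ ^ 2)) :=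
  LocalTurbulence.contDiff_tail hρ.contDiff_tail

lemma isTest_tail (hρ : Weight ℓ ρ) : IsTest univ fun h : E3 => tail ρ (2 * ℓ ^ 2) (‖h‖ ^ 2) :=
  isTest_radial hρ.contDiff_tail fun _ hs => hρ.tail_eq_zero hs.le

lemma isTest_tail_tail (hρ : Weight ℓ ρ) :
    IsTest univ fun h : E3 => tail (tail ρ (2 * ℓ ^ 2)) (2 * ℓ ^ 2) (‖h‖ ^ 2) :=
  isTest_radial hρ.contDiff_tail_tail fun _ hs => hρ.tail_tail_eq_zero hs.le

lemma isTest_weight (hρ : Weight ℓ ρ) : IsTest univ fun h : E3 => ρ (‖h‖ ^ 2) :=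
  isTest_radial hρ.contDiff hρ.eq_zero_right

lemma contDiff_coord_mul (i j : Fin 3) : ContDiff ℝ (⊤ : ℕ∞) fun h : E3 => h i * h j :=
  (contDiff_coord i).mul (contDiff_coord j)

lemma pd_tail (hρ : Weight ℓ ρ) (l : Fin 3) (h : E3) :
    pd l (fun h : E3 => tail ρ (2 * ℓ ^ 2) (‖h‖ ^ 2)) h = - ρ (‖h‖ ^ 2) * (2 * h l) := by
  rw [pd_radial hρ.contDiff_tail, hρ.deriv_tail]

lemma pd_tail_tail (hρ : Weight ℓ ρ) (l : Fin 3) (h : E3) :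
    pd l (fun h : E3 => tail (tail ρ (2 * ℓ ^ 2)) (2 * ℓ ^ 2) (‖h‖ ^ 2)) h =
      - tail ρ (2 * ℓ ^ 2) (‖h‖ ^ 2) * (2 * h l) := by
  rw [pd_radial hρ.contDiff_tail_tail, (hasDerivAt_tail hρ.contDiff_tail.continuous _).deriv]

/-- The isotropic kernel. -/
noncomputable def zeroKernel : TwoPointKernel where
  K i j h := (if i = j then 1 else 0) * tail ρ (2 * ℓ ^ 2) (‖h‖ ^ 2)
  Q h := tail ρ (2 * ℓ ^ 2) (‖h‖ ^ 2)
  isTest i j := by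
    have := hρ.isTest_tail.mul (contDiff_const (c := if i = j then (1 : ℝ) else 0))
    simpa only [mul_comm] using this
  isTest_Q := hρ.isTest_tail
  symm i j h := by simp only [eq_comm]
  div j h := by
    simp only [pd_const_mul hρ.isTest_tail.1]
    simp

lemma pd_zeroKernel (l i j : Fin 3) (h : E3) : pd l (hρ.zeroKernel.K i j) h =
    (if i = j then 1 else 0) * (- ρ (‖h‖ ^ 2) * (2 * h l)) := by
  simp only [zeroKernel]
  rw [pd_const_mul hρ.isTest_tail.1, hρ.pd_tail]

lemma pd_parKernel_aux (hρ : Weight ℓ ρ) (l i j : Fin 3) (h : E3) :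
    pd l (fun h : E3 => (if i = j then 1 else 0) * tail (tail ρ (2 * ℓ ^ 2)) (2 * ℓ ^ 2) (‖h‖ ^ 2) +
      tail ρ (2 * ℓ ^ 2) (‖h‖ ^ 2) * (h i * h j)) h =
    (if i = j then 1 else 0) * (- tail ρ (2 * ℓ ^ 2) (‖h‖ ^ 2) * (2 * h l)) +
      (- ρ (‖h‖ ^ 2) * (2 * h l) * (h i * h j) + tail ρ (2 * ℓ ^ 2) (‖h‖ ^ 2) *
        ((if i = l then 1 else 0) * h j + h i * if j = l then 1 else 0)) := by
  rw [pd_add (contDiff_const.mul hρ.isTest_tail_tail.1)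
    (hρ.isTest_tail.1.mul (contDiff_coord_mul i j)), pd_const_mul hρ.isTest_tail_tail.1,
    pd_mul hρ.isTest_tail.1 (contDiff_coord_mul i j), pd_mul (contDiff_coord i) (contDiff_coord j),
    hρ.pd_tail, hρ.pd_tail_tail, pd_coord, pd_coord]

lemma contDiff_mul_tail (hρ : Weight ℓ ρ) :
    ContDiff ℝ (⊤ : ℕ∞) fun s => s * tail ρ (2 * ℓ ^ 2) s := contDiff_id.mul hρ.contDiff_tail

lemma deriv_mul_tail (hρ : Weight ℓ ρ) (s : ℝ) : deriv (fun s => s * tail ρ (2 * ℓ ^ 2) s) s =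
    tail ρ (2 * ℓ ^ 2) s - s * ρ s := by
  have := ((hasDerivAt_id s).mul (hasDerivAt_tail (b := 2 * ℓ ^ 2) hρ.contDiff.continuous s)).deriv
  simp only [id_eq, one_mul] at this
  rw [show (fun s => s * tail ρ (2 * ℓ ^ 2) s) = id * tail ρ (2 * ℓ ^ 2) from rfl, this]
  ring

/-- The kernel which singles out longitudinal increments. -/
noncomputable def parKernel : TwoPointKernel where
  K i j h := (if i = j then 1 else 0) * tail (tail ρ (2 * ℓ ^ 2)) (2 * ℓ ^ 2) (‖h‖ ^ 2) +
    tail ρ (2 * ℓ ^ 2) (‖h‖ ^ 2) * (h i * h j)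
  Q h := ‖h‖ ^ 2 * tail ρ (2 * ℓ ^ 2) (‖h‖ ^ 2)
  isTest i j := by
    have h1 := hρ.isTest_tail_tail.mul (contDiff_const (c := if i = j then (1 : ℝ) else 0))
    have h2 := h1.add (hρ.isTest_tail.mul (contDiff_coord_mul i j))
    convert h2 using 1
    funext h
    simp only [Pi.add_apply]; ring
  isTest_Q := isTest_radial hρ.contDiff_mul_tail fun s hs => by rw [hρ.tail_eq_zero hs.le, mul_zero]
  symm i j h := by simp only [eq_comm, mul_comm (h i)]
  div j h := by
    -- With F the tail of ρ, the divergence is −2F h_j − 2ρ|h|²h_j + (3 + 1)F h_j, which is ∂_j of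
    -- |h|²F.
    simp only [hρ.pd_parKernel_aux]
    rw [pd_radial hρ.contDiff_mul_tail, hρ.deriv_mul_tail, ← sum_coord_sq]
    fin_cases j <;> simp [Fin.sum_univ_three] <;> ring

lemma pd_parKernel (l i j : Fin 3) (h : E3) : pd l (hρ.parKernel.K i j) h =
    (if i = j then 1 else 0) * (- tail ρ (2 * ℓ ^ 2) (‖h‖ ^ 2) * (2 * h l)) +
      (- ρ (‖h‖ ^ 2) * (2 * h l) * (h i * h j) + tail ρ (2 * ℓ ^ 2) (‖h‖ ^ 2) *
        ((if i = l then 1 else 0) * h j + h i * if j = l then 1 else 0)) :=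
  hρ.pd_parKernel_aux l i j h

/-- `integral_radial` applied to the tail F, where F' = −ρ, gives 3∫F = 2∫ρ|h|². This is the factor
2/3 of the law for `structZero`. -/
lemma integral_zeroKernel : ∫ h, hρ.zeroKernel.Q h = 2 / 3 * ∫ h : E3, ρ (‖h‖ ^ 2) * ‖h‖ ^ 2 := by
  have := integral_radial hρ.contDiff_tail fun _ hs => hρ.tail_eq_zero hs.le
  simp only [hρ.deriv_tail] at this
  have e : ∀ x : E3, 2 * (‖x‖ ^ 2 * - ρ (‖x‖ ^ 2)) = (-2) * (ρ (‖x‖ ^ 2) * ‖x‖ ^ 2) := fun x => by ring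
  simp only [e, integral_const_mul] at this
  simp only [zeroKernel]
  linarith

/-- `integral_radial` applied to sF(s) gives 3∫|h|²F = −2∫|h|²F + 2∫ρ|h|⁴. This is the factor 2/5 of
the longitudinal law. -/
lemma integral_parKernel : ∫ h, hρ.parKernel.Q h = 2 / 5 * ∫ h : E3, ρ (‖h‖ ^ 2) * ‖h‖ ^ 4 := by
  have := integral_radial hρ.contDiff_mul_tail fun s hs => by rw [hρ.tail_eq_zero hs.le, mul_zero]
  simp only [hρ.deriv_mul_tail] at this
  have e : ∀ x : E3, 2 * (‖x‖ ^ 2 * (tail ρ (2 * ℓ ^ 2) (‖x‖ ^ 2) - ‖x‖ ^ 2 * ρ (‖x‖ ^ 2))) =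
      2 * (‖x‖ ^ 2 * tail ρ (2 * ℓ ^ 2) (‖x‖ ^ 2)) - 2 * (ρ (‖x‖ ^ 2) * ‖x‖ ^ 4) := fun x => by ring
  have i1 : Integrable fun x : E3 => ‖x‖ ^ 2 * tail ρ (2 * ℓ ^ 2) (‖x‖ ^ 2) :=
    hρ.parKernel.isTest_Q.integrable
  have i2 : Integrable fun x : E3 => ρ (‖x‖ ^ 2) * ‖x‖ ^ 4 := by
    have h1 := (hρ.isTest_weight.mul ((contDiff_norm_sq ℝ).pow 2)).integrable
    refine h1.congr (.of_forall fun x => ?_)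
    simp only; ring
  simp only [e] at this
  rw [integral_sub (i1.const_mul 2) (i2.const_mul 2), integral_const_mul, integral_const_mul] at this
  simp only [parKernel]
  linarith

end Weight

/-! ### Bounds for the radial kernels in terms of the integral of Q. -/

namespace Weight

variable {ℓ : ℝ} {ρ : ℝ → ℝ} (hρ : Weight ℓ ρ)
include hρ

/-- A multiple of the indicator of the ball that contains the supports of the kernels. -/
lemma integrable_ball (m : ℝ) :
    Integrable ((Metric.closedBall (0 : E3) (2 * ℓ)).indicator fun _ => m) := by
  have := hρ
  exact (integrable_indicator_iff Metric.isClosed_closedBall.measurableSet).2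
    (integrableOn_const measure_closedBall_lt_top.ne)

lemma integrable_mul_norm_pow (n : ℕ) : Integrable fun h : E3 => ρ (‖h‖ ^ 2) * ‖h‖ ^ n := by
  have h1 := hρ.isTest_weight
  exact (h1.1.continuous.mul (continuous_norm.pow n)).integrable_of_hasCompactSupport
    h1.2.1.mul_right

lemma sq_le_of_norm (hℓ : 0 < ℓ) {h : E3} (hh : 2 * ℓ < ‖h‖) : 2 * ℓ ^ 2 ≤ ‖h‖ ^ 2 := by
  have := hρ
  nlinarith

/-- The weight vanishes for s < ℓ²/2, so the tail equals its maximum on the ball of radius ℓ/2.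
Passing to radius 2ℓ multiplies the volume by 4³ = 64. -/
lemma integral_ball_le (hℓ : 0 < ℓ) :
    ∫ h, (Metric.closedBall (0 : E3) (2 * ℓ)).indicator (fun _ => tail ρ (2 * ℓ ^ 2) 0) h ≤
      64 * ∫ h, hρ.zeroKernel.Q h := by
  set m := tail ρ (2 * ℓ ^ 2) 0 with hm
  have hm0 : 0 ≤ m := hρ.tail_nonneg le_rfl
  have h1 : ∫ h, (Metric.closedBall (0 : E3) (ℓ / 2)).indicator (fun _ => m) h ≤
      ∫ h, hρ.zeroKernel.Q h := by
    refine integral_mono ((integrable_indicator_iff Metric.isClosed_closedBall.measurableSet).2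
      (integrableOn_const measure_closedBall_lt_top.ne)) hρ.zeroKernel.isTest_Q.integrable
      fun h => ?_
    simp only [zeroKernel]
    refine indicator_apply_le' (fun hh => ?_) fun _ => hρ.tail_nonneg (by positivity)
    rw [mem_closedBall_zero_iff] at hh
    exact (tail_eq (b := 2 * ℓ ^ 2) (s := ‖h‖ ^ 2) hρ.contDiff.continuous hρ.eq_zero_left
      (by nlinarith [norm_nonneg h]) (by positivity)).ge
  rw [integral_indicator Metric.isClosed_closedBall.measurableSet, setIntegral_const,
    smul_eq_mul] at h1 ⊢
  rw [Measure.addHaar_real_closedBall _ _ (by positivity)] at h1 ⊢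
  have h3 : Module.finrank ℝ E3 = 3 := by simp
  rw [h3] at h1 ⊢
  nlinarith

/-- On the support of the weight |h| ≥ ℓ/√2 ≥ ℓ/2, so one power of |h| can be exchanged for 2/ℓ. -/
lemma integral_norm_mul_le (hℓ : 0 < ℓ) (n : ℕ) :
    ∫ h : E3, ρ (‖h‖ ^ 2) * ‖h‖ ^ n ≤ 2 / ℓ * ∫ h : E3, ρ (‖h‖ ^ 2) * ‖h‖ ^ (n + 1) := by
  rw [← integral_const_mul]
  refine integral_mono (hρ.integrable_mul_norm_pow n) ((hρ.integrable_mul_norm_pow _).const_mul _)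
    fun h => ?_
  by_cases hs : ‖h‖ ^ 2 < ℓ ^ 2 / 2
  · simp [hρ.eq_zero_left _ hs]
  · have h1 : ℓ / 2 ≤ ‖h‖ := by
      by_contra hc
      push Not at hc hs
      nlinarith [norm_nonneg h]
    have h2 : 1 ≤ 2 / ℓ * ‖h‖ := by
      rw [div_mul_eq_mul_div, le_div_iff₀ hℓ]; linarith
    have h3 : 0 ≤ ρ (‖h‖ ^ 2) * ‖h‖ ^ n := mul_nonneg (hρ.nonneg _) (by positivity)
    calc ρ (‖h‖ ^ 2) * ‖h‖ ^ n = ρ (‖h‖ ^ 2) * ‖h‖ ^ n * 1 := (mul_one _).symm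
      _ ≤ ρ (‖h‖ ^ 2) * ‖h‖ ^ n * (2 / ℓ * ‖h‖) := by gcongr
      _ = _ := by ring

omit hρ in
lemma abs_ite_le (p : Prop) [Decidable p] : |(if p then 1 else 0 : ℝ)| ≤ 1 := by
  split_ifs <;> simp

/-- The relevant scaling: the kernel is comparable to its potential in the mean, and a derivative
costs 1/ℓ. The constants are generous so as to serve both kernels. -/
lemma exists_bound_zeroKernel (hℓ : 0 < ℓ) : ∃ k₀ k₁ : E3 → ℝ,
    Flow.KernelBound hρ.zeroKernel k₀ k₁ (2 * ℓ) ∧ ∫ h, k₀ h ≤ 1000 * ∫ h, hρ.zeroKernel.Q h ∧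
      ∫ h, k₁ h ≤ 3000 / ℓ * ∫ h, hρ.zeroKernel.Q h := by
  set m := tail ρ (2 * ℓ ^ 2) 0 with hm
  have hκ : 0 ≤ ∫ h, hρ.zeroKernel.Q h := integral_nonneg fun h => hρ.tail_nonneg (by positivity)
  have hQ : ∀ h : E3, |tail ρ (2 * ℓ ^ 2) (‖h‖ ^ 2)| ≤
      (Metric.closedBall (0 : E3) (2 * ℓ)).indicator (fun _ => m) h := fun h => by
    rw [abs_of_nonneg (hρ.tail_nonneg (by positivity))]
    by_cases hh : h ∈ Metric.closedBall (0 : E3) (2 * ℓ)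
    · rw [indicator_of_mem hh]; exact hρ.tail_le (by positivity)
    · rw [indicator_of_notMem hh, hρ.tail_eq_zero]
      rw [mem_closedBall_zero_iff, not_le] at hh
      exact hρ.sq_le_of_norm hℓ hh
  refine ⟨_, fun h => 2 * (ρ (‖h‖ ^ 2) * ‖h‖ ^ 1), ⟨fun i j h => ?_, hQ, fun l i j h => ?_,
    fun h hh => ?_, hρ.integrable_ball m, (hρ.integrable_mul_norm_pow 1).const_mul 2⟩, ?_, ?_⟩
  · simp only [zeroKernel]
    rw [abs_mul]
    exact (mul_le_of_le_one_left (abs_nonneg _) (abs_ite_le _)).trans (hQ h)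
  · rw [hρ.pd_zeroKernel, abs_mul, abs_mul, abs_neg, abs_of_nonneg (hρ.nonneg _), abs_mul,
      abs_of_pos (by norm_num : (0 : ℝ) < 2)]
    have h1 := abs_coord_le h l
    have h2 := hρ.nonneg (‖h‖ ^ 2)
    calc _ ≤ 1 * (ρ (‖h‖ ^ 2) * (2 * ‖h‖)) := by gcongr; exact abs_ite_le _
      _ = _ := by ring
  · rw [indicator_of_notMem]
    rwa [mem_closedBall_zero_iff, not_le]
  · exact (hρ.integral_ball_le hℓ).trans (by linarith)
  · rw [integral_const_mul]
    have h1 := hρ.integral_norm_mul_le hℓ 1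
    have h2 := hρ.integral_zeroKernel
    have h3 : 0 ≤ ∫ h : E3, ρ (‖h‖ ^ 2) * ‖h‖ ^ (1 + 1) := by
      norm_num; linarith
    calc 2 * ∫ h : E3, ρ (‖h‖ ^ 2) * ‖h‖ ^ 1
        ≤ 2 * (2 / ℓ * ∫ h : E3, ρ (‖h‖ ^ 2) * ‖h‖ ^ (1 + 1)) := by gcongr
      _ = 6 / ℓ * (2 / 3 * ∫ h : E3, ρ (‖h‖ ^ 2) * ‖h‖ ^ 2) := by norm_num; ring
      _ ≤ 3000 / ℓ * (2 / 3 * ∫ h : E3, ρ (‖h‖ ^ 2) * ‖h‖ ^ 2) := by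
        have h4 : 0 ≤ ∫ h : E3, ρ (‖h‖ ^ 2) * ‖h‖ ^ 2 := h3
        gcongr; norm_num
      _ = _ := by rw [h2]

/-- On the support of the weight |h|² ≥ ℓ²/2; the constant is (2/3)·2·(5/2) = 10/3. It transfers the
ball estimate for the isotropic kernel to the longitudinal one. -/
lemma sq_mul_le_parKernel : ℓ ^ 2 * ∫ h, hρ.zeroKernel.Q h ≤ 10 / 3 * ∫ h, hρ.parKernel.Q h := by
  rw [hρ.integral_zeroKernel, hρ.integral_parKernel]
  have h1 : ℓ ^ 2 / 2 * ∫ h : E3, ρ (‖h‖ ^ 2) * ‖h‖ ^ 2 ≤ ∫ h : E3, ρ (‖h‖ ^ 2) * ‖h‖ ^ 4 := by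
    rw [← integral_const_mul]
    refine integral_mono ((hρ.integrable_mul_norm_pow 2).const_mul _) (hρ.integrable_mul_norm_pow 4)
      fun h => ?_
    by_cases hs : ‖h‖ ^ 2 < ℓ ^ 2 / 2
    · simp [hρ.eq_zero_left _ hs]
    · push Not at hs
      have h3 : 0 ≤ ρ (‖h‖ ^ 2) * ‖h‖ ^ 2 := mul_nonneg (hρ.nonneg _) (by positivity)
      calc ℓ ^ 2 / 2 * (ρ (‖h‖ ^ 2) * ‖h‖ ^ 2) ≤ ‖h‖ ^ 2 * (ρ (‖h‖ ^ 2) * ‖h‖ ^ 2) := by gcongr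
        _ = _ := by ring
  linarith

/-- The iterated tail is at most 2ℓ²m and |h|²F at most 2ℓ²m, where m is the maximum of the tail F.
The derivative has terms F|h|, at most 2ℓm on the ball, and ρ|h|³; both cost 1/ℓ relative to ∫Q. -/
lemma exists_bound_parKernel (hℓ : 0 < ℓ) : ∃ k₀ k₁ : E3 → ℝ,
    Flow.KernelBound hρ.parKernel k₀ k₁ (2 * ℓ) ∧ ∫ h, k₀ h ≤ 1000 * ∫ h, hρ.parKernel.Q h ∧
      ∫ h, k₁ h ≤ 3000 / ℓ * ∫ h, hρ.parKernel.Q h := by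
  set m := tail ρ (2 * ℓ ^ 2) 0 with hm
  have hm0 : 0 ≤ m := hρ.tail_nonneg le_rfl
  have hκ : 0 ≤ ∫ h, hρ.parKernel.Q h := integral_nonneg fun h =>
    mul_nonneg (by positivity) (hρ.tail_nonneg (by positivity))
  have hF1 : ∀ h : E3, 0 ≤ tail ρ (2 * ℓ ^ 2) (‖h‖ ^ 2) := fun h => hρ.tail_nonneg (by positivity)
  have hF2 : ∀ h : E3, 0 ≤ tail (tail ρ (2 * ℓ ^ 2)) (2 * ℓ ^ 2) (‖h‖ ^ 2) := fun h =>
    hρ.tail_tail_nonneg (by positivity)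
  have hout : ∀ h : E3, h ∉ Metric.closedBall (0 : E3) (2 * ℓ) → 2 * ℓ ^ 2 ≤ ‖h‖ ^ 2 := fun h hh => by
    rw [mem_closedBall_zero_iff, not_le] at hh
    exact hρ.sq_le_of_norm hℓ hh
  have hQ : ∀ h : E3, ‖h‖ ^ 2 * tail ρ (2 * ℓ ^ 2) (‖h‖ ^ 2) ≤ 2 * ℓ ^ 2 * m := fun h => by
    by_cases hh : 2 * ℓ ^ 2 ≤ ‖h‖ ^ 2
    · rw [hρ.tail_eq_zero hh, mul_zero]; positivity
    · have h1 := hρ.tail_le (s := ‖h‖ ^ 2) (by positivity)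
      have h2 := hF1 h
      push Not at hh
      gcongr
  have hcc : ∀ (h : E3) (i j : Fin 3), |h i * h j| ≤ ‖h‖ ^ 2 := fun h i j => by
    rw [abs_mul, pow_two]; gcongr <;> exact abs_coord_le _ _
  set k₀ : E3 → ℝ := (Metric.closedBall (0 : E3) (2 * ℓ)).indicator fun _ => 4 * ℓ ^ 2 * m with hk₀
  set k₁ : E3 → ℝ := fun h => (Metric.closedBall (0 : E3) (2 * ℓ)).indicator
    (fun _ => 8 * ℓ * m) h + 2 * (ρ (‖h‖ ^ 2) * ‖h‖ ^ 3) with hk₁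
  have hball : ∀ c : ℝ, ∫ h, (Metric.closedBall (0 : E3) (2 * ℓ)).indicator (fun _ => c * m) h =
      c * ∫ h, (Metric.closedBall (0 : E3) (2 * ℓ)).indicator (fun _ => m) h := fun c => by
    rw [← integral_const_mul]
    refine integral_congr_ae (.of_forall fun h => ?_)
    by_cases hh : h ∈ Metric.closedBall (0 : E3) (2 * ℓ)
    · simp only [indicator_of_mem hh]
    · simp only [indicator_of_notMem hh, mul_zero]
  have hb := hρ.integral_ball_le hℓ
  have hsq := hρ.sq_mul_le_parKernel
  refine ⟨k₀, k₁, ⟨fun i j h => ?_, fun h => ?_, fun l i j h => ?_, fun h hh => ?_,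
    hρ.integrable_ball _, (hρ.integrable_ball _).add ((hρ.integrable_mul_norm_pow 3).const_mul 2)⟩,
    ?_, ?_⟩
  · simp only [parKernel, hk₀]
    by_cases hh : h ∈ Metric.closedBall (0 : E3) (2 * ℓ)
    · rw [indicator_of_mem hh]
      refine (abs_add_le _ _).trans ?_
      rw [abs_mul, abs_mul, abs_of_nonneg (hF1 h), abs_of_nonneg (hF2 h)]
      have h1 : |(if i = j then 1 else 0 : ℝ)| * tail (tail ρ (2 * ℓ ^ 2)) (2 * ℓ ^ 2) (‖h‖ ^ 2) ≤
          2 * ℓ ^ 2 * m :=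
        (mul_le_of_le_one_left (hF2 h) (abs_ite_le _)).trans (hρ.tail_tail_le (by positivity))
      have h2 : tail ρ (2 * ℓ ^ 2) (‖h‖ ^ 2) * |h i * h j| ≤
          ‖h‖ ^ 2 * tail ρ (2 * ℓ ^ 2) (‖h‖ ^ 2) := by
        rw [mul_comm]; exact mul_le_mul_of_nonneg_right (hcc h i j) (hF1 h)
      have := hQ h
      linarith
    · rw [hρ.tail_eq_zero (hout h hh), hρ.tail_tail_eq_zero (hout h hh), indicator_of_notMem hh]
      simp
  · simp only [parKernel, hk₀]
    by_cases hh : h ∈ Metric.closedBall (0 : E3) (2 * ℓ)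
    · rw [indicator_of_mem hh, abs_of_nonneg (mul_nonneg (by positivity) (hF1 h))]
      have : 0 ≤ 2 * ℓ ^ 2 * m := by positivity
      linarith [hQ h]
    · rw [hρ.tail_eq_zero (hout h hh), indicator_of_notMem hh]; simp
  · rw [hρ.pd_parKernel]
    have c1 := abs_coord_le h l
    have c2 := abs_coord_le h i
    have c3 := abs_coord_le h j
    have hr := hρ.nonneg (‖h‖ ^ 2)
    have hn := norm_nonneg h
    have b1 : |(if i = j then 1 else 0 : ℝ) * (- tail ρ (2 * ℓ ^ 2) (‖h‖ ^ 2) * (2 * h l))| ≤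
        2 * (tail ρ (2 * ℓ ^ 2) (‖h‖ ^ 2) * ‖h‖) := by
      rw [abs_mul, abs_mul, abs_neg, abs_of_nonneg (hF1 h), abs_mul,
        abs_of_pos (by norm_num : (0 : ℝ) < 2)]
      have := hF1 h
      calc _ ≤ 1 * (tail ρ (2 * ℓ ^ 2) (‖h‖ ^ 2) * (2 * ‖h‖)) := by gcongr; exact abs_ite_le _
        _ = _ := by ring
    have b2 : |- ρ (‖h‖ ^ 2) * (2 * h l) * (h i * h j)| ≤ 2 * (ρ (‖h‖ ^ 2) * ‖h‖ ^ 3) := by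
      rw [abs_mul, abs_mul, abs_neg, abs_of_nonneg hr, abs_mul,
        abs_of_pos (by norm_num : (0 : ℝ) < 2)]
      calc _ ≤ ρ (‖h‖ ^ 2) * (2 * ‖h‖) * ‖h‖ ^ 2 := by gcongr; exact hcc h i j
        _ = _ := by ring
    have b3 : |tail ρ (2 * ℓ ^ 2) (‖h‖ ^ 2) *
        ((if i = l then 1 else 0) * h j + h i * if j = l then 1 else 0)| ≤
        2 * (tail ρ (2 * ℓ ^ 2) (‖h‖ ^ 2) * ‖h‖) := by
      rw [abs_mul, abs_of_nonneg (hF1 h)]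
      have d1 : |(if i = l then 1 else 0 : ℝ) * h j| ≤ ‖h‖ := by
        rw [abs_mul]; exact (mul_le_of_le_one_left (abs_nonneg _) (abs_ite_le _)).trans c3
      have d2 : |h i * (if j = l then 1 else 0 : ℝ)| ≤ ‖h‖ := by
        rw [abs_mul]; exact (mul_le_of_le_one_right (abs_nonneg _) (abs_ite_le _)).trans c2
      have d3 := (abs_add_le ((if i = l then 1 else 0 : ℝ) * h j) (h i * if j = l then 1 else 0))
      calc _ ≤ tail ρ (2 * ℓ ^ 2) (‖h‖ ^ 2) * (2 * ‖h‖) :=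
            mul_le_mul_of_nonneg_left (by linarith) (hF1 h)
        _ = _ := by ring
    have b4 : 4 * (tail ρ (2 * ℓ ^ 2) (‖h‖ ^ 2) * ‖h‖) ≤
        (Metric.closedBall (0 : E3) (2 * ℓ)).indicator (fun _ => 8 * ℓ * m) h := by
      by_cases hh : h ∈ Metric.closedBall (0 : E3) (2 * ℓ)
      · rw [indicator_of_mem hh]
        rw [mem_closedBall_zero_iff] at hh
        have h1 := hρ.tail_le (s := ‖h‖ ^ 2) (by positivity)
        calc 4 * (tail ρ (2 * ℓ ^ 2) (‖h‖ ^ 2) * ‖h‖) ≤ 4 * (m * (2 * ℓ)) := by gcongr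
          _ = _ := by ring
      · rw [hρ.tail_eq_zero (hout h hh), indicator_of_notMem hh]; simp
    refine (abs_add_le _ _).trans ((add_le_add b1 ((abs_add_le _ _).trans (add_le_add b2 b3))).trans ?_)
    simp only [hk₁]
    linarith
  · rw [hk₀, indicator_of_notMem]
    rwa [mem_closedBall_zero_iff, not_le]
  · rw [hk₀, hball]
    nlinarith
  · simp only [hk₁]
    rw [integral_add (hρ.integrable_ball _) ((hρ.integrable_mul_norm_pow 3).const_mul 2), hball,
      integral_const_mul]
    have h1 := hρ.integral_norm_mul_le hℓ 3
    have h2 := hρ.integral_parKernel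
    norm_num at h1
    have h3 : 8 * ℓ * ∫ h, (Metric.closedBall (0 : E3) (2 * ℓ)).indicator (fun _ => m) h ≤
        1800 / ℓ * ∫ h, hρ.parKernel.Q h := by
      rw [div_mul_eq_mul_div, le_div_iff₀ hℓ]
      nlinarith
    have h4 : 2 * ∫ h : E3, ρ (‖h‖ ^ 2) * ‖h‖ ^ 3 ≤ 10 / ℓ * ∫ h, hρ.parKernel.Q h := by
      rw [h2]
      calc _ ≤ 2 * (2 / ℓ * ∫ h : E3, ρ (‖h‖ ^ 2) * ‖h‖ ^ 4) := by gcongr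
        _ = _ := by ring
    have h5 : 1800 / ℓ * (∫ h, hρ.parKernel.Q h) + 10 / ℓ * ∫ h, hρ.parKernel.Q h ≤
        3000 / ℓ * ∫ h, hρ.parKernel.Q h := by
      rw [← add_mul]
      refine mul_le_mul_of_nonneg_right ?_ hκ
      rw [← add_div]
      gcongr
      norm_num
    linarith

end Weight

/-! ### Spherical means -/

/-- The surface measure of the unit sphere. -/
noncomputable abbrev surface : Measure (Metric.sphere (0 : E3) 1) := (volume : Measure E3).toSphere

/-- The mean of `s` over the sphere of radius `r`. -/
noncomputable def sphereMean (s : E3 → ℝ) (r : ℝ) : ℝ :=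
  1 / (4 * Real.pi) * ∫ n : Metric.sphere (0 : E3) 1, s (r • (n : E3)) ∂surface

lemma surface_real_univ : surface.real univ = 4 * Real.pi := by
  rw [Measure.toSphere_real_apply_univ, measureReal_def, EuclideanSpace.volume_ball_fin_three]
  have : 0 ≤ Real.pi * 4 / 3 := by positivity
  simp [ENNReal.toReal_ofReal this]
  ring

lemma polar_eq : (fun q : Metric.sphere (0 : E3) 1 × Ioi (0 : ℝ) => (q.2 : ℝ) • (q.1 : E3)) =
    Subtype.val ∘ (homeomorphUnitSphereProd E3).symm := by
  funext q; simp

lemma measurableEmbedding_polar :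
    MeasurableEmbedding fun q : Metric.sphere (0 : E3) 1 × Ioi (0 : ℝ) => (q.2 : ℝ) • (q.1 : E3) := by
  rw [polar_eq]
  exact (MeasurableEmbedding.subtype_coe (measurableSet_singleton (0 : E3)).compl).comp
    (homeomorphUnitSphereProd E3).symm.measurableEmbedding

/-- Polar coordinates as a measure preserving map. The origin, missed by the parametrization, is a
null set. -/
lemma measurePreserving_polar :
    MeasurePreserving (fun q : Metric.sphere (0 : E3) 1 × Ioi (0 : ℝ) => (q.2 : ℝ) • (q.1 : E3))
      (surface.prod (Measure.volumeIoiPow 2)) volume := by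
  rw [polar_eq]
  have h1 : MeasurePreserving (homeomorphUnitSphereProd E3)
      ((volume : Measure E3).comap Subtype.val) (surface.prod (Measure.volumeIoiPow 2)) := by
    have := (volume : Measure E3).measurePreserving_homeomorphUnitSphereProd
    simpa using this
  have h2 : MeasurePreserving (homeomorphUnitSphereProd E3).symm
      (surface.prod (Measure.volumeIoiPow 2)) ((volume : Measure E3).comap Subtype.val) :=
    h1.symm (homeomorphUnitSphereProd E3).toMeasurableEquiv
  have h3 : MeasurePreserving (Subtype.val : ({0}ᶜ : Set E3) → E3)
      ((volume : Measure E3).comap Subtype.val) volume := by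
    have := measurePreserving_subtype_coe (μa := (volume : Measure E3))
      (measurableSet_singleton (0 : E3)).compl
    rwa [restrict_compl_singleton] at this
  exact h3.comp h2

/-- A radial factor does not distinguish a function from its spherical mean, so integrals against
weights only see structure functions averaged over directions. -/
lemma integral_sphereMean {f : ℝ → ℝ} {s : E3 → ℝ} (hi : Integrable fun h : E3 => f ‖h‖ * s h) :
    Integrable (fun h : E3 => f ‖h‖ * sphereMean s ‖h‖) ∧
      ∫ h : E3, f ‖h‖ * sphereMean s ‖h‖ = ∫ h : E3, f ‖h‖ * s h := by
  have hn : ∀ q : Metric.sphere (0 : E3) 1 × Ioi (0 : ℝ), ‖(q.2 : ℝ) • (q.1 : E3)‖ = q.2 := fun q => by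
    rw [norm_smul, norm_eq_of_mem_sphere, mul_one, Real.norm_of_nonneg (le_of_lt q.2.2)]
  have h1 := (measurePreserving_polar.integrable_comp_emb measurableEmbedding_polar).2 hi
  simp only [Function.comp_def, hn] at h1
  have e : ∀ r : Ioi (0 : ℝ), f r * sphereMean s r = 1 / (4 * Real.pi) *
      ∫ n : Metric.sphere (0 : E3) 1, f r * s ((r : ℝ) • (n : E3)) ∂surface := fun r => by
    rw [sphereMean, integral_const_mul]; ring
  have h2 : Integrable (fun r : Ioi (0 : ℝ) => f r * sphereMean s r) (Measure.volumeIoiPow 2) := by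
    simp only [e]
    exact h1.integral_prod_right.const_mul _
  have h3 : Integrable (fun q : Metric.sphere (0 : E3) 1 × Ioi (0 : ℝ) => f q.2 * sphereMean s q.2)
      (surface.prod (Measure.volumeIoiPow 2)) := h2.comp_snd surface
  refine ⟨?_, ?_⟩
  · refine (measurePreserving_polar.integrable_comp_emb measurableEmbedding_polar).1 ?_
    simpa only [Function.comp_def, hn] using h3
  · rw [← measurePreserving_polar.integral_comp measurableEmbedding_polar,
      ← measurePreserving_polar.integral_comp measurableEmbedding_polar]
    simp only [hn]
    rw [integral_prod_symm _ h3, integral_prod_symm _ h1]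
    refine integral_congr_ae (.of_forall fun r => ?_)
    simp only [integral_const, surface_real_univ, smul_eq_mul, e]
    have := Real.pi_pos
    field_simp

/-- A function which is bounded in the mean with respect to all weights near a point is bounded at
the point. -/
lemma abs_le_of_weight {ℓ : ℝ} (hℓ : 0 < ℓ) {b : ℕ} {f : ℝ → ℝ} {E : ℝ} (hc : ContinuousAt f ℓ)
    (hi : ∀ ρ, Weight ℓ ρ → Integrable fun h : E3 => ρ (‖h‖ ^ 2) * ‖h‖ ^ b * f ‖h‖)
    (hE : ∀ ρ, Weight ℓ ρ → |∫ h : E3, ρ (‖h‖ ^ 2) * ‖h‖ ^ b * f ‖h‖| ≤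
      E * ∫ h : E3, ρ (‖h‖ ^ 2) * ‖h‖ ^ b) : |f ℓ| ≤ E := by
  by_contra! hlt
  obtain ⟨s, hs, hsf⟩ : ∃ s : ℝ, |s| = 1 ∧ s * f ℓ = |f ℓ| := by
    rcases le_total 0 (f ℓ) with h | h
    · exact ⟨1, by simp, by rw [abs_of_nonneg h, one_mul]⟩
    · exact ⟨-1, by simp, by rw [abs_of_nonpos h]; ring⟩
  -- By continuity s·f exceeds E' > E near ℓ, and a bump weight concentrated there contradicts the
  -- bound in the mean.
  obtain ⟨E', hE1, hE2⟩ := exists_between hlt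
  have h1 : ∀ᶠ r in 𝓝 ℓ, E' < s * f r :=
    (hc.const_mul s).eventually (lt_mem_nhds (by simp only [hsf]; exact hE2))
  obtain ⟨δ, hδ, hball⟩ := Metric.eventually_nhds_iff.1 h1
  -- The bound ε ≤ ℓδ gives |r − ℓ| < δ, because |r² − ℓ²| ≥ ℓ|r − ℓ|. The bound ε ≤ ℓ²/2 keeps the
  -- bump an admissible weight.
  set ε := min (ℓ * δ) (ℓ ^ 2 / 2) with hε
  have hε0 : 0 < ε := by positivity
  set g : ContDiffBump (ℓ ^ 2) := ⟨ε / 2, ε, by positivity, by linarith⟩ with hg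
  have hsupp : ∀ t, g t ≠ 0 → |t - ℓ ^ 2| < ε := fun t ht => by
    have : t ∈ Function.support g := ht
    rw [g.support_eq, Metric.mem_ball, Real.dist_eq] at this
    exact this
  have hW : Weight ℓ g := by
    refine ⟨g.contDiff, fun t => g.nonneg, fun t ht => ?_, fun t ht => ?_⟩
    · by_contra h
      have h2 := abs_lt.1 (hsupp t h)
      have h3 : ε ≤ ℓ ^ 2 / 2 := min_le_right _ _
      linarith
    · by_contra h
      have h2 := abs_lt.1 (hsupp t h)
      have h3 : ε ≤ ℓ ^ 2 / 2 := min_le_right _ _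
      nlinarith
  have hw := hW.integrable_mul_norm_pow b
  have hpos : 0 < ∫ h : E3, g (‖h‖ ^ 2) * ‖h‖ ^ b := by
    have h2 := hW.isTest_weight
    refine Continuous.integral_pos_of_hasCompactSupport_nonneg_nonzero
      (x := EuclideanSpace.single 0 ℓ) (h2.1.continuous.mul (continuous_norm.pow b)) h2.2.1.mul_right
      (fun h => mul_nonneg g.nonneg (by positivity)) ?_
    have h3 : ‖(EuclideanSpace.single 0 ℓ : E3)‖ = ℓ := by simp [abs_of_pos hℓ]
    simp only [h3]
    have h4 : g (ℓ ^ 2) = 1 := g.one_of_mem_closedBall (Metric.mem_closedBall_self (by positivity))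
    rw [h4]; positivity
  have hle : E' * ∫ h : E3, g (‖h‖ ^ 2) * ‖h‖ ^ b ≤
      s * ∫ h : E3, g (‖h‖ ^ 2) * ‖h‖ ^ b * f ‖h‖ := by
    rw [← integral_const_mul, ← integral_const_mul]
    refine integral_mono (hw.const_mul _) ((hi _ hW).const_mul _) fun h => ?_
    by_cases h0 : g (‖h‖ ^ 2) = 0
    · simp [h0]
    · have h2 := hsupp _ h0
      have h3 : |‖h‖ - ℓ| < δ := by
        have h4 : |‖h‖ ^ 2 - ℓ ^ 2| = |‖h‖ - ℓ| * (‖h‖ + ℓ) := by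
          rw [show ‖h‖ ^ 2 - ℓ ^ 2 = (‖h‖ - ℓ) * (‖h‖ + ℓ) by ring, abs_mul,
            abs_of_nonneg (by positivity : 0 ≤ ‖h‖ + ℓ)]
        have h5 : ε ≤ ℓ * δ := min_le_left _ _
        by_contra! h6
        have h7 : δ * ℓ ≤ |‖h‖ - ℓ| * (‖h‖ + ℓ) := by
          gcongr; linarith [norm_nonneg h]
        linarith
      have h8 := hball h3
      have h9 : 0 ≤ g (‖h‖ ^ 2) * ‖h‖ ^ b := mul_nonneg g.nonneg (by positivity)
      simp only
      nlinarith
  have h2 := hE _ hW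
  have h3 : s * ∫ h : E3, g (‖h‖ ^ 2) * ‖h‖ ^ b * f ‖h‖ ≤
      |∫ h : E3, g (‖h‖ ^ 2) * ‖h‖ ^ b * f ‖h‖| := by
    refine (le_abs_self _).trans ?_
    rw [abs_mul, hs, one_mul]
  nlinarith

/-! ### Cubic forms of increments -/

/-- Functions of an increment `d` and a separation `h`, cubic in `d`. -/
structure CubicForm (T : E3 → E3 → ℝ) : Prop where
  measurable : Measurable fun q : E3 × E3 => T q.1 q.2
  abs_le : ∀ d h, ‖h‖ ≤ 1 → |T d h| ≤ ‖d‖ ^ 3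
  abs_sub_le : ∀ d d' h h', ‖h‖ ≤ 1 → ‖h'‖ ≤ 1 →
    |T d h - T d' h'| ≤ 3 * (‖d - d'‖ * (‖d‖ ^ 2 + ‖d'‖ ^ 2)) + 3 * (‖h - h'‖ * ‖d'‖ ^ 3)

/-- `|d|² d · h`. -/
noncomputable def zeroForm (d h : E3) : ℝ := ‖d‖ ^ 2 * inner ℝ d h

/-- `(d · h)³`. -/
noncomputable def parForm (d h : E3) : ℝ := inner ℝ d h ^ 3

lemma cubicForm_zeroForm : CubicForm zeroForm := by
  refine ⟨?_, fun d h hh => ?_, fun d d' h h' hh hh' => ?_⟩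
  · exact (measurable_fst.norm.pow_const 2).mul (measurable_fst.inner measurable_snd)
  · have h1 := abs_real_inner_le_norm d h
    rw [zeroForm, abs_mul, abs_of_nonneg (by positivity : 0 ≤ ‖d‖ ^ 2)]
    calc ‖d‖ ^ 2 * |inner ℝ d h| ≤ ‖d‖ ^ 2 * (‖d‖ * 1) := by gcongr; exact h1.trans (by gcongr)
      _ = _ := by ring
  · have e : zeroForm d h - zeroForm d' h' = ‖d‖ ^ 2 * inner ℝ (d - d') h +
        (‖d‖ - ‖d'‖) * (‖d‖ + ‖d'‖) * inner ℝ d' h + ‖d'‖ ^ 2 * inner ℝ d' (h - h') := by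
      simp only [zeroForm, inner_sub_left, inner_sub_right]; ring
    have h1 : |inner ℝ (d - d') h| ≤ ‖d - d'‖ := (abs_real_inner_le_norm _ _).trans
      (mul_le_of_le_one_right (norm_nonneg _) hh)
    have h2 : |inner ℝ d' h| ≤ ‖d'‖ := (abs_real_inner_le_norm _ _).trans
      (mul_le_of_le_one_right (norm_nonneg _) hh)
    have h3 := abs_real_inner_le_norm d' (h - h')
    have h4 := abs_norm_sub_norm_le d d'
    have n1 := norm_nonneg d
    have n2 := norm_nonneg d'
    have n3 := norm_nonneg (d - d')
    have n4 := norm_nonneg (h - h')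
    rw [e]
    refine (abs_add_three _ _ _).trans ?_
    rw [abs_mul, abs_mul, abs_mul, abs_mul, abs_of_nonneg (by positivity : 0 ≤ ‖d‖ ^ 2),
      abs_of_nonneg (by positivity : 0 ≤ ‖d'‖ ^ 2), abs_of_nonneg (by positivity : 0 ≤ ‖d‖ + ‖d'‖)]
    calc _ ≤ ‖d‖ ^ 2 * ‖d - d'‖ + ‖d - d'‖ * (‖d‖ + ‖d'‖) * ‖d'‖ +
          ‖d'‖ ^ 2 * (‖d'‖ * ‖h - h'‖) := by gcongr
      _ ≤ _ := by
        have t1 := mul_nonneg n3 (sq_nonneg (‖d‖ - ‖d'‖))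
        have t2 := mul_nonneg n3 (sq_nonneg ‖d‖)
        have t3 := mul_nonneg n3 (sq_nonneg ‖d'‖)
        have t4 : 0 ≤ ‖h - h'‖ * ‖d'‖ ^ 3 := by positivity
        nlinarith

lemma abs_cube_sub_cube_le (a b : ℝ) : |a ^ 3 - b ^ 3| ≤ 3 / 2 * (|a - b| * (a ^ 2 + b ^ 2)) := by
  have e : a ^ 3 - b ^ 3 = (a - b) * (a ^ 2 + a * b + b ^ 2) := by ring
  have h1 : 0 ≤ a ^ 2 + a * b + b ^ 2 := by nlinarith [sq_nonneg (a + b), sq_nonneg a, sq_nonneg b]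
  rw [e, abs_mul, abs_of_nonneg h1]
  have h2 : a ^ 2 + a * b + b ^ 2 ≤ 3 / 2 * (a ^ 2 + b ^ 2) := by nlinarith [sq_nonneg (a - b)]
  calc _ ≤ |a - b| * (3 / 2 * (a ^ 2 + b ^ 2)) := by gcongr
    _ = _ := by ring

/-- For ‖h‖ ≤ 1 the scalar d·h is bounded by ‖d‖, so everything reduces to the difference of two
cubes of real numbers, changing d and h one after the other. -/
lemma cubicForm_parForm : CubicForm parForm := by
  have key : ∀ d h : E3, ‖h‖ ≤ 1 → |inner ℝ d h| ≤ ‖d‖ := fun d h hh =>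
    (abs_real_inner_le_norm _ _).trans (mul_le_of_le_one_right (norm_nonneg _) hh)
  have key2 : ∀ d h : E3, ‖h‖ ≤ 1 → inner ℝ d h ^ 2 ≤ ‖d‖ ^ 2 := fun d h hh => by
    rw [← sq_abs]; gcongr; exact key d h hh
  refine ⟨(measurable_fst.inner measurable_snd).pow_const 3, fun d h hh => ?_,
    fun d d' h h' hh hh' => ?_⟩
  · rw [parForm, abs_pow]
    gcongr
    exact key d h hh
  · have e : parForm d h - parForm d' h' = (inner ℝ d h ^ 3 - inner ℝ d' h ^ 3) +
        (inner ℝ d' h ^ 3 - inner ℝ d' h' ^ 3) := by simp only [parForm]; ring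
    have h1 := abs_cube_sub_cube_le (inner ℝ d h) (inner ℝ d' h)
    have h2 := abs_cube_sub_cube_le (inner ℝ d' h) (inner ℝ d' h')
    rw [← inner_sub_left] at h1
    rw [← inner_sub_right] at h2
    rw [e]
    refine (abs_add_le _ _).trans (add_le_add (h1.trans ?_) (h2.trans ?_))
    · calc 3 / 2 * (|inner ℝ (d - d') h| * (inner ℝ d h ^ 2 + inner ℝ d' h ^ 2))
          ≤ 3 / 2 * (‖d - d'‖ * (‖d‖ ^ 2 + ‖d'‖ ^ 2)) := by
            have := key (d - d') h hh
            have := key2 d h hh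
            have := key2 d' h hh
            gcongr ?_ * (?_ * (?_ + ?_))
        _ ≤ _ := by gcongr; norm_num
    · calc 3 / 2 * (|inner ℝ d' (h - h')| * (inner ℝ d' h ^ 2 + inner ℝ d' h' ^ 2))
          ≤ 3 / 2 * (‖d'‖ * ‖h - h'‖ * (‖d'‖ ^ 2 + ‖d'‖ ^ 2)) := by
            have := abs_real_inner_le_norm d' (h - h')
            have := key2 d' h hh
            have := key2 d' h' hh'
            gcongr ?_ * (?_ * (?_ + ?_))
        _ = _ := by ring

lemma zeroForm_smul (d h : E3) (r : ℝ) : zeroForm d (r • h) = r ^ 1 * zeroForm d h := by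
  rw [zeroForm, zeroForm, inner_smul_right]; ring

lemma parForm_smul (d h : E3) (r : ℝ) : parForm d (r • h) = r ^ 3 * parForm d h := by
  rw [parForm, parForm, inner_smul_right]; ring

/-! ### Mean cubic forms of the increments and their continuity in the separation. -/

namespace Flow

variable {D : Set E3} {ν : ℝ} {X : Type u} [MeasurableSpace X] {μ : Measure X} (F : Flow D ν μ)
  {T : E3 → E3 → ℝ} {ψ : E3 → ℝ} {C R : ℝ}

/-- The increment of the velocity. -/
def du (q : X × E3 × E3) : E3 := F.u q.1 (q.2.1 + q.2.2) - F.u q.1 q.2.1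

/-- The localized mean of a cubic form of the increments of the velocity. -/
noncomputable def third (μ : Measure X) (F : Flow D ν μ) (T : E3 → E3 → ℝ) (ψ : E3 → ℝ) (h : E3) : ℝ :=
  ∫ q : X × E3, ψ q.2 * T (F.du (q.1, q.2, h)) h ∂(μ.prod volume)

open Classical in
/-- The cube of the increments of the velocity inside the domain. -/
noncomputable def innerIncr (q : X × E3 × E3) : ℝ :=
  if q.2.1 ∈ D ∧ q.2.1 + q.2.2 ∈ D then ‖F.du q‖ ^ 3 else 0

lemma measurable_du : Measurable F.du :=
  (F.measurable_u.comp (measurable_fst.prodMk measurable_add)).sub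
    (F.measurable_u.comp (measurable_fst.prodMk measurable_fst_snd))

lemma measurable_third_integrand (hT : CubicForm T) (hψ : IsTest D ψ) :
    Measurable fun q : X × E3 × E3 => ψ q.2.1 * T (F.du q) q.2.2 :=
  ((IsTest.measurable hψ).comp measurable_fst_snd).mul
    (hT.measurable.comp (F.measurable_du.prodMk (measurable_snd.comp measurable_snd)))

lemma measurable_slice (h : E3) : Measurable fun q : X × E3 => (q.1, q.2, h) :=
  measurable_fst.prodMk (measurable_snd.prodMk measurable_const)

lemma measurePreserving_add_right [SFinite μ] (h : E3) :
    MeasurePreserving (fun q : X × E3 => (q.1, q.2 + h)) (μ.prod volume) (μ.prod volume) :=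
  (MeasurePreserving.id μ).prod (MeasureTheory.measurePreserving_add_right volume h)

lemma norm_du_cube_le (q : X × E3 × E3) :
    ‖F.du q‖ ^ 3 ≤ 4 * (‖F.u q.1 (q.2.1 + q.2.2)‖ ^ 3 + ‖F.u q.1 q.2.1‖ ^ 3) :=
  norm_sub_cube_le _ _

lemma measurableEmbedding_add_right (h : E3) :
    MeasurableEmbedding (fun q : X × E3 => (q.1, q.2 + h)) :=
  ((MeasurableEquiv.refl X).prodCongr (MeasurableEquiv.addRight h)).measurableEmbedding

lemma integrable_du [SFinite μ] (h : E3) :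
    Integrable (fun q : X × E3 => ‖F.du (q.1, q.2, h)‖ ^ 3) (μ.prod volume) := by
  have h1 := (measurePreserving_add_right (μ := μ) h).integrable_comp_of_integrable F.integrable_u
  refine ((h1.add F.integrable_u).const_mul 4).mono'
    ((F.measurable_du.comp (measurable_slice h)).norm.pow_const 3).aestronglyMeasurable
    (.of_forall fun q => ?_)
  rw [Real.norm_of_nonneg (by positivity)]
  exact F.norm_du_cube_le _

lemma integral_du_le [SFinite μ] (h : E3) :
    ∫ q : X × E3, ‖F.du (q.1, q.2, h)‖ ^ 3 ∂(μ.prod volume) ≤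
      8 * ∫ q, ‖F.u q.1 q.2‖ ^ 3 ∂(μ.prod volume) := by
  have h1 := (measurePreserving_add_right (μ := μ) h).integrable_comp_of_integrable F.integrable_u
  have h2 := (measurePreserving_add_right (μ := μ) h).integral_comp (measurableEmbedding_add_right h)
    (fun q : X × E3 => ‖F.u q.1 q.2‖ ^ 3)
  simp only at h2
  simp only [Function.comp_def] at h1
  calc _ ≤ ∫ q : X × E3, 4 * (‖F.u q.1 (q.2 + h)‖ ^ 3 + ‖F.u q.1 q.2‖ ^ 3) ∂(μ.prod volume) :=
        integral_mono (F.integrable_du h) ((h1.add F.integrable_u).const_mul 4) fun q =>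
          F.norm_du_cube_le _
    _ = _ := by
      rw [integral_const_mul, integral_add h1 F.integrable_u]
      rw [h2]; ring

lemma abs_third_integrand_le (hT : CubicForm T) (hψ : CutoffBound D ψ C) {q : X × E3 × E3}
    (hq : ‖q.2.2‖ ≤ 1) : |ψ q.2.1 * T (F.du q) q.2.2| ≤ C * ‖F.du q‖ ^ 3 := by
  have hC : 0 ≤ C := (abs_nonneg _).trans (hψ.abs_le 0)
  rw [abs_mul]
  gcongr
  exacts [hψ.abs_le _, hT.abs_le _ _ hq]

lemma integrable_third [SFinite μ] (hT : CubicForm T) (hψ : CutoffBound D ψ C) {h : E3} (hh : ‖h‖ ≤ 1) :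
    Integrable (fun q : X × E3 => ψ q.2 * T (F.du (q.1, q.2, h)) h) (μ.prod volume) :=
  ((F.integrable_du h).const_mul C).mono'
    ((F.measurable_third_integrand hT hψ.isTest).comp (measurable_slice h)).aestronglyMeasurable
    (.of_forall fun q => F.abs_third_integrand_le hT hψ (q := (q.1, q.2, h)) hh)

lemma abs_third_le [SFinite μ] (hT : CubicForm T) (hψ : CutoffBound D ψ C) {h : E3} (hh : ‖h‖ ≤ 1) :
    |third μ F T ψ h| ≤ C * (8 * ∫ q, ‖F.u q.1 q.2‖ ^ 3 ∂(μ.prod volume)) := by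
  have hC : 0 ≤ C := (abs_nonneg _).trans (hψ.abs_le 0)
  rw [← Real.norm_eq_abs]
  refine (norm_integral_le_of_norm_le ((F.integrable_du h).const_mul C) (.of_forall fun q =>
    F.abs_third_integrand_le hT hψ (q := (q.1, q.2, h)) hh)).trans ?_
  rw [integral_const_mul]
  gcongr
  exact F.integral_du_le h

lemma measurable_third [SFinite μ] (hT : CubicForm T) (hψ : IsTest D ψ) : Measurable (third μ F T ψ) := by
  have h1 : Measurable fun s : E3 × X × E3 => ψ s.2.2 * T (F.du (s.2.1, s.2.2, s.1)) s.1 :=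
    (F.measurable_third_integrand hT hψ).comp (measurable_snd.fst.prodMk
      (measurable_snd.snd.prodMk measurable_fst))
  exact (h1.stronglyMeasurable.integral_prod_right' (ν := μ.prod volume)).measurable

lemma measurable_innerIncr (hD : IsOpen D) : Measurable F.innerIncr := by
  classical
  unfold innerIncr
  exact Measurable.ite ((measurable_fst_snd hD.measurableSet).inter (measurable_add hD.measurableSet))
    (F.measurable_du.norm.pow_const 3) measurable_const

lemma innerIncr_nonneg (q : X × E3 × E3) : 0 ≤ F.innerIncr q := by
  unfold innerIncr; split_ifs <;> positivity

lemma innerIncr_le (q : X × E3 × E3) : F.innerIncr q ≤ ‖F.du q‖ ^ 3 := by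
  unfold innerIncr; split_ifs; exacts [le_rfl, by positivity]

lemma integrable_innerIncr [SFinite μ] (hD : IsOpen D) (h : E3) :
    Integrable (fun q : X × E3 => F.innerIncr (q.1, q.2, h)) (μ.prod volume) :=
  (F.integrable_du h).mono' ((F.measurable_innerIncr hD).comp (measurable_slice h)).aestronglyMeasurable
    (.of_forall fun q => by
      rw [Real.norm_of_nonneg (F.innerIncr_nonneg _)]
      exact F.innerIncr_le _)

/-- The difference δ_h u(x) − δ_{h'} u(x) is the increment δ_{h−h'} u(x + h'). For x in the support
of ψ both of its points lie in D, so the modulus of continuity inside D applies. -/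
lemma abs_third_sub_le [SFinite μ] (hD : IsOpen D) (hT : CubicForm T) (hψ : CutoffBound D ψ C)
    (hR1 : R ≤ 1) (hsupp : ∀ x ∈ tsupport ψ, ∀ y, ‖y‖ ≤ R → x + y ∈ D) {h h' : E3} (hh : ‖h‖ ≤ R)
    (hh' : ‖h'‖ ≤ R) {lam : ℝ} (hl : 1 ≤ lam) :
    |third μ F T ψ h - third μ F T ψ h'| ≤
      3 * C * (2 * lam ^ 3 * (∫ q : X × E3, F.innerIncr (q.1, q.2, h - h') ∂(μ.prod volume)) +
        (lam⁻¹ * 16 + ‖h - h'‖ * 8) * ∫ q, ‖F.u q.1 q.2‖ ^ 3 ∂(μ.prod volume)) := by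
  have hC : 0 ≤ C := (abs_nonneg _).trans (hψ.abs_le 0)
  have hl0 : 0 < lam⁻¹ := by positivity
  have hi := F.integrable_third (μ := μ) hT hψ (hh.trans hR1)
  have hi' := F.integrable_third (μ := μ) hT hψ (hh'.trans hR1)
  have j0 := (measurePreserving_add_right (μ := μ) h').integrable_comp_of_integrable
    (F.integrable_innerIncr hD (h - h'))
  have j0e := (measurePreserving_add_right (μ := μ) h').integral_comp (measurableEmbedding_add_right h')
    (fun q : X × E3 => F.innerIncr (q.1, q.2, h - h'))
  simp only [Function.comp_def] at j0 j0e
  have j1 := F.integrable_du (μ := μ) h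
  have j2 := F.integrable_du (μ := μ) h'
  have j3 : Integrable (fun q : X × E3 => 3 * C * (2 * lam ^ 3 * F.innerIncr (q.1, q.2 + h', h - h') +
      (lam⁻¹ * (‖F.du (q.1, q.2, h)‖ ^ 3 + ‖F.du (q.1, q.2, h')‖ ^ 3) +
        ‖h - h'‖ * ‖F.du (q.1, q.2, h')‖ ^ 3))) (μ.prod volume) :=
    (((j0.const_mul _).add (((j1.add j2).const_mul _).add (j2.const_mul _))).const_mul _)
  have j4 : Integrable (fun q : X × E3 => lam⁻¹ * (‖F.du (q.1, q.2, h)‖ ^ 3 +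
      ‖F.du (q.1, q.2, h')‖ ^ 3)) (μ.prod volume) := (j1.add j2).const_mul _
  have j5 : Integrable (fun q : X × E3 => lam⁻¹ * (‖F.du (q.1, q.2, h)‖ ^ 3 +
      ‖F.du (q.1, q.2, h')‖ ^ 3) + ‖h - h'‖ * ‖F.du (q.1, q.2, h')‖ ^ 3) (μ.prod volume) :=
    j4.add (j2.const_mul _)
  rw [third, third, ← integral_sub hi hi', ← Real.norm_eq_abs]
  refine (norm_integral_le_of_norm_le j3 (.of_forall fun q => ?_)).trans ?_
  · rw [← mul_sub, Real.norm_eq_abs]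
    by_cases hx : q.2 ∈ tsupport ψ
    · have h1 := hT.abs_sub_le (F.du (q.1, q.2, h)) (F.du (q.1, q.2, h')) h h' (hh.trans hR1)
        (hh'.trans hR1)
      have e1 : F.du (q.1, q.2, h) - F.du (q.1, q.2, h') = F.du (q.1, q.2 + h', h - h') := by
        simp only [du]
        rw [show q.2 + h' + (h - h') = q.2 + h by abel]
        abel
      have e2 : F.innerIncr (q.1, q.2 + h', h - h') = ‖F.du (q.1, q.2 + h', h - h')‖ ^ 3 := by
        rw [innerIncr, if_pos]
        refine ⟨hsupp _ hx _ hh', ?_⟩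
        simp only
        rw [show q.2 + h' + (h - h') = q.2 + h by abel]
        exact hsupp _ hx _ hh
      rw [e1] at h1
      have y1 := mul_sq_le_cube (norm_nonneg (F.du (q.1, q.2 + h', h - h')))
        (norm_nonneg (F.du (q.1, q.2, h))) hl
      have y2 := mul_sq_le_cube (norm_nonneg (F.du (q.1, q.2 + h', h - h')))
        (norm_nonneg (F.du (q.1, q.2, h'))) hl
      rw [abs_mul, e2]
      calc _ ≤ C * (3 * (2 * lam ^ 3 * ‖F.du (q.1, q.2 + h', h - h')‖ ^ 3 +
            (lam⁻¹ * (‖F.du (q.1, q.2, h)‖ ^ 3 + ‖F.du (q.1, q.2, h')‖ ^ 3) +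
            ‖h - h'‖ * ‖F.du (q.1, q.2, h')‖ ^ 3))) := by
            gcongr
            · exact hψ.abs_le _
            · refine h1.trans ?_
              linarith
        _ = _ := by ring
    · rw [image_eq_zero_of_notMem_tsupport hx, zero_mul, abs_zero]
      have := F.innerIncr_nonneg (q.1, q.2 + h', h - h')
      positivity
  · rw [integral_const_mul, integral_add (j0.const_mul _) j5, integral_add j4 (j2.const_mul _), integral_const_mul, integral_const_mul,
      integral_const_mul, integral_add j1 j2, j0e]
    have k1 := F.integral_du_le (μ := μ) h
    have k2 := F.integral_du_le (μ := μ) h'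
    have k3 := mul_le_mul_of_nonneg_left (add_le_add k1 k2) hl0.le
    have k4 := mul_le_mul_of_nonneg_left k2 (norm_nonneg (h - h'))
    refine mul_le_mul_of_nonneg_left ?_ (by positivity)
    linarith

lemma tendsto_third [SFinite μ] (hD : IsOpen D) (hT : CubicForm T) (hψ : CutoffBound D ψ C)
    (hR1 : R ≤ 1) (hsupp : ∀ x ∈ tsupport ψ, ∀ y, ‖y‖ ≤ R → x + y ∈ D)
    (hm : Tendsto (fun τ => ∫ q : X × E3, F.innerIncr (q.1, q.2, τ) ∂(μ.prod volume)) (𝓝 0) (𝓝 0))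
    {h' : E3} (hh' : ‖h'‖ < R) : ContinuousAt (third μ F T ψ) h' := by
  have hC : 0 ≤ C := (abs_nonneg _).trans (hψ.abs_le 0)
  set U := ∫ q, ‖F.u q.1 q.2‖ ^ 3 ∂(μ.prod volume) with hU
  have hU0 : 0 ≤ U := integral_nonneg fun q => by positivity
  rw [ContinuousAt, tendsto_iff_norm_sub_tendsto_zero, tendsto_order]
  refine ⟨fun a ha => .of_forall fun h => ha.trans_le (norm_nonneg _), fun ε hε => ?_⟩
  -- λ is fixed first, making the λ⁻¹ term at most ε/2. The remaining terms tend to zero as h → h'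
  -- with λ fixed.
  set lam := 1 + 96 * C * U / ε with hlam
  have hl : 1 ≤ lam := by
    have : 0 ≤ 96 * C * U / ε := by positivity
    linarith
  have hl2 : 3 * C * (lam⁻¹ * 16) * U < ε / 2 + ε / 4 := by
    have : 48 * C * U ≤ ε / 2 * lam := by
      rw [hlam, mul_add, mul_one]
      have : ε / 2 * (96 * C * U / ε) = 48 * C * U := by field_simp; ring
      linarith
    have h2 : 48 * C * U * lam⁻¹ ≤ ε / 2 := by
      rwa [← div_eq_mul_inv, div_le_iff₀ (by linarith)]
    linarith
  have hsub : Tendsto (fun h => h - h') (𝓝 h') (𝓝 0) := by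
    simpa using (continuous_sub_right h').tendsto h'
  have h1 : Tendsto (fun h => 3 * C * (2 * lam ^ 3 *
      (∫ q : X × E3, F.innerIncr (q.1, q.2, h - h') ∂(μ.prod volume)) +
        (lam⁻¹ * 16 + ‖h - h'‖ * 8) * U)) (𝓝 h')
      (𝓝 (3 * C * (2 * lam ^ 3 * 0 + (lam⁻¹ * 16 + ‖(0 : E3)‖ * 8) * U))) :=
    (((hm.comp hsub).const_mul _).add (((hsub.norm.mul_const 8).const_add _).mul_const U)).const_mul _
  have h2 : 3 * C * (2 * lam ^ 3 * 0 + (lam⁻¹ * 16 + ‖(0 : E3)‖ * 8) * U) < ε := by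
    rw [norm_zero]; linarith
  have h3 : ∀ᶠ h in 𝓝 h', ‖h‖ < R := continuous_norm.tendsto h' |>.eventually (gt_mem_nhds hh')
  filter_upwards [h1.eventually (gt_mem_nhds h2), h3] with h h4 h5
  exact (F.abs_third_sub_le hD hT hψ hR1 hsupp h5.le hh'.le hl).trans_lt h4

lemma continuousAt_sphereMean_third [SFinite μ] (hD : IsOpen D) (hT : CubicForm T)
    (hψ : CutoffBound D ψ C) (hR1 : R ≤ 1) (hsupp : ∀ x ∈ tsupport ψ, ∀ y, ‖y‖ ≤ R → x + y ∈ D)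
    (hm : Tendsto (fun τ => ∫ q : X × E3, F.innerIncr (q.1, q.2, τ) ∂(μ.prod volume)) (𝓝 0) (𝓝 0))
    {ℓ : ℝ} (hℓ : 0 < ℓ) (hℓR : ℓ < R) : ContinuousAt (sphereMean (third μ F T ψ)) ℓ := by
  have hn : ∀ (r : ℝ) (n : Metric.sphere (0 : E3) 1), ‖r • (n : E3)‖ = |r| := fun r n => by
    rw [norm_smul, norm_eq_of_mem_sphere, mul_one, Real.norm_eq_abs]
  have h1 : ∀ᶠ r in 𝓝 ℓ, |r| < R :=
    (continuous_abs.tendsto ℓ).eventually (gt_mem_nhds (by rwa [abs_of_pos hℓ]))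
  refine ContinuousAt.const_mul (continuousAt_of_dominated (F := fun r (n : Metric.sphere (0 : E3) 1) =>
    third μ F T ψ (r • (n : E3)))
    (bound := fun _ => C * (8 * ∫ q, ‖F.u q.1 q.2‖ ^ 3 ∂(μ.prod volume))) (.of_forall fun r => ?_) ?_
    (integrable_const _) (.of_forall fun n => ?_)) _
  · exact ((F.measurable_third hT hψ.isTest).comp
      (measurable_subtype_coe.const_smul r)).aestronglyMeasurable
  · filter_upwards [h1] with r hr
    refine .of_forall fun n => F.abs_third_le hT hψ ?_
    rw [hn]; exact hr.le.trans hR1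
  · refine ContinuousAt.comp (g := third μ F T ψ) (f := fun r : ℝ => r • (n : E3))
      (F.tendsto_third hD hT hψ hR1 hsupp hm ?_) (by fun_prop)
    rwa [hn, abs_of_pos hℓ]

end Flow

/-! ### The third order laws for a balanced flow. -/

namespace Flow

variable {D : Set E3} {ν : ℝ} {X : Type u} [MeasurableSpace X] {μ : Measure X} (F : Flow D ν μ)
  {T : E3 → E3 → ℝ} {ψ : E3 → ℝ} {C R ℓ : ℝ} {ρ : ℝ → ℝ}

lemma inner_eq_sum (d h : E3) : inner ℝ d h = ∑ i, h i * d i := by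
  simp [PiLp.inner_apply]

lemma norm_sq_eq_sum (d : E3) : ‖d‖ ^ 2 = ∑ i, d i * d i := by
  rw [EuclideanSpace.real_norm_sq_eq]; simp [pow_two]

lemma cubic_zeroKernel (hρ : Weight ℓ ρ) (q : X × E3 × E3) : F.cubic hρ.zeroKernel ψ q =
    - (ρ (‖q.2.2‖ ^ 2) * (ψ q.2.1 * zeroForm (F.du q) q.2.2)) := by
  simp only [cubic, hρ.pd_zeroKernel, zeroForm, inner_eq_sum, norm_sq_eq_sum (F.du q)]
  simp only [du, Fin.sum_univ_three, PiLp.sub_apply]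
  simp
  ring

/-- The derivative of the iterated tail contributes −2F|d|²(d·h) and the derivative of h_i h_j
contributes +2F|d|²(d·h). These cancel and only −2ρ(d·h)³ remains, halved by the prefactor; the
iterated tail is in the kernel for this purpose. -/
lemma cubic_parKernel (hρ : Weight ℓ ρ) (q : X × E3 × E3) : F.cubic hρ.parKernel ψ q =
    - (ρ (‖q.2.2‖ ^ 2) * (ψ q.2.1 * parForm (F.du q) q.2.2)) := by
  simp only [cubic, hρ.pd_parKernel, parForm, inner_eq_sum]
  simp only [du, Fin.sum_univ_three, PiLp.sub_apply]
  simp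
  ring

lemma integrable_weight_third [IsFiniteMeasure μ] (hν : 0 ≤ ν) (hD : IsOpen D)
    (hb : Bornology.IsBounded D) (hT : CubicForm T) (hψ : CutoffBound D ψ C) (hρ : Weight ℓ ρ)
    (hℓ : 0 < ℓ) (hℓ1 : 2 * ℓ ≤ 1) :
    Integrable (fun q : X × E3 × E3 => ρ (‖q.2.2‖ ^ 2) * (ψ q.2.1 * T (F.du q) q.2.2))
      (μ.prod (volume.prod volume)) := by
  have hC : 0 ≤ C := (abs_nonneg _).trans (hψ.abs_le 0)
  have h1 := F.integrable_dens_mul_kernel hD hb hρ.isTest_weight.integrable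
  refine (h1.const_mul (C * 4)).mono' (((hρ.isTest_weight.1.continuous.measurable.comp
    (measurable_snd.comp measurable_snd)).mul
    (F.measurable_third_integrand hT hψ.isTest)).aestronglyMeasurable) (.of_forall fun q => ?_)
  rw [Real.norm_eq_abs, abs_mul, abs_of_nonneg (hρ.nonneg _)]
  by_cases hq : ‖q.2.2‖ ≤ 1
  · have h2 := F.abs_third_integrand_le hT hψ hq
    have h3 := F.norm_du_cube_le q
    have h4 := F.norm_u_cube_le hν (q.1, q.2.1)
    have h5 := F.norm_u_cube_le hν (q.1, q.2.1 + q.2.2)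
    have h6 : ‖F.du q‖ ^ 3 ≤ 4 * F.dens₂ q.1 q.2.1 (q.2.1 + q.2.2) := by
      simp only [dens₂]; simp only at h4 h5; linarith
    have h7 := hρ.nonneg (‖q.2.2‖ ^ 2)
    calc _ ≤ ρ (‖q.2.2‖ ^ 2) * (C * (4 * F.dens₂ q.1 q.2.1 (q.2.1 + q.2.2))) := by
          gcongr
          exact h2.trans (by gcongr)
      _ = _ := by ring
  · have : 2 * ℓ ^ 2 < ‖q.2.2‖ ^ 2 := by
      push Not at hq
      nlinarith
    simp [hρ.eq_zero_right _ this]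

lemma integral_weight_third [IsFiniteMeasure μ] (hν : 0 ≤ ν) (hD : IsOpen D)
    (hb : Bornology.IsBounded D) (hT : CubicForm T) (hψ : CutoffBound D ψ C) (hρ : Weight ℓ ρ)
    (hℓ : 0 < ℓ) (hℓ1 : 2 * ℓ ≤ 1) :
    Integrable (fun h : E3 => ρ (‖h‖ ^ 2) * third μ F T ψ h) ∧
    ∫ h : E3, ρ (‖h‖ ^ 2) * third μ F T ψ h =
    ∫ q : X × E3 × E3, ρ (‖q.2.2‖ ^ 2) * (ψ q.2.1 * T (F.du q) q.2.2)
      ∂(μ.prod (volume.prod volume)) := by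
  have h1 := F.integrable_weight_third hν hD hb hT hψ hρ hℓ hℓ1
  have h2 := (measurePreserving_assoc.integrable_comp_emb (MeasurableEquiv.measurableEmbedding _)).2 h1
  rw [← measurePreserving_assoc.integral_comp (MeasurableEquiv.measurableEmbedding _)]
  have e : ∀ h : E3, ρ (‖h‖ ^ 2) * third μ F T ψ h = ∫ s : X × E3,
      ρ (‖h‖ ^ 2) * (ψ s.2 * T (F.du (s.1, s.2, h)) h) ∂(μ.prod volume) := fun h => by
    rw [third, integral_const_mul]
  simp only [e]
  exact ⟨h2.integral_prod_right, (integral_prod_symm _ h2).symm⟩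

/-- The error in the law of the structure functions. -/
noncomputable def lawError (ν C G M lam ℓ : ℝ) : ℝ :=
  400 * C * ((lam ^ 3 * M + (lam⁻¹ + 2 * ℓ) * G) * 1000 + √ν * G * (1000 + 3000 / ℓ))

/-- The bounds and moduli of continuity of a flow which enter the error estimates. -/
structure ModulusBound (μ : Measure X) (F : Flow D ν μ) (ψ : E3 → ℝ) (R G M : ℝ) : Prop where
  dens_le : ∫ q, F.dens q ∂(μ.prod volume) ≤ G
  incr_le : ∀ h, ‖h‖ ≤ R → ∫ q : X × E3, F.incrDens ψ (q.1, q.2, h) ∂(μ.prod volume) ≤ M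
  tendsto : Tendsto (fun τ => ∫ q : X × E3, F.innerIncr (q.1, q.2, τ) ∂(μ.prod volume)) (𝓝 0) (𝓝 0)

/-- Both laws at once; b is the power of |h| in ∫Q = c∫ρ|h|^b. The mean of (|h|^b)⁻¹ times the
spherical mean plus cL, against ρ|h|^b, is exactly minus the remainder integral of `integral_cubic`.
This holds for every weight, so the bound descends to the single radius ℓ. -/
lemma abs_sphereMean_add_le [IsFiniteMeasure μ] (hF : F.Balanced) (hν : 0 ≤ ν) (hν1 : ν ≤ 1) (hD : IsOpen D)
    (hb : Bornology.IsBounded D) (hT : CubicForm T) (hψ : CutoffBound D ψ C) {r : ℝ} (hr : 0 < r)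
    (hR1 : R ≤ 1) (hsupp : ∀ x ∈ tsupport ψ, ∀ y, ‖y‖ ≤ R → Metric.closedBall (x + y) r ⊆ D)
    (hℓ : 0 < ℓ) (hℓR : 2 * ℓ ≤ R) {G M lam : ℝ} (hm : ModulusBound μ F ψ (2 * ℓ) G M) (hl : 1 ≤ lam)
    {b : ℕ} {c : ℝ}
    (hk : ∀ ρ, Weight ℓ ρ → ∃ (k : TwoPointKernel) (k₀ k₁ : E3 → ℝ), KernelBound k k₀ k₁ (2 * ℓ) ∧
      ∫ h, k₀ h ≤ 1000 * ∫ h, k.Q h ∧ ∫ h, k₁ h ≤ 3000 / ℓ * ∫ h, k.Q h ∧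
      ∫ h, k.Q h = c * ∫ h : E3, ρ (‖h‖ ^ 2) * ‖h‖ ^ b ∧
      ∀ q, F.cubic k ψ q = - (ρ (‖q.2.2‖ ^ 2) * (ψ q.2.1 * T (F.du q) q.2.2))) :
    |(ℓ ^ b)⁻¹ * sphereMean (third μ F T ψ) ℓ + c * ∫ q, F.local_ ψ q ∂(μ.prod volume)| ≤
      c * lawError ν C G M lam ℓ := by
  have hC : 0 ≤ C := (abs_nonneg _).trans (hψ.abs_le 0)
  have hsupp' : ∀ x ∈ tsupport ψ, ∀ y, ‖y‖ ≤ R → x + y ∈ D := fun x hx y hy =>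
    hsupp x hx y hy (Metric.mem_closedBall_self hr.le)
  have hG : 0 ≤ G := (integral_nonneg fun q => F.dens_nonneg hν q).trans hm.dens_le
  have hM : 0 ≤ M := (integral_nonneg fun q => F.incrDens_nonneg _ _).trans
    (hm.incr_le 0 (by rw [norm_zero]; positivity))
  set L := ∫ q, F.local_ ψ q ∂(μ.prod volume) with hL
  set s := sphereMean (third μ F T ψ) with hs
  have hscont : ContinuousAt s ℓ :=
    F.continuousAt_sphereMean_third hD hT hψ hR1 hsupp' hm.tendsto hℓ (by linarith)
  have key : ∀ ρ, Weight ℓ ρ →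
      (Integrable fun h : E3 => ρ (‖h‖ ^ 2) * ‖h‖ ^ b * ((‖h‖ ^ b)⁻¹ * s ‖h‖ + c * L)) ∧
      ∫ h : E3, ρ (‖h‖ ^ 2) * ‖h‖ ^ b * ((‖h‖ ^ b)⁻¹ * s ‖h‖ + c * L) =
        (∫ h : E3, ρ (‖h‖ ^ 2) * third μ F T ψ h) + (c * ∫ h : E3, ρ (‖h‖ ^ 2) * ‖h‖ ^ b) * L := by
    intro ρ hρ
    have e : ∀ h : E3, ρ (‖h‖ ^ 2) * ‖h‖ ^ b * ((‖h‖ ^ b)⁻¹ * s ‖h‖ + c * L) =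
        ρ (‖h‖ ^ 2) * s ‖h‖ + c * L * (ρ (‖h‖ ^ 2) * ‖h‖ ^ b) := fun h => by
      -- At the origin the weight vanishes, so the value 0⁻¹ = 0 plays no role.
      by_cases h0 : h = 0
      · have : ρ 0 = 0 := hρ.eq_zero_left 0 (by positivity)
        simp [h0, this]
      · have : ‖h‖ ^ b ≠ 0 := pow_ne_zero _ (norm_ne_zero_iff.2 h0)
        field_simp
    have h1 := F.integral_weight_third hν hD hb hT hψ hρ hℓ (hℓR.trans hR1)
    have h2 := integral_sphereMean (f := fun r => ρ (r ^ 2)) h1.1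
    have h3 := (hρ.integrable_mul_norm_pow b).const_mul (c * L)
    simp only [e]
    refine ⟨h2.1.add h3, ?_⟩
    rw [integral_add h2.1 h3, h2.2, integral_const_mul]
    ring
  have := abs_le_of_weight (b := b) hℓ (f := fun r => (r ^ b)⁻¹ * s r + c * L)
    (E := c * lawError ν C G M lam ℓ)
    (((continuousAt_id.pow b).inv₀ (pow_ne_zero _ hℓ.ne')).mul hscont |>.add continuousAt_const)
    (fun ρ hρ => (key ρ hρ).1) fun ρ hρ => ?_
  · exact this
  · obtain ⟨k, k₀, k₁, hkb, hk₀, hk₁, hQ, hcub⟩ := hk ρ hρ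
    have h1 := F.integral_cubic hF hν hν1 hD hb hψ hkb hr fun x hx y hy =>
      hsupp x hx y (hy.trans hℓR)
    simp only [hcub] at h1
    rw [integral_neg, ← (F.integral_weight_third hν hD hb hT hψ hρ hℓ (hℓR.trans hR1)).2, hQ,
      ← hL] at h1
    have h2 := F.abs_integral_remainder_le hν hD hb hψ hkb hl hm.dens_le (by positivity) hm.incr_le
    rw [(key ρ hρ).2]
    have h3 : (∫ h : E3, ρ (‖h‖ ^ 2) * third μ F T ψ h) +
        (c * ∫ h : E3, ρ (‖h‖ ^ 2) * ‖h‖ ^ b) * L =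
        - ∫ q, (F.remainder k ψ q - F.viscousRemainder k ψ q) ∂(μ.prod (volume.prod volume)) := by
      linarith
    rw [h3, abs_neg]
    refine h2.trans ?_
    rw [mul_right_comm c, ← hQ]
    have hsν := Real.sqrt_nonneg ν
    have hl0 : 0 ≤ lam⁻¹ := by positivity
    calc _ ≤ 400 * C * ((lam ^ 3 * M + (lam⁻¹ + 2 * ℓ) * G) * (1000 * ∫ h, k.Q h) +
          √ν * G * ((1000 * ∫ h, k.Q h) + 3000 / ℓ * ∫ h, k.Q h)) := by gcongr
      _ = _ := by rw [lawError]; ring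

variable [IsFiniteMeasure μ] (hF : F.Balanced) (hν : 0 ≤ ν) (hν1 : ν ≤ 1) (hD : IsOpen D)
    (hb : Bornology.IsBounded D) (hψ : CutoffBound D ψ C) {r : ℝ} (hr : 0 < r)
    (hR1 : R ≤ 1) (hsupp : ∀ x ∈ tsupport ψ, ∀ y, ‖y‖ ≤ R → Metric.closedBall (x + y) r ⊆ D)
    (hℓ : 0 < ℓ) (hℓR : 2 * ℓ ≤ R) {G M lam : ℝ} (hm : ModulusBound μ F ψ (2 * ℓ) G M) (hl : 1 ≤ lam)
include hF hν hν1 hD hb hψ hr hR1 hsupp hℓ hℓR hm hl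

/-- The law of the third order structure function. -/
theorem abs_zeroForm_add_le :
    |(ℓ ^ 2)⁻¹ * sphereMean (third μ F zeroForm ψ) ℓ +
      2 / 3 * ∫ q, F.local_ ψ q ∂(μ.prod volume)| ≤ 2 / 3 * lawError ν C G M lam ℓ :=
  F.abs_sphereMean_add_le hF hν hν1 hD hb cubicForm_zeroForm hψ hr hR1 hsupp hℓ hℓR hm hl
    fun _ hρ => by
      obtain ⟨k₀, k₁, h1, h2, h3⟩ := hρ.exists_bound_zeroKernel hℓ
      exact ⟨hρ.zeroKernel, k₀, k₁, h1, h2, h3, hρ.integral_zeroKernel, F.cubic_zeroKernel hρ⟩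

/-- The law of the third order longitudinal structure function. -/
theorem abs_parForm_add_le :
    |(ℓ ^ 4)⁻¹ * sphereMean (third μ F parForm ψ) ℓ +
      2 / 5 * ∫ q, F.local_ ψ q ∂(μ.prod volume)| ≤ 2 / 5 * lawError ν C G M lam ℓ :=
  F.abs_sphereMean_add_le hF hν hν1 hD hb cubicForm_parForm hψ hr hR1 hsupp hℓ hℓR hm hl
    fun _ hρ => by
      obtain ⟨k₀, k₁, h1, h2, h3⟩ := hρ.exists_bound_parKernel hℓ
      exact ⟨hρ.parKernel, k₀, k₁, h1, h2, h3, hρ.integral_parKernel, F.cubic_parKernel hρ⟩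

end Flow

/-- Fubini for products of fields at two points: for each ω the double space integral is a product
of two single ones. -/
lemma integral_slice_mul {X : Type*} [MeasurableSpace X] {μ : Measure X} [SFinite μ]
    {a b : X → E3 → ℝ} (h : Integrable (fun q : X × E3 × E3 => a q.1 q.2.1 * b q.1 q.2.2)
      (μ.prod (volume.prod volume))) :
    Integrable (fun ω => (∫ x, a ω x) * ∫ x, b ω x) μ ∧
    ∫ q : X × E3 × E3, a q.1 q.2.1 * b q.1 q.2.2 ∂(μ.prod (volume.prod volume)) =
      ∫ ω, ((∫ x, a ω x) * ∫ x, b ω x) ∂μ := by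
  have e : ∀ ω, ∫ q : E3 × E3, a ω q.1 * b ω q.2 ∂(volume.prod volume) =
      (∫ x, a ω x) * ∫ x, b ω x := fun ω => integral_prod_mul _ _
  refine ⟨?_, ?_⟩
  · refine h.integral_prod_left.congr (.of_forall fun ω => ?_)
    exact e ω
  · rw [integral_prod _ h]
    exact integral_congr_ae (.of_forall fun ω => e ω)

namespace Flow

variable {D : Set E3} {ν : ℝ} {X : Type u} [MeasurableSpace X] {μ : Measure X} (F : Flow D ν μ)

/-- A component of the momentum, tested with `α`. -/
noncomputable def mom (α : E3 → ℝ) (i : Fin 3) (ω : X) : ℝ := ∫ x, α x * F.u ω x i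

/-- The rate of change of `mom`. -/
noncomputable def rate (α : E3 → ℝ) (i : Fin 3) (ω : X) : ℝ :=
  (∫ x, α x * F.z ω x i) + ∑ k, ∫ x, pd k α x * (F.u ω x k * F.u ω x i - ν * F.w ω x (k, i) +
    if k = i then F.p ω x else 0)

variable {F}

lemma integrable_mul_test {M : X × E3 × E3 → ℝ} (hM : Integrable M (μ.prod (volume.prod volume)))
    {α β : E3 → ℝ} (hα : IsTest univ α) (hβ : IsTest univ β) :
    Integrable (fun q => M q * (α q.2.1 * β q.2.2)) (μ.prod (volume.prod volume)) := by
  obtain ⟨A, hA⟩ := hα.bounded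
  obtain ⟨B, hB⟩ := hβ.bounded
  refine hM.mul_bdd (c := A * B) (((IsTest.measurable hα).comp measurable_snd.fst).mul
    ((IsTest.measurable hβ).comp measurable_snd.snd)).aestronglyMeasurable (.of_forall fun q => ?_)
  rw [norm_mul]
  exact mul_le_mul (hA _) (hB _) (norm_nonneg _) ((abs_nonneg _).trans (hA 0))

/-- For tensor products α(x)β(y), Fubini turns the two-point integrand into the product rule for two
momenta. The balance then says that their product has zero mean rate of change. -/
lemma balanced_of_rate [IsFiniteMeasure μ] (hν : 0 ≤ ν) (hν1 : ν ≤ 1) (hD : IsOpen D)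
    (hb : Bornology.IsBounded D)
    (h : ∀ α β : E3 → ℝ, IsTest D α → IsTest D β → ∀ i j,
      ∫ ω, (F.rate α i ω * F.mom β j ω + F.mom α i ω * F.rate β j ω) ∂μ = 0) : F.Balanced := by
  intro α β hα hβ i j
  have hα' := hα.univ
  have hβ' := hβ.univ
  have re : ∀ {f g : X × E3 × E3 → ℝ}, Integrable f (μ.prod (volume.prod volume)) →
      (∀ q, f q = g q) → Integrable g (μ.prod (volume.prod volume)) := fun hf hfg =>
    hf.congr (.of_forall hfg)
  have i1 : Integrable (fun q : X × E3 × E3 => (α q.2.1 * F.z q.1 q.2.1 i) * (β q.2.2 * F.u q.1 q.2.2 j))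
      (μ.prod (volume.prod volume)) :=
    re (integrable_mul_test (F.integrable_zu hν hD hb i j) hα' hβ') fun q => by ring
  have i2 : Integrable (fun q : X × E3 × E3 => (α q.2.1 * F.u q.1 q.2.1 i) * (β q.2.2 * F.z q.1 q.2.2 j))
      (μ.prod (volume.prod volume)) :=
    re (integrable_mul_test (F.integrable_uz hν hD hb i j) hα' hβ') fun q => by ring
  have i3 : ∀ k, Integrable (fun q : X × E3 × E3 => (pd k α q.2.1 * (F.u q.1 q.2.1 k * F.u q.1 q.2.1 i -
      ν * F.w q.1 q.2.1 (k, i) + if k = i then F.p q.1 q.2.1 else 0)) * (β q.2.2 * F.u q.1 q.2.2 j))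
      (μ.prod (volume.prod volume)) := fun k =>
    re (integrable_mul_test (F.integrable_stress_u hν hν1 hD hb k i j) (hα'.pd k) hβ') fun q => by
      ring
  have i4 : ∀ k, Integrable (fun q : X × E3 × E3 => (α q.2.1 * F.u q.1 q.2.1 i) *
      (pd k β q.2.2 * (F.u q.1 q.2.2 k * F.u q.1 q.2.2 j - ν * F.w q.1 q.2.2 (k, j) +
        if k = j then F.p q.1 q.2.2 else 0))) (μ.prod (volume.prod volume)) := fun k =>
    re (integrable_mul_test (F.integrable_u_stress hν hν1 hD hb k i j) hα' (hβ'.pd k)) fun q => by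
      ring
  have s1 := integral_slice_mul (a := fun ω x => α x * F.z ω x i) (b := fun ω x => β x * F.u ω x j) i1
  have s2 := integral_slice_mul (a := fun ω x => α x * F.u ω x i) (b := fun ω x => β x * F.z ω x j) i2
  have s3 := fun k => integral_slice_mul (a := fun ω x => pd k α x * (F.u ω x k * F.u ω x i -
    ν * F.w ω x (k, i) + if k = i then F.p ω x else 0)) (b := fun ω x => β x * F.u ω x j) (i3 k)
  have s4 := fun k => integral_slice_mul (a := fun ω x => α x * F.u ω x i)
    (b := fun ω x => pd k β x * (F.u ω x k * F.u ω x j -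
    ν * F.w ω x (k, j) + if k = j then F.p ω x else 0)) (i4 k)
  have lhs : ∫ q : X × E3 × E3, ((F.z q.1 q.2.1 i * F.u q.1 q.2.2 j + F.u q.1 q.2.1 i * F.z q.1 q.2.2 j) *
        (α q.2.1 * β q.2.2) +
      (∑ k, (F.u q.1 q.2.1 k * F.u q.1 q.2.1 i - ν * F.w q.1 q.2.1 (k, i) +
          if k = i then F.p q.1 q.2.1 else 0) * F.u q.1 q.2.2 j * (pd k α q.2.1 * β q.2.2) +
        ∑ k, F.u q.1 q.2.1 i * (F.u q.1 q.2.2 k * F.u q.1 q.2.2 j - ν * F.w q.1 q.2.2 (k, j) +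
          if k = j then F.p q.1 q.2.2 else 0) * (α q.2.1 * pd k β q.2.2)))
      ∂(μ.prod (volume.prod volume)) =
      ∫ q : X × E3 × E3, (((α q.2.1 * F.z q.1 q.2.1 i) * (β q.2.2 * F.u q.1 q.2.2 j) +
        (α q.2.1 * F.u q.1 q.2.1 i) * (β q.2.2 * F.z q.1 q.2.2 j)) +
        (∑ k, (pd k α q.2.1 * (F.u q.1 q.2.1 k * F.u q.1 q.2.1 i -
          ν * F.w q.1 q.2.1 (k, i) + if k = i then F.p q.1 q.2.1 else 0)) *
          (β q.2.2 * F.u q.1 q.2.2 j) +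
        ∑ k, (α q.2.1 * F.u q.1 q.2.1 i) * (pd k β q.2.2 * (F.u q.1 q.2.2 k * F.u q.1 q.2.2 j -
          ν * F.w q.1 q.2.2 (k, j) + if k = j then F.p q.1 q.2.2 else 0))))
      ∂(μ.prod (volume.prod volume)) := by
    refine integral_congr_ae (.of_forall fun q => ?_)
    simp only
    congr 1
    · ring
    · congr 1 <;> refine Finset.sum_congr rfl fun k _ => ?_ <;> ring
  have i12 := i1.add i2
  simp only [Pi.add_def] at i12
  have i3' : Integrable (fun q : X × E3 × E3 => ∑ k, (pd k α q.2.1 * (F.u q.1 q.2.1 k * F.u q.1 q.2.1 i -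
      ν * F.w q.1 q.2.1 (k, i) + if k = i then F.p q.1 q.2.1 else 0)) * (β q.2.2 * F.u q.1 q.2.2 j))
      (μ.prod (volume.prod volume)) := integrable_finsetSum _ fun k _ => i3 k
  have i4' : Integrable (fun q : X × E3 × E3 => ∑ k, (α q.2.1 * F.u q.1 q.2.1 i) *
      (pd k β q.2.2 * (F.u q.1 q.2.2 k * F.u q.1 q.2.2 j - ν * F.w q.1 q.2.2 (k, j) +
        if k = j then F.p q.1 q.2.2 else 0))) (μ.prod (volume.prod volume)) :=
    integrable_finsetSum _ fun k _ => i4 k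
  have i34 := i3'.add i4'
  simp only [Pi.add_def] at i34
  rw [lhs, integral_add i12 i34, integral_add i1 i2, integral_add i3' i4',
    integral_finsetSum _ fun k _ => i3 k, integral_finsetSum _ fun k _ => i4 k, s1.2, s2.2]
  simp only [(s3 _).2, (s4 _).2]
  have j3 : Integrable (fun ω => ∑ k, (∫ x, pd k α x * (F.u ω x k * F.u ω x i -
      ν * F.w ω x (k, i) + if k = i then F.p ω x else 0)) * ∫ x, β x * F.u ω x j) μ :=
    integrable_finsetSum _ fun k _ => (s3 k).1
  have j4 : Integrable (fun ω => ∑ k, (∫ x, α x * F.u ω x i) * ∫ x, pd k β x * (F.u ω x k * F.u ω x j -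
      ν * F.w ω x (k, j) + if k = j then F.p ω x else 0)) μ :=
    integrable_finsetSum _ fun k _ => (s4 k).1
  have j12 := s1.1.add s2.1
  have j34 := j3.add j4
  simp only [Pi.add_def] at j12 j34
  rw [← integral_finsetSum _ fun k _ => (s3 k).1, ← integral_finsetSum _ fun k _ => (s4 k).1,
    ← integral_add s1.1 s2.1, ← integral_add j3 j4, ← integral_add j12 j34]
  refine (integral_congr_ae (.of_forall fun ω => ?_)).trans (h α β hα hβ i j)
  simp only [rate, mom, ← Finset.sum_mul, ← Finset.mul_sum]
  ring

end Flow

/-! ### Jointly measurable fields -/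

section field

variable {D : Set E3} {ι : Type*} [Fintype ι]

/-- A representative of an `L²` field which is jointly measurable and vanishes outside `D`. -/
noncomputable def field (D : Set E3) {ι : Type*} [Fintype ι] [MeasurableSpace (Lp (EuclideanSpace ℝ ι) 2 (volume.restrict D))]
    [BorelSpace (Lp (EuclideanSpace ℝ ι) 2 (volume.restrict D))]
    [SecondCountableTopology (Lp (EuclideanSpace ℝ ι) 2 (volume.restrict D))]
    (v : Lp (EuclideanSpace ℝ ι) 2 (volume.restrict D)) : E3 → EuclideanSpace ℝ ι :=
  D.indicator fun x => (exists_measurable_rep (F := EuclideanSpace ℝ ι)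
    (μ := (volume : Measure E3).restrict D)).choose (v, x)

variable [MeasurableSpace (Lp (EuclideanSpace ℝ ι) 2 (volume.restrict D))]
    [BorelSpace (Lp (EuclideanSpace ℝ ι) 2 (volume.restrict D))]
    [SecondCountableTopology (Lp (EuclideanSpace ℝ ι) 2 (volume.restrict D))]

lemma measurable_field (hD : IsOpen D) :
    Measurable fun q : Lp (EuclideanSpace ℝ ι) 2 (volume.restrict D) × E3 => field D q.1 q.2 := by
  have h := (exists_measurable_rep (F := EuclideanSpace ℝ ι)
    (μ := (volume : Measure E3).restrict D)).choose_spec.1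
  exact h.indicator (measurable_snd hD.measurableSet)

lemma field_ae (hD : IsOpen D) (v : Lp (EuclideanSpace ℝ ι) 2 (volume.restrict D)) :
    field D v =ᵐ[volume.restrict D] v := by
  have h := (exists_measurable_rep (F := EuclideanSpace ℝ ι)
    (μ := (volume : Measure E3).restrict D)).choose_spec.2 v
  filter_upwards [h, ae_restrict_mem hD.measurableSet] with x hx hxD
  rw [field, indicator_of_mem hxD, hx]

lemma field_eq_zero (v : Lp (EuclideanSpace ℝ ι) 2 (volume.restrict D)) {x : E3} (hx : x ∉ D) :
    field D v x = 0 := indicator_of_notMem hx _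

lemma lintegral_field (hD : IsOpen D) (v : Lp (EuclideanSpace ℝ ι) 2 (volume.restrict D))
    {g : EuclideanSpace ℝ ι → ℝ≥0∞} (hg : g 0 = 0) :
    ∫⁻ x, g (field D v x) = ∫⁻ x in D, g (v x) := by
  have h1 : ∫⁻ x, g (field D v x) = ∫⁻ x in D, g (field D v x) := by
    rw [← lintegral_indicator hD.measurableSet]
    refine lintegral_congr fun x => ?_
    by_cases hx : x ∈ D
    · rw [indicator_of_mem hx]
    · rw [indicator_of_notMem hx, field_eq_zero v hx, hg]
  rw [h1]
  exact lintegral_congr_ae ((field_ae hD v).mono fun x hx => by simp only [hx])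

lemma integral_field (hD : IsOpen D) (v : Lp (EuclideanSpace ℝ ι) 2 (volume.restrict D))
    {g : E3 → EuclideanSpace ℝ ι → ℝ} (hg : ∀ x, g x 0 = 0) :
    ∫ x, g x (field D v x) = ∫ x in D, g x (v x) := by
  rw [← setIntegral_eq_integral_of_tsupport (D := D) fun x hx => by rw [field_eq_zero v hx, hg]]
  exact integral_congr_ae ((field_ae hD v).mono fun x hx => by simp only [hx])

omit [MeasurableSpace (Lp (EuclideanSpace ℝ ι) 2 (volume.restrict D))]
    [BorelSpace (Lp (EuclideanSpace ℝ ι) 2 (volume.restrict D))]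
    [SecondCountableTopology (Lp (EuclideanSpace ℝ ι) 2 (volume.restrict D))] in
lemma lintegral_norm_sq (v : Lp (EuclideanSpace ℝ ι) 2 (volume.restrict D)) :
    ∫⁻ x in D, ‖v x‖ₑ ^ 2 = ‖v‖ₑ ^ 2 := by
  rw [Lp.enorm_def, eLpNorm_eq_lintegral_rpow_enorm_toReal (by simp) (by simp)]
  simp only [ENNReal.toReal_ofNat, ENNReal.rpow_ofNat, one_div]
  rw [← ENNReal.rpow_natCast, ← ENNReal.rpow_mul]
  simp

end field

lemma sq_le_one_add_cube (a : ℝ≥0∞) : a ^ 2 ≤ 1 + a ^ 3 := by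
  rcases le_total a 1 with h | h
  · exact (pow_le_one' h 2).trans le_self_add
  · exact (pow_le_pow_right₀ h (by norm_num)).trans le_add_self

lemma enorm_sq_le_of_cube {D : Set E3} (v : L2 D) :
    ‖v‖ₑ ^ 2 ≤ volume D + ∫⁻ x in D, ‖v x‖ₑ ^ 3 := by
  rw [← lintegral_norm_sq]
  refine (lintegral_mono fun x => sq_le_one_add_cube _).trans ?_
  rw [lintegral_add_left measurable_const]
  simp

/-! ### Integrals over time, events and space -/

section time

variable {Ω : Type*} [MeasurableSpace Ω] {P : Measure Ω}

/-- The product of a probability measure and the time interval `[0, 1]`. -/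
noncomputable abbrev timeProd (P : Measure Ω) : Measure (Ω × ℝ) := P.prod (volume.restrict (Icc 0 1))

/-- The time interval has length one, so a bound valid at each time survives time averaging with the
same constant. -/
lemma lintegral_timeProd_le [SFinite P] {f : (Ω × ℝ) × E3 → ℝ≥0∞} (hf : Measurable f) {C : ℝ≥0∞}
    (h : ∀ s, ∫⁻ ω, ∫⁻ x, f ((ω, s), x) ∂volume ∂P ≤ C) :
    ∫⁻ q, f q ∂((timeProd P).prod volume) ≤ C := by
  rw [lintegral_prod _ hf.aemeasurable,
    lintegral_prod_symm (fun q : Ω × ℝ => ∫⁻ x, f (q, x)) hf.lintegral_prod_right'.aemeasurable]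
  refine (lintegral_mono fun s => h s).trans ?_
  simp

lemma integrable_timeProd [SFinite P] {f : (Ω × ℝ) × E3 → ℝ} (hf : Measurable f) (h0 : ∀ q, 0 ≤ f q)
    {C : ℝ} (hC : 0 ≤ C)
    (h : ∀ s, ∫⁻ ω, ∫⁻ x, ENNReal.ofReal (f ((ω, s), x)) ∂volume ∂P ≤ ENNReal.ofReal C) :
    Integrable f ((timeProd P).prod volume) ∧ ∫ q, f q ∂((timeProd P).prod volume) ≤ C := by
  have h1 := lintegral_timeProd_le hf.ennreal_ofReal h
  refine ⟨⟨hf.aestronglyMeasurable, ?_⟩, ?_⟩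
  · rw [hasFiniteIntegral_iff_ofReal (.of_forall h0)]
    exact h1.trans_lt ENNReal.ofReal_lt_top
  · rw [integral_eq_lintegral_of_nonneg_ae (.of_forall h0) hf.aestronglyMeasurable]
    exact ENNReal.toReal_le_of_le_ofReal hC h1

end time

/-! ### The flow of a stationary solution -/

section solution

variable {D : Set E3} {B : StokesBasis D} {σ : ℕ → ℝ} {a : Vsol D →L[ℝ] Vsol D →L[ℝ] ℝ} {ν : ℝ}

/-- Moment bounds for a solution and its pressure. -/
structure SolutionBound (S : StationarySolution.{u} B σ a ν) (p : ℝ≥0 → S.Ω → E3 → ℝ) (G : ℝ≥0) :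
    Prop where
  measurable_p : Measurable fun q : ℝ≥0 × S.Ω × E3 => p q.1 q.2.1 q.2.2
  velocity : ∀ t, ∫⁻ ω, ∫⁻ x in D, ‖(S.u t ω : L2 D) x‖ₑ ^ 3 ∂volume ∂S.P ≤ G
  pressure : ∀ t, ∫⁻ ω, ∫⁻ x in D, ‖p t ω x‖ₑ ^ (3 / 2 : ℝ) ∂volume ∂S.P ≤ G
  force : ∀ t, ∫⁻ ω, ‖S.Z t ω‖ₑ ^ 2 ∂S.P ≤ G
  gradient : ∀ t, ENNReal.ofReal ν * ∫⁻ ω, dirichlet D (S.u t ω : L2 D) ∂S.P ≤ G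

lemma ofReal_sqrt_abs_cube (b : ℝ) : ENNReal.ofReal (√|b| ^ 3) = ‖b‖ₑ ^ (3 / 2 : ℝ) := by
  rw [Real.enorm_eq_ofReal_abs, ENNReal.ofReal_rpow_of_nonneg (abs_nonneg _) (by norm_num),
    Real.sqrt_eq_rpow, ← Real.rpow_natCast, ← Real.rpow_mul (abs_nonneg _)]
  norm_num

variable (S : StationarySolution.{u} B σ a ν) {p : ℝ≥0 → S.Ω → E3 → ℝ} {G : ℝ≥0}

lemma StationarySolution.measurable_u_time : Measurable fun q : S.Ω × ℝ => S.u q.2.toNNReal q.1 :=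
  S.measurable_u.comp ((measurable_real_toNNReal.comp measurable_snd).prodMk measurable_fst)

lemma StationarySolution.measurable_Z_time : Measurable fun q : S.Ω × ℝ => S.Z q.2.toNNReal q.1 :=
  S.measurable_Z.comp ((measurable_real_toNNReal.comp measurable_snd).prodMk measurable_fst)

lemma measurable_field_comp (hD : IsOpen D) {X : Type*} [MeasurableSpace X] {f : X → Hsol D}
    (hf : Measurable f) : Measurable fun q : X × E3 => field D (f q.1 : L2 D) q.2 :=
  (measurable_field hD).comp
    ((continuous_subtype_val.measurable.comp (hf.comp measurable_fst)).prodMk measurable_snd)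

lemma measurable_gradField_comp (hD : IsOpen D) {X : Type*} [MeasurableSpace X] {f : X → Hsol D}
    (hf : Measurable f) : Measurable fun q : X × E3 => field D (grad D (f q.1 : L2 D)) q.2 :=
  (measurable_field hD).comp
    (((measurable_grad hD).comp (hf.comp measurable_fst)).prodMk measurable_snd)

variable {S} in
lemma SolutionBound.measurable_pressure (hD : IsOpen D) (hG : SolutionBound S p G) :
    Measurable fun q : (S.Ω × ℝ) × E3 => D.indicator (p q.1.2.toNNReal q.1.1) q.2 := by
  have h : Measurable fun q : (S.Ω × ℝ) × E3 => p q.1.2.toNNReal q.1.1 q.2 :=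
    hG.measurable_p.comp ((measurable_real_toNNReal.comp measurable_fst.snd).prodMk
      (measurable_fst.fst.prodMk measurable_snd))
  exact h.indicator (measurable_snd hD.measurableSet)

section bounds

variable {S} (hν : 0 ≤ ν) (hD : IsOpen D) (hG : SolutionBound S p G)
include hD hG

lemma SolutionBound.integrable_u : Integrable (fun q : (S.Ω × ℝ) × E3 =>
      ‖field D (S.u q.1.2.toNNReal q.1.1 : L2 D) q.2‖ ^ 3) ((timeProd S.P).prod volume) ∧
    ∫ q : (S.Ω × ℝ) × E3, ‖field D (S.u q.1.2.toNNReal q.1.1 : L2 D) q.2‖ ^ 3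
      ∂((timeProd S.P).prod volume) ≤ G := by
  refine integrable_timeProd ((measurable_field_comp hD S.measurable_u_time).norm.pow_const 3)
    (fun q => by positivity) G.2 fun s => ?_
  simp only [ENNReal.ofReal_pow (norm_nonneg _), ofReal_norm]
  simp only [lintegral_field hD _ (g := fun y : E3 => ‖y‖ₑ ^ 3) (by simp)]
  exact (hG.velocity _).trans_eq (ENNReal.ofReal_coe_nnreal).symm

lemma SolutionBound.integrable_z : Integrable (fun q : (S.Ω × ℝ) × E3 =>
      ‖field D (S.Z q.1.2.toNNReal q.1.1 : L2 D) q.2‖ ^ 2) ((timeProd S.P).prod volume) ∧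
    ∫ q : (S.Ω × ℝ) × E3, ‖field D (S.Z q.1.2.toNNReal q.1.1 : L2 D) q.2‖ ^ 2
      ∂((timeProd S.P).prod volume) ≤ G := by
  refine integrable_timeProd ((measurable_field_comp hD S.measurable_Z_time).norm.pow_const 2)
    (fun q => by positivity) G.2 fun s => ?_
  simp only [ENNReal.ofReal_pow (norm_nonneg _), ofReal_norm]
  simp only [lintegral_field hD _ (g := fun y : E3 => ‖y‖ₑ ^ 2) (by simp), lintegral_norm_sq]
  exact (hG.force _).trans_eq (ENNReal.ofReal_coe_nnreal).symm

lemma SolutionBound.integrable_p : Integrable (fun q : (S.Ω × ℝ) × E3 =>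
      √|D.indicator (p q.1.2.toNNReal q.1.1) q.2| ^ 3) ((timeProd S.P).prod volume) ∧
    ∫ q : (S.Ω × ℝ) × E3, √|D.indicator (p q.1.2.toNNReal q.1.1) q.2| ^ 3
      ∂((timeProd S.P).prod volume) ≤ G := by
  have hm : Measurable fun q : (S.Ω × ℝ) × E3 => √|D.indicator (p q.1.2.toNNReal q.1.1) q.2| ^ 3 :=
    (Real.continuous_sqrt.measurable.comp (hG.measurable_pressure hD).abs).pow_const 3
  refine integrable_timeProd hm (fun q => by positivity) G.2 fun s => ?_
  simp only [ofReal_sqrt_abs_cube]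
  refine le_trans (lintegral_mono fun ω => ?_)
    ((hG.pressure s.toNNReal).trans_eq (ENNReal.ofReal_coe_nnreal).symm)
  rw [← lintegral_indicator hD.measurableSet]
  refine lintegral_mono fun x => ?_
  by_cases hx : x ∈ D
  · simp [hx]
  · simp [hx]

include hν

lemma SolutionBound.integrable_w : Integrable (fun q : (S.Ω × ℝ) × E3 =>
      ν * ‖field D (grad D (S.u q.1.2.toNNReal q.1.1 : L2 D)) q.2‖ ^ 2) ((timeProd S.P).prod volume) ∧
    ∫ q : (S.Ω × ℝ) × E3, ν * ‖field D (grad D (S.u q.1.2.toNNReal q.1.1 : L2 D)) q.2‖ ^ 2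
      ∂((timeProd S.P).prod volume) ≤ G := by
  have hm : Measurable fun q : (S.Ω × ℝ) × E3 =>
      ν * ‖field D (grad D (S.u q.1.2.toNNReal q.1.1 : L2 D)) q.2‖ ^ 2 :=
    ((measurable_gradField_comp hD S.measurable_u_time).norm.pow_const 2).const_mul ν
  refine integrable_timeProd hm (fun q => mul_nonneg hν (sq_nonneg _)) G.2 fun s => ?_
  simp only [ENNReal.ofReal_mul hν, ENNReal.ofReal_pow (norm_nonneg _), ofReal_norm]
  simp only [lintegral_const_mul' _ _ ENNReal.ofReal_ne_top,
    lintegral_field hD _ (g := fun y : M3 => ‖y‖ₑ ^ 2) (by simp), lintegral_norm_sq]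
  refine le_trans ?_ ((hG.gradient s.toNNReal).trans_eq (ENNReal.ofReal_coe_nnreal).symm)
  gcongr
  exact enorm_grad_sq_le hD _

end bounds

/-- The flow of a stationary solution over the time interval `[0, 1]`. -/
noncomputable def StationarySolution.flow (hν : 0 ≤ ν) (hD : IsOpen D) (hG : SolutionBound S p G) :
    Flow D ν (timeProd S.P) where
  u q := field D (S.u q.2.toNNReal q.1 : L2 D)
  w q := field D (grad D (S.u q.2.toNNReal q.1 : L2 D))
  p q := D.indicator (p q.2.toNNReal q.1)
  z q := field D (S.Z q.2.toNNReal q.1 : L2 D)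
  measurable_u := measurable_field_comp hD S.measurable_u_time
  measurable_w := measurable_gradField_comp hD S.measurable_u_time
  measurable_p := hG.measurable_pressure hD
  measurable_z := measurable_field_comp hD S.measurable_Z_time
  u_eq_zero _ _ hx := field_eq_zero _ hx
  w_eq_zero _ _ hx := field_eq_zero _ hx
  p_eq_zero _ _ hx := indicator_of_notMem hx _
  z_eq_zero _ _ hx := field_eq_zero _ hx
  integrable_u := (hG.integrable_u hD).1
  integrable_p := (hG.integrable_p hD).1
  integrable_z := (hG.integrable_z hD).1
  integrable_w := (hG.integrable_w hν hD).1
  divFree q φ hφ := by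
    have h := Hsol_divFree (S.u q.2.toNNReal q.1).2 hφ
    rw [integral_field hD _ (g := fun x y => ∑ k, pd k φ x * y k) (by simp), integral_finsetSum]
    · exact h
    · exact fun k _ => integrable_mul_coord k _
        (memLp_of_continuous_hasCompactSupport (contDiff_pd hφ.1 k).continuous
          (hasCompactSupport_pd hφ.2.1 k) _ _)

end solution

/-! ### Integrability of the fields against a single test function. -/

namespace Flow

variable {D : Set E3} {ν : ℝ} {X : Type u} [MeasurableSpace X] {μ : Measure X} (F : Flow D ν μ)

lemma dens_of_mem {ω : X} {x : E3} (hx : x ∈ D) : F.dens (ω, x) =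
    1 + ‖F.u ω x‖ ^ 3 + √|F.p ω x| ^ 3 + ‖F.z ω x‖ ^ 2 + ν * ‖F.w ω x‖ ^ 2 := by
  rw [dens, if_pos hx]

/-- First powers are absorbed by the indicator of D in `dens`, since s ≤ 1 + s². -/
lemma abs_z_le (hν : 0 ≤ ν) (q : X × E3) (i : Fin 3) : |F.z q.1 q.2 i| ≤ F.dens q := by
  by_cases hx : q.2 ∈ D
  · rw [F.dens_of_mem hx]
    have h1 := abs_coord_le (F.z q.1 q.2) i
    have h2 : 0 ≤ ‖F.u q.1 q.2‖ ^ 3 + √|F.p q.1 q.2| ^ 3 + ν * ‖F.w q.1 q.2‖ ^ 2 := by positivity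
    nlinarith [sq_nonneg (‖F.z q.1 q.2‖ - 1), sq_nonneg ‖F.z q.1 q.2‖]
  · rw [F.z_eq_zero _ _ hx]
    simpa using F.dens_nonneg hν q

lemma abs_w_le (hν : 0 ≤ ν) (hν1 : ν ≤ 1) (q : X × E3) (k : Fin 3 × Fin 3) :
    |ν * F.w q.1 q.2 k| ≤ F.dens q := by
  by_cases hx : q.2 ∈ D
  · rw [F.dens_of_mem hx, abs_mul, abs_of_nonneg hν]
    have h1 := mul_le_mul_of_nonneg_left (abs_coord_le (F.w q.1 q.2) k) hν
    have h2 : 0 ≤ ‖F.u q.1 q.2‖ ^ 3 + √|F.p q.1 q.2| ^ 3 + ‖F.z q.1 q.2‖ ^ 2 := by positivity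
    have h3 : 0 ≤ ν * ‖F.w q.1 q.2‖ ^ 2 := by positivity
    nlinarith [mul_nonneg hν (sq_nonneg (‖F.w q.1 q.2‖ - 1))]
  · rw [F.w_eq_zero _ _ hx]
    simpa using F.dens_nonneg hν q

lemma abs_p_le (hν : 0 ≤ ν) (q : X × E3) : |F.p q.1 q.2| ≤ F.dens q := by
  by_cases hx : q.2 ∈ D
  · rw [F.dens_of_mem hx]
    have h1 := Real.sq_sqrt (abs_nonneg (F.p q.1 q.2))
    have h2 : 0 ≤ ‖F.u q.1 q.2‖ ^ 3 + ‖F.z q.1 q.2‖ ^ 2 + ν * ‖F.w q.1 q.2‖ ^ 2 := by positivity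
    have h3 := Real.sqrt_nonneg |F.p q.1 q.2|
    set r := √|F.p q.1 q.2|
    nlinarith [mul_nonneg h3 (sq_nonneg (r - 1)), sq_nonneg (r - 1)]
  · rw [F.p_eq_zero _ _ hx]
    simpa using F.dens_nonneg hν q

variable [IsFiniteMeasure μ] (hν : 0 ≤ ν) (hν1 : ν ≤ 1) (hD : IsOpen D) (hb : Bornology.IsBounded D)
  {α : E3 → ℝ} (hα : IsTest univ α)
include hν hD hb hα

lemma integrable_test_uu (k i : Fin 3) :
    Integrable (fun q : X × E3 => α q.2 * (F.u q.1 q.2 k * F.u q.1 q.2 i)) (μ.prod volume) := by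
  obtain ⟨A, hA⟩ := hα.bounded
  exact F.integrable_one_point hD hb (IsTest.measurable hα) hA
    ((F.measurable_u_comp measurable_fst measurable_snd k).mul
      (F.measurable_u_comp measurable_fst measurable_snd i))
    fun q => abs_z_mul_le (F.norm_u_sq_le hν q) (F.norm_u_sq_le hν q) k i

lemma integrable_test_p :
    Integrable (fun q : X × E3 => α q.2 * F.p q.1 q.2) (μ.prod volume) := by
  obtain ⟨A, hA⟩ := hα.bounded
  exact F.integrable_one_point hD hb (IsTest.measurable hα) hA
    (F.measurable_p_comp measurable_fst measurable_snd) (F.abs_p_le hν)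

lemma integrable_test_z (i : Fin 3) :
    Integrable (fun q : X × E3 => α q.2 * F.z q.1 q.2 i) (μ.prod volume) := by
  obtain ⟨A, hA⟩ := hα.bounded
  exact F.integrable_one_point hD hb (IsTest.measurable hα) hA
    (F.measurable_z_comp measurable_fst measurable_snd i) fun q => F.abs_z_le hν q i

include hν1

lemma integrable_test_w (k : Fin 3 × Fin 3) :
    Integrable (fun q : X × E3 => α q.2 * (ν * F.w q.1 q.2 k)) (μ.prod volume) := by
  obtain ⟨A, hA⟩ := hα.bounded
  exact F.integrable_one_point hD hb (IsTest.measurable hα) hA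
    ((F.measurable_w_comp measurable_fst measurable_snd k).const_mul ν)
    fun q => F.abs_w_le hν hν1 q k

omit hα in
/-- The rate of change of the momentum, term by term. -/
lemma rate_ae (hα : IsTest D α) (i : Fin 3) : ∀ᵐ ω ∂μ, F.rate α i ω =
    (∫ x, α x * F.z ω x i) + (∑ k, ∫ x, pd k α x * (F.u ω x k * F.u ω x i)) -
      (∑ k, ∫ x, pd k α x * (ν * F.w ω x (k, i))) + ∫ x, pd i α x * F.p ω x := by
  have h1 := fun k => (F.integrable_test_uu hν hD hb (hα.univ.pd k) k i).prod_right_ae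
  have h2 := fun k => (F.integrable_test_w hν hν1 hD hb (hα.univ.pd k) (k, i)).prod_right_ae
  have h3 := (F.integrable_test_p hν hD hb (hα.univ.pd i)).prod_right_ae
  filter_upwards [ae_all_iff.2 h1, ae_all_iff.2 h2, h3] with ω h1 h2 h3
  have e : ∀ k, ∫ x, pd k α x * (F.u ω x k * F.u ω x i - ν * F.w ω x (k, i) +
      if k = i then F.p ω x else 0) = (∫ x, pd k α x * (F.u ω x k * F.u ω x i)) -
      (∫ x, pd k α x * (ν * F.w ω x (k, i))) + if k = i then ∫ x, pd i α x * F.p ω x else 0 := by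
    intro k
    have h12 := (h1 k).sub (h2 k)
    simp only [Pi.sub_def] at h12
    by_cases hk : k = i
    · subst hk
      simp only [if_true]
      rw [← integral_sub (h1 k) (h2 k), ← integral_add h12 h3]
      refine integral_congr_ae (.of_forall fun x => ?_)
      simp only; ring
    · simp only [if_neg hk, add_zero]
      rw [← integral_sub (h1 k) (h2 k)]
      refine integral_congr_ae (.of_forall fun x => ?_)
      simp only; ring
  rw [rate]
  simp only [e, Finset.sum_add_distrib, Finset.sum_sub_distrib, Finset.sum_ite_eq', Finset.mem_univ,
    if_true]
  ring

end Flow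

/-! ### Test fields with one component -/

section component

variable {D : Set E3} {α : E3 → ℝ}

/-- The vector field with a single component. -/
noncomputable def compField (α : E3 → ℝ) (i : Fin 3) (x : E3) : E3 := α x • EuclideanSpace.single i 1

lemma compField_apply (α : E3 → ℝ) (i j : Fin 3) (x : E3) :
    compField α i x j = (if j = i then 1 else 0) * α x := by
  simp [compField, eq_comm]

lemma isTest_compField (hα : IsTest D α) (i : Fin 3) : IsTest D (compField α i) :=
  ⟨hα.1.smul contDiff_const, hα.2.1.smul_right, (tsupport_smul_subset_left _ _).trans hα.2.2⟩

lemma partialDeriv_compField (hα : IsTest D α) (k i j : Fin 3) (x : E3) :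
    partialDeriv (compField α i) k j x = (if j = i then 1 else 0) * pd k α x := by
  rw [partialDeriv_eq_pd (isTest_compField hα i).1]
  simp only [compField_apply]
  exact pd_const_mul hα.1 _ _ _

lemma divergence_compField (hα : IsTest D α) (i : Fin 3) (x : E3) :
    divergence (compField α i) x = pd i α x := by
  simp [divergence, partialDeriv_compField hα]

lemma pair_compField (f : L2 D) (α : E3 → ℝ) (i : Fin 3) :
    pair f (compField α i) = ∫ x in D, α x * f x i := by
  simp [pair, compField, inner_smul_right, EuclideanSpace.inner_single_right]

lemma viscous_compField (hα : IsTest D α) (v : L2 D) (i : Fin 3) :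
    viscous v (compField α i) = ∑ k, ∫ x in D, pd k α x * grad D v x (k, i) := by
  rw [viscous, ← integral_finsetSum]
  · refine integral_congr_ae (.of_forall fun x => ?_)
    simp [PiLp.inner_apply, Fintype.sum_prod_type, jacobian, partialDeriv_compField hα]
  · exact fun k _ => integrable_mul_coord (k, i) _
      (memLp_of_continuous_hasCompactSupport (contDiff_pd hα.1 k).continuous
        (hasCompactSupport_pd hα.2.1 k) _ _)

/-- Membership in V is needed: the convection term is given through ∇u, and integration by parts
brings it to the form u ⊗ u paired with ∇α. -/
lemma convection_compField (hα : IsTest D α) {v : L2 D} (hv : ∃ G : L2M D, (v, G) ∈ Vsol D)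
    (i : Fin 3) : convection v (compField α i) = - ∑ k, ∫ x in D, pd k α x * (v x k * v x i) := by
  have h := Vsol_convection (mem_Vsol_grad hv) hα.univ i
  simp only [mul_assoc] at h
  rw [← h, convection, ← integral_finsetSum]
  · refine integral_congr_ae (.of_forall fun x => ?_)
    simp only [compField_apply]
    simp
    refine Finset.sum_congr rfl fun k _ => ?_
    ring
  · intro k _
    have := integrable_mul_coord_coord k (k, i) v (grad D v) (hα.memLp_top D)
    simpa only [mul_assoc] using this

end component

/-! ### The balance of two-point correlations from stationarity. -/

section solution

variable {D : Set E3} {B : StokesBasis D} {σ : ℕ → ℝ} {a : Vsol D →L[ℝ] Vsol D →L[ℝ] ℝ} {ν : ℝ}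
  {S : StationarySolution.{u} B σ a ν} {p : ℝ≥0 → S.Ω → E3 → ℝ} {G : ℝ≥0}
  (hν : 0 ≤ ν) (hν1 : ν ≤ 1) (hD : IsOpen D) (hb : Bornology.IsBounded D) (hG : SolutionBound S p G)

lemma lintegral_velocity_sq_le {t : ℝ≥0}
    (h : ∫⁻ ω, ∫⁻ x in D, ‖(S.u t ω : L2 D) x‖ₑ ^ 3 ∂volume ∂S.P ≤ G) :
    ∫⁻ ω, ‖S.u t ω‖ₑ ^ 2 ∂S.P ≤ volume D + G := by
  refine (lintegral_mono fun ω => enorm_sq_le_of_cube (S.u t ω : L2 D)).trans ?_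
  rw [lintegral_add_left measurable_const]
  simpa using add_le_add_right h (volume D)

lemma SolutionBound.velocity_sq (hG : SolutionBound S p G) (t : ℝ≥0) :
    ∫⁻ ω, ‖S.u t ω‖ₑ ^ 2 ∂S.P ≤ volume D + G :=
  lintegral_velocity_sq_le (hG.velocity t)

lemma mom_flow (α : E3 → ℝ) (i : Fin 3) (ω : S.Ω) (s : ℝ) :
    (S.flow hν hD hG).mom α i (ω, s) = ∫ x in D, α x * (S.u s.toNNReal ω : L2 D) x i := by
  simp only [Flow.mom, StationarySolution.flow]
  exact integral_field hD _ (g := fun x y => α x * y i) (by simp)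

include hν1 hb in
/-- The momentum equation for a single component along almost every path. -/
lemma mom_eq_add_integral_rate (hp : IsPressure S.toMartingaleSolution p) {α : E3 → ℝ}
    (hα : IsTest D α) (i : Fin 3) : ∀ᵐ ω ∂S.P,
      IntervalIntegrable (fun s => (S.flow hν hD hG).rate α i (ω, s)) volume 0 1 ∧
      ∀ t ∈ Icc (0 : ℝ) 1, (S.flow hν hD hG).mom α i (ω, t) = (S.flow hν hD hG).mom α i (ω, 0) +
        ∫ s in (0 : ℝ)..t, (S.flow hν hD hG).rate α i (ω, s) := by
  set F := S.flow hν hD hG with hF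
  have j1 : Integrable (fun q => ∑ k, ∫ x, pd k α x * (F.u q x k * F.u q x i)) (timeProd S.P) :=
    integrable_finsetSum _ fun k _ =>
      (F.integrable_test_uu hν hD hb (hα.univ.pd k) k i).integral_prod_left
  have j2 : Integrable (fun q => ∑ k, ∫ x, pd k α x * (ν * F.w q x (k, i))) (timeProd S.P) :=
    integrable_finsetSum _ fun k _ =>
      (F.integrable_test_w hν hν1 hD hb (hα.univ.pd k) (k, i)).integral_prod_left
  have j3 : Integrable (fun q => ∫ x, pd i α x * F.p q x) (timeProd S.P) :=
    (F.integrable_test_p hν hD hb (hα.univ.pd i)).integral_prod_left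
  have j4 : Integrable (fun q => ∫ x, α x * F.z q x i) (timeProd S.P) :=
    (F.integrable_test_z hν hD hb hα.univ i).integral_prod_left
  have hrate := Measure.ae_ae_of_ae_prod (F.rate_ae hν hν1 hD hb hα i)
  obtain ⟨_, -, hreg⟩ := S.regular
  filter_upwards [hp.2, hreg, hrate, j1.prod_right_ae, j2.prod_right_ae, j3.prod_right_ae,
    j4.prod_right_ae] with ω hmom hreg hrate j1 j2 j3 j4
  have toI : ∀ {f : ℝ → ℝ}, Integrable f (volume.restrict (Icc 0 1)) →
      IntervalIntegrable f volume 0 1 := fun {f} hf =>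
    (intervalIntegrable_iff_integrableOn_Icc_of_le zero_le_one).2 hf
  have sub : ∀ {t : ℝ}, t ∈ Icc (0 : ℝ) 1 → uIcc 0 t ⊆ uIcc (0 : ℝ) 1 := fun {t} ht => by
    rw [uIcc_of_le ht.1, uIcc_of_le zero_le_one]; exact Icc_subset_Icc_right ht.2
  have congrT : ∀ {t : ℝ} {f g : ℝ → ℝ}, t ∈ Icc (0 : ℝ) 1 →
      (∀ᵐ s ∂(volume.restrict (Icc (0 : ℝ) 1)), f s = g s) →
      ∫ s in (0 : ℝ)..t, f s = ∫ s in (0 : ℝ)..t, g s := fun {t f g} ht h => by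
    refine intervalIntegral.integral_congr_ae ?_
    rw [ae_restrict_iff' measurableSet_Icc] at h
    filter_upwards [h] with s hs hst
    rw [uIoc_of_le ht.1] at hst
    exact hs ⟨hst.1.le, hst.2.trans ht.2⟩
  -- A finite time integral of the Dirichlet energy puts u(s) in V for almost every s, which is
  -- enough for identities under time integrals.
  have hV : ∀ᵐ s ∂(volume.restrict (Icc (0 : ℝ) 1)),
      ∃ G : L2M D, ((S.u s.toNNReal ω : L2 D), G) ∈ Vsol D := by
    have hm : Measurable fun s : ℝ => S.u s.toNNReal ω :=
      S.measurable_u.comp (measurable_real_toNNReal.prodMk measurable_const)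
    filter_upwards [ae_lt_top ((measurable_dirichlet hD).comp hm) (hreg.1.2.2 1).ne] with s hs
    exact exists_of_dirichlet_ne_top hs.ne
  have jr : Integrable (fun s => F.rate α i (ω, s)) (volume.restrict (Icc 0 1)) :=
    (((j4.add j1).sub j2).add j3).congr (hrate.mono fun s hs => hs.symm)
  refine ⟨toI jr, fun t ht => ?_⟩
  have i1 := (toI j1).mono_set (sub ht)
  have i2 := (toI j2).mono_set (sub ht)
  have i3 := (toI j3).mono_set (sub ht)
  have i4 := (toI j4).mono_set (sub ht)
  -- A field with one component is not divergence free, so the form of the equation with pressure is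
  -- used.
  have hm := hmom (compField α i) (isTest_compField hα i) t.toNNReal
  rw [momentum, Real.coe_toNNReal _ ht.1] at hm
  have c1 : ∫ s in (0 : ℝ)..t, convection (S.u s.toNNReal ω : L2 D) (compField α i) =
      - ∫ s in (0 : ℝ)..t, ∑ k, ∫ x, pd k α x * (F.u (ω, s) x k * F.u (ω, s) x i) := by
    rw [← intervalIntegral.integral_neg]
    refine congrT ht (hV.mono fun s hs => ?_)
    rw [convection_compField hα hs]
    congr 1
    exact Finset.sum_congr rfl fun k _ =>
      (integral_field hD _ (g := fun x y : E3 => pd k α x * (y k * y i)) (by simp)).symm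
  have c2 : ν * ∫ s in (0 : ℝ)..t, viscous (S.u s.toNNReal ω : L2 D) (compField α i) =
      ∫ s in (0 : ℝ)..t, ∑ k, ∫ x, pd k α x * (ν * F.w (ω, s) x (k, i)) := by
    rw [← intervalIntegral.integral_const_mul]
    refine congrT ht (.of_forall fun s => ?_)
    rw [viscous_compField hα, Finset.mul_sum]
    refine Finset.sum_congr rfl fun k _ => ?_
    rw [← integral_const_mul]
    refine Eq.trans ?_ (integral_field hD (grad D (S.u s.toNNReal ω : L2 D))
      (g := fun x y => pd k α x * (ν * y (k, i))) (by simp)).symm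
    refine integral_congr_ae (.of_forall fun x => ?_)
    simp only; ring
  have c3 : ∫ s in (0 : ℝ)..t, ∫ x in D, p s.toNNReal ω x * divergence (compField α i) x =
      ∫ s in (0 : ℝ)..t, ∫ x, pd i α x * F.p (ω, s) x := by
    refine congrT ht (.of_forall fun s => ?_)
    rw [← integral_indicator hD.measurableSet]
    refine integral_congr_ae (.of_forall fun x => ?_)
    simp only [divergence_compField hα, hF, StationarySolution.flow]
    by_cases hx : x ∈ D
    · simp [hx, mul_comm]
    · simp [hx]
  have c4 : ∫ s in (0 : ℝ)..t, pair (S.Z s.toNNReal ω : L2 D) (compField α i) =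
      ∫ s in (0 : ℝ)..t, ∫ x, α x * F.z (ω, s) x i := by
    refine congrT ht (.of_forall fun s => ?_)
    rw [pair_compField]
    exact (integral_field hD _ (g := fun x y : E3 => α x * y i) (by simp)).symm
  have c5 : ∫ s in (0 : ℝ)..t, F.rate α i (ω, s) =
      (∫ s in (0 : ℝ)..t, ∫ x, α x * F.z (ω, s) x i) +
      (∫ s in (0 : ℝ)..t, ∑ k, ∫ x, pd k α x * (F.u (ω, s) x k * F.u (ω, s) x i)) -
      (∫ s in (0 : ℝ)..t, ∑ k, ∫ x, pd k α x * (ν * F.w (ω, s) x (k, i))) +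
      ∫ s in (0 : ℝ)..t, ∫ x, pd i α x * F.p (ω, s) x := by
    rw [← intervalIntegral.integral_add i4 i1, ← intervalIntegral.integral_sub (i4.add i1) i2,
      ← intervalIntegral.integral_add ((i4.add i1).sub i2) i3]
    exact congrT ht hrate
  have hm0 : ∀ s, F.mom α i (ω, s) = pair (S.u s.toNNReal ω : L2 D) (compField α i) := fun s => by
    rw [pair_compField]; exact mom_flow hν hD hG α i ω s
  rw [hm0, hm0, Real.toNNReal_zero, c5]
  rw [c1, c2, c3, c4] at hm
  linarith

include hν1 hb in
/-- The flow of a stationary solution satisfies the balance of two-point correlations. -/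
theorem balanced_flow (hp : IsPressure S.toMartingaleSolution p) :
    (S.flow hν hD hG).Balanced := by
  set F := S.flow hν hD hG with hF
  refine Flow.balanced_of_rate hν hν1 hD hb fun α β hα hβ i j => ?_
  -- If the product of rate and momentum is not integrable, its integral is 0 by convention, which
  -- is the value claimed.
  by_cases hint : Integrable (fun q => F.rate α i q * F.mom β j q + F.mom α i q * F.rate β j q)
    (timeProd S.P)
  swap
  · exact integral_undef hint
  have cont : ∀ {α : E3 → ℝ}, IsTest D α → ∀ i : Fin 3, Continuous fun v : Hsol D =>
      ∫ x in D, α x * (v : L2 D) x i := fun hα i =>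
    (continuous_integral_coord i (memLp_of_continuous_hasCompactSupport hα.1.continuous hα.2.1 _
      _)).comp continuous_subtype_val
  -- The product of the two momenta as a function of the state. It is continuous and bounded by a
  -- multiple of ‖v‖², hence integrable at every time.
  set g : Hsol D → ℝ := fun v => (∫ x in D, α x * (v : L2 D) x i) * ∫ x in D, β x * (v : L2 D) x j
    with hg
  have hgc : Continuous g := (cont hα i).mul (cont hβ j)
  have hbound : ∀ {α : E3 → ℝ}, IsTest D α → ∀ i : Fin 3, ∃ c : ℝ, 0 ≤ c ∧ ∀ v : Hsol D,
      |∫ x in D, α x * (v : L2 D) x i| ≤ c * ‖v‖ := by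
    intro α hα i
    have hmem : MemLp (compField α i) 2 (volume.restrict D) :=
      ((isTest_compField hα i).1.continuous.memLp_of_hasCompactSupport
        (isTest_compField hα i).2.1).restrict D
    refine ⟨‖hmem.toLp‖, norm_nonneg _, fun v => ?_⟩
    have e : ∫ x in D, α x * (v : L2 D) x i = inner ℝ (v : L2 D) hmem.toLp := by
      rw [← pair_compField, pair, L2.inner_def]
      refine integral_congr_ae ?_
      filter_upwards [hmem.coeFn_toLp] with x hx
      rw [hx]
    rw [e, mul_comm]
    exact abs_real_inner_le_norm _ _
  have hgi : ∀ t : ℝ≥0, Integrable (fun ω => g (S.u t ω)) S.P := by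
    intro t
    obtain ⟨c, hc0, hc⟩ := hbound hα i
    obtain ⟨d, hd0, hd⟩ := hbound hβ j
    have hu : Measurable (S.u t) := S.measurable_u.comp measurable_prodMk_left
    have h2 : Integrable (fun ω => ‖S.u t ω‖ ^ 2) S.P := by
      refine ⟨(hu.norm.pow_const 2).aestronglyMeasurable, ?_⟩
      rw [hasFiniteIntegral_iff_ofReal (.of_forall fun ω => by positivity)]
      simp only [ENNReal.ofReal_pow (norm_nonneg _), ofReal_norm]
      exact (hG.velocity_sq t).trans_lt
        (ENNReal.add_lt_top.2 ⟨hb.measure_lt_top, ENNReal.coe_lt_top⟩)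
    refine (h2.const_mul (c * d)).mono' (hgc.measurable.comp hu).aestronglyMeasurable
      (.of_forall fun ω => ?_)
    rw [Real.norm_eq_abs, hg, abs_mul]
    calc _ ≤ (c * ‖S.u t ω‖) * (d * ‖S.u t ω‖) := by gcongr; exacts [hc _, hd _]
      _ = _ := by ring
  -- This is where stationarity enters the balance: the endpoint terms of the product rule have
  -- equal means.
  have hstat : ∫ ω, g (S.u 1 ω) ∂S.P = ∫ ω, g (S.u 0 ω) ∂S.P :=
    (((S.identDistrib 1).comp measurable_fst).comp hgc.measurable).integral_eq
  rw [integral_prod _ hint]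
  have key : ∀ᵐ ω ∂S.P, ∫ s in Icc (0 : ℝ) 1,
      (F.rate α i (ω, s) * F.mom β j (ω, s) + F.mom α i (ω, s) * F.rate β j (ω, s)) =
      g (S.u 1 ω) - g (S.u 0 ω) := by
    filter_upwards [mom_eq_add_integral_rate hν hν1 hD hb hG hp hα i,
      mom_eq_add_integral_rate hν hν1 hD hb hG hp hβ j] with ω h1 h2
    have h3 := primitive_mul zero_le_one h1.1 h2.1 h1.2 h2.2
    rw [intervalIntegral.integral_of_le zero_le_one, ← integral_Icc_eq_integral_Ioc] at h3
    simp only [mom_flow, Real.toNNReal_one, Real.toNNReal_zero] at h3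
    simp only [hF, mom_flow]
    exact h3.symm
  rw [integral_congr_ae key, integral_sub (hgi 1) (hgi 0), hstat, sub_self]

end solution

/-! ### Structure functions as spherical means over the flow. -/

section representative

variable {D : Set E3} {T : E3 → E3 → ℝ} {ψ : E3 → ℝ} {C : ℝ}

lemma indicator_ae_eq_field (hD : IsOpen D) (v : L2 D) : D.indicator v =ᵐ[volume] field D v := by
  have h := (ae_restrict_iff' hD.measurableSet).1 (field_ae hD v)
  filter_upwards [h] with x hx
  by_cases hxD : x ∈ D
  · rw [indicator_of_mem hxD, hx hxD]
  · rw [indicator_of_notMem hxD, field_eq_zero v hxD]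

lemma ae_add_right {p : E3 → Prop} (h : ∀ᵐ x ∂(volume : Measure E3), p x) (y : E3) :
    ∀ᵐ x ∂(volume : Measure E3), p (x + y) :=
  (measurePreserving_add_right volume y).quasiMeasurePreserving.ae h

/-- The integral over the sphere of a cubic form of the increments of a field. -/
noncomputable def sphereForm (T : E3 → E3 → ℝ) (ψ : E3 → ℝ) (ℓ : ℝ) (v : L2 D) : ℝ :=
  ∫ n : Metric.sphere (0 : E3) 1, (∫ x, ψ x * T (field D v (x + ℓ • (n : E3)) - field D v x) n) ∂surface

/-- For each direction the representative is changed on a null set and on its translate only. Being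
supported in D, ψ allows integration over the whole space. -/
lemma integral_incr_eq_sphereForm (hD : IsOpen D) (hψ : IsTest D ψ) (ℓ : ℝ) (v : L2 D) :
    ∫ n : Metric.sphere (0 : E3) 1, (∫ x in D, ψ x *
      T (incr (D.indicator v) (ℓ • (n : E3)) x) n) ∂surface = sphereForm T ψ ℓ v := by
  refine integral_congr_ae (.of_forall fun n => ?_)
  simp only
  rw [setIntegral_eq_integral_of_tsupport fun x hx => by rw [hψ.eq_zero hx, zero_mul]]
  have h := indicator_ae_eq_field hD v
  refine integral_congr_ae ?_
  filter_upwards [h, ae_add_right h (ℓ • (n : E3))] with x h1 h2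
  rw [incr, h1, h2]

/-- Measurability in the state is what lets equality of laws transfer to the structure function. -/
lemma measurable_sphereForm (hD : IsOpen D) (hT : CubicForm T) (hψ : IsTest D ψ) (ℓ : ℝ) :
    Measurable fun v : Hsol D => sphereForm T ψ ℓ (v : L2 D) := by
  have h1 : Measurable fun s : (Hsol D × Metric.sphere (0 : E3) 1) × E3 => ψ s.2 *
      T (field D (s.1.1 : L2 D) (s.2 + ℓ • (s.1.2 : E3)) - field D (s.1.1 : L2 D) s.2) s.1.2 := by
    have m1 : Measurable fun s : (Hsol D × Metric.sphere (0 : E3) 1) × E3 => (s.1.1 : L2 D) :=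
      continuous_subtype_val.measurable.comp measurable_fst.fst
    have m2 : Measurable fun s : (Hsol D × Metric.sphere (0 : E3) 1) × E3 => (s.1.2 : E3) :=
      measurable_subtype_coe.comp measurable_fst.snd
    have m3 : Measurable fun s : (Hsol D × Metric.sphere (0 : E3) 1) × E3 => s.2 := measurable_snd
    have m4 : Measurable fun s : (Hsol D × Metric.sphere (0 : E3) 1) × E3 =>
        field D (s.1.1 : L2 D) (s.2 + ℓ • (s.1.2 : E3)) - field D (s.1.1 : L2 D) s.2 :=
      ((measurable_field hD).comp (m1.prodMk (m3.add (m2.const_smul ℓ)))).sub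
        ((measurable_field hD).comp (m1.prodMk m3))
    exact ((Flow.IsTest.measurable hψ).comp m3).mul (hT.measurable.comp (m4.prodMk m2))
  have h2 := h1.stronglyMeasurable.integral_prod_right' (ν := (volume : Measure E3))
  exact (h2.integral_prod_right' (ν := surface)).measurable

end representative

section solution

variable {D : Set E3} {B : StokesBasis D} {σ : ℕ → ℝ} {a : Vsol D →L[ℝ] Vsol D →L[ℝ] ℝ} {ν : ℝ}
  {S : StationarySolution.{u} B σ a ν}

/-- Time averages of functions of the state agree with the means at a fixed time. -/
lemma integral_timeProd_state {Θ : Hsol D × Hsol D → ℝ} (hΘ : Measurable Θ)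
    (hi : Integrable (fun q : S.Ω × ℝ => Θ (S.u q.2.toNNReal q.1, S.Z q.2.toNNReal q.1))
      (timeProd S.P)) (t : ℝ≥0) :
    ∫ q : S.Ω × ℝ, Θ (S.u q.2.toNNReal q.1, S.Z q.2.toNNReal q.1) ∂(timeProd S.P) =
      ∫ ω, Θ (S.u t ω, S.Z t ω) ∂S.P := by
  have hlaw : ∀ s, ∫ ω, Θ (S.u s ω, S.Z s ω) ∂S.P = ∫ ω, Θ (S.u 0 ω, S.Z 0 ω) ∂S.P := fun s =>
    ((S.identDistrib s).comp hΘ).integral_eq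
  rw [integral_prod_symm _ hi]
  simp only [hlaw]
  simp

variable {p : ℝ≥0 → S.Ω → E3 → ℝ} {G : ℝ≥0} {T : E3 → E3 → ℝ} {ψ : E3 → ℝ} {C ℓ : ℝ}

/-- Stationarity replaces the mean at time t by the mean over [0, 1]. Homogeneity of degree m in the
direction accounts for ℓ^m, since `third` evaluates the form at h = ℓn rather than at n. -/
lemma integral_sphereForm (hν : 0 ≤ ν) (hD : IsOpen D) (hG : SolutionBound S p G) (hT : CubicForm T)
    (hψ : Flow.CutoffBound D ψ C) {m : ℕ} (hhom : ∀ d h r, T d (r • h) = r ^ m * T d h) (hℓ : 0 < ℓ)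
    (hℓ1 : ℓ ≤ 1) (t : ℝ≥0) :
    1 / (4 * Real.pi) * ∫ ω, sphereForm T ψ ℓ (S.u t ω : L2 D) ∂S.P =
      (ℓ ^ m)⁻¹ * sphereMean (Flow.third (timeProd S.P) (S.flow hν hD hG) T ψ) ℓ := by
  set F := S.flow hν hD hG with hF
  set K : Metric.sphere (0 : E3) 1 × (S.Ω × ℝ) × E3 → ℝ := fun s =>
    ψ s.2.2 * T (F.du (s.2.1, s.2.2, ℓ • (s.1 : E3))) s.1 with hK
  have hn : ∀ n : Metric.sphere (0 : E3) 1, ‖ℓ • (n : E3)‖ ≤ 1 := fun n => by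
    rw [norm_smul, norm_eq_of_mem_sphere, mul_one, Real.norm_of_nonneg hℓ.le]; exact hℓ1
  have hn1 : ∀ n : Metric.sphere (0 : E3) 1, ‖(n : E3)‖ ≤ 1 := fun n =>
    (norm_eq_of_mem_sphere n).le
  have hC : 0 ≤ C := (abs_nonneg _).trans (hψ.abs_le 0)
  have hKm : Measurable K := by
    have m1 : Measurable fun s : Metric.sphere (0 : E3) 1 × (S.Ω × ℝ) × E3 => (s.1 : E3) :=
      measurable_subtype_coe.comp measurable_fst
    have m2 : Measurable fun s : Metric.sphere (0 : E3) 1 × (S.Ω × ℝ) × E3 =>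
        F.du (s.2.1, s.2.2, ℓ • (s.1 : E3)) :=
      F.measurable_du.comp (measurable_snd.fst.prodMk
        (measurable_snd.snd.prodMk (m1.const_smul ℓ)))
    exact ((Flow.IsTest.measurable hψ.isTest).comp measurable_snd.snd).mul
      (hT.measurable.comp (m2.prodMk m1))
  have hKb : ∀ s, ‖K s‖ ≤ C * ‖F.du (s.2.1, s.2.2, ℓ • (s.1 : E3))‖ ^ 3 := fun s => by
    rw [hK, Real.norm_eq_abs, abs_mul]
    gcongr
    exacts [hψ.abs_le _, hT.abs_le _ _ (hn1 _)]
  have hKi : ∀ n, Integrable (fun q => K (n, q)) ((timeProd S.P).prod volume) := fun n =>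
    ((F.integrable_du (ℓ • (n : E3))).const_mul C).mono'
      (hKm.comp measurable_prodMk_left).aestronglyMeasurable (.of_forall fun q => hKb (n, q))
  have hKint : Integrable K (surface.prod ((timeProd S.P).prod volume)) := by
    rw [integrable_prod_iff hKm.aestronglyMeasurable]
    refine ⟨.of_forall hKi, ?_⟩
    refine Integrable.of_bound (C := C * (8 * ∫ q, ‖F.u q.1 q.2‖ ^ 3 ∂((timeProd S.P).prod volume)))
      (hKm.norm.stronglyMeasurable.integral_prod_right'
        (ν := (timeProd S.P).prod volume)).aestronglyMeasurable (.of_forall fun n => ?_)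
    rw [Real.norm_of_nonneg (integral_nonneg fun q => norm_nonneg _)]
    calc _ ≤ ∫ q : (S.Ω × ℝ) × E3, C * ‖F.du (q.1, q.2, ℓ • (n : E3))‖ ^ 3
          ∂((timeProd S.P).prod volume) :=
          integral_mono (hKi n).norm ((F.integrable_du _).const_mul C) fun q => hKb (n, q)
      _ ≤ _ := by
        rw [integral_const_mul]
        gcongr
        exact F.integral_du_le _
  have hassoc := measurePreserving_prodAssoc surface (timeProd S.P) (volume : Measure E3)
  have hK2 : Integrable (fun s : Metric.sphere (0 : E3) 1 × S.Ω × ℝ => ∫ x, K (s.1, s.2, x))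
      (surface.prod (timeProd S.P)) :=
    ((hassoc.integrable_comp_emb (MeasurableEquiv.measurableEmbedding _)).2 hKint).integral_prod_left
  have e1 : ∀ q : S.Ω × ℝ, sphereForm T ψ ℓ (S.u q.2.toNNReal q.1 : L2 D) =
      ∫ n : Metric.sphere (0 : E3) 1, (∫ x, K (n, q, x)) ∂surface := fun q => rfl
  have hi : Integrable (fun q : S.Ω × ℝ => sphereForm T ψ ℓ (S.u q.2.toNNReal q.1 : L2 D))
      (timeProd S.P) := hK2.integral_prod_right
  have e2 := integral_timeProd_state (S := S)
    (Θ := fun v => sphereForm T ψ ℓ (v.1 : L2 D))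
    ((measurable_sphereForm hD hT hψ.isTest ℓ).comp measurable_fst) hi t
  rw [← e2]
  simp only [e1]
  rw [integral_integral_swap (f := fun (q : S.Ω × ℝ) (n : Metric.sphere (0 : E3) 1) =>
    ∫ x, K (n, q, x)) hK2.swap, sphereMean, mul_left_comm, ← integral_const_mul (ℓ ^ m)⁻¹]
  congr 1
  refine integral_congr_ae (.of_forall fun n => ?_)
  simp only
  rw [← integral_prod (f := fun q : (S.Ω × ℝ) × E3 => K (n, q)) (hKi n), Flow.third,
    ← integral_const_mul]
  refine integral_congr_ae (.of_forall fun q => ?_)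
  simp only [hK, hhom]
  have : ℓ ^ m ≠ 0 := pow_ne_zero _ hℓ.ne'
  field_simp

lemma structZero_eq (hν : 0 ≤ ν) (hD : IsOpen D) (hG : SolutionBound S p G)
    (hψ : Flow.CutoffBound D ψ C) (hℓ : 0 < ℓ) (hℓ1 : ℓ ≤ 1) (t : ℝ≥0) :
    1 / ℓ * structZero S.P (S.u t) ψ ℓ =
      (ℓ ^ 2)⁻¹ * sphereMean (Flow.third (timeProd S.P) (S.flow hν hD hG) zeroForm ψ) ℓ := by
  have h := integral_sphereForm hν hD hG cubicForm_zeroForm hψ zeroForm_smul hℓ hℓ1 t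
  have e : structZero S.P (S.u t) ψ ℓ =
      1 / (4 * Real.pi) * ∫ ω, sphereForm zeroForm ψ ℓ (S.u t ω : L2 D) ∂S.P := by
    simp only [← integral_incr_eq_sphereForm hD hψ.isTest]
    rfl
  rw [e, h]
  field_simp

lemma structPar_eq (hν : 0 ≤ ν) (hD : IsOpen D) (hG : SolutionBound S p G)
    (hψ : Flow.CutoffBound D ψ C) (hℓ : 0 < ℓ) (hℓ1 : ℓ ≤ 1) (t : ℝ≥0) :
    1 / ℓ * structPar S.P (S.u t) ψ ℓ =
      (ℓ ^ 4)⁻¹ * sphereMean (Flow.third (timeProd S.P) (S.flow hν hD hG) parForm ψ) ℓ := by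
  have h := integral_sphereForm hν hD hG cubicForm_parForm hψ parForm_smul hℓ hℓ1 t
  have e : structPar S.P (S.u t) ψ ℓ =
      1 / (4 * Real.pi) * ∫ ω, sphereForm parForm ψ ℓ (S.u t ω : L2 D) ∂S.P := by
    simp only [← integral_incr_eq_sphereForm hD hψ.isTest]
    rfl
  rw [e, h]
  field_simp

end solution

section calculus

variable {D : Set E3} {ψ : E3 → ℝ}

lemma inner_gradient_eq_sum (y x : E3) : inner ℝ y (gradient ψ x) = ∑ l, pd l ψ x * y l := by
  rw [real_inner_comm, inner_gradient_left]
  conv_lhs => rw [← (EuclideanSpace.basisFun (Fin 3) ℝ).sum_repr y]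
  rw [map_sum]
  simp [pd, mul_comm]

lemma IsTest.continuous_laplacian (hψ : IsTest D ψ) :
    Continuous (Laplacian.laplacian ψ : E3 → ℝ) := by
  rw [InnerProductSpace.laplacian_eq_iteratedFDeriv_stdOrthonormalBasis]
  have h : Continuous (iteratedFDeriv ℝ 2 ψ) := hψ.1.continuous_iteratedFDeriv (WithTop.coe_le_coe.2 (le_top : (2 : ℕ∞) ≤ ⊤))
  fun_prop

lemma IsTest.exists_abs_laplacian_le (hψ : IsTest D ψ) :
    ∃ A, ∀ x, |(Laplacian.laplacian ψ : E3 → ℝ) x| ≤ A := by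
  have hc : HasCompactSupport (Laplacian.laplacian ψ : E3 → ℝ) := by
    refine (hψ.2.1.iteratedFDeriv (𝕜 := ℝ) 2).mono fun x hx => ?_
    contrapose! hx
    simp only [Function.mem_support, ne_eq, not_not] at hx
    rw [InnerProductSpace.laplacian_eq_iteratedFDeriv_stdOrthonormalBasis]
    simp [hx]
  obtain ⟨A, hA⟩ := hc.exists_bound_of_continuous hψ.continuous_laplacian
  exact ⟨A, hA⟩

end calculus

/-! ### Flux, input and diffusion at a fixed time. -/

section solution

variable {D : Set E3} {B : StokesBasis D} {σ : ℕ → ℝ} {a : Vsol D →L[ℝ] Vsol D →L[ℝ] ℝ} {ν : ℝ}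
  {S : StationarySolution.{u} B σ a ν} {p : ℝ≥0 → S.Ω → E3 → ℝ} {G : ℝ≥0} {ψ : E3 → ℝ} {C : ℝ}

lemma localDissipation_eq (hD : IsOpen D) (hψ : IsTest D ψ) (t : ℝ≥0) :
    localDissipation S.P (S.u t) ψ = localDissipation S.P (S.u 0) ψ := by
  have hm : Measurable fun q : (Hsol D × Hsol D) × E3 =>
      ψ q.2 * ‖field D (grad D (q.1.1 : L2 D)) q.2‖ ^ 2 :=
    ((Flow.IsTest.measurable hψ).comp measurable_snd).mul
      ((measurable_gradField_comp hD measurable_fst).norm.pow_const 2)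
  have h := ((S.identDistrib t).comp
    (hm.stronglyMeasurable.integral_prod_right' (ν := (volume : Measure E3))).measurable).integral_eq
  simp only [Function.comp_def] at h
  simp only [integral_field hD _ (g := fun x (y : M3) => ψ x * ‖y‖ ^ 2) (by simp)] at h
  exact h

lemma localDiffusion_eq (hD : IsOpen D) (hψ : IsTest D ψ) (t : ℝ≥0) :
    localDiffusion S.P (S.u t) ψ = localDiffusion S.P (S.u 0) ψ := by
  have hm : Measurable fun q : (Hsol D × Hsol D) × E3 =>
      ‖field D (q.1.1 : L2 D) q.2‖ ^ 2 * (Laplacian.laplacian ψ : E3 → ℝ) q.2 :=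
    ((measurable_field_comp hD measurable_fst).norm.pow_const 2).mul
      (hψ.continuous_laplacian.measurable.comp measurable_snd)
  have h := ((S.identDistrib t).comp
    (hm.stronglyMeasurable.integral_prod_right' (ν := (volume : Measure E3))).measurable).integral_eq
  simp only [Function.comp_def] at h
  simp only [integral_field hD _
    (g := fun x (y : E3) => ‖y‖ ^ 2 * (Laplacian.laplacian ψ : E3 → ℝ) x) (by simp)] at h
  exact h

lemma integral_field_inner (hD : IsOpen D) (v z : L2 D) :
    ∫ x, ψ x * inner ℝ (field D v x) (field D z x) = ∫ x in D, ψ x * inner ℝ (v x) (z x) := by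
  rw [integral_field hD v (g := fun x y => ψ x * inner ℝ y (field D z x)) (by simp)]
  exact integral_congr_ae ((field_ae hD z).mono fun x hx => by simp only [hx])

lemma localInput_eq (hD : IsOpen D) (hψ : IsTest D ψ) (t : ℝ≥0) :
    localInput S.P (S.u t) (S.Z t) ψ = localInput S.P (S.u 0) (S.Z 0) ψ := by
  have hm : Measurable fun q : (Hsol D × Hsol D) × E3 =>
      ψ q.2 * inner ℝ (field D (q.1.1 : L2 D) q.2) (field D (q.1.2 : L2 D) q.2) :=
    ((Flow.IsTest.measurable hψ).comp measurable_snd).mul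
      ((measurable_field_comp hD measurable_fst).inner (measurable_field_comp hD measurable_snd))
  have h := ((S.identDistrib t).comp
    (hm.stronglyMeasurable.integral_prod_right' (ν := (volume : Measure E3))).measurable).integral_eq
  simp only [Function.comp_def, integral_field_inner hD] at h
  exact h

/-- Stationarity concerns (u, Z) only and says nothing about the pressure. The flux is nevertheless
independent of time, because the local energy equality expresses it through functionals of (u, Z).
-/
lemma localFlux_eq (hD : IsOpen D) (hψ : IsTest D ψ)
    (h : ∀ t, 2 * ν * localDissipation S.P (S.u t) ψ = ν * localDiffusion S.P (S.u t) ψ +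
      localFlux S.P (S.u t) (p t) ψ + 2 * localInput S.P (S.u t) (S.Z t) ψ) (t : ℝ≥0) :
    localFlux S.P (S.u t) (p t) ψ = localFlux S.P (S.u 0) (p 0) ψ := by
  have h1 := h t
  have h2 := h 0
  rw [localDissipation_eq hD hψ, localDiffusion_eq hD hψ, localInput_eq hD hψ] at h1
  linarith

lemma integral_timeProd_eq {Ω : Type*} [MeasurableSpace Ω] {P : Measure Ω} [SFinite P]
    {g : (Ω × ℝ) × E3 → ℝ} (hg : Integrable g ((timeProd P).prod volume)) {c : ℝ}
    (h : ∀ s, ∫ ω, (∫ x, g ((ω, s), x)) ∂P = c) : ∫ q, g q ∂((timeProd P).prod volume) = c := by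
  rw [integral_prod _ hg, integral_prod_symm _ hg.integral_prod_left]
  simp [h]

lemma integral_field_flux (hD : IsOpen D) (v : L2 D) (b : E3 → ℝ) :
    ∫ x, (‖field D v x‖ ^ 2 + 2 * D.indicator b x) * inner ℝ (field D v x) (gradient ψ x) =
      ∫ x in D, (‖v x‖ ^ 2 + 2 * b x) * inner ℝ (v x) (gradient ψ x) := by
  rw [integral_field hD v
    (g := fun x y => (‖y‖ ^ 2 + 2 * D.indicator b x) * inner ℝ y (gradient ψ x)) (by simp)]
  exact setIntegral_congr_fun hD.measurableSet fun x hx => by simp only [indicator_of_mem hx]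

/-- The local flux and energy input, as a space-time integral. -/
theorem integral_local_flow (hν : 0 ≤ ν) (hD : IsOpen D) (hb : Bornology.IsBounded D)
    (hG : SolutionBound S p G) (hψ : Flow.CutoffBound D ψ C)
    (h : ∀ t, 2 * ν * localDissipation S.P (S.u t) ψ = ν * localDiffusion S.P (S.u t) ψ +
      localFlux S.P (S.u t) (p t) ψ + 2 * localInput S.P (S.u t) (S.Z t) ψ) (t : ℝ≥0) :
    ∫ q, (S.flow hν hD hG).local_ ψ q ∂((timeProd S.P).prod volume) =
      localFlux S.P (S.u t) (p t) ψ + 2 * localInput S.P (S.u t) (S.Z t) ψ := by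
  set F := S.flow hν hD hG with hF
  have i1 : Integrable (fun q : (S.Ω × ℝ) × E3 => (‖F.u q.1 q.2‖ ^ 2 + 2 * F.p q.1 q.2) *
      inner ℝ (F.u q.1 q.2) (gradient ψ q.2)) ((timeProd S.P).prod volume) := by
    have h1 := integrable_finsetSum Finset.univ fun l _ => (integrable_finsetSum Finset.univ
      fun i _ => F.integrable_advection hν hD hb hψ l i i).add
        ((F.integrable_pressureWork hν hD hb hψ l l).const_mul 2)
    refine h1.congr (.of_forall fun q => ?_)
    simp only [Pi.add_apply, inner_gradient_eq_sum, Flow.norm_sq_eq_sum, Fin.sum_univ_three]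
    ring
  have i2 : Integrable (fun q : (S.Ω × ℝ) × E3 => ψ q.2 * inner ℝ (F.u q.1 q.2) (F.z q.1 q.2))
      ((timeProd S.P).prod volume) := by
    have h1 := integrable_finsetSum Finset.univ fun i _ => F.integrable_power hν hD hb hψ i i
    refine h1.congr (.of_forall fun q => ?_)
    simp only [Flow.inner_eq_sum, Fin.sum_univ_three]
    ring
  have e1 := integral_timeProd_eq i1 (c := localFlux S.P (S.u t) (p t) ψ) fun s => by
    rw [localFlux_eq hD hψ.isTest h t, ← localFlux_eq hD hψ.isTest h s.toNNReal]
    exact integral_congr_ae (.of_forall fun ω => integral_field_flux hD (S.u s.toNNReal ω : L2 D) (p s.toNNReal ω))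
  have e2 := integral_timeProd_eq i2 (c := localInput S.P (S.u t) (S.Z t) ψ) fun s => by
    rw [localInput_eq hD hψ.isTest t, ← localInput_eq hD hψ.isTest s.toNNReal]
    exact integral_congr_ae (.of_forall fun ω =>
      integral_field_inner hD (S.u s.toNNReal ω : L2 D) (S.Z s.toNNReal ω : L2 D))
  rw [← e1, ← e2, ← integral_const_mul, ← integral_add i1 (i2.const_mul 2)]
  refine integral_congr_ae (.of_forall fun q => ?_)
  simp only [Flow.local_, inner_gradient_eq_sum, Flow.norm_sq_eq_sum]
  simp only [Flow.inner_eq_sum, Fin.sum_univ_three]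
  ring

/-- E‖u‖² is at most |D| plus the third moment of u. After multiplication by ν this term is
therefore O(ν) uniformly. -/
lemma abs_localDiffusion_le (hG : SolutionBound S p G) {A : ℝ} (hb : Bornology.IsBounded D)
    (hA : ∀ x, |(Laplacian.laplacian ψ : E3 → ℝ) x| ≤ A) (t : ℝ≥0) :
    |localDiffusion S.P (S.u t) ψ| ≤ A * ((volume D).toReal + G) := by
  have hA0 : 0 ≤ A := (abs_nonneg _).trans (hA 0)
  have h1 : ∀ v : L2 D, ‖∫ x in D, ‖v x‖ ^ 2 * (Laplacian.laplacian ψ : E3 → ℝ) x‖ₑ ≤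
      ENNReal.ofReal A * ‖v‖ₑ ^ 2 := fun v => by
    refine (enorm_integral_le_lintegral_enorm _).trans ?_
    rw [← lintegral_norm_sq, ← lintegral_const_mul' _ _ ENNReal.ofReal_ne_top]
    refine lintegral_mono fun x => ?_
    rw [enorm_mul, mul_comm, enorm_pow, enorm_norm, Real.enorm_eq_ofReal_abs]
    gcongr
    exact hA x
  have h2 : ‖localDiffusion S.P (S.u t) ψ‖ₑ ≤ ENNReal.ofReal (A * ((volume D).toReal + G)) := by
    refine (enorm_integral_le_lintegral_enorm _).trans ((lintegral_mono fun ω => h1 _).trans ?_)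
    rw [lintegral_const_mul' _ _ ENNReal.ofReal_ne_top, ENNReal.ofReal_mul hA0,
      ENNReal.ofReal_add ENNReal.toReal_nonneg G.coe_nonneg, ENNReal.ofReal_toReal hb.measure_lt_top.ne,
      ENNReal.ofReal_coe_nnreal]
    gcongr
    exact hG.velocity_sq t
  rw [Real.enorm_eq_ofReal_abs] at h2
  exact (ENNReal.ofReal_le_ofReal_iff (by positivity)).1 h2

end solution

section cutoff

variable {D : Set E3} {ψ : E3 → ℝ}

lemma IsTest.exists_cutoffBound (hψ : IsTest D ψ) : ∃ C, Flow.CutoffBound D ψ C := by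
  obtain ⟨C₀, h₀⟩ := hψ.bounded
  choose C₁ h₁ using fun l => (hψ.pd l).bounded
  obtain ⟨K, hK⟩ := hψ.1.lipschitzWith_of_hasCompactSupport hψ.2.1 (by simp)
  have hC₀ : 0 ≤ C₀ := (abs_nonneg _).trans (h₀ 0)
  have hC₁ : ∀ l, 0 ≤ C₁ l := fun l => (abs_nonneg _).trans (h₁ l 0)
  have hs := fun l => Finset.single_le_sum (fun i _ => hC₁ i) (Finset.mem_univ l)
  have hs0 : 0 ≤ ∑ l, C₁ l := Finset.sum_nonneg fun l _ => hC₁ l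
  have hK0 := K.coe_nonneg
  refine ⟨C₀ + ∑ l, C₁ l + K, hψ, fun x => ?_, fun l x => ?_, fun x h => ?_⟩
  · linarith [h₀ x]
  · linarith [h₁ l x, hs l]
  · have h2 := hK.dist_le_mul (x + h) x
    rw [Real.dist_eq, dist_eq_norm, add_sub_cancel_left] at h2
    refine h2.trans ?_
    gcongr
    linarith

/-- Room around supp ψ for a separation y and, around x + y, for the mollifiers of
`integral_two_point`; one radius R serves both purposes. -/
lemma IsTest.exists_radius (hD : IsOpen D) (hψ : IsTest D ψ) : ∃ R > 0, R ≤ 1 ∧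
    ∀ x ∈ tsupport ψ, ∀ y, ‖y‖ ≤ R → Metric.closedBall (x + y) R ⊆ D := by
  obtain ⟨δ, hδ, h⟩ := hψ.2.1.exists_cthickening_subset_open hD hψ.2.2
  refine ⟨min 1 (δ / 2), by positivity, min_le_left _ _, fun x hx y hy z hz => h ?_⟩
  refine Metric.mem_cthickening_of_dist_le z x δ _ hx ?_
  have h1 := dist_triangle z (x + y) x
  have h2 : dist (x + y) x = ‖y‖ := by rw [dist_eq_norm, add_sub_cancel_left]
  have h3 := min_le_right 1 (δ / 2)
  rw [Metric.mem_closedBall] at hz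
  linarith

end cutoff

/-! ### Moments and moduli of continuity of the flow. -/

section solution

variable {D : Set E3} {B : StokesBasis D} {σ : ℕ → ℝ} {a : Vsol D →L[ℝ] Vsol D →L[ℝ] ℝ} {ν : ℝ}
  {S : StationarySolution.{u} B σ a ν} {p : ℝ≥0 → S.Ω → E3 → ℝ} {G : ℝ≥0} {ψ : E3 → ℝ}
  (hν : 0 ≤ ν) (hD : IsOpen D) (hb : Bornology.IsBounded D) (hG : SolutionBound S p G)

include hb in
lemma integral_dens_flow_le : ∫ q, (S.flow hν hD hG).dens q ∂((timeProd S.P).prod volume) ≤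
    (volume D).toReal + 4 * G := by
  classical
  have hv := hb.measure_lt_top (μ := (volume : Measure E3))
  have h0 := integrable_timeProd (P := S.P) (f := fun q => D.indicator (fun _ => 1) q.2)
    ((measurable_const.indicator hD.measurableSet).comp measurable_snd)
    (fun q => indicator_nonneg (fun _ _ => zero_le_one) _) (C := (volume D).toReal)
    ENNReal.toReal_nonneg fun s => by
      have e : ∀ x, ENNReal.ofReal (D.indicator (fun _ => 1) x) = D.indicator (fun _ => 1) x :=
        fun x => by by_cases hx : x ∈ D <;> simp [hx]
      simp only [e]
      rw [lintegral_indicator hD.measurableSet, ENNReal.ofReal_toReal hv.ne]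
      simp
  have h1 := hG.integrable_u hD
  have h2 := hG.integrable_p hD
  have h3 := hG.integrable_z hD
  have h4 := hG.integrable_w hν hD
  have e : ∀ q, (S.flow hν hD hG).dens q = D.indicator (fun _ => 1) q.2 +
      ‖field D (S.u q.1.2.toNNReal q.1.1 : L2 D) q.2‖ ^ 3 +
      √|D.indicator (p q.1.2.toNNReal q.1.1) q.2| ^ 3 +
      ‖field D (S.Z q.1.2.toNNReal q.1.1 : L2 D) q.2‖ ^ 2 +
      ν * ‖field D (grad D (S.u q.1.2.toNNReal q.1.1 : L2 D)) q.2‖ ^ 2 := fun q => by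
    rw [indicator_apply]; rfl
  simp only [e]
  have i1 := h0.1.add h1.1
  have i2 := i1.add h2.1
  have i3 := i2.add h3.1
  simp only [Pi.add_def] at i1 i2 i3
  rw [integral_add i3 h4.1, integral_add i2 h3.1, integral_add i1 h2.1, integral_add h0.1 h1.1]
  linarith [h0.2, h1.2, h2.2, h3.2, h4.2]

lemma measurableSet_overlap (hD : IsOpen D) (h : E3) : MeasurableSet (overlap D h) :=
  hD.measurableSet.inter (measurable_add_const h hD.measurableSet)

/-- The compactness hypothesis controls only increments between points of D, and `innerIncr` sees no
others, so the jump caused by extension by zero does not enter. -/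
lemma integral_innerIncr_flow_le {h : E3} {m : ℝ} (hm : 0 ≤ m)
    (H : ∀ t, ∫⁻ ω, (∫⁻ x in overlap D h, ‖incr (S.u t ω : L2 D) h x‖ₑ ^ 3) ∂S.P ≤
      ENNReal.ofReal m) :
    ∫ q : (S.Ω × ℝ) × E3, (S.flow hν hD hG).innerIncr (q.1, q.2, h)
      ∂((timeProd S.P).prod volume) ≤ m := by
  classical
  set F := S.flow hν hD hG with hF
  refine (integrable_timeProd ((F.measurable_innerIncr hD).comp (Flow.measurable_slice h))
    (fun q => F.innerIncr_nonneg _) hm fun s => ?_).2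
  refine le_trans (lintegral_mono fun ω => ?_) (H s.toNNReal)
  rw [← lintegral_indicator (measurableSet_overlap hD h)]
  have h1 := (ae_restrict_iff' hD.measurableSet).1 (field_ae hD (S.u s.toNNReal ω : L2 D))
  refine lintegral_mono_ae ?_
  filter_upwards [h1, ae_add_right h1 h] with x hx hx'
  simp only [Function.comp, Flow.innerIncr]
  split_ifs with hxD
  · rw [indicator_of_mem (show x ∈ overlap D h from hxD), ENNReal.ofReal_pow (norm_nonneg _),
      ofReal_norm, incr, ← hx hxD.1, ← hx' hxD.2]
    rfl
  · simp

include hD in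
lemma integral_pressureIncr_le (hG : SolutionBound S p G) {h : E3} {m : ℝ} (hm : 0 ≤ m)
    (H : ∀ t, ∫⁻ ω, (∫⁻ x in overlap D h, ‖incr (p t ω) h x‖ₑ ^ (3 / 2 : ℝ)) ∂S.P ≤
      ENNReal.ofReal m) :
    Integrable (fun q : (S.Ω × ℝ) × E3 => (overlap D h).indicator (fun x =>
      √|D.indicator (p q.1.2.toNNReal q.1.1) (x + h) -
        D.indicator (p q.1.2.toNNReal q.1.1) x| ^ 3) q.2) ((timeProd S.P).prod volume) ∧
    ∫ q : (S.Ω × ℝ) × E3, (overlap D h).indicator (fun x =>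
      √|D.indicator (p q.1.2.toNNReal q.1.1) (x + h) -
        D.indicator (p q.1.2.toNNReal q.1.1) x| ^ 3) q.2 ∂((timeProd S.P).prod volume) ≤ m := by
  have hp := hG.measurable_pressure hD
  have hd : Measurable fun q : (S.Ω × ℝ) × E3 =>
      √|D.indicator (p q.1.2.toNNReal q.1.1) (q.2 + h) -
        D.indicator (p q.1.2.toNNReal q.1.1) q.2| ^ 3 :=
    (Real.continuous_sqrt.measurable.comp (((hp.comp (measurable_fst.prodMk
      (measurable_snd.add_const h))).sub hp).abs)).pow_const 3
  have hd' : Measurable fun q : (S.Ω × ℝ) × E3 => (overlap D h).indicator (fun x =>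
      √|D.indicator (p q.1.2.toNNReal q.1.1) (x + h) -
        D.indicator (p q.1.2.toNNReal q.1.1) x| ^ 3) q.2 :=
    hd.indicator (measurable_snd (measurableSet_overlap hD h))
  refine integrable_timeProd hd'
    (fun q => indicator_nonneg (fun _ _ => by positivity) _) hm fun s => ?_
  refine le_trans (lintegral_mono fun ω => ?_) (H s.toNNReal)
  rw [← lintegral_indicator (measurableSet_overlap hD h)]
  refine lintegral_mono fun x => ?_
  by_cases hx : x ∈ overlap D h
  · simp only [indicator_of_mem hx, ofReal_sqrt_abs_cube, incr, indicator_of_mem hx.1,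
      indicator_of_mem hx.2, le_refl]
  · simp [indicator_of_notMem hx]

/-- For x in supp ψ the translate x + h stays in D, so the hypotheses apply; velocity and pressure
contribute m each. -/
lemma integral_incrDens_flow_le {h : E3} {m : ℝ} (hm : 0 ≤ m)
    (hh : ∀ x ∈ tsupport ψ, x ∈ overlap D h)
    (H : ∀ t, ∫⁻ ω, (∫⁻ x in overlap D h, ‖incr (S.u t ω : L2 D) h x‖ₑ ^ 3) ∂S.P ≤
      ENNReal.ofReal m)
    (H' : ∀ t, ∫⁻ ω, (∫⁻ x in overlap D h, ‖incr (p t ω) h x‖ₑ ^ (3 / 2 : ℝ)) ∂S.P ≤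
      ENNReal.ofReal m) :
    ∫ q : (S.Ω × ℝ) × E3, (S.flow hν hD hG).incrDens ψ (q.1, q.2, h)
      ∂((timeProd S.P).prod volume) ≤ 2 * m := by
  have h1 := integral_innerIncr_flow_le hν hD hG hm H
  have h2 := integral_pressureIncr_le hD hG hm H'
  have h3 := (S.flow hν hD hG).integrable_innerIncr hD h
  refine (integral_mono_of_nonneg (.of_forall fun q => (S.flow hν hD hG).incrDens_nonneg _ _)
    (h3.add h2.1) (.of_forall fun q => ?_)).trans ?_
  · simp only [Flow.incrDens, Pi.add_apply]
    split_ifs with hq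
    · have hq' : q.2 ∈ D ∧ q.2 + h ∈ D := hh _ hq
      rw [indicator_of_mem (hh _ hq), Flow.innerIncr, if_pos hq']
      rfl
    · exact add_nonneg ((S.flow hν hD hG).innerIncr_nonneg _)
        (indicator_nonneg (fun _ _ => by positivity) _)
  · have e := integral_add h3 h2.1
    simp only [Pi.add_apply]
    rw [e]
    linarith [h2.2]

end solution

/-! ### Vanishing in a range of scales -/

lemma tendsto_coe_viscToZero : Tendsto (fun ν : Visc => (ν : ℝ)) viscToZero (𝓝 0) :=
  tendsto_comap

/-- The scales `ν ^ (1 / 4)`. -/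
noncomputable def rootScale (ν : Visc) : ℝ := √√(ν : ℝ)

lemma rootScale_pos (ν : Visc) : 0 < rootScale ν := Real.sqrt_pos.2 (Real.sqrt_pos.2 ν.2.1)

lemma tendsto_rootScale : Tendsto rootScale viscToZero (𝓝 0) := by
  have h := ((Real.continuous_sqrt.comp Real.continuous_sqrt).tendsto 0).comp tendsto_coe_viscToZero
  change Tendsto (fun ν : Visc => √√(ν : ℝ)) viscToZero (𝓝 0)
  simpa [Function.comp_def] using h

/-- With ℓ_ν = ν^{1/4} one has √ν = ℓ_ν² ≤ ηℓ as soon as ℓ_ν ≤ η and ℓ ≥ ℓ_ν, so the scale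
separation needed for the estimate holds on the whole range. -/
lemma vanishesInRange_rootScale {F : Visc → ℝ → ℝ} (hF : ∀ ε > 0, ∃ η > 0, ∀ (ν : Visc) (ℓ : ℝ),
    0 < ℓ → ℓ ≤ η → √(ν : ℝ) ≤ η * ℓ → |F ν ℓ| ≤ ε) : VanishesInRange rootScale F := by
  refine ENNReal.tendsto_nhds_zero.2 fun ε hε => ?_
  obtain ⟨e, he, heε⟩ := ENNReal.lt_iff_exists_nnreal_btwn.1 hε
  obtain ⟨η, hη, h⟩ := hF e (by exact_mod_cast he)
  filter_upwards [Ioo_mem_nhdsGT hη] with ℓI hℓI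
  refine limsup_le_of_le (by isBoundedDefault) ?_
  filter_upwards [tendsto_rootScale.eventually (ge_mem_nhds hη)] with ν hν
  refine iSup₂_le fun ℓ hℓ => le_trans ?_ heε.le
  have hr := rootScale_pos ν
  have h1 := h ν ℓ (hr.trans_le hℓ.1) (hℓ.2.trans hℓI.2.le) (by
    have h2 : rootScale ν * rootScale ν = √(ν : ℝ) := Real.mul_self_sqrt (Real.sqrt_nonneg _)
    rw [← h2]
    exact mul_le_mul hν hℓ.1 hr.le hη.le)
  rw [Real.enorm_eq_ofReal_abs]
  exact ENNReal.ofReal_le_of_le_toReal (by simpa using h1)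

lemma VanishesInRange.congr_of_abs_sub_le {ℓν : Visc → ℝ} {F F' : Visc → ℝ → ℝ} {A : ℝ}
    (hF : VanishesInRange ℓν F) (h : ∀ ν ℓ, |F' ν ℓ - F ν ℓ| ≤ ν * A) : VanishesInRange ℓν F' := by
  refine ENNReal.tendsto_nhds_zero.2 fun ε hε => ?_
  have hε2 : 0 < ε / 2 := ENNReal.half_pos hε.ne'
  have hA : Tendsto (fun ν : Visc => ENNReal.ofReal (ν * A)) viscToZero (𝓝 0) := by
    have := ENNReal.tendsto_ofReal (tendsto_coe_viscToZero.mul_const A)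
    simpa using this
  filter_upwards [hF.eventually (gt_mem_nhds hε2)] with ℓI hℓI
  refine limsup_le_of_le (by isBoundedDefault) ?_
  filter_upwards [eventually_lt_of_limsup_lt hℓI, hA.eventually (gt_mem_nhds hε2)] with ν h1 h2
  refine iSup₂_le fun ℓ hℓ => ?_
  have h3 : ‖F ν ℓ‖ₑ ≤ ε / 2 :=
    (le_iSup₂ (f := fun ℓ (_ : ℓ ∈ Icc (ℓν ν) ℓI) => ‖F ν ℓ‖ₑ) ℓ hℓ).trans h1.le
  have h4 : ‖F' ν ℓ - F ν ℓ‖ₑ ≤ ε / 2 := by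
    rw [Real.enorm_eq_ofReal_abs]
    exact (ENNReal.ofReal_le_ofReal (h ν ℓ)).trans h2.le
  calc ‖F' ν ℓ‖ₑ = ‖F ν ℓ + (F' ν ℓ - F ν ℓ)‖ₑ := by rw [add_sub_cancel]
    _ ≤ ‖F ν ℓ‖ₑ + ‖F' ν ℓ - F ν ℓ‖ₑ := enorm_add_le _ _
    _ ≤ ε / 2 + ε / 2 := add_le_add h3 h4
    _ = ε := ENNReal.add_halves ε

/-! ### The error is small uniformly in the viscosity -/

lemma exists_lawError_le {C G : ℝ} (hC : 0 ≤ C) (hG : 0 ≤ G) {ε : ℝ} (hε : 0 < ε) :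
    ∃ lam M η : ℝ, 1 ≤ lam ∧ 0 < M ∧ 0 < η ∧ ∀ ν ℓ : ℝ, 0 < ℓ → ℓ ≤ η → √ν ≤ η * ℓ →
      Flow.lawError ν C G M lam ℓ ≤ ε := by
  set K := 400000 * C * (6 * G + 1) + 1 with hK
  have hK0 : 0 < K := by positivity
  have hCG : 0 ≤ C * G := mul_nonneg hC hG
  -- The order of choice matters: λ makes the λ⁻¹ term at most ε/3, then M is taken small depending
  -- on λ, and η controls ℓ, √ν and √ν/ℓ, again by ε/3.
  refine ⟨1 + 3 * K / ε, ε / (3 * K * (1 + 3 * K / ε) ^ 3), min 1 (ε / (3 * K)), ?_, by positivity,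
    by positivity, fun ν ℓ hℓ hℓη hν => ?_⟩
  · have : 0 ≤ 3 * K / ε := by positivity
    linarith
  set lam := 1 + 3 * K / ε with hlam
  have hl : 0 < lam := by positivity
  set η := min 1 (ε / (3 * K)) with hη
  have hη0 : 0 < η := by positivity
  have hη1 : η ≤ 1 := min_le_left _ _
  have h1 : √ν / ℓ ≤ η := (div_le_iff₀ hℓ).2 hν
  have h2 : √ν ≤ η := hν.trans (by nlinarith)
  have h3 : K * (lam ^ 3 * (ε / (3 * K * lam ^ 3))) = ε / 3 := by field_simp
  have h4 : K * lam⁻¹ ≤ ε / 3 := by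
    rw [← div_eq_mul_inv, div_le_iff₀ hl, hlam]
    have : ε / 3 * (1 + 3 * K / ε) = ε / 3 + K := by field_simp
    linarith
  have h5 : K * η ≤ ε / 3 := by
    calc K * η ≤ K * (ε / (3 * K)) := by gcongr; exact min_le_right _ _
      _ = ε / 3 := by field_simp
  have hM : 0 ≤ lam ^ 3 * (ε / (3 * K * lam ^ 3)) := by positivity
  have hl' : 0 ≤ lam⁻¹ := by positivity
  have e : Flow.lawError ν C G (ε / (3 * K * lam ^ 3)) lam ℓ =
      400000 * C * (lam ^ 3 * (ε / (3 * K * lam ^ 3))) + 400000 * C * G * lam⁻¹ +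
      400000 * C * G * (2 * ℓ + √ν + 3 * (√ν / ℓ)) := by
    rw [Flow.lawError]; ring
  have k1 : 400000 * C ≤ K := by rw [hK]; nlinarith
  have k2 : 400000 * C * G ≤ K := by rw [hK]; nlinarith
  have k3 : 400000 * C * G * (2 * ℓ + √ν + 3 * (√ν / ℓ)) ≤ K * η := by
    calc _ ≤ 400000 * C * G * (2 * η + η + 3 * η) := by gcongr
      _ = (400000 * C * G * 6) * η := by ring
      _ ≤ K * η := by gcongr; rw [hK]; nlinarith
  rw [e]
  have := mul_le_mul_of_nonneg_right k1 hM
  have := mul_le_mul_of_nonneg_right k2 hl'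
  linarith

/-! ### Bounds uniform in the viscosity and the flux scale. -/

section families

variable {D : Set E3} {B : StokesBasis D} {σ : ℕ → ℝ} {a : Vsol D →L[ℝ] Vsol D →L[ℝ] ℝ}
  {S : ∀ ν : Visc, StationarySolution.{u} B σ a ν} {p : ∀ ν : Visc, ℝ≥0 → (S ν).Ω → E3 → ℝ}
  {ψ : E3 → ℝ}

/-- The velocity and pressure moments are assumed and the forcing moment comes from
`exists_forcing_bound`. The energy estimate bounds ν times the mean Dirichlet energy through E‖u‖² ≤
|D| + C₁. -/
lemma exists_solutionBound (hD : IsOpen D) (hb : Bornology.IsBounded D)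
    (hσ : Summable fun k => σ k ^ 2) (ha : ComparableToStokes a) (hS : EnergyEstimate S)
    (h1 : VelocityCompactness S) (h2 : PressureCompactness S p) :
    ∃ G : ℝ≥0, ∀ ν, SolutionBound (S ν) (p ν) G := by
  obtain ⟨K, hK⟩ := exists_forcing_bound (B := B) hD hb hσ ha
  obtain ⟨⟨C₁, hC₁⟩, -⟩ := h1
  obtain ⟨hp, ⟨C₂, hC₂⟩, -⟩ := h2
  obtain ⟨c₁, c₂, hE⟩ := hS
  set v := (volume D).toNNReal with hv
  have hv' : volume D = v := (ENNReal.coe_toNNReal hb.measure_lt_top.ne).symm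
  set E := c₁ * (v + C₁) + c₂ * (v + C₁) ^ (3 / 2 : ℝ) with hEdef
  have hle : ∀ {x : ℝ≥0∞} {y z : ℝ≥0}, x ≤ y → y ≤ z → x ≤ z := fun h h' =>
    h.trans (ENNReal.coe_le_coe.2 h')
  refine ⟨C₁ + C₂ + K + E, fun ν => ⟨(hp ν).1, fun t => hle (hC₁ ν t) ?_, fun t => hle (hC₂ ν t) ?_,
    fun t => hle (hK ν (S ν) t) ?_, fun t => hle (y := E) ?_ le_add_self⟩⟩
  · exact le_add_right (le_add_right le_self_add)
  · exact le_add_right (le_add_right le_add_self)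
  · exact le_add_right le_add_self
  · have hu := lintegral_velocity_sq_le (S := S ν) (hC₁ ν t)
    have hν1 : ENNReal.ofReal ν ≤ 1 := by simpa using ν.2.2.le
    rw [hv'] at hu
    refine (hE ν t).trans ?_
    rw [hEdef]
    push_cast
    rw [ENNReal.coe_rpow_of_nonneg _ (by norm_num)]
    push_cast
    refine add_le_add ?_ (by gcongr)
    calc _ ≤ (c₁ : ℝ≥0∞) * 1 * (v + C₁) := by gcongr
      _ = _ := by rw [mul_one]

/-- The increments of the velocity and the pressure are uniformly small. -/
lemma exists_modulus (h1 : VelocityCompactness S) (h2 : PressureCompactness S p) {m : ℝ}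
    (hm : 0 < m) : ∃ δ > 0, ∀ h : E3, ‖h‖ < δ → ∀ ν t,
      ∫⁻ ω, (∫⁻ x in overlap D h, ‖incr ((S ν).u t ω : L2 D) h x‖ₑ ^ 3) ∂(S ν).P ≤
        ENNReal.ofReal m ∧
      ∫⁻ ω, (∫⁻ x in overlap D h, ‖incr (p ν t ω) h x‖ₑ ^ (3 / 2 : ℝ)) ∂(S ν).P ≤
        ENNReal.ofReal m := by
  have hm' : 0 < ENNReal.ofReal m := ENNReal.ofReal_pos.2 hm
  obtain ⟨δ, hδ, h⟩ := Metric.eventually_nhds_iff.1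
    ((h1.2.eventually (gt_mem_nhds hm')).and (h2.2.2.eventually (gt_mem_nhds hm')))
  refine ⟨δ, hδ, fun y hy ν t => ?_⟩
  obtain ⟨h3, h4⟩ := h (y := y) (by simpa using hy)
  exact ⟨(le_iSup₂ (f := fun (ν : Visc) (t : ℝ≥0) => ∫⁻ ω, (∫⁻ x in overlap D y,
      ‖incr ((S ν).u t ω : L2 D) y x‖ₑ ^ 3) ∂(S ν).P) ν t).trans h3.le,
    (le_iSup₂ (f := fun (ν : Visc) (t : ℝ≥0) => ∫⁻ ω, (∫⁻ x in overlap D y,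
      ‖incr (p ν t ω) y x‖ₑ ^ (3 / 2 : ℝ)) ∂(S ν).P) ν t).trans h4.le⟩

/-- The structure functions are close to the flux and the energy input, uniformly in the viscosity,
at small scales which are large compared with the square root of the viscosity. -/
theorem exists_scale_structure_le (hD : IsOpen D) (hb : Bornology.IsBounded D)
    (hψ : IsTest D ψ) {G : ℝ≥0} (hG : ∀ ν, SolutionBound (S ν) (p ν) G)
    (h1 : VelocityCompactness S) (h2 : PressureCompactness S p)
    (h3 : LocalEnergyEquality S p ψ) {ε : ℝ} (hε : 0 < ε) :
    ∃ η > 0, ∀ (ν : Visc) (t : ℝ≥0) (ℓ : ℝ), 0 < ℓ → ℓ ≤ η → √(ν : ℝ) ≤ η * ℓ →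
      |1 / ℓ * structZero (S ν).P ((S ν).u t) ψ ℓ
        + 2 / 3 * localFlux (S ν).P ((S ν).u t) (p ν t) ψ
        + 4 / 3 * localInput (S ν).P ((S ν).u t) ((S ν).Z t) ψ| ≤ ε ∧
      |1 / ℓ * structPar (S ν).P ((S ν).u t) ψ ℓ
        + 2 / 5 * localFlux (S ν).P ((S ν).u t) (p ν t) ψ
        + 4 / 5 * localInput (S ν).P ((S ν).u t) ((S ν).Z t) ψ| ≤ ε := by
  obtain ⟨C, hC⟩ := hψ.exists_cutoffBound
  have hC0 : 0 ≤ C := (abs_nonneg _).trans (hC.abs_le 0)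
  obtain ⟨R, hR, hR1, hsupp⟩ := hψ.exists_radius hD
  set G' : ℝ := (volume D).toReal + 4 * G with hG'
  obtain ⟨lam, M, η, hlam, hM, hη, hlaw⟩ := exists_lawError_le hC0 (G := G') (by positivity) hε
  obtain ⟨δ, hδ, hmod⟩ := exists_modulus h1 h2 (m := M / 2) (by positivity)
  -- R/2 keeps separations up to 2ℓ inside D, and δ/3 keeps them below the modulus threshold δ. That
  -- threshold was taken for M/2 because velocity and pressure increments add up to M.
  refine ⟨min η (min (R / 2) (δ / 3)), by positivity, fun ν t ℓ hℓ hℓη hνℓ => ?_⟩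
  have hℓ1 : ℓ ≤ η := hℓη.trans (min_le_left _ _)
  have hℓ2 : 2 * ℓ ≤ R := by
    have := hℓη.trans ((min_le_right _ _).trans (min_le_left _ _)); linarith
  have hℓ3 : 2 * ℓ < δ := by
    have := hℓη.trans ((min_le_right _ _).trans (min_le_right _ _)); linarith
  have hν : (0 : ℝ) ≤ ν := ν.2.1.le
  have hν1 : (ν : ℝ) ≤ 1 := ν.2.2.le
  have he := hlaw ν ℓ hℓ hℓ1 (hνℓ.trans (by gcongr; exact min_le_left _ _))
  set F := (S ν).flow hν hD (hG ν) with hF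
  have hbound : Flow.ModulusBound (timeProd (S ν).P) F ψ (2 * ℓ) G' M := by
    refine ⟨integral_dens_flow_le hν hD hb (hG ν), fun h hh => ?_, ?_⟩
    · have hm := hmod h (hh.trans_lt hℓ3) ν
      refine (integral_incrDens_flow_le hν hD (hG ν) (m := M / 2) (by positivity) (fun x hx =>
        ⟨hψ.2.2 hx, hsupp x hx h (hh.trans hℓ2) (Metric.mem_closedBall_self hR.le)⟩)
        (fun t => (hm t).1) fun t => (hm t).2).trans_eq ?_
      ring
    · refine Metric.tendsto_nhds.2 fun e he => ?_
      obtain ⟨δ', hδ', hmod'⟩ := exists_modulus h1 h2 (m := e / 2) (by positivity)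
      filter_upwards [Metric.ball_mem_nhds 0 hδ'] with h hh
      rw [Real.dist_0_eq_abs, abs_of_nonneg (integral_nonneg fun q => F.innerIncr_nonneg _)]
      refine (integral_innerIncr_flow_le hν hD (hG ν) (m := e / 2) (by positivity)
        fun t => (hmod' h (by simpa using hh) ν t).1).trans_lt ?_
      linarith
  have hbal := balanced_flow hν hν1 hD hb (hG ν) (h2.1 ν)
  have hloc := integral_local_flow hν hD hb (hG ν) hC (h3 ν) t
  have hz := F.abs_zeroForm_add_le hbal hν hν1 hD hb hC hR hR1 hsupp hℓ hℓ2 hbound hlam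
  have hp := F.abs_parForm_add_le hbal hν hν1 hD hb hC hR hR1 hsupp hℓ hℓ2 hbound hlam
  rw [← structZero_eq hν hD (hG ν) hC hℓ (by linarith) t, hloc] at hz
  rw [← structPar_eq hν hD (hG ν) hC hℓ (by linarith) t, hloc] at hp
  constructor
  · refine (le_of_eq ?_).trans (hz.trans (by linarith))
    congr 1; ring
  · refine (le_of_eq ?_).trans (hp.trans (by linarith))
    congr 1; ring

lemma isFluxScale_rootScale (hD : IsOpen D) (hb : Bornology.IsBounded D)
    (hψ : IsTest D ψ) {G : ℝ≥0} (hG : ∀ ν, SolutionBound (S ν) (p ν) G)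
    (h1 : VelocityCompactness S) (h2 : PressureCompactness S p)
    (h3 : LocalEnergyEquality S p ψ) : IsFluxScale S p ψ rootScale := by
  refine ⟨rootScale_pos, tendsto_rootScale, fun t => vanishesInRange_rootScale fun ε hε => ?_,
    fun t => vanishesInRange_rootScale fun ε hε => ?_⟩
  all_goals
    obtain ⟨η, hη, h⟩ := exists_scale_structure_le hD hb hψ hG h1 h2 h3 hε
    refine ⟨η, hη, fun ν ℓ hℓ hℓη hν => ?_⟩
  · exact (h ν t ℓ hℓ hℓη hν).1
  · exact (h ν t ℓ hℓ hℓη hν).2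

end families

end LocalTurbulence

theorem theorem1p2 {D : Set E3} (hDo : IsOpen D) (hDc : IsConnected D)
    (hDb : Bornology.IsBounded D)
    (B : StokesBasis D) (σ : ℕ → ℝ) (hσ : Summable fun k => σ k ^ 2)
    (a : Vsol D →L[ℝ] Vsol D →L[ℝ] ℝ) (ha : ComparableToStokes a)
    (S : ∀ ν : Visc, StationarySolution.{u} B σ a ν) (hS : EnergyEstimate S)
    (p : ∀ ν : Visc, ℝ≥0 → (S ν).Ω → E3 → ℝ)
    (ψ : E3 → ℝ) (hψ : IsTest D ψ)
    (h1 : VelocityCompactness S) (h2 : PressureCompactness S p)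
    (h3 : LocalEnergyEquality S p ψ) :
    (∃ ℓν : Visc → ℝ, IsFluxScale S p ψ ℓν) ∧
    ∀ ℓν : Visc → ℝ, IsFluxScale S p ψ ℓν → ∀ t : ℝ≥0,
      VanishesInRange ℓν (fun ν ℓ =>
        1 / ℓ * structZero (S ν).P ((S ν).u t) ψ ℓ
          + 4 / 3 * (ν : ℝ) * localDissipation (S ν).P ((S ν).u t) ψ) ∧
      VanishesInRange ℓν (fun ν ℓ =>
        1 / ℓ * structPar (S ν).P ((S ν).u t) ψ ℓ
          + 4 / 5 * (ν : ℝ) * localDissipation (S ν).P ((S ν).u t) ψ) := by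
  obtain ⟨G, hG⟩ := exists_solutionBound hDo hDb hσ ha hS h1 h2
  refine ⟨⟨rootScale, isFluxScale_rootScale hDo hDb hψ hG h1 h2 h3⟩, fun ℓν hℓν t => ?_⟩
  obtain ⟨A, hA⟩ := hψ.exists_abs_laplacian_le
  have hdiff : ∀ ν, |localDiffusion (S ν).P ((S ν).u t) ψ| ≤ A * ((volume D).toReal + G) := fun ν =>
    abs_localDiffusion_le (hG ν) hDb hA t
  -- The local energy equality multiplied by c exchanges flux and input for dissipation, leaving
  -- only cν times the diffusion term. The cases c = 2/3 and c = 2/5 give the factors 4/3 and 4/5,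
  -- and the O(ν) difference is invisible in the limit.
  have key : ∀ (c : ℝ), 0 ≤ c → c ≤ 1 → ∀ (ν : Visc) (x : ℝ),
      |(x + 2 * c * (ν : ℝ) * localDissipation (S ν).P ((S ν).u t) ψ) -
        (x + c * localFlux (S ν).P ((S ν).u t) (p ν t) ψ +
          2 * c * localInput (S ν).P ((S ν).u t) ((S ν).Z t) ψ)| ≤
        ν * (A * ((volume D).toReal + G)) := fun c hc hc1 ν x => by
    have e : (x + 2 * c * (ν : ℝ) * localDissipation (S ν).P ((S ν).u t) ψ) -
        (x + c * localFlux (S ν).P ((S ν).u t) (p ν t) ψ +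
          2 * c * localInput (S ν).P ((S ν).u t) ((S ν).Z t) ψ) =
        c * ((ν : ℝ) * localDiffusion (S ν).P ((S ν).u t) ψ) := by
      linear_combination c * h3 ν t
    have hν : (0 : ℝ) < ν := ν.2.1
    rw [e, abs_mul, abs_mul, abs_of_nonneg hc, abs_of_pos hν]
    exact (mul_le_of_le_one_left (by positivity) hc1).trans (by gcongr; exact hdiff ν)
  constructor
  · refine (hℓν.flux_zero t).congr_of_abs_sub_le fun ν ℓ =>
      le_of_eq_of_le ?_ (key (2 / 3) (by norm_num) (by norm_num) ν
        (1 / ℓ * structZero (S ν).P ((S ν).u t) ψ ℓ))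
    norm_num
  · refine (hℓν.flux_par t).congr_of_abs_sub_le fun ν ℓ =>
      le_of_eq_of_le ?_ (key (2 / 5) (by norm_num) (by norm_num) ν
        (1 / ℓ * structPar (S ν).P ((S ν).u t) ψ ℓ))
    norm_num
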